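/- **Setting.** Let $T\in(0,\infty)$, let $\mathbb H$ be a separable real Hilbert space with inner product $(\cdot,\cdot)$, and $\mathbb V$ a reflexive real Banach space that is continuously and densely embedded in $\mathbb H$, so that $\mathbb V\subset\mathbb H\cong\mathbb H^*\subset\mathbb V^*$ with duality pairing $\langle\cdot,\cdot\rangle$ and $\langle u,v\rangle=(u,v)$ for $u\in\mathbb H$, $v\in\mathbb V$. Let $\mathrm L_2$ be the space of Hilbert–Schmidt operators on $\mathbb H$. Let $\mathrm Z$ be a locally compact Polish space with a Borel measure $\nu$ that is finite on compact sets; put $\mathrm Z_T=[0,T]\times\mathrm Z$ and $\nu_T=\lambda_T\otimes\nu$, with $\lambda_T$ the Lebesgue measure on $[0,T]$. Let $\mathrm A:[0,T]\times\mathbb V\to\mathbb V^*$, $\mathrm B:[0,T]\times\mathbb V\to\mathrm L_2$ and $\gamma:[0,T]\times\mathbb V\times\mathrm Z\to\mathbb H$ be measurable, and let $\beta\in(1,\infty)$, $\alpha\ge 0$ and $0\le\mathfrak a\in L^1(0,T)$. For $p>0$ let $\mathcal H_p$ be the set of functions $h:\mathrm Z_T\to[0,\infty)$ for which there is $\delta>0$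 with $\int_E e^{\delta h^p}\,d\nu_T<\infty$ for every measurable $E\subset\mathrm Z_T$ with $\nu_T(E)<\infty$. **Assumptions.** For a.e. $t\in[0,T]$ the following hold for all $x,y,w\in\mathbb V$ and all sequences $(x_n)$ in $\mathbb V$. * (H.1) $\lambda\mapsto\langle\mathrm A(t,x+\lambda y),w\rangle$ is continuous on $\mathbb R$. * (H.2) $2\langle\mathrm A(t,x)-\mathrm A(t,y),x-y\rangle+\|\mathrm B(t,x)-\mathrm B(t,y)\|_{\mathrm L_2}^2+\int_{\mathrm Z}\|\gamma(t,x,z)-\gamma(t,y,z)\|_{\mathbb H}^2\,\nu(dz)\le[\mathfrak a(t)+\rho(x)+\eta(y)]\,\|x-y\|_{\mathbb H}^2$, for some measurable $\rho,\eta:\mathbb V\to\mathbb R$ with $|\rho(x)|+|\eta(x)|\le C(1+\|x\|_{\mathbb V}^\beta)(1+\|x\|_{\mathbb H}^\zeta)$ for all $x\in\mathbb V$, where $C,\zeta\ge0$ are constants. * (H.3) $\langle\mathrm A(t,x),x\rangle\le\mathfrak a(t)(1+\|x\|_{\mathbb H}^2)-L_{\mathrm A}\|x\|_{\mathbb V}^\beta$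 with a constant $L_{\mathrm A}>0$. * (H.4) $\|\mathrm A(t,x)\|_{\mathbb V^*}^{\beta/(\beta-1)}\le(\mathfrak a(t)+C\|x\|_{\mathbb V}^\beta)(1+\|x\|_{\mathbb H}^\alpha)$ with a constant $C\ge0$. * (H.5) If $\|x_n-x\|_{\mathbb H}\to0$, then $\|\mathrm B(t,x_n)-\mathrm B(t,x)\|_{\mathrm L_2}\to0$; moreover $\|\mathrm B(t,x)\|_{\mathrm L_2}^2\le\mathfrak b(t)(1+\|x\|_{\mathbb H}^2)$ for some $0\le\mathfrak b\in L^1(0,T)$. * (H.6) $\int_0^T\int_{\mathrm Z}\|\gamma(s,x,z)\|_{\mathbb H}^2\,\nu(dz)\,ds<\infty$ for every $x\in\mathbb V$; if $\|x_n-x\|_{\mathbb H}\to0$, then $\int_{\mathrm Z}\|\gamma(t,x_n,z)-\gamma(t,x,z)\|_{\mathbb H}^2\,\nu(dz)\to0$; and for every $p\in[2,\infty)$ there is $0\le\mathfrak h_p\in L^1(0,T)$ with $\int_{\mathrm Z}\|\gamma(t,x,z)\|_{\mathbb H}^p\,\nu(dz)\le\mathfrak h_p(t)(1+\|x\|_{\mathbb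 H}^p)$. For all $t\in[0,T]$, $x,y\in\mathbb V$ and $z\in\mathrm Z$ the following hold. * (H.7) $\|\mathrm B(t,x)-\mathrm B(t,y)\|_{\mathrm L_2}^2\le L_{\mathrm B}(t)\|x-y\|_{\mathbb H}^2$ for some $0\le L_{\mathrm B}\in L^1(0,T)$. * (H.8) $\|\gamma(t,x,z)\|_{\mathbb H}\le L_\gamma(t,z)(1+\|x\|_{\mathbb H})$, where, for some $\eta_0>0$, $M:=\frac{2\alpha(\beta-1)(\beta+\eta_0)}{\beta}\vee\frac{4(\beta-1)(\beta+\eta_0)}{\beta}\vee4\vee(\alpha+2)$ and some $p\ge M$, one has $L_\gamma\in L^2(\nu_T)\cap L^4(\nu_T)\cap L^{\alpha+2}(\nu_T)\cap L^M(\nu_T)\cap L^{M/2}(\nu_T)\cap\mathcal H_p$. * (H.9) $\|\gamma(t,x,z)-\gamma(t,y,z)\|_{\mathbb H}\le R_\gamma(t,z)\|x-y\|_{\mathbb H}$ for some $R_\gamma\in L^2(\nu_T)\cap\mathcal H_2$. **Controls.** For $\Upsilon\in\mathbb N$ let $\bar S^\Upsilon$ be the set of pairs $\boldsymbol p=(f,g)$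 with $f\in L^2(0,T;\mathbb H)$, $\frac12\int_0^T\|f(t)\|_{\mathbb H}^2\,dt\le\Upsilon$, and $g:\mathrm Z_T\to[0,\infty)$ measurable with $\int_{\mathrm Z_T}(g\ln g-g+1)\,d\nu_T\le\Upsilon$ (where $0\ln 0=0$). Let $\mathbb S=\bigcup_{\Upsilon\ge1}\bar S^\Upsilon$. **Theorem.** For every $x\in\mathbb H$ and every $\boldsymbol p=(f,g)\in\mathbb S$ there is a unique $\mathbf Y^{\boldsymbol p}\in C([0,T];\mathbb H)\cap L^\beta(0,T;\mathbb V)$ such that, for all $t\in[0,T]$, $$\mathbf Y^{\boldsymbol p}(t)=x+\int_0^t\mathrm A(s,\mathbf Y^{\boldsymbol p}(s))\,ds+\int_0^t\mathrm B(s,\mathbf Y^{\boldsymbol p}(s))f(s)\,ds+\int_0^t\int_{\mathrm Z}\gamma(s,\mathbf Y^{\boldsymbol p}(s),z)\,(g(s,z)-1)\,\nu(dz)\,ds\quad\text{in }\mathbb V^*,$$ all integrals being Bochner integrals that exist (a *weak solution*). Moreover, for every $\Upsilon\in\mathbb N$ there is a constant $C>0$, independent of $x$, such that for all $x\in\mathbb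 H$ $$\sup_{\boldsymbol p\in\bar S^\Upsilon}\Big[\sup_{t\in[0,T]}\|\mathbf Y^{\boldsymbol p}(t)\|_{\mathbb H}^2+\int_0^T\|\mathbf Y^{\boldsymbol p}(s)\|_{\mathbb V}^\beta\,ds\Big]\le C\,(1+\|x\|_{\mathbb H}^2).$$ -/

import Mathlib

open MeasureTheory Set Filter Topology
open scoped ENNReal NNReal

noncomputable section

namespace SkeletonEq

/-! ### Hilbert-Schmidt operators -/

section HilbertSchmidt

variable {H : Type*} [NormedAddCommGroup H] [InnerProductSpace ℝ H] [CompleteSpace H]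

variable (H) in
/-- An index set (a subset of `H`) for some Hilbert basis of `H`. -/
def basisSet : Set H := Classical.choose (exists_hilbertBasis ℝ H)

variable (H) in
/-- Some Hilbert basis of `H`. -/
def someBasis : HilbertBasis (basisSet H) ℝ H :=
  Classical.choose (Classical.choose_spec (exists_hilbertBasis ℝ H))

/-- The squared Hilbert-Schmidt norm `∑ i, ‖T e i‖ ^ 2`, with value `∞` if the series diverges.
It does not depend on the Hilbert basis `e`, see `hsNormSq_eq_tsum`. -/
def hsNormSq (T : H →L[ℝ] H) : ℝ≥0∞ := ∑' i, ‖T (someBasis H i)‖ₑ ^ 2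

/-- Membership in the space of Hilbert-Schmidt operators from `H` to itself. -/
def IsHilbertSchmidt (T : H →L[ℝ] H) : Prop := hsNormSq T < ∞

theorem enorm_sq_eq_tsum {κ : Type*} (b : HilbertBasis κ ℝ H) (x : H) :
    ‖x‖ₑ ^ 2 = ∑' i, ‖inner ℝ (b i) x‖ₑ ^ 2 := by
  have h := b.hasSum_inner_mul_inner x x
  have h1 : ∀ i, inner ℝ x (b i) * inner ℝ (b i) x = ‖inner ℝ (b i) x‖ ^ 2 := fun i => by
    rw [real_inner_comm, ← sq, Real.norm_eq_abs, sq_abs]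
  simp only [h1, real_inner_self_eq_norm_sq] at h
  have h2 := ENNReal.ofReal_tsum_of_nonneg (fun i => sq_nonneg ‖inner ℝ (b i) x‖) h.summable
  rw [h.tsum_eq] at h2
  simpa only [ENNReal.ofReal_pow (norm_nonneg _), ofReal_norm] using h2

theorem tsum_eq_tsum_adjoint {κ₁ κ₂ : Type*} (b₁ : HilbertBasis κ₁ ℝ H)
    (b₂ : HilbertBasis κ₂ ℝ H) (T : H →L[ℝ] H) :
    ∑' i, ‖T (b₁ i)‖ₑ ^ 2 = ∑' j, ‖ContinuousLinearMap.adjoint T (b₂ j)‖ₑ ^ 2 := by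
  simp only [enorm_sq_eq_tsum b₂ (T _), enorm_sq_eq_tsum b₁ (ContinuousLinearMap.adjoint T _)]
  rw [ENNReal.tsum_comm]
  refine tsum_congr fun j => tsum_congr fun i => ?_
  rw [ContinuousLinearMap.adjoint_inner_right, real_inner_comm]

theorem hsNormSq_eq_tsum {κ : Type*} (b : HilbertBasis κ ℝ H) (T : H →L[ℝ] H) :
    hsNormSq T = ∑' i, ‖T (b i)‖ₑ ^ 2 := by
  rw [tsum_eq_tsum_adjoint b b T, hsNormSq, tsum_eq_tsum_adjoint (someBasis H) b T]

end HilbertSchmidt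

/-! ### Time interval, reference measures and controls -/

/-- Lebesgue measure `λ_T` on `[0, T]`. -/
def timeMeasure (T : ℝ) : Measure ℝ := volume.restrict (Icc 0 T)

section Controls

variable {H Z : Type*} [NormedAddCommGroup H] [InnerProductSpace ℝ H] [MeasurableSpace Z]

/-- The product measure `ν_T = λ_T ⊗ ν` on `[0, T] × Z`. -/
def prodMeasure (T : ℝ) (ν : Measure Z) : Measure (ℝ × Z) := (timeMeasure T).prod ν

/-- The class `𝓗_p` of functions `h : [0, T] × Z → [0, ∞)` for which there is `δ > 0` with
`∫_E exp (δ h ^ p) dν_T < ∞` for every measurable `E` of finite `ν_T` measure. -/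
def ExpClass (T : ℝ) (ν : Measure Z) (p : ℝ) : Set (ℝ × Z → ℝ) :=
  {h | (∀ t ∈ Icc 0 T, ∀ z, 0 ≤ h (t, z)) ∧
    ∃ δ : ℝ, 0 < δ ∧ ∀ E : Set (ℝ × Z), MeasurableSet E → prodMeasure T ν E < ∞ →
      ∫⁻ q in E, ENNReal.ofReal (Real.exp (δ * h q ^ p)) ∂(prodMeasure T ν) < ∞}

/-- The set of controls `(f, g)` with `f ∈ L²(0, T; H)`, `½ ∫ ‖f‖² dt ≤ Υ`, and
`g : [0, T] × Z → [0, ∞)` measurable with `∫ (g log g - g + 1) dν_T ≤ Υ`. -/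
def controlBall (H : Type*) [NormedAddCommGroup H] [InnerProductSpace ℝ H]
    (T : ℝ) (ν : Measure Z) (Υ : ℕ) : Set ((ℝ → H) × (ℝ × Z → ℝ≥0)) :=
  {p | (MemLp p.1 2 (timeMeasure T) ∧ (1 / 2 : ℝ) * ∫ t, ‖p.1 t‖ ^ 2 ∂(timeMeasure T) ≤ Υ) ∧
    (AEMeasurable p.2 (prodMeasure T ν) ∧
      ∫⁻ q, ENNReal.ofReal (InformationTheory.klFun (p.2 q)) ∂(prodMeasure T ν) ≤ Υ)}

/-- The set `𝕊` of all controls of finite cost. -/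
def controls (H : Type*) [NormedAddCommGroup H] [InnerProductSpace ℝ H]
    (T : ℝ) (ν : Measure Z) : Set ((ℝ → H) × (ℝ × Z → ℝ≥0)) :=
  ⋃ Υ : ℕ, ⋃ _ : 1 ≤ Υ, controlBall H T ν Υ

end Controls

section Equation

variable {H V Z : Type*} [NormedAddCommGroup H] [InnerProductSpace ℝ H] [CompleteSpace H]
  [MeasurableSpace H] [NormedAddCommGroup V] [NormedSpace ℝ V] [MeasurableSpace V]
  [MeasurableSpace Z]

/-- The embedding `H ≅ H* ⊂ V*` of the Gelfand triplet, `⟨h, v⟩ = (h, ι v)`. -/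
def toDual (ι : V →L[ℝ] H) : H →L[ℝ] StrongDual ℝ V :=
  (ContinuousLinearMap.compL ℝ V H ℝ).flip ι ∘L innerSL ℝ

theorem toDual_apply (ι : V →L[ℝ] H) (h : H) (v : V) : toDual ι h v = inner ℝ h (ι v) := rfl

/-! ### Assumptions on the coefficients

The coefficients are `A : [0, T] × V → V*`, `B : [0, T] × V → L₂(H, H)` and
`γ : [0, T] × V × Z → H`; their values at times outside `[0, T]` play no role. -/

/-- `V ⊂ H ⊂ V*` is a Gelfand triplet with `V` reflexive: the embedding `ι : V → H` is continuous,
injective and has dense range, and the canonical map `V → V**` is onto. -/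
structure IsGelfandTriplet (ι : V →L[ℝ] H) : Prop where
  injective : Function.Injective ι
  denseRange : DenseRange ι
  reflexive : Function.Surjective (NormedSpace.inclusionInDoubleDual ℝ V)

/-- The coefficients are measurable and `B` takes values in the Hilbert-Schmidt operators. As
`L₂(H, H)` is a separable Hilbert space, Borel measurability of an `L₂(H, H)`-valued map is the
same as measurability of its evaluations at the vectors of `H`. -/
structure MeasurableCoefficients (T : ℝ) (A : ℝ → V → StrongDual ℝ V) (B : ℝ → V → H →L[ℝ] H)
    (γ : ℝ → V → Z → H) : Prop where
  measurable_A : Measurable fun q : Icc (0 : ℝ) T × V => A q.1 q.2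
  isHilbertSchmidt_B : ∀ t ∈ Icc 0 T, ∀ x, IsHilbertSchmidt (B t x)
  measurable_B : ∀ h : H, Measurable fun q : Icc (0 : ℝ) T × V => B q.1 q.2 h
  measurable_γ : Measurable fun q : Icc (0 : ℝ) T × V × Z => γ q.1 q.2.1 q.2.2

/-- The first group of assumptions: hemicontinuity, (full) local monotonicity, coercivity and
growth of `A`, continuity and growth of `B` and of `γ`. -/
structure StructuralHypothesis (T β α : ℝ) (ν : Measure Z) (ι : V →L[ℝ] H)
    (A : ℝ → V → StrongDual ℝ V) (B : ℝ → V → H →L[ℝ] H) (γ : ℝ → V → Z → H) (a : ℝ → ℝ) :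
    Prop where
  integrable_a : Integrable a (timeMeasure T)
  nonneg_a : ∀ t ∈ Icc 0 T, 0 ≤ a t
  hemicontinuity : ∀ᵐ t ∂(timeMeasure T), ∀ x y z : V,
    Continuous fun r : ℝ => A t (x + r • y) z
  local_monotonicity : ∃ (ρ η : V → ℝ) (ζ C : ℝ), Measurable ρ ∧ Measurable η ∧
    0 ≤ ζ ∧ 0 ≤ C ∧
    (∀ᵐ t ∂(timeMeasure T), ∀ x y : V,
      2 * (A t x - A t y) (x - y) + (hsNormSq (B t x - B t y)).toReal
          + ∫ z, ‖γ t x z - γ t y z‖ ^ 2 ∂ν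
        ≤ (a t + ρ x + η y) * ‖ι x - ι y‖ ^ 2) ∧
    ∀ x : V, |ρ x| + |η x| ≤ C * (1 + ‖x‖ ^ β) * (1 + ‖ι x‖ ^ ζ)
  coercivity : ∃ L : ℝ, 0 < L ∧ ∀ᵐ t ∂(timeMeasure T), ∀ x : V,
    A t x x ≤ a t * (1 + ‖ι x‖ ^ 2) - L * ‖x‖ ^ β
  growth : 0 ≤ α ∧ ∃ C : ℝ, 0 ≤ C ∧ ∀ᵐ t ∂(timeMeasure T), ∀ x : V,
    ‖A t x‖ ^ (β / (β - 1)) ≤ (a t + C * ‖x‖ ^ β) * (1 + ‖ι x‖ ^ α)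
  continuity_B : ∀ᵐ t ∂(timeMeasure T), ∀ (xs : ℕ → V) (x : V),
    Tendsto (fun n => ‖ι (xs n) - ι x‖) atTop (𝓝 0) →
      Tendsto (fun n => hsNormSq (B t (xs n) - B t x)) atTop (𝓝 0)
  growth_B : ∃ b : ℝ → ℝ, Integrable b (timeMeasure T) ∧ (∀ t ∈ Icc 0 T, 0 ≤ b t) ∧
    ∀ᵐ t ∂(timeMeasure T), ∀ x : V,
      hsNormSq (B t x) ≤ ENNReal.ofReal (b t * (1 + ‖ι x‖ ^ 2))
  square_integrable_γ : ∀ x : V,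
    ∫⁻ t, ∫⁻ z, ‖γ t x z‖ₑ ^ 2 ∂ν ∂(timeMeasure T) < ∞
  continuity_γ : ∀ᵐ t ∂(timeMeasure T), ∀ (xs : ℕ → V) (x : V),
    Tendsto (fun n => ‖ι (xs n) - ι x‖) atTop (𝓝 0) →
      Tendsto (fun n => ∫⁻ z, ‖γ t (xs n) z - γ t x z‖ₑ ^ 2 ∂ν) atTop (𝓝 0)
  growth_γ : ∀ p : ℝ, 2 ≤ p → ∃ h : ℝ → ℝ, Integrable h (timeMeasure T) ∧
    (∀ t ∈ Icc 0 T, 0 ≤ h t) ∧ ∀ᵐ t ∂(timeMeasure T), ∀ x : V,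
      ∫⁻ z, ‖γ t x z‖ₑ ^ p ∂ν ≤ ENNReal.ofReal (h t * (1 + ‖ι x‖ ^ p))

/-- The exponent `M = (2α(β-1)(β+η₀)/β) ∨ (4(β-1)(β+η₀)/β) ∨ 4 ∨ (α+2)`. -/
def exponentM (α β η₀ : ℝ) : ℝ :=
  max (max (max (2 * α * (β - 1) * (β + η₀) / β) (4 * (β - 1) * (β + η₀) / β)) 4) (α + 2)

/-- The second group of assumptions: Lipschitz continuity of `B`, linear growth and Lipschitz
continuity of `γ`, with constants depending on time (and on `z`). -/
structure NoiseHypothesis (T β α : ℝ) (ν : Measure Z) (ι : V →L[ℝ] H)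
    (B : ℝ → V → H →L[ℝ] H) (γ : ℝ → V → Z → H) : Prop where
  lipschitz_B : ∃ L : ℝ → ℝ, Integrable L (timeMeasure T) ∧ (∀ t ∈ Icc 0 T, 0 ≤ L t) ∧
    ∀ t ∈ Icc 0 T, ∀ x y : V,
      hsNormSq (B t x - B t y) ≤ ENNReal.ofReal (L t * ‖ι x - ι y‖ ^ 2)
  linear_growth_γ : ∃ (η₀ p : ℝ) (L : ℝ × Z → ℝ), 0 < η₀ ∧ 0 < p ∧ exponentM α β η₀ ≤ p ∧
    MemLp L 2 (prodMeasure T ν) ∧ MemLp L 4 (prodMeasure T ν) ∧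
    MemLp L (ENNReal.ofReal (α + 2)) (prodMeasure T ν) ∧
    MemLp L (ENNReal.ofReal (exponentM α β η₀)) (prodMeasure T ν) ∧
    MemLp L (ENNReal.ofReal (exponentM α β η₀ / 2)) (prodMeasure T ν) ∧
    L ∈ ExpClass T ν p ∧
    ∀ t ∈ Icc 0 T, ∀ (x : V) (z : Z), ‖γ t x z‖ ≤ L (t, z) * (1 + ‖ι x‖)
  lipschitz_γ : ∃ R : ℝ × Z → ℝ, MemLp R 2 (prodMeasure T ν) ∧ R ∈ ExpClass T ν 2 ∧
    ∀ t ∈ Icc 0 T, ∀ (z : Z) (x y : V), ‖γ t x z - γ t y z‖ ≤ R (t, z) * ‖ι x - ι y‖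

/-! ### Weak solutions of the skeleton equation -/

/-- `Y ∈ C([0, T]; H) ∩ L^β(0, T; V)` is a weak solution, with initial datum `x` and control
`(f, g)`, of
`dY = [A(t, Y) + B(t, Y) f + ∫ γ(t, Y, z) (g(t, z) - 1) ν(dz)] dt`, `Y(0) = x`.
The function `y` is the `V`-valued version of `Y`: `ι (y t) = Y t` for almost every `t`. All the
integrals are Bochner integrals, required to exist, and the equation holds in `V*` at every time. -/
structure IsWeakSolution (T β : ℝ) (ν : Measure Z) (ι : V →L[ℝ] H)
    (A : ℝ → V → StrongDual ℝ V) (B : ℝ → V → H →L[ℝ] H) (γ : ℝ → V → Z → H)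
    (x : H) (p : (ℝ → H) × (ℝ × Z → ℝ≥0)) (Y : ℝ → H) (y : ℝ → V) : Prop where
  continuousOn : ContinuousOn Y (Icc 0 T)
  memLp : MemLp y (ENNReal.ofReal β) (timeMeasure T)
  version : ∀ᵐ t ∂(timeMeasure T), ι (y t) = Y t
  integrable_A : Integrable (fun s => A s (y s)) (timeMeasure T)
  integrable_B : Integrable (fun s => B s (y s) (p.1 s)) (timeMeasure T)
  integrable_γ : Integrable (fun q : ℝ × Z => ((p.2 q : ℝ) - 1) • γ q.1 (y q.1) q.2)
    (prodMeasure T ν)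
  equation : ∀ t ∈ Icc 0 T,
    toDual ι (Y t) = toDual ι x + (∫ s in (0 : ℝ)..t, A s (y s))
      + toDual ι (∫ s in (0 : ℝ)..t, B s (y s) (p.1 s))
      + toDual ι (∫ s in (0 : ℝ)..t, ∫ z, ((p.2 (s, z) : ℝ) - 1) • γ s (y s) z ∂ν)

/-- The quantity `sup_{t ∈ [0, T]} ‖Y(t)‖_H² + ∫_0^T ‖Y(t)‖_V^β dt`. -/
def energy (T β : ℝ) (Y : ℝ → H) (y : ℝ → V) : ℝ≥0∞ :=
  (⨆ t ∈ Icc (0 : ℝ) T, ‖Y t‖ₑ ^ 2) + ∫⁻ t, ‖y t‖ₑ ^ β ∂(timeMeasure T)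

end Equation

end SkeletonEq

end

/-! The control is absorbed into the drift. For a control `(f, g)` of cost at most `Υ`, put `F t x =
B t x (f t) + ∫ (g - 1) γ t x dν`. The inequality `abs_sub_one_mul_le`, which bounds `|g - 1| h` by
a multiple of `klFun g`, plus `h ^ 2`, plus `exp (δ h) / δ` on the set `h > 1`, together with the
exponential integrability of the moduli of `γ`, makes `F` Lipschitz and of linear growth in the norm
of `H`. The moduli are integrable in time, with integrals bounded over the whole ball of controls
(`StructuralHypothesis.exists_forcing`). The equation becomes `Y' = 𝒢(t, Y)` with `𝒢 = A + F`
hemicontinuous, coercive and locally monotone (`CoreHyp`).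

As the moduli of `F` are merely integrable, `𝒢(t, Y)` lies only in `L^q(V*) + L¹(H)`, where `q = β /
(β - 1)`. The basic tool is therefore the energy equality for functions with a weak derivative in
this sum (`Evol.energy`), obtained from Steklov quotients; it also yields continuity in `H`.
Combined with Grönwall's inequality it gives uniqueness, from local monotonicity, and the bound on
the energy, from coercivity, with a constant that sees the control only through the integral of the
coefficient `κ`.

For existence, Galerkin equations are solved as Carathéodory ordinary differential equations. A
subsequence `Y n` converges weakly in `H`, uniformly in time against each element of a dense
sequence; the limit `Yl` has a version `yl` in `L^β(V)` and a weak derivative `ξ`, and it remains to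
show `ξ = 𝒢(yl)`. Monotonicity is only local, with a weight growing like `‖x‖ ^ β + ‖y‖ ^ β` in both
arguments, so weak convergence is not enough for Minty's argument. These weights have bounded
integrals along the approximations, however, so Grönwall's inequality for `Y n - Y m` gives strong
convergence in `C([0, T]; H)` (`GalerkinLimit.tendstoUniformlyOn`), once the projection defect
tested against the limit is known to be small (`GalerkinLimit.smallPrimitive_defect`). No
compactness of the embedding is used. After that, the monotonicity error for the test function `yl -
r v` is of order `r ^ 2`, and dividing by `r` identifies `ξ` (`GalerkinLimit.integral_eq`). -/

namespace SkeletonEq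

/-! ### Continuity of translations -/

section Translation

variable {E : Type*} [NormedAddCommGroup E] {p : ℝ≥0∞}

/-- Translations act continuously on `L^p` for finite `p`; this is continuity at the zero shift, for
functions instead of classes. -/
theorem tendsto_eLpNorm_translate_sub (hp1 : 1 ≤ p) (hp : p ≠ ∞) {f : ℝ → E}
    (hf : MemLp f p volume) :
    Tendsto (fun τ : ℝ => eLpNorm (fun r => f (r + τ) - f r) p volume) (𝓝 0) (𝓝 0) := by
  have : Fact (1 ≤ p) := ⟨hp1⟩
  have : Fact (p ≠ ∞) := ⟨hp⟩
  have hc : Continuous fun τ : ℝ => DomAddAct.mk τ +ᵥ hf.toLp f := by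
    have : Continuous fun τ : ℝ => (DomAddAct.mk τ, hf.toLp f) := by
      refine Continuous.prodMk ?_ continuous_const
      exact DomAddAct.continuous_mk
    exact continuous_vadd.comp this
  have h0 : Tendsto (fun τ : ℝ => edist (DomAddAct.mk τ +ᵥ hf.toLp f) (hf.toLp f)) (𝓝 0) (𝓝 0) := by
    have h1 := (hc.tendsto 0)
    have h2 : DomAddAct.mk (0 : ℝ) +ᵥ hf.toLp f = hf.toLp f := by
      rw [show DomAddAct.mk (0 : ℝ) = 0 from rfl, zero_vadd]
    rw [h2] at h1
    exact tendsto_iff_edist_tendsto_0.1 h1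
  refine h0.congr fun τ => ?_
  rw [DomAddAct.mk_vadd_toLp, Lp.edist_toLp_toLp]
  refine eLpNorm_congr_ae (Eventually.of_forall fun r => ?_)
  simp [add_comm]

/-- Hölder's inequality cannot handle a weight that is only integrable, so boundedness of `f` takes
its place: the translates converge almost everywhere along a subsequence, and `2 R |k|` dominates.
-/
theorem tendsto_lintegral_mul_translate_sub (hp1 : 1 ≤ p) (hp : p ≠ ∞) {f : ℝ → E}
    (hf : MemLp f p volume) {R : ℝ} (hR : ∀ᵐ r, ‖f r‖ ≤ R) {k : ℝ → ℝ} (hk : Integrable k volume) :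
    Tendsto (fun τ : ℝ => ∫⁻ r, ‖k r‖ₑ * ‖f (r + τ) - f r‖ₑ) (𝓝 0) (𝓝 0) := by
  refine tendsto_of_subseq_tendsto fun τ hτ => ?_
  have h1 := (tendsto_eLpNorm_translate_sub hp1 hp hf).comp hτ
  have hm : ∀ n, AEStronglyMeasurable (fun r => f (r + τ n) - f r) volume := fun n =>
    (hf.1.comp_measurePreserving (measurePreserving_add_right volume (τ n))).sub hf.1
  have h2 : TendstoInMeasure volume (fun n r => f (r + τ n) - f r) atTop (fun _ => 0) := by
    refine tendstoInMeasure_of_tendsto_eLpNorm (p := p) (by positivity) hm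
      aestronglyMeasurable_const ?_
    refine h1.congr fun n => ?_
    refine congrArg (fun u => eLpNorm u p volume) (funext fun r => ?_)
    simp
  obtain ⟨ns, hns, hae⟩ := h2.exists_seq_tendsto_ae
  refine ⟨ns, ?_⟩
  have hb : ∀ τ : ℝ, ∀ᵐ r, ‖f (r + τ)‖ ≤ R := fun τ =>
    (measurePreserving_add_right volume τ).quasiMeasurePreserving.ae hR
  have h3 := tendsto_lintegral_of_dominated_convergence' (μ := volume)
    (F := fun n r => ‖k r‖ₑ * ‖f (r + τ (ns n)) - f r‖ₑ) (f := fun _ => 0)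
    (fun r => ‖k r‖ₑ * ENNReal.ofReal (2 * R)) ?_ ?_ ?_ ?_
  · simpa using h3
  · exact fun n => hk.1.enorm.mul (hm _).enorm
  · intro n
    filter_upwards [hR, hb (τ (ns n))] with r h1 h2
    gcongr
    rw [← ofReal_norm]
    refine ENNReal.ofReal_le_ofReal ((norm_sub_le _ _).trans (by linarith))
  · rw [lintegral_mul_const'' _ hk.1.enorm]
    exact ENNReal.mul_ne_top hk.2.ne ENNReal.ofReal_ne_top
  · filter_upwards [hae] with r hr
    have := ENNReal.Tendsto.const_mul (a := ‖k r‖ₑ) hr.enorm (Or.inr (by simp))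
    simpa using this

end Translation

/-- Replacing `w` by a nearby `ι v` costs at most `(R + ‖x‖) ‖w - ι v‖`, so a norm bound upgrades
convergence on a dense set to weak convergence. -/
theorem tendsto_inner_of_denseRange {H V : Type*} [NormedAddCommGroup H] [InnerProductSpace ℝ H]
    {ι : V → H} (hι : DenseRange ι) {κ : Type*} {l : Filter κ} {X : κ → H} {x : H} {R : ℝ}
    (hR : ∀ᶠ i in l, ‖X i‖ ≤ R)
    (h : ∀ v, Tendsto (fun i => inner ℝ (X i) (ι v)) l (𝓝 (inner ℝ x (ι v)))) (w : H) :
    Tendsto (fun i => inner ℝ (X i) w) l (𝓝 (inner ℝ x w)) := by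
  rw [Metric.tendsto_nhds]
  intro ε hε
  obtain ⟨v, hv⟩ := hι.exists_dist_lt w (ε := ε / (2 * (|R| + ‖x‖ + 1))) (by positivity)
  rw [dist_eq_norm] at hv
  filter_upwards [hR, Metric.tendsto_nhds.1 (h v) (ε / 2) (by positivity)] with i h1 h2
  rw [Real.dist_eq] at h2 ⊢
  have e : inner ℝ (X i) w - inner ℝ x w
      = (inner ℝ (X i) (ι v) - inner ℝ x (ι v)) + inner ℝ (X i - x) (w - ι v) := by
    simp only [inner_sub_left, inner_sub_right]; ring
  have h3 : |inner ℝ (X i - x) (w - ι v)| ≤ (|R| + ‖x‖ + 1) * ‖w - ι v‖ := by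
    refine (abs_real_inner_le_norm _ _).trans ?_
    gcongr
    refine (norm_sub_le _ _).trans ?_
    linarith [le_abs_self R]
  have h4 : (|R| + ‖x‖ + 1) * ‖w - ι v‖ < ε / 2 := by
    have := mul_lt_mul_of_pos_left hv (show 0 < |R| + ‖x‖ + 1 by positivity)
    refine this.trans_eq ?_
    field_simp
  rw [e]
  exact (abs_add_le _ _).trans_lt (by linarith)

/-! ### Functionals bounded in the sum of V* and H -/

section Mixed

variable {H V : Type*} [NormedAddCommGroup H] [InnerProductSpace ℝ H]
  [NormedAddCommGroup V] [NormedSpace ℝ V]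

/-- `‖ξ t v‖ ≤ M t ‖v‖_V + k t ‖v‖_H` for almost every `t`. -/
def MixedBound (μ : Measure ℝ) (ι : V →L[ℝ] H) (ξ : ℝ → StrongDual ℝ V) (M k : ℝ → ℝ) : Prop :=
  ∀ᵐ t ∂μ, ∀ v, ‖ξ t v‖ ≤ ‖M t‖ * ‖v‖ + ‖k t‖ * ‖ι v‖

/-- Hölder's inequality serves the part in `V*`. The part in `H` is kept as it stands, to be
controlled by a uniform bound on `ι z`. -/
theorem MixedBound.lintegral_le {μ : Measure ℝ} {ι : V →L[ℝ] H} {ξ : ℝ → StrongDual ℝ V}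
    {M k : ℝ → ℝ} (h : MixedBound μ ι ξ M k) {p q : ℝ≥0∞} [ENNReal.HolderTriple q p 1]
    (hM : AEStronglyMeasurable M μ) {z : ℝ → V} (hz : AEStronglyMeasurable z μ) :
    ∫⁻ t, ‖ξ t (z t)‖ₑ ∂μ
      ≤ eLpNorm M q μ * eLpNorm z p μ + ∫⁻ t, ‖k t‖ₑ * ‖ι (z t)‖ₑ ∂μ := by
  have h1 : ∫⁻ t, ‖M t‖ₑ * ‖z t‖ₑ ∂μ ≤ eLpNorm M q μ * eLpNorm z p μ := by
    have := eLpNorm_smul_le_mul_eLpNorm (p := q) (q := p) (r := 1) hz hM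
    rw [eLpNorm_one_eq_lintegral_enorm] at this
    simpa [enorm_smul] using this
  calc ∫⁻ t, ‖ξ t (z t)‖ₑ ∂μ ≤ ∫⁻ t, (‖M t‖ₑ * ‖z t‖ₑ + ‖k t‖ₑ * ‖ι (z t)‖ₑ) ∂μ := by
        refine lintegral_mono_ae ?_
        filter_upwards [h] with t ht
        have := ENNReal.ofReal_le_ofReal (ht (z t))
        rwa [ENNReal.ofReal_add (by positivity) (by positivity), ENNReal.ofReal_mul (by positivity),
          ENNReal.ofReal_mul (by positivity), ofReal_norm, ofReal_norm, ofReal_norm, ofReal_norm,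
          ofReal_norm] at this
    _ = ∫⁻ t, ‖M t‖ₑ * ‖z t‖ₑ ∂μ + ∫⁻ t, ‖k t‖ₑ * ‖ι (z t)‖ₑ ∂μ :=
        lintegral_add_left' (hM.enorm.mul hz.enorm) _
    _ ≤ _ := by gcongr

theorem aestronglyMeasurable_clm_apply {μ : Measure ℝ} {ξ : ℝ → StrongDual ℝ V} {z : ℝ → V}
    (hξ : AEStronglyMeasurable ξ μ) (hz : AEStronglyMeasurable z μ) :
    AEStronglyMeasurable (fun t => ξ t (z t)) μ :=
  (isBoundedBilinearMap_apply (𝕜 := ℝ) (E := V) (F := ℝ)).continuous.comp_aestronglyMeasurable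
    (hξ.prodMk hz)

theorem MixedBound.integrable {μ : Measure ℝ} {ι : V →L[ℝ] H} {ξ : ℝ → StrongDual ℝ V}
    {M k : ℝ → ℝ} (h : MixedBound μ ι ξ M k) {p q : ℝ≥0∞} [ENNReal.HolderTriple q p 1]
    (hξ : AEStronglyMeasurable ξ μ) (hM : MemLp M q μ) (hk : Integrable k μ)
    {z : ℝ → V} (hz : MemLp z p μ) {R : ℝ} (hR : ∀ᵐ t ∂μ, ‖ι (z t)‖ ≤ R) :
    Integrable (fun t => ξ t (z t)) μ := by
  refine ⟨aestronglyMeasurable_clm_apply hξ hz.1, ?_⟩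
  refine (h.lintegral_le (p := p) (q := q) hM.1 hz.1).trans_lt ?_
  refine ENNReal.add_lt_top.2 ⟨ENNReal.mul_lt_top hM.2 hz.2, ?_⟩
  calc ∫⁻ t, ‖k t‖ₑ * ‖ι (z t)‖ₑ ∂μ ≤ ∫⁻ t, ‖k t‖ₑ * ENNReal.ofReal R ∂μ := by
        refine lintegral_mono_ae ?_
        filter_upwards [hR] with t ht
        gcongr
        rw [← ofReal_norm]
        exact ENNReal.ofReal_le_ofReal ht
    _ < ∞ := by
        rw [lintegral_mul_const'' _ hk.1.enorm]
        exact ENNReal.mul_lt_top hk.2 ENNReal.ofReal_lt_top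

end Mixed

/-! ### Steklov quotients -/

section Steklov

variable {H V : Type*} [NormedAddCommGroup H] [InnerProductSpace ℝ H]
  [NormedAddCommGroup V] [NormedSpace ℝ V] {p q : ℝ≥0∞}

/-- The modulus of continuity of translations of `y`, measured against a mixed bound. -/
noncomputable def translationModulus (q p : ℝ≥0∞) (ι : V →L[ℝ] H) (M k : ℝ → ℝ) (y : ℝ → V)
    (τ : ℝ) : ℝ≥0∞ :=
  eLpNorm M q volume * eLpNorm (fun r => y (r + τ) - y r) p volume
    + ∫⁻ r, ‖k r‖ₑ * ‖ι (y (r + τ)) - ι (y r)‖ₑ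

theorem tendsto_translationModulus (hp1 : 1 ≤ p) (hp : p ≠ ∞) {ι : V →L[ℝ] H} {M k : ℝ → ℝ}
    {y : ℝ → V} (hM : MemLp M q volume) (hk : Integrable k volume) (hy : MemLp y p volume)
    {R : ℝ} (hR : ∀ᵐ t, ‖ι (y t)‖ ≤ R) :
    Tendsto (translationModulus q p ι M k y) (𝓝 0) (𝓝 0) := by
  have h1 := ENNReal.Tendsto.const_mul (a := eLpNorm M q volume)
    (tendsto_eLpNorm_translate_sub hp1 hp hy) (Or.inr hM.2.ne)
  have h2 := tendsto_lintegral_mul_translate_sub hp1 hp (ι.comp_memLp' hy) hR hk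
  have h3 := h1.add h2
  simp only [mul_zero, add_zero] at h3
  exact h3

variable [ENNReal.HolderTriple q p 1]

/-- Shifting the variable by `c` leaves only `d - c`, so one modulus controls all pairs of shifts.
-/
theorem lintegral_apply_translate_sub_le {ι : V →L[ℝ] H} {M k : ℝ → ℝ} {ξ : ℝ → StrongDual ℝ V}
    (hb : MixedBound volume ι ξ M k) {y : ℝ → V} (hM : MemLp M q volume) (hy : MemLp y p volume)
    (c d : ℝ) :
    ∫⁻ r, ‖ξ (r + c) (y (r + d) - y (r + c))‖ₑ ≤ translationModulus q p ι M k y (d - c) := by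
  have h1 : ∫⁻ r, ‖ξ (r + c) (y (r + d) - y (r + c))‖ₑ
      = ∫⁻ r, ‖ξ r (y (r + (d - c)) - y r)‖ₑ := by
    rw [← lintegral_add_right_eq_self (fun r => ‖ξ r (y (r + (d - c)) - y r)‖ₑ) c]
    refine lintegral_congr fun r => ?_
    rw [show r + c + (d - c) = r + d by ring]
  rw [h1]
  have hz : AEStronglyMeasurable (fun r => y (r + (d - c)) - y r) volume :=
    (hy.1.comp_measurePreserving (measurePreserving_add_right volume (d - c))).sub hy.1
  refine (hb.lintegral_le (p := p) (q := q) hM.1 hz).trans_eq ?_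
  simp [translationModulus]

/-- The substitution `σ = r + θ h` turns the inner integral into `h` times a mean over `θ` in `[0,
1]`. For fixed `θ`, both `y (r + h)` and `y r` are replaced by `y (r + θ h)` at the cost of
`translationModulus`, and the remaining shift of `r ↦ ξ r (y r)` is removed by continuity of
translations in `L¹`. The errors are integrated over the whole line, whence the uniformity in `a`
and `b`. -/
theorem exists_steklov_close (hp1 : 1 ≤ p) (hp : p ≠ ∞) {ι : V →L[ℝ] H} {M k : ℝ → ℝ}
    {ξ : ℝ → StrongDual ℝ V} (hb : MixedBound volume ι ξ M k) (hξ : StronglyMeasurable ξ)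
    {y : ℝ → V} (hys : StronglyMeasurable y) (hM : MemLp M q volume) (hk : Integrable k volume)
    (hy : MemLp y p volume) {R : ℝ} (hR : ∀ᵐ t, ‖ι (y t)‖ ≤ R) {ε : ℝ} (hε : 0 < ε) :
    ∃ δ > 0, ∀ h : ℝ, 0 < h → h < δ → ∀ a b : ℝ, a ≤ b →
      |h⁻¹ * (∫ r in a..b, ∫ σ in r..r + h, ξ σ (y (r + h) + y r))
        - 2 * ∫ r in a..b, ξ r (y r)| ≤ ε := by
  have hp0 : Integrable (fun r => ξ r (y r)) volume :=
    hb.integrable (p := p) (q := q) hξ.aestronglyMeasurable hM hk hy hR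
  have hW := tendsto_translationModulus (q := q) hp1 hp hM hk hy hR
  have hW1 := tendsto_eLpNorm_translate_sub (p := 1) le_rfl (by simp)
      (memLp_one_iff_integrable.2 hp0)
  -- Four quarters of `ε`: one for each of `y (r + h)` and `y r`, and two for the doubled shift
  -- error.
  have hε4 : (0 : ℝ≥0∞) < ENNReal.ofReal (ε / 4) := by simpa using hε
  obtain ⟨δ, hδ, hδ'⟩ := Metric.eventually_nhds_iff.1
    ((hW.eventually_lt_const hε4).and (hW1.eventually_lt_const hε4))
  refine ⟨δ, hδ, fun h h0 h1 a b hab => ?_⟩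
  set g : ℝ → ℝ → ℝ := fun r θ => ξ (r + θ * h) (y (r + h) + y r) with hg
  have hgm : StronglyMeasurable (Function.uncurry g) := by
    have e1 : StronglyMeasurable fun z : ℝ × ℝ => ξ (z.1 + z.2 * h) :=
      hξ.comp_measurable (by fun_prop)
    have e2 : StronglyMeasurable fun z : ℝ × ℝ => y (z.1 + h) + y z.1 :=
      (hys.comp_measurable (by fun_prop)).add (hys.comp_measurable (by fun_prop))
    exact (isBoundedBilinearMap_apply (𝕜 := ℝ) (E := V) (F := ℝ)).continuous.comp_stronglyMeasurable
      (e1.prodMk e2)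
  have hdecomp : ∀ θ r, g r θ = ξ (r + θ * h) (y (r + h) - y (r + θ * h))
      + ξ (r + θ * h) (y (r + 0) - y (r + θ * h)) + 2 * ξ (r + θ * h) (y (r + θ * h)) := by
    intro θ r
    simp only [hg, map_add, map_sub, add_zero]; ring
  have hmeas1 : ∀ c d : ℝ, AEStronglyMeasurable (fun r => ξ (r + c) (y (r + d) - y (r + c)))
      volume := by
    intro c d
    refine aestronglyMeasurable_clm_apply ?_ ?_
    · exact (hξ.comp_measurable (by fun_prop)).aestronglyMeasurable
    · exact ((hys.comp_measurable (by fun_prop)).sub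
        (hys.comp_measurable (by fun_prop))).aestronglyMeasurable
  have hsmall : ∀ θ ∈ Icc (0 : ℝ) 1, ∀ d ∈ Icc (0 : ℝ) h,
      ∫⁻ r, ‖ξ (r + θ * h) (y (r + d) - y (r + θ * h))‖ₑ ≤ ENNReal.ofReal (ε / 4) := by
    intro θ hθ d hd
    refine (lintegral_apply_translate_sub_le hb hM hy (θ * h) d).trans (hδ' ?_).1.le
    rw [Real.dist_eq, sub_zero, abs_lt]
    have := hθ.1; have := hθ.2; have := hd.1; have := hd.2
    constructor <;> nlinarith
  have hint1 : ∀ θ ∈ Icc (0 : ℝ) 1, ∀ d ∈ Icc (0 : ℝ) h,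
      Integrable (fun r => ξ (r + θ * h) (y (r + d) - y (r + θ * h))) volume := fun θ hθ d hd =>
    ⟨hmeas1 _ _, (hsmall θ hθ d hd).trans_lt ENNReal.ofReal_lt_top⟩
  have hint2 : ∀ c, Integrable (fun r => ξ (r + c) (y (r + c))) volume := fun c =>
    hp0.comp_add_right c
  have hbd : ∀ f : ℝ → ℝ, Integrable f volume → ∀ η : ℝ, 0 ≤ η → ∫⁻ r, ‖f r‖ₑ ≤ ENNReal.ofReal η →
      |∫ r in a..b, f r| ≤ η := by
    intro f hf η hη hle
    rw [intervalIntegral.integral_of_le hab]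
    have h1 : ‖∫ r in Ioc a b, f r‖ₑ ≤ ENNReal.ofReal η :=
      (enorm_integral_le_lintegral_enorm _).trans ((setLIntegral_le_lintegral _ _).trans hle)
    rw [← ofReal_norm, ENNReal.ofReal_le_ofReal_iff hη] at h1
    exact h1
  have hinner : ∀ θ ∈ Icc (0 : ℝ) 1,
      |(∫ r in a..b, g r θ) - 2 * ∫ r in a..b, ξ r (y r)| ≤ ε := by
    intro θ hθ
    have i1 := hint1 θ hθ h ⟨h0.le, le_rfl⟩
    have i2 := hint1 θ hθ 0 ⟨le_rfl, h0.le⟩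
    have i3 := hint2 (θ * h)
    have e1 : ∫ r in a..b, g r θ = (∫ r in a..b, ξ (r + θ * h) (y (r + h) - y (r + θ * h)))
        + (∫ r in a..b, ξ (r + θ * h) (y (r + 0) - y (r + θ * h)))
        + 2 * ∫ r in a..b, ξ (r + θ * h) (y (r + θ * h)) := by
      have i12 : Integrable (fun r => ξ (r + θ * h) (y (r + h) - y (r + θ * h))
          + ξ (r + θ * h) (y (r + 0) - y (r + θ * h))) volume := i1.add i2
      simp_rw [hdecomp θ]
      rw [intervalIntegral.integral_add i12.intervalIntegrable
        (i3.const_mul 2).intervalIntegrable,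
        intervalIntegral.integral_add i1.intervalIntegrable i2.intervalIntegrable,
        intervalIntegral.integral_const_mul]
    have e2 : ∫ r in a..b, (ξ (r + θ * h) (y (r + θ * h)) - ξ r (y r))
        = (∫ r in a..b, ξ (r + θ * h) (y (r + θ * h))) - ∫ r in a..b, ξ r (y r) :=
      intervalIntegral.integral_sub i3.intervalIntegrable hp0.intervalIntegrable
    have b1 := hbd _ i1 (ε / 4) (by positivity) (hsmall θ hθ h ⟨h0.le, le_rfl⟩)
    have b2 := hbd _ i2 (ε / 4) (by positivity) (hsmall θ hθ 0 ⟨le_rfl, h0.le⟩)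
    have b3 := hbd _ (i3.sub hp0) (ε / 4) (by positivity) (by
      have := (hδ' (y := θ * h) (by
        rw [Real.dist_eq, sub_zero, abs_lt]
        have := hθ.1; have := hθ.2
        constructor <;> nlinarith)).2.le
      rwa [eLpNorm_one_eq_lintegral_enorm] at this)
    rw [e1]
    simp only [Pi.sub_apply] at b3
    rw [e2] at b3
    rw [abs_le] at *
    constructor <;> linarith [b1.1, b1.2, b2.1, b2.2, b3.1, b3.2]
  -- The same decomposition gives the integrability that Fubini's theorem needs to exchange `r` and
  -- `θ`.
  have hprod : Integrable (Function.uncurry g)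
      ((volume.restrict (Ioc a b)).prod (volume.restrict (Ioc (0 : ℝ) 1))) := by
    refine ⟨hgm.aestronglyMeasurable, ?_⟩
    rw [HasFiniteIntegral, lintegral_prod_symm _ hgm.aestronglyMeasurable.enorm]
    have hK : ∀ᵐ θ ∂(volume.restrict (Ioc (0 : ℝ) 1)),
        ∫⁻ r in Ioc a b, ‖Function.uncurry g (r, θ)‖ₑ
          ≤ ENNReal.ofReal (ε / 4) + ENNReal.ofReal (ε / 4) + 2 * ∫⁻ r, ‖ξ r (y r)‖ₑ := by
      refine (ae_restrict_iff' measurableSet_Ioc).2 (Eventually.of_forall fun θ hθ => ?_)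
      have hθ' : θ ∈ Icc (0 : ℝ) 1 := ⟨hθ.1.le, hθ.2⟩
      refine (setLIntegral_le_lintegral _ _).trans ?_
      calc ∫⁻ r, ‖Function.uncurry g (r, θ)‖ₑ
          ≤ ∫⁻ r, (‖ξ (r + θ * h) (y (r + h) - y (r + θ * h))‖ₑ
            + ‖ξ (r + θ * h) (y (r + 0) - y (r + θ * h))‖ₑ
            + 2 * ‖ξ (r + θ * h) (y (r + θ * h))‖ₑ) := by
              refine lintegral_mono fun r => ?_
              simp only [Function.uncurry_apply_pair]
              rw [hdecomp θ r]
              refine (enorm_add_le _ _).trans (add_le_add (enorm_add_le _ _) ?_)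
              rw [enorm_mul]
              gcongr
              rw [← ofReal_norm]; simp
        _ = _ := by
              have hm12 : AEMeasurable (fun r => ‖ξ (r + θ * h) (y (r + h) - y (r + θ * h))‖ₑ
                  + ‖ξ (r + θ * h) (y (r + 0) - y (r + θ * h))‖ₑ) volume :=
                (hmeas1 _ _).enorm.add (hmeas1 _ _).enorm
              rw [lintegral_add_left' hm12, lintegral_add_left' (hmeas1 _ _).enorm,
                lintegral_const_mul'' _ (hint2 _).1.enorm,
                lintegral_add_right_eq_self (fun r => ‖ξ r (y r)‖ₑ) (θ * h)]
        _ ≤ _ := by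
              gcongr
              exacts [hsmall θ hθ' h ⟨h0.le, le_rfl⟩, hsmall θ hθ' 0 ⟨le_rfl, h0.le⟩]
    refine (lintegral_mono_ae hK).trans_lt ?_
    rw [lintegral_const]
    refine ENNReal.mul_lt_top ?_ (by simp)
    refine ENNReal.add_lt_top.2 ⟨by simp, ENNReal.mul_lt_top (by simp) hp0.2⟩
  have hswap : h⁻¹ * (∫ r in a..b, ∫ σ in r..r + h, ξ σ (y (r + h) + y r))
      = ∫ θ in (0 : ℝ)..1, ∫ r in a..b, g r θ := by
    have e1 : ∀ r, ∫ σ in r..r + h, ξ σ (y (r + h) + y r) = h * ∫ θ in (0 : ℝ)..1, g r θ := by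
      intro r
      have := intervalIntegral.smul_integral_comp_add_mul (a := 0) (b := 1)
        (fun σ => ξ σ (y (r + h) + y r)) h r
      simp only [mul_zero, add_zero, mul_one, smul_eq_mul] at this
      rw [← this]
      simp only [hg, mul_comm]
    simp_rw [e1]
    rw [intervalIntegral.integral_const_mul, ← mul_assoc, inv_mul_cancel₀ h0.ne', one_mul]
    simp_rw [intervalIntegral.integral_of_le hab, intervalIntegral.integral_of_le zero_le_one]
    exact integral_integral_swap hprod
  rw [hswap]
  have hi : IntervalIntegrable (fun θ => ∫ r in a..b, g r θ) volume 0 1 := by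
    rw [intervalIntegrable_iff, uIoc_of_le zero_le_one]
    simp_rw [intervalIntegral.integral_of_le hab]
    exact hprod.integral_prod_right
  have hc : (∫ θ in (0 : ℝ)..1, ∫ r in a..b, g r θ) - 2 * ∫ r in a..b, ξ r (y r)
      = ∫ θ in (0 : ℝ)..1, ((∫ r in a..b, g r θ) - 2 * ∫ r in a..b, ξ r (y r)) := by
    rw [intervalIntegral.integral_sub hi intervalIntegrable_const]
    simp
  rw [hc]
  have := intervalIntegral.norm_integral_le_of_norm_le_const (a := (0 : ℝ)) (b := 1) (C := ε)
    (f := fun θ => (∫ r in a..b, g r θ) - 2 * ∫ r in a..b, ξ r (y r)) (fun θ hθ => by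
      rw [uIoc_of_le zero_le_one] at hθ
      exact hinner θ ⟨hθ.1.le, hθ.2⟩)
  simpa using this

end Steklov

/-! ### Energy equality and continuity in H -/

section Evolution

variable {H V : Type*} [NormedAddCommGroup H] [InnerProductSpace ℝ H]
  [NormedAddCommGroup V] [NormedSpace ℝ V] {p q : ℝ≥0∞}

/-- `Y` is a bounded `H`-valued function with a `V`-valued version `y` in `L^p`, and with weak
derivative `ξ` in the sum of `L^q(V*)` and `L¹(H)`. -/
structure Evol (T : ℝ) (p q : ℝ≥0∞) (ι : V →L[ℝ] H) (Y : ℝ → H) (y : ℝ → V)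
    (ξ : ℝ → StrongDual ℝ V) : Prop where
  memLp : MemLp y p (timeMeasure T)
  version : ∀ᵐ t ∂(timeMeasure T), ι (y t) = Y t
  bdd : ∃ R, ∀ t ∈ Icc 0 T, ‖Y t‖ ≤ R
  meas : AEStronglyMeasurable ξ (timeMeasure T)
  mixed : ∃ M k : ℝ → ℝ, MemLp M q (timeMeasure T) ∧ Integrable k (timeMeasure T) ∧
    MixedBound (timeMeasure T) ι ξ M k
  eq : ∀ t ∈ Icc 0 T, ∀ v, inner ℝ (Y t) (ι v) = inner ℝ (Y 0) (ι v) + ∫ s in (0 : ℝ)..t, ξ s v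

variable {T : ℝ} {ι : V →L[ℝ] H} {Y : ℝ → H} {y : ℝ → V} {ξ : ℝ → StrongDual ℝ V}

instance isFiniteMeasure_timeMeasure : IsFiniteMeasure (timeMeasure T) :=
  ⟨by simp [timeMeasure]⟩

theorem intervalIntegrable_of_timeMeasure {E : Type*} [NormedAddCommGroup E] {f : ℝ → E}
    (hf : Integrable f (timeMeasure T)) {a b : ℝ} (ha : a ∈ Icc 0 T) (hb : b ∈ Icc 0 T) :
    IntervalIntegrable f volume a b := by
  have : IntegrableOn f (Icc 0 T) volume := hf
  exact (this.mono_set (uIcc_subset_Icc ha hb)).intervalIntegrable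

theorem Evol.integrable_const_apply [ENNReal.HolderTriple q p 1] (h : Evol T p q ι Y y ξ) (v : V) :
    Integrable (fun s => ξ s v) (timeMeasure T) := by
  obtain ⟨M, k, hM, hk, hb⟩ := h.mixed
  exact hb.integrable (p := p) (q := q) h.meas hM hk (memLp_const v) (R := ‖ι v‖)
    (Eventually.of_forall fun _ => le_rfl)

theorem Evol.ae_norm_le (h : Evol T p q ι Y y ξ) {R : ℝ} (hR : ∀ t ∈ Icc 0 T, ‖Y t‖ ≤ R) :
    ∀ᵐ t ∂(timeMeasure T), ‖ι (y t)‖ ≤ R := by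
  filter_upwards [h.version, ae_restrict_mem measurableSet_Icc] with t h1 h2
  rw [h1]
  exact hR t h2

theorem Evol.integrable_apply [ENNReal.HolderTriple q p 1] (h : Evol T p q ι Y y ξ) :
    Integrable (fun s => ξ s (y s)) (timeMeasure T) := by
  obtain ⟨M, k, hM, hk, hb⟩ := h.mixed
  obtain ⟨R, hR⟩ := h.bdd
  exact hb.integrable (p := p) (q := q) h.meas hM hk h.memLp (h.ae_norm_le hR)

theorem Evol.eq_sub [ENNReal.HolderTriple q p 1] (h : Evol T p q ι Y y ξ) {a b : ℝ}
    (ha : a ∈ Icc 0 T) (hb : b ∈ Icc 0 T) (v : V) :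
    inner ℝ (Y b - Y a) (ι v) = ∫ s in a..b, ξ s v := by
  have h0 : (0 : ℝ) ∈ Icc 0 T := ⟨le_rfl, ha.1.trans ha.2⟩
  rw [inner_sub_left, h.eq a ha, h.eq b hb, ← intervalIntegral.integral_interval_sub_left
    (intervalIntegrable_of_timeMeasure (h.integrable_const_apply v) h0 hb)
    (intervalIntegrable_of_timeMeasure (h.integrable_const_apply v) h0 ha)]
  ring

theorem Evol.tendsto_inner [ENNReal.HolderTriple q p 1] (h : Evol T p q ι Y y ξ)
    (hι : DenseRange ι) {t : ℝ} (ht : t ∈ Icc 0 T) (w : H) :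
    Tendsto (fun s => inner ℝ (Y s) w) (𝓝[Icc 0 T] t) (𝓝 (inner ℝ (Y t) w)) := by
  obtain ⟨R, hR⟩ := h.bdd
  refine tendsto_inner_of_denseRange hι (R := R) ?_ (fun v => ?_) w
  · filter_upwards [self_mem_nhdsWithin] with s hs using hR s hs
  · have h0 : (0 : ℝ) ∈ Icc 0 T := ⟨le_rfl, ht.1.trans ht.2⟩
    have hc : ContinuousOn (fun s => inner ℝ (Y s) (ι v)) (Icc 0 T) := by
      have h1 : ContinuousOn (fun s => ∫ r in (0 : ℝ)..s, ξ r v) (Icc 0 T) := by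
        have : IntegrableOn (fun s => ξ s v) (Icc 0 T) volume := h.integrable_const_apply v
        refine (intervalIntegral.continuousOn_primitive this).congr fun s hs => ?_
        exact intervalIntegral.integral_of_le hs.1
      exact (continuousOn_const.add h1).congr fun s hs => h.eq s hs v
    exact hc t ht

variable [ENNReal.HolderTriple q p 1]

/-- Energy equality between almost all pairs of times. -/
theorem Evol.exists_ae_energy (h : Evol T p q ι Y y ξ) (hT : 0 < T) (hp1 : 1 ≤ p) (hp : p ≠ ∞) :
    ∃ c : ℝ, ∀ᵐ t ∂(timeMeasure T), ‖Y t‖ ^ 2 = c + 2 * ∫ s in (0 : ℝ)..t, ξ s (y s) := by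
  obtain ⟨M, k, hM, hk, hb⟩ := h.mixed
  obtain ⟨R, hR⟩ := h.bdd
  have hR0 : 0 ≤ R := (norm_nonneg _).trans (hR 0 ⟨le_rfl, hT.le⟩)
  -- All data are extended by zero to the line and replaced by strongly measurable representatives,
  -- so that translates make sense.
  have hy' : MemLp ((Icc 0 T).indicator y) p volume :=
    (memLp_indicator_iff_restrict measurableSet_Icc).2 h.memLp
  have hM' : MemLp ((Icc 0 T).indicator M) q volume :=
    (memLp_indicator_iff_restrict measurableSet_Icc).2 hM
  have hk' : Integrable ((Icc 0 T).indicator k) volume :=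
    (integrable_indicator_iff measurableSet_Icc).2 hk
  have hξ' : AEStronglyMeasurable ((Icc 0 T).indicator ξ) volume :=
    (aestronglyMeasurable_indicator_iff measurableSet_Icc).2 h.meas
  set y₁ := hy'.1.mk _ with hy₁
  set ξ₁ := hξ'.mk _ with hξ₁
  have hys : StronglyMeasurable y₁ := hy'.1.stronglyMeasurable_mk
  have hξs : StronglyMeasurable ξ₁ := hξ'.stronglyMeasurable_mk
  have ey := hy'.1.ae_eq_mk
  have eξ := hξ'.ae_eq_mk
  have hy1 : MemLp y₁ p volume := hy'.ae_eq ey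
  have hR1 : ∀ᵐ t, ‖ι (y₁ t)‖ ≤ R := by
    have := (ae_restrict_iff' measurableSet_Icc).1 (h.ae_norm_le hR)
    filter_upwards [ey, this] with t h1 h2
    rw [hy₁, ← h1]
    by_cases ht : t ∈ Icc 0 T
    · simpa [ht] using h2 ht
    · simpa [ht] using hR0
  have hb1 : MixedBound volume ι ξ₁ ((Icc 0 T).indicator M) ((Icc 0 T).indicator k) := by
    have := (ae_restrict_iff' measurableSet_Icc).1 hb
    filter_upwards [eξ, this] with t h1 h2 v
    rw [hξ₁, ← h1]
    by_cases ht : t ∈ Icc 0 T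
    · simpa [ht] using h2 ht v
    · simp [ht]
  have eY : ∀ᵐ t, t ∈ Icc 0 T → ι (y₁ t) = Y t := by
    have := (ae_restrict_iff' measurableSet_Icc).1 h.version
    filter_upwards [ey, this] with t h1 h2 h3
    rw [hy₁, ← h1, indicator_of_mem h3, h2 h3]
  have eξv : ∀ a ∈ Icc 0 T, ∀ b ∈ Icc 0 T, ∀ v, ∫ s in a..b, ξ₁ s v = ∫ s in a..b, ξ s v := by
    intro a ha b hb v
    refine intervalIntegral.integral_congr_ae ?_
    filter_upwards [eξ] with t h1 h2
    rw [hξ₁, ← h1, indicator_of_mem (uIcc_subset_Icc ha hb (uIoc_subset_uIcc h2))]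
  have hint : Integrable (fun s => ξ₁ s (y₁ s)) volume :=
    hb1.integrable (p := p) (q := q) hξs.aestronglyMeasurable hM' hk' hy1 hR1
  have eP : ∀ t ∈ Icc 0 T, ∫ s in (0 : ℝ)..t, ξ s (y s) = ∫ s in (0 : ℝ)..t, ξ₁ s (y₁ s) := by
    intro t ht
    refine intervalIntegral.integral_congr_ae ?_
    filter_upwards [eξ, ey] with s h1 h2 h3
    have hs : s ∈ Icc 0 T := uIcc_subset_Icc ⟨le_rfl, hT.le⟩ ht (uIoc_subset_uIcc h3)
    rw [hξ₁, hy₁, ← h1, ← h2, indicator_of_mem hs, indicator_of_mem hs]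
  -- Built from `y₁` to be measurable; it agrees with `‖Y‖ ^ 2` almost everywhere on `[0, T]`.
  set N : ℝ → ℝ := fun r => ‖ι (y₁ r)‖ ^ 2 with hN
  have hNint : LocallyIntegrable N volume := by
    have : MemLp N ∞ volume := by
      refine memLp_top_of_bound ?_ (R ^ 2) ?_
      · exact ((ι.continuous.comp_stronglyMeasurable hys).norm.pow 2).aestronglyMeasurable
      · filter_upwards [hR1] with t ht
        simp only [hN]
        rw [Real.norm_of_nonneg (by positivity)]
        gcongr
    exact this.locallyIntegrable le_top
  have hNi : ∀ a b, IntervalIntegrable N volume a b := fun a b =>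
    (hNint.integrableOn_isCompact isCompact_uIcc).intervalIntegrable
  -- Integrate `N (r + η) - N r = (Y (r + η) - Y r, Y (r + η) + Y r) = ∫ ξ σ (y (r + η) + y r) dσ`
  -- over `r` in `[a, b]` and divide by `η`. The left side collapses to the means of `N` just after
  -- `b` and just after `a`, which converge where the primitive of `N` has derivative `N`; the right
  -- side is the Steklov quotient.
  have key : ∀ a ∈ Ioo 0 T, ∀ b ∈ Ioo 0 T, a ≤ b →
      HasDerivAt (fun x => ∫ s in (0 : ℝ)..x, N s) (N a) a →
      HasDerivAt (fun x => ∫ s in (0 : ℝ)..x, N s) (N b) b →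
      N b - N a = 2 * ∫ r in a..b, ξ₁ r (y₁ r) := by
    intro a ha b hb' hab hda hdb
    have hlim : ∀ x, HasDerivAt (fun x => ∫ s in (0 : ℝ)..x, N s) (N x) x →
        Tendsto (fun h : ℝ => h⁻¹ * ∫ s in x..x + h, N s) (𝓝[>] 0) (𝓝 (N x)) := by
      intro x hx
      have h1 := (hasDerivAt_iff_tendsto_slope_zero.1 hx).mono_left
        (nhdsWithin_mono 0 (fun z (hz : 0 < z) => hz.ne') : 𝓝[>] (0 : ℝ) ≤ 𝓝[≠] 0)
      refine h1.congr fun h => ?_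
      rw [smul_eq_mul, intervalIntegral.integral_interval_sub_left (hNi _ _) (hNi _ _)]
    have hl := (hlim b hdb).sub (hlim a hda)
    have hab' : ∀ ε > 0, |(N b - N a) - 2 * ∫ r in a..b, ξ₁ r (y₁ r)| ≤ ε := by
      intro ε hε
      obtain ⟨δ, hδ, hδ'⟩ := exists_steklov_close (q := q) hp1 hp hb1 hξs hys hM' hk' hy1 hR1 hε
      refine le_of_tendsto ((hl.sub_const (2 * ∫ r in a..b, ξ₁ r (y₁ r))).abs) ?_
      have hpos : 0 < min δ (T - b) := lt_min hδ (sub_pos.2 hb'.2)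
      filter_upwards [Ioo_mem_nhdsGT hpos] with η hh
      have h0 : 0 < η := hh.1
      have h1 : η < δ := hh.2.trans_le (min_le_left _ _)
      have h2 : η < T - b := hh.2.trans_le (min_le_right _ _)
      have := hδ' η h0 h1 a b hab
      have e1 : ∫ r in a..b, ∫ σ in r..r + η, ξ₁ σ (y₁ (r + η) + y₁ r)
          = ∫ r in a..b, (N (r + η) - N r) := by
        refine intervalIntegral.integral_congr_ae ?_
        filter_upwards [eY, (measurePreserving_add_right volume η).quasiMeasurePreserving.ae eY]
          with r h3 h4 h5
        rw [uIoc_of_le hab] at h5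
        have hr : r ∈ Icc 0 T := ⟨ha.1.le.trans h5.1.le, h5.2.trans hb'.2.le⟩
        have hr' : r + η ∈ Icc 0 T := ⟨by linarith [hr.1], by linarith [h5.2]⟩
        rw [eξv r hr _ hr', ← h.eq_sub hr hr', map_add, h3 hr, h4 hr', hN]
        simp only [h3 hr, h4 hr', inner_sub_left, inner_add_right, real_inner_self_eq_norm_sq]
        rw [real_inner_comm (Y r) (Y (r + η))]
        ring
      have e2 : ∫ r in a..b, (N (r + η) - N r) = (∫ s in b..b + η, N s) - ∫ s in a..a + η, N s := by
        rw [intervalIntegral.integral_sub (by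
            have := (hNi (a + η) (b + η)).comp_add_right η
            simpa using this) (hNi _ _),
          intervalIntegral.integral_comp_add_right N η]
        have i1 := intervalIntegral.integral_add_adjacent_intervals (hNi a (a + η))
            (hNi (a + η) (b + η))
        have i2 := intervalIntegral.integral_add_adjacent_intervals (hNi a b) (hNi b (b + η))
        linarith
      rw [e1, e2, mul_sub] at this
      exact this
    have := le_of_forall_pos_le_add (a := |(N b - N a) - 2 * ∫ r in a..b, ξ₁ r (y₁ r)|) (b := 0)
      (fun ε hε => by simpa using hab' ε hε)
    have := abs_eq_zero.1 (le_antisymm this (abs_nonneg _))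
    linarith
  have hgood : ∀ᵐ t ∂(timeMeasure T), t ∈ Ioo 0 T ∧ ι (y₁ t) = Y t ∧
      HasDerivAt (fun x => ∫ s in (0 : ℝ)..x, N s) (N t) t := by
    refine (ae_restrict_iff' measurableSet_Icc).2 ?_
    have n1 : ∀ᵐ t : ℝ, t ≠ 0 := by simp [ae_iff, measure_singleton]
    have n2 : ∀ᵐ t : ℝ, t ≠ T := by simp [ae_iff, measure_singleton]
    filter_upwards [eY, LocallyIntegrable.ae_hasDerivAt_integral hNint, n1, n2] with t h1 h2 h3
        h4 h5
    exact ⟨⟨lt_of_le_of_ne h5.1 (Ne.symm h3), lt_of_le_of_ne h5.2 h4⟩, h1 h5, h2 0⟩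
  have hne : NeZero (timeMeasure T) := ⟨by
    simp [timeMeasure, Measure.restrict_eq_zero, hT]⟩
  -- A single good time fixes the constant.
  obtain ⟨a, ha⟩ := hgood.exists
  refine ⟨‖Y a‖ ^ 2 - 2 * ∫ s in (0 : ℝ)..a, ξ s (y s), ?_⟩
  filter_upwards [hgood] with t ht
  rw [eP a ⟨ha.1.1.le, ha.1.2.le⟩, eP t ⟨ht.1.1.le, ht.1.2.le⟩, ← ha.2.1, ← ht.2.1]
  have hii : ∀ a b, IntervalIntegrable (fun s => ξ₁ s (y₁ s)) volume a b := fun a b =>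
    hint.intervalIntegrable
  have i1 := intervalIntegral.integral_add_adjacent_intervals (hii 0 a) (hii a t)
  have i2 := intervalIntegral.integral_add_adjacent_intervals (hii 0 t) (hii t a)
  rcases le_total a t with hat | hat
  · have := key a ha.1 t ht.1 hat ha.2.2 ht.2.2
    simp only [hN] at this
    linarith
  · have := key t ht.1 a ha.1 hat ht.2.2 ha.2.2
    simp only [hN] at this
    linarith

end Evolution

section Evolution

variable {H V : Type*} [NormedAddCommGroup H] [InnerProductSpace ℝ H]
  [NormedAddCommGroup V] [NormedSpace ℝ V] {p q : ℝ≥0∞}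
variable {T : ℝ} {ι : V →L[ℝ] H} {Y : ℝ → H} {y : ℝ → V} {ξ : ℝ → StrongDual ℝ V}

/-- Within any set of full measure, `‖y‖ ^ p` is somewhere at most its mean. -/
theorem exists_eLpNorm_const_le {μ : Measure ℝ} [IsFiniteMeasure μ] (hμ : μ ≠ 0) (hp0 : p ≠ 0)
    (hp : p ≠ ∞) (hy : MemLp y p μ) {P : ℝ → Prop} (hP : ∀ᵐ t ∂μ, P t) :
    ∃ r, P r ∧ eLpNorm (fun _ : ℝ => y r) p μ ≤ eLpNorm y p μ := by
  have hp' : 0 < p.toReal := ENNReal.toReal_pos hp0 hp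
  obtain ⟨r, hr, hle⟩ := exists_notMem_null_le_laverage (f := fun t => ‖y t‖ₑ ^ p.toReal) hμ
    (hy.1.enorm.pow_const _) (ae_iff.1 hP)
  refine ⟨r, by simpa using hr, ?_⟩
  rw [eLpNorm_const _ hp0 hμ, eLpNorm_eq_lintegral_rpow_enorm_toReal hp0 hp]
  rw [laverage_eq, ENNReal.le_div_iff_mul_le (by simp [hμ]) (by simp)] at hle
  calc ‖y r‖ₑ * μ univ ^ (1 / p.toReal)
      = (‖y r‖ₑ ^ p.toReal * μ univ) ^ (1 / p.toReal) := by
        rw [ENNReal.mul_rpow_of_nonneg _ _ (by positivity), ← ENNReal.rpow_mul,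
          mul_one_div_cancel hp'.ne', ENNReal.rpow_one]
    _ ≤ _ := by gcongr

variable [ENNReal.HolderTriple q p 1]

/-- Such sequences carry almost-everywhere identities to an arbitrary `t`. In a short interval next
to `t`, the time `r n` is chosen so that the constant `y (r n)` has `L^p` norm at most that of `y`
there. Then `(Y t - Y (r n), Y (r n)) = ∫ ξ s (y (r n)) ds` is at most the `L^q` norm of `M` times
the `L^p` norm of `y` on that interval, plus `R ∫ |k|` over it. -/
theorem Evol.exists_seq_version (h : Evol T p q ι Y y ξ) (hT : 0 < T) (hp1 : 1 ≤ p) (hp : p ≠ ∞)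
    {P : ℝ → Prop} (hP : ∀ᵐ t ∂(timeMeasure T), P t) {t : ℝ} (ht : t ∈ Icc 0 T) :
    ∃ r : ℕ → ℝ, (∀ n, P (r n)) ∧ (∀ n, r n ∈ Icc 0 T) ∧ Tendsto r atTop (𝓝 t) ∧
      Tendsto (fun n => inner ℝ (Y t - Y (r n)) (Y (r n))) atTop (𝓝 0) := by
  have hp0 : p ≠ 0 := (zero_lt_one.trans_le hp1).ne'
  have hp' : 0 < p.toReal := ENNReal.toReal_pos hp0 hp
  obtain ⟨M, k, hM, hk, hb⟩ := h.mixed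
  obtain ⟨R, hR⟩ := h.bdd
  set δ : ℕ → ℝ := fun n => T / 2 * (1 / ((n : ℝ) + 1)) with hδ
  have hδ0 : ∀ n, 0 < δ n := fun n => by positivity
  have hδT : ∀ n, δ n ≤ T / 2 := fun n => by
    have : 1 / ((n : ℝ) + 1) ≤ 1 := by
      rw [div_le_one (by positivity)]; linarith [n.cast_nonneg (α := ℝ)]
    simp only [hδ]; nlinarith
  have hδlim : Tendsto δ atTop (𝓝 0) := by
    have := (tendsto_one_div_add_atTop_nhds_zero_nat (𝕜 := ℝ)).const_mul (T / 2)
    rwa [mul_zero] at this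
  -- The interval is taken on the side of `t` where at least `T / 2` of `[0, T]` remains.
  set I : ℕ → Set ℝ := fun n => if T / 2 ≤ t then Icc (t - δ n) t else Icc t (t + δ n) with hI
  have hIsub : ∀ n, I n ⊆ Icc 0 T := by
    intro n r hr
    have := hδT n; have := ht.1; have := ht.2
    simp only [hI] at hr
    split_ifs at hr with hc
    · exact ⟨by linarith [hr.1], by linarith [hr.2]⟩
    · exact ⟨by linarith [hr.1], by linarith [hr.2]⟩
  have hImeas : ∀ n, MeasurableSet (I n) := by
    intro n; simp only [hI]; split_ifs <;> exact measurableSet_Icc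
  have hIvol : ∀ n, volume (I n) = ENNReal.ofReal (δ n) := by
    intro n; simp only [hI]; split_ifs <;> simp
  have hIt : ∀ n, ∀ r ∈ I n, |r - t| ≤ δ n ∧ uIoc r t ⊆ I n := by
    intro n r hr
    simp only [hI] at hr ⊢
    split_ifs at hr ⊢ with hc
    · rw [uIoc_of_le hr.2, abs_le]
      exact ⟨⟨by linarith [hr.1], by linarith [hr.2, hδ0 n]⟩,
        fun s hs => ⟨hr.1.trans hs.1.le, hs.2⟩⟩
    · rw [uIoc_of_ge hr.1, abs_le]
      exact ⟨⟨by linarith [hr.1, hδ0 n], by linarith [hr.2]⟩,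
        fun s hs => ⟨hs.1.le, hs.2.trans hr.2⟩⟩
  set ν : ℕ → Measure ℝ := fun n => (timeMeasure T).restrict (I n) with hν
  have hνeq : ∀ n, ν n = volume.restrict (I n) := fun n => by
    simp only [hν, timeMeasure]
    rw [Measure.restrict_restrict_of_subset (hIsub n)]
  have hνle : ∀ n, ν n ≤ timeMeasure T := fun n => Measure.restrict_le_self
  have hνne : ∀ n, ν n ≠ 0 := fun n => by
    rw [hνeq, Ne, Measure.restrict_eq_zero, hIvol]; simpa using hδ0 n
  have hex : ∀ n, ∃ r, (P r ∧ ι (y r) = Y r ∧ r ∈ I n) ∧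
      eLpNorm (fun _ : ℝ => y r) p (ν n) ≤ eLpNorm y p (ν n) := fun n => by
    refine exists_eLpNorm_const_le (hνne n) hp0 hp (h.memLp.mono_measure (hνle n)) ?_
    filter_upwards [ae_mono (hνle n) hP, ae_mono (hνle n) h.version, ae_restrict_mem (hImeas n)]
      with r h1 h2 h3 using ⟨h1, h2, h3⟩
  choose r hr hrle using hex
  refine ⟨r, fun n => (hr n).1, fun n => hIsub n (hr n).2.2, ?_, ?_⟩
  · rw [tendsto_iff_dist_tendsto_zero]
    exact squeeze_zero (fun _ => dist_nonneg) (fun n => (hIt n _ (hr n).2.2).1) hδlim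
  have hμI : Tendsto (fun n => timeMeasure T (I n)) atTop (𝓝 0) := by
    have : ∀ n, timeMeasure T (I n) = ENNReal.ofReal (δ n) := fun n => by
      rw [timeMeasure, Measure.restrict_apply (hImeas n), inter_eq_left.2 (hIsub n), hIvol]
    simp_rw [this]
    simpa using ENNReal.tendsto_ofReal hδlim
  have l1 : Tendsto (fun n => eLpNorm y p (ν n)) atTop (𝓝 0) := by
    have h1 := tendsto_setLIntegral_zero (μ := timeMeasure T) (f := fun s => ‖y s‖ₑ ^ p.toReal)
      (by
        have := lintegral_rpow_enorm_lt_top_of_eLpNorm_lt_top hp0 hp h.memLp.2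
        exact this.ne) hμI
    have h2 := h1.ennrpow_const (1 / p.toReal)
    rw [ENNReal.zero_rpow_of_pos (by positivity)] at h2
    refine h2.congr fun n => ?_
    rw [eLpNorm_eq_lintegral_rpow_enorm_toReal hp0 hp]
  have l2 := tendsto_setLIntegral_zero (μ := timeMeasure T) (f := fun s => ‖k s‖ₑ) hk.2.ne hμI
  have l3 := (ENNReal.Tendsto.const_mul (a := eLpNorm M q (timeMeasure T)) l1
    (Or.inr hM.2.ne)).add (ENNReal.Tendsto.mul_const (b := ENNReal.ofReal R) l2 (Or.inr (by simp)))
  simp only [mul_zero, zero_mul, add_zero] at l3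
  have l4 : Tendsto (fun n => ‖inner ℝ (Y t - Y (r n)) (Y (r n))‖ₑ) atTop (𝓝 0) := by
    refine tendsto_of_tendsto_of_tendsto_of_le_of_le tendsto_const_nhds l3
      (fun _ => zero_le) fun n => ?_
    have hrn := hIsub n (hr n).2.2
    simp only
    have e1 : inner ℝ (Y t - Y (r n)) (Y (r n)) = ∫ s in r n..t, ξ s (y (r n)) := by
      rw [← h.eq_sub hrn ht, (hr n).2.1]
    rw [e1]
    calc ‖∫ s in r n..t, ξ s (y (r n))‖ₑ
        ≤ ∫⁻ s in uIoc (r n) t, ‖ξ s (y (r n))‖ₑ := by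
          rw [← ofReal_norm, intervalIntegral.norm_intervalIntegral_eq, ofReal_norm]
          exact enorm_integral_le_lintegral_enorm _
      _ ≤ ∫⁻ s in I n, ‖ξ s (y (r n))‖ₑ := lintegral_mono_set (hIt n _ (hr n).2.2).2
      _ = ∫⁻ s, ‖ξ s (y (r n))‖ₑ ∂(ν n) := by rw [hνeq]
      _ ≤ eLpNorm M q (ν n) * eLpNorm (fun _ : ℝ => y (r n)) p (ν n)
          + ∫⁻ s, ‖k s‖ₑ * ‖ι (y (r n))‖ₑ ∂(ν n) :=
          MixedBound.lintegral_le (ae_mono (hνle n) hb) (p := p) (q := q)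
            (hM.1.mono_measure (hνle n)) (z := fun _ => y (r n)) aestronglyMeasurable_const
      _ ≤ _ := by
          gcongr
          · exact hνle n
          · exact hrle n
          · rw [lintegral_mul_const'' _ (hk.1.enorm.mono_measure (hνle n))]
            gcongr
            rw [(hr n).2.1, ← ofReal_norm]
            exact ENNReal.ofReal_le_ofReal (hR _ hrn)
  rw [tendsto_zero_iff_norm_tendsto_zero]
  have := (ENNReal.tendsto_toReal (by simp)).comp l4
  simpa [Function.comp_def] using this

theorem Evol.continuousOn_primitive (h : Evol T p q ι Y y ξ) :
    ContinuousOn (fun t => ∫ s in (0 : ℝ)..t, ξ s (y s)) (Icc 0 T) := by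
  have : IntegrableOn (fun s => ξ s (y s)) (Icc 0 T) volume := h.integrable_apply
  refine (intervalIntegral.continuousOn_primitive this).congr fun s hs => ?_
  exact intervalIntegral.integral_of_le hs.1

/-- Energy equality. -/
theorem Evol.energy (h : Evol T p q ι Y y ξ) (hT : 0 < T) (hp1 : 1 ≤ p) (hp : p ≠ ∞)
    (hι : DenseRange ι) {t : ℝ} (ht : t ∈ Icc 0 T) :
    ‖Y t‖ ^ 2 = ‖Y 0‖ ^ 2 + 2 * ∫ s in (0 : ℝ)..t, ξ s (y s) := by
  obtain ⟨c, hc⟩ := h.exists_ae_energy hT hp1 hp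
  -- Weak continuity gives `(Y t, Y (r n)) → ‖Y t‖ ^ 2`, while `‖Y (r n)‖ ^ 2` converges to the
  -- right-hand side at `t`; along the chosen sequence these limits agree.
  have key : ∀ t ∈ Icc 0 T, ‖Y t‖ ^ 2 = c + 2 * ∫ s in (0 : ℝ)..t, ξ s (y s) := by
    intro t ht
    obtain ⟨r, hr1, hr2, hr3, hr4⟩ := h.exists_seq_version hT hp1 hp hc ht
    have hr5 : Tendsto r atTop (𝓝[Icc 0 T] t) :=
      tendsto_nhdsWithin_iff.2 ⟨hr3, Eventually.of_forall hr2⟩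
    have l1 := (h.tendsto_inner hι ht (Y t)).comp hr5
    have l2 : Tendsto (fun n => c + 2 * ∫ s in (0 : ℝ)..r n, ξ s (y s)) atTop
        (𝓝 (c + 2 * ∫ s in (0 : ℝ)..t, ξ s (y s))) :=
      (((h.continuousOn_primitive t ht).tendsto.comp hr5).const_mul 2).const_add c
    have l3 := (l1.sub l2).congr (f₂ := fun n => inner ℝ (Y t - Y (r n)) (Y (r n))) (fun n => by
      simp only [Function.comp]
      rw [← hr1 n, inner_sub_left, real_inner_self_eq_norm_sq, real_inner_comm])
    have := tendsto_nhds_unique l3 hr4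
    rw [real_inner_self_eq_norm_sq] at this
    linarith
  have h0 := key 0 ⟨le_rfl, hT.le⟩
  rw [key t ht, h0]
  simp

/-- The energy equality makes the norm continuous, and in a Hilbert space weak continuity together
with continuity of the norm is strong continuity. -/
theorem Evol.continuousOn (h : Evol T p q ι Y y ξ) (hT : 0 < T) (hp1 : 1 ≤ p) (hp : p ≠ ∞)
    (hι : DenseRange ι) : ContinuousOn Y (Icc 0 T) := by
  intro t ht
  have h1 : Tendsto (fun s => ‖Y s‖ ^ 2) (𝓝[Icc 0 T] t) (𝓝 (‖Y t‖ ^ 2)) := by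
    rw [h.energy hT hp1 hp hι ht]
    refine (((h.continuousOn_primitive t ht).tendsto.const_mul 2).const_add (‖Y 0‖ ^ 2)).congr' ?_
    filter_upwards [self_mem_nhdsWithin] with s hs using (h.energy hT hp1 hp hι hs).symm
  have h2 := h.tendsto_inner hι ht (Y t)
  have h3 := ((h1.sub (h2.const_mul 2)).add_const (‖Y t‖ ^ 2)).congr
    (f₂ := fun s => ‖Y s - Y t‖ ^ 2) (fun s => by rw [norm_sub_sq_real])
  rw [real_inner_self_eq_norm_sq, show ‖Y t‖ ^ 2 - 2 * ‖Y t‖ ^ 2 + ‖Y t‖ ^ 2 = 0 by ring] at h3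
  have h4 := h3.sqrt
  simp only [Real.sqrt_sq (norm_nonneg _), Real.sqrt_zero] at h4
  exact tendsto_iff_norm_sub_tendsto_zero.2 h4

end Evolution

/-! ### Linear combinations and integration by parts -/

section Linear

variable {H V : Type*} [NormedAddCommGroup H] [InnerProductSpace ℝ H]
  [NormedAddCommGroup V] [NormedSpace ℝ V] {p q : ℝ≥0∞} [ENNReal.HolderTriple q p 1]
variable {T : ℝ} {ι : V →L[ℝ] H} {Y Y' : ℝ → H} {y y' : ℝ → V} {ξ ξ' : ℝ → StrongDual ℝ V}

theorem Evol.neg (h : Evol T p q ι Y y ξ) :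
    Evol T p q ι (fun t => -Y t) (fun t => -y t) (fun t => -ξ t) where
  memLp := h.memLp.neg
  version := by filter_upwards [h.version] with t h1; simp [h1]
  bdd := by
    obtain ⟨R, hR⟩ := h.bdd
    exact ⟨R, fun t ht => by simpa using hR t ht⟩
  meas := h.meas.neg
  mixed := by
    obtain ⟨M, k, hM, hk, hb⟩ := h.mixed
    refine ⟨M, k, hM, hk, ?_⟩
    filter_upwards [hb] with t h1 v using by simpa using h1 v
  eq t ht v := by
    simp only [inner_neg_left, neg_apply, intervalIntegral.integral_neg,
      h.eq t ht v]
    ring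

theorem Evol.add (h : Evol T p q ι Y y ξ) (h' : Evol T p q ι Y' y' ξ') :
    Evol T p q ι (fun t => Y t + Y' t) (fun t => y t + y' t) (fun t => ξ t + ξ' t) where
  memLp := h.memLp.add h'.memLp
  version := by filter_upwards [h.version, h'.version] with t h1 h2; simp [h1, h2]
  bdd := by
    obtain ⟨R, hR⟩ := h.bdd
    obtain ⟨R', hR'⟩ := h'.bdd
    exact ⟨R + R', fun t ht => (norm_add_le _ _).trans (add_le_add (hR t ht) (hR' t ht))⟩
  meas := h.meas.add h'.meas
  mixed := by
    obtain ⟨M, k, hM, hk, hb⟩ := h.mixed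
    obtain ⟨M', k', hM', hk', hb'⟩ := h'.mixed
    refine ⟨fun t => ‖M t‖ + ‖M' t‖, fun t => ‖k t‖ + ‖k' t‖, hM.norm.add hM'.norm,
      hk.norm.add hk'.norm, ?_⟩
    filter_upwards [hb, hb'] with t h1 h2 v
    rw [Real.norm_of_nonneg (by positivity : 0 ≤ ‖M t‖ + ‖M' t‖),
      Real.norm_of_nonneg (by positivity : 0 ≤ ‖k t‖ + ‖k' t‖), add_apply]
    refine (norm_add_le _ _).trans ((add_le_add (h1 v) (h2 v)).trans_eq (by ring))
  eq t ht v := by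
    have h0 : (0 : ℝ) ∈ Icc 0 T := ⟨le_rfl, ht.1.trans ht.2⟩
    simp only [inner_add_left, add_apply]
    rw [h.eq t ht, h'.eq t ht, intervalIntegral.integral_add
      (intervalIntegrable_of_timeMeasure (h.integrable_const_apply v) h0 ht)
      (intervalIntegrable_of_timeMeasure (h'.integrable_const_apply v) h0 ht)]
    ring

theorem Evol.sub (h : Evol T p q ι Y y ξ) (h' : Evol T p q ι Y' y' ξ') :
    Evol T p q ι (fun t => Y t - Y' t) (fun t => y t - y' t) (fun t => ξ t - ξ' t) := by
  simpa only [sub_eq_add_neg] using h.add h'.neg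

theorem Evol.integrable_cross (h : Evol T p q ι Y y ξ) (h' : Evol T p q ι Y' y' ξ') :
    Integrable (fun s => ξ s (y' s)) (timeMeasure T) := by
  obtain ⟨M, k, hM, hk, hb⟩ := h.mixed
  obtain ⟨R, hR⟩ := h'.bdd
  exact hb.integrable (p := p) (q := q) h.meas hM hk h'.memLp (h'.ae_norm_le hR)

/-- Integration by parts. -/
theorem Evol.inner_eq (h : Evol T p q ι Y y ξ) (h' : Evol T p q ι Y' y' ξ') (hT : 0 < T)
    (hp1 : 1 ≤ p) (hp : p ≠ ∞) (hι : DenseRange ι) {t : ℝ} (ht : t ∈ Icc 0 T) :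
    inner ℝ (Y t) (Y' t) = inner ℝ (Y 0) (Y' 0)
      + (∫ s in (0 : ℝ)..t, ξ s (y' s)) + ∫ s in (0 : ℝ)..t, ξ' s (y s) := by
  have h0 : (0 : ℝ) ∈ Icc 0 T := ⟨le_rfl, hT.le⟩
  -- Polarisation: the energy equality for the sum, minus those for the summands.
  have e1 := (h.add h').energy hT hp1 hp hι ht
  have e2 := h.energy hT hp1 hp hι ht
  have e3 := h'.energy hT hp1 hp hι ht
  have i1 := intervalIntegrable_of_timeMeasure h.integrable_apply h0 ht
  have i2 := intervalIntegrable_of_timeMeasure h'.integrable_apply h0 ht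
  have i3 := intervalIntegrable_of_timeMeasure (h.integrable_cross h') h0 ht
  have i4 := intervalIntegrable_of_timeMeasure (h'.integrable_cross h) h0 ht
  have e4 : ∫ s in (0 : ℝ)..t, (ξ s + ξ' s) (y s + y' s)
      = (∫ s in (0 : ℝ)..t, ξ s (y s)) + (∫ s in (0 : ℝ)..t, ξ' s (y' s))
        + ((∫ s in (0 : ℝ)..t, ξ s (y' s)) + ∫ s in (0 : ℝ)..t, ξ' s (y s)) := by
    rw [← intervalIntegral.integral_add i1 i2, ← intervalIntegral.integral_add i3 i4,
      ← intervalIntegral.integral_add (i1.add i2) (i3.add i4)]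
    refine intervalIntegral.integral_congr fun s _ => ?_
    simp only [add_apply, map_add]
    ring
  rw [e4, norm_add_sq_real, norm_add_sq_real] at e1
  linarith

end Linear

/-! ### Grönwall's inequality with an integrable coefficient -/

theorem AbsolutelyContinuousOnInterval.lipschitz_comp {f g : ℝ → ℝ} {a b : ℝ} {K : ℝ}
    (hf : AbsolutelyContinuousOnInterval f a b)
    (hg : ∀ s ∈ uIcc a b, ∀ t ∈ uIcc a b, |g s - g t| ≤ K * |f s - f t|) :
    AbsolutelyContinuousOnInterval g a b := by
  unfold AbsolutelyContinuousOnInterval at hf ⊢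
  refine squeeze_zero' ?_ ?_ (by simpa using hf.const_mul K)
  · exact Eventually.of_forall fun _ => Finset.sum_nonneg fun i _ => dist_nonneg
  · rw [eventually_inf_principal]
    filter_upwards with E hE
    rw [Finset.mul_sum]
    exact Finset.sum_le_sum fun i hi => hg _ (hE.1 i hi).1 _ (hE.1 i hi).2

/-- The primitive of `φ` is absolutely continuous and bounded, and `exp` is Lipschitz on
bounded-above sets, so the exponential is absolutely continuous and is recovered from its
derivative. -/
theorem integral_mul_exp_primitive {T : ℝ} {φ : ℝ → ℝ} (hφ : Integrable φ (timeMeasure T)) {t : ℝ}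
    (ht : t ∈ Icc 0 T) :
    ∫ s in (0 : ℝ)..t, φ s * Real.exp (∫ r in (0 : ℝ)..s, φ r)
      = Real.exp (∫ r in (0 : ℝ)..t, φ r) - 1 := by
  have h0 : (0 : ℝ) ∈ Icc 0 T := ⟨le_rfl, ht.1.trans ht.2⟩
  have hi := intervalIntegrable_of_timeMeasure hφ h0 ht
  set I : ℝ → ℝ := fun s => ∫ r in (0 : ℝ)..s, φ r with hI
  have hac : AbsolutelyContinuousOnInterval I 0 t :=
    hi.absolutelyContinuousOnInterval_intervalIntegral (by simp)
  obtain ⟨C, hC⟩ := hac.exists_bound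
  have hac' : AbsolutelyContinuousOnInterval (fun s => Real.exp (I s)) 0 t := by
    refine AbsolutelyContinuousOnInterval.lipschitz_comp (K := Real.exp C) hac fun r hr s hs => ?_
    have := Convex.norm_image_sub_le_of_norm_deriv_le (f := Real.exp) (C := Real.exp C)
      (s := Iic C) (x := I s) (y := I r) (fun x _ => Real.differentiableAt_exp)
      (fun x hx => by simpa using hx) (convex_Iic C)
      ((le_abs_self _).trans (hC s hs)) ((le_abs_self _).trans (hC r hr))
    simpa [Real.norm_eq_abs] using this
  have h1 := hac'.integral_deriv_eq_sub
  have h2 : Real.exp (I 0) = 1 := by simp [hI]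
  rw [h2] at h1
  rw [← h1]
  refine intervalIntegral.integral_congr_ae ?_
  filter_upwards [hi.ae_hasDerivAt_integral] with s hs hs'
  have := (hs (uIoc_subset_uIcc hs') 0 (by simp)).exp
  rw [this.deriv, mul_comm]

/-- Grönwall's inequality in integral form, with an integrable coefficient. -/
theorem le_mul_exp_of_le_add_integral {T b : ℝ} {f φ : ℝ → ℝ} (hf : ContinuousOn f (Icc 0 T))
    (hφ : Integrable φ (timeMeasure T)) (hφ0 : ∀ᵐ t ∂(timeMeasure T), 0 ≤ φ t) (hb : 0 ≤ b)
    (h : ∀ t ∈ Icc 0 T, f t ≤ b + ∫ s in (0 : ℝ)..t, φ s * f s) {t : ℝ} (ht : t ∈ Icc 0 T) :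
    f t ≤ b * Real.exp (∫ s in (0 : ℝ)..t, φ s) := by
  have h0 : (0 : ℝ) ∈ Icc 0 T := ⟨le_rfl, ht.1.trans ht.2⟩
  set I : ℝ → ℝ := fun s => ∫ r in (0 : ℝ)..s, φ r with hI
  have hIc : ContinuousOn I (Icc 0 T) := by
    have : IntegrableOn φ (Icc 0 T) volume := hφ
    exact (intervalIntegral.continuousOn_primitive this).congr fun s hs =>
      intervalIntegral.integral_of_le hs.1
  have hmul : ∀ g : ℝ → ℝ, ContinuousOn g (Icc 0 T) →
      Integrable (fun s => φ s * g s) (timeMeasure T) := by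
    intro g hg
    have h1 : IntegrableOn φ (Icc 0 T) volume := hφ
    exact h1.mul_continuousOn hg isCompact_Icc
  -- Suppose `f` reaches `(b + ε) exp I`, for the first time at `τ`. Inserting this barrier into the
  -- hypothesis gives `f τ ≤ (b + ε) exp (I τ) - ε`, a contradiction.
  have key : ∀ ε > 0, ∀ t ∈ Icc 0 T, f t < (b + ε) * Real.exp (I t) := by
    intro ε hε
    by_contra! hcon
    obtain ⟨t₁, ht₁, hle₁⟩ := hcon
    set g : ℝ → ℝ := fun s => (b + ε) * Real.exp (I s) with hg
    have hgc : ContinuousOn g (Icc 0 T) := continuousOn_const.mul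
        (Real.continuous_exp.comp_continuousOn hIc)
    set S : Set ℝ := {s ∈ Icc 0 T | g s ≤ f s} with hS
    have hSc : IsClosed S := isClosed_Icc.isClosed_le hgc hf
    have hSne : S.Nonempty := ⟨t₁, ht₁, hle₁⟩
    have hSb : BddBelow S := ⟨0, fun s hs => hs.1.1⟩
    have hmem : sInf S ∈ S := hSc.csInf_mem hSne hSb
    set τ := sInf S with hτ
    have hτI := hmem.1
    have hlt : ∀ s ∈ Icc 0 T, s < τ → f s ≤ g s := by
      intro s hs hsτ
      by_contra! hc
      exact absurd (csInf_le hSb ⟨hs, hc.le⟩) (not_le.2 hsτ)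
    have h0' : (0 : ℝ) ∈ Icc 0 T := ⟨le_rfl, hτI.1.trans hτI.2⟩
    have e1 : ∫ s in (0 : ℝ)..τ, φ s * f s ≤ ∫ s in (0 : ℝ)..τ, φ s * g s := by
      refine intervalIntegral.integral_mono_ae_restrict hτI.1
        (intervalIntegrable_of_timeMeasure (hmul f hf) h0' hτI)
        (intervalIntegrable_of_timeMeasure (hmul g hgc) h0' hτI) ?_
      have h1 : ∀ᵐ s ∂(volume.restrict (Icc 0 τ)), 0 ≤ φ s :=
        ae_mono (Measure.restrict_mono_set _ (Icc_subset_Icc le_rfl hτI.2)) hφ0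
      have h2 : ∀ᵐ s ∂(volume.restrict (Icc 0 τ)), s ≠ τ :=
        ae_restrict_of_ae (by simp [ae_iff, measure_singleton])
      filter_upwards [h1, h2, ae_restrict_mem measurableSet_Icc] with s h3 h4 h5
      exact mul_le_mul_of_nonneg_left
        (hlt s ⟨h5.1, h5.2.trans hτI.2⟩ (lt_of_le_of_ne h5.2 h4)) h3
    have e2 : ∫ s in (0 : ℝ)..τ, φ s * g s = (b + ε) * (Real.exp (I τ) - 1) := by
      rw [← integral_mul_exp_primitive hφ hτI, ← intervalIntegral.integral_const_mul]
      refine intervalIntegral.integral_congr fun s _ => ?_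
      simp only [hg, hI]; ring
    have e3 := h τ hτI
    have e4 : g τ ≤ f τ := hmem.2
    simp only [hg] at e4
    nlinarith
  refine le_of_forall_pos_lt_add fun ε hε => ?_
  have h1 := key (ε / Real.exp (I t)) (by positivity) t ht
  rw [add_mul, div_mul_cancel₀ _ (Real.exp_pos _).ne'] at h1
  exact h1

/-! ### Measurability of functions with values in a separable dual -/

theorem measurable_of_measurable_norm_sub {α E : Type*} [MeasurableSpace α] [NormedAddCommGroup E]
    [MeasurableSpace E] [BorelSpace E] [SecondCountableTopology E] {f : α → E}
    (h : ∀ e, Measurable fun x => ‖f x - e‖) : Measurable f := by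
  refine measurable_of_isOpen fun U hU => ?_
  have hr : ∀ x : U, ∃ r > 0, Metric.ball (x : E) r ⊆ U := fun x => Metric.isOpen_iff.1 hU x x.2
  choose r hr0 hr using hr
  -- By the Lindelöf property an open set is a countable union of balls, whose preimages are
  -- measurable by hypothesis.
  obtain ⟨S, hS, hSU⟩ := TopologicalSpace.isOpen_iUnion_countable
    (fun x : U => Metric.ball (x : E) (r x)) fun x => Metric.isOpen_ball
  have e : U = ⋃ x ∈ S, Metric.ball (x : E) (r x) := by
    rw [hSU]
    refine Subset.antisymm (fun x hx => mem_iUnion.2 ⟨⟨x, hx⟩, Metric.mem_ball_self (hr0 _)⟩) ?_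
    exact iUnion_subset hr
  rw [e, preimage_iUnion₂]
  refine MeasurableSet.biUnion hS fun x _ => ?_
  have : f ⁻¹' Metric.ball (x : E) (r x) = {z | ‖f z - x‖ < r x} := by
    ext z; simp [dist_eq_norm]
  rw [this]
  exact measurableSet_lt (h x) measurable_const

/-- Weakly measurable functions with values in a separable dual are measurable. -/
theorem measurable_dual_of_denseRange {α V : Type*} [MeasurableSpace α] [NormedAddCommGroup V]
    [NormedSpace ℝ V] [SecondCountableTopology (StrongDual ℝ V)] {D : ℕ → V} (hD : DenseRange D)
    {f : α → StrongDual ℝ V} (h : ∀ j, Measurable fun x => f x (D j)) : Measurable f := by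
  refine measurable_of_measurable_norm_sub fun e => ?_
  refine measurable_of_Iic fun c => ?_
  by_cases hc : 0 ≤ c
  -- The operator-norm bound need only be tested on the dense sequence, hence by countably many
  -- measurable conditions.
  · have : (fun x => ‖f x - e‖) ⁻¹' Iic c = ⋂ j, {x | ‖f x (D j) - e (D j)‖ ≤ c * ‖D j‖} := by
      ext x
      simp only [mem_preimage, mem_Iic, mem_iInter, mem_ofPred_eq]
      constructor
      · intro hx j
        exact ((f x - e).le_opNorm (D j)).trans (by gcongr)
      · intro hx
        refine ContinuousLinearMap.opNorm_le_bound _ hc fun v => ?_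
        have hcl : IsClosed {v | ‖(f x - e) v‖ ≤ c * ‖v‖} :=
          isClosed_le (f x - e).continuous.norm (continuous_const.mul continuous_norm)
        exact hD.induction_on v hcl fun j => hx j
    rw [this]
    refine MeasurableSet.iInter fun j => ?_
    exact measurableSet_le ((h j).sub_const _).norm measurable_const
  · have : (fun x => ‖f x - e‖) ⁻¹' Iic c = ∅ := by
      ext x
      simp only [mem_preimage, mem_Iic, mem_empty_iff_false, iff_false, not_le]
      exact (not_le.1 hc).trans_le (norm_nonneg _)
    rw [this]
    exact MeasurableSet.empty

/-! ### Weak compactness and separability -/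

section Functional

variable {V : Type*} [NormedAddCommGroup V] [NormedSpace ℝ V]

/-- Banach–Alaoglu. Ultrafilters make metrisability of the weak-* topology unnecessary. -/
theorem exists_dual_limit {κ : Type*} {l : Filter κ} [l.NeBot] {Q : κ → StrongDual ℝ V} {C : ℝ}
    (hC : ∀ᶠ i in l, ‖Q i‖ ≤ C) :
    ∃ (U : Ultrafilter κ) (ξ : StrongDual ℝ V), (U : Filter κ) ≤ l ∧
      ∀ v, Tendsto (fun i => Q i v) U (𝓝 (ξ v)) := by
  obtain ⟨U, hU⟩ := Ultrafilter.exists_le l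
  have hcomp := WeakDual.isCompact_closedBall (𝕜 := ℝ) (0 : StrongDual ℝ V) C
  have hmem : (WeakDual.toStrongDual ⁻¹' Metric.closedBall (0 : StrongDual ℝ V) C)
      ∈ U.map (fun i => StrongDual.toWeakDual (Q i)) := by
    rw [Ultrafilter.mem_map]
    refine mem_of_superset (hU hC) fun i hi => ?_
    simpa using hi
  obtain ⟨ξ, -, hξ⟩ := hcomp.ultrafilter_le_nhds' _ hmem
  refine ⟨U, WeakDual.toStrongDual ξ, hU, fun v => ?_⟩
  have hξ' : Tendsto (fun i => StrongDual.toWeakDual (Q i)) U (𝓝 ξ) := hξ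
  exact ((WeakDual.eval_continuous v).tendsto ξ).comp hξ'

/-- Hahn–Banach: a point off the closure would be separated from it by a functional bounded above on
the subspace, hence zero there. -/
theorem dense_of_forall_dual_eq_zero {S : Submodule ℝ V}
    (h : ∀ f : StrongDual ℝ V, (∀ x ∈ S, f x = 0) → f = 0) : Dense (S : Set V) := by
  intro x
  by_contra hx
  have hx' : x ∉ (S.topologicalClosure : Set V) := hx
  obtain ⟨f, u, hf, hfx⟩ := geometric_hahn_banach_closed_point
    S.topologicalClosure.convex S.isClosed_topologicalClosure hx'
  have hz : ∀ y ∈ S, f y = 0 := by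
    intro y hy
    by_contra hne
    have := hf (((u + 1) / f y) • y) (S.topologicalClosure.smul_mem _ (S.le_topologicalClosure hy))
    rw [map_smul, smul_eq_mul, div_mul_cancel₀ _ hne] at this
    linarith
  have h0 := hf 0 (Submodule.zero_mem _)
  rw [map_zero] at h0
  rw [h f hz] at hfx
  simp at hfx
  linarith

/-- Take nearly norming vectors `v g` in the unit ball for `g` in a dense sequence of functionals.
If a nonzero `f` vanishes on all of them, choose `g` within `‖f‖ / 4` of `f`; then `‖g (v g)‖` is at
most `‖f - g‖` and at least `‖g‖ / 2`, which is impossible. So they span a dense subspace. -/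
theorem separableSpace_of_dual [TopologicalSpace.SeparableSpace (StrongDual ℝ V)] :
    TopologicalSpace.SeparableSpace V := by
  have hex : ∀ f : StrongDual ℝ V, ∃ v : V, ‖v‖ ≤ 1 ∧ ‖f‖ / 2 ≤ ‖f v‖ := by
    intro f
    by_contra! hcon
    rcases (norm_nonneg f).eq_or_lt with h0 | h0
    · have := hcon 0 (by simp)
      rw [← h0] at this
      simp at this
    · have h1 : ‖f‖ ≤ ‖f‖ / 2 := by
        refine ContinuousLinearMap.opNorm_le_of_unit_norm (by positivity) fun v hv => ?_
        exact (hcon v hv.le).le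
      linarith
  choose v hv1 hv2 using hex
  set S : Submodule ℝ V := Submodule.span ℝ
    (range fun n => v (TopologicalSpace.denseSeq (StrongDual ℝ V) n)) with hS
  have hd : Dense (S : Set V) := by
    refine dense_of_forall_dual_eq_zero fun f hf => ?_
    by_contra hne
    have hpos : 0 < ‖f‖ := norm_pos_iff.2 hne
    obtain ⟨n, hn⟩ := (TopologicalSpace.denseRange_denseSeq (StrongDual ℝ V)).exists_dist_lt f
      (ε := ‖f‖ / 4) (by positivity)
    set g := TopologicalSpace.denseSeq (StrongDual ℝ V) n with hg
    rw [dist_eq_norm] at hn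
    have h1 : f (v g) = 0 := hf _ (Submodule.subset_span ⟨n, rfl⟩)
    have h2 : ‖g (v g)‖ ≤ ‖f - g‖ := by
      have : ‖(f - g) (v g)‖ ≤ ‖f - g‖ * ‖v g‖ := (f - g).le_opNorm _
      rw [sub_apply, h1, zero_sub, norm_neg] at this
      exact this.trans (mul_le_of_le_one_right (norm_nonneg _) (hv1 g))
    have h3 := hv2 g
    have h4 := norm_sub_norm_le f g
    linarith
  have hsep : TopologicalSpace.IsSeparable (S : Set V) :=
    (countable_range _).isSeparable.span
  have := hsep.closure
  rw [hd.closure_eq] at this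
  exact TopologicalSpace.isSeparable_univ_iff.1 this

variable {H : Type*} [NormedAddCommGroup H] [InnerProductSpace ℝ H]

/-- Reflexivity brings the weak-* limit in the bidual back to `V`. -/
theorem exists_weak_limit (hrefl : Function.Surjective (NormedSpace.inclusionInDoubleDual ℝ V))
    {κ : Type*} {l : Filter κ} [l.NeBot] {x : κ → V} {C : ℝ} (hC : ∀ᶠ i in l, ‖x i‖ ≤ C) :
    ∃ (U : Ultrafilter κ) (v : V), (U : Filter κ) ≤ l ∧ ‖v‖ ≤ C ∧
      ∀ f : StrongDual ℝ V, Tendsto (fun i => f (x i)) U (𝓝 (f v)) := by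
  obtain ⟨U, ξ, hU, hξ⟩ := exists_dual_limit (l := l)
    (Q := fun i => NormedSpace.inclusionInDoubleDual ℝ V (x i)) (C := C) (by
      filter_upwards [hC] with i hi
      exact (NormedSpace.double_dual_bound ℝ V (x i)).trans hi)
  obtain ⟨v, rfl⟩ := hrefl ξ
  refine ⟨U, v, hU, ?_, fun f => by simpa using hξ f⟩
  obtain ⟨f, hf1, hf2⟩ := exists_dual_vector'' ℝ v
  have h1 : Tendsto (fun i => f (x i)) U (𝓝 (f v)) := by simpa using hξ f
  have hf2' : f v = ‖v‖ := by simpa using hf2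
  rw [← hf2']
  refine le_of_tendsto h1 ?_
  filter_upwards [hU hC] with i hi
  refine (le_abs_self _).trans ((f.le_opNorm _).trans ?_)
  exact (mul_le_of_le_one_left (norm_nonneg _) hf1).trans hi

/-- Weak limits in `H` of sequences whose `V`-norms do not tend to infinity lie in `V`. -/
theorem exists_preimage_of_liminf
    (hrefl : Function.Surjective (NormedSpace.inclusionInDoubleDual ℝ V)) {ι : V →L[ℝ] H}
    (hinj : Function.Injective ι) {x : ℕ → V} {h : H}
    (hx : ∀ w, Tendsto (fun n => inner ℝ (ι (x n)) w) atTop (𝓝 (inner ℝ h w)))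
    (hlim : liminf (fun n => ‖x n‖ₑ) atTop < ∞) :
    ∃ v, ι v = h ∧ ‖v‖ₑ ≤ liminf (fun n => ‖x n‖ₑ) atTop := by
  set L := liminf (fun n => ‖x n‖ₑ) atTop with hL
  -- The norms fall below any level `b` above the liminf infinitely often, and a weak limit along
  -- those indices has norm at most `b`. Injectivity of `ι` makes the preimages for different `b`
  -- equal.
  have key : ∀ b : ℝ≥0, L < b → ∃ v, ι v = h ∧ ‖v‖ₑ ≤ b := by
    intro b hb
    have hf : ∃ᶠ n in atTop, ‖x n‖ₑ < b := frequently_lt_of_liminf_lt (by isBoundedDefault) hb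
    have hne : (atTop ⊓ 𝓟 {n | ‖x n‖ₑ < b}).NeBot := frequently_iff_neBot.1 hf
    obtain ⟨U, v, hU, hv, hlimv⟩ := exists_weak_limit hrefl (l := atTop ⊓ 𝓟 {n | ‖x n‖ₑ < b})
      (x := x) (C := b) (by
        refine eventually_inf_principal.2 (Eventually.of_forall fun n hn => ?_)
        have : ‖x n‖ₑ < b := hn
        rw [← ofReal_norm, ENNReal.ofReal_lt_coe_iff (by positivity)] at this
        exact this.le)
    refine ⟨v, ?_, ?_⟩
    · refine ext_inner_right ℝ fun w => ?_
      have h1 : Tendsto (fun i => inner ℝ w (ι (x i))) U (𝓝 (inner ℝ w (ι v))) :=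
        hlimv ((innerSL ℝ w).comp ι)
      have h2 := (hx w).mono_left (hU.trans inf_le_left)
      refine tendsto_nhds_unique (h1.congr fun i => real_inner_comm _ _) h2 |>.symm ▸ ?_
      exact real_inner_comm _ _
    · rw [← ofReal_norm, ← ENNReal.ofReal_coe_nnreal]
      exact ENNReal.ofReal_le_ofReal hv
  obtain ⟨b₀, hb₀⟩ := ENNReal.lt_iff_exists_nnreal_btwn.1 hlim
  obtain ⟨v, hv, -⟩ := key b₀ hb₀.1
  refine ⟨v, hv, ?_⟩
  refine le_of_forall_gt fun c hc => ?_
  obtain ⟨b, hb1, hb2⟩ := ENNReal.lt_iff_exists_nnreal_btwn.1 hc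
  obtain ⟨v', hv', hle⟩ := key b hb1
  have : v' = v := hinj (hv'.trans hv.symm)
  rw [this] at hle
  exact hle.trans_lt hb2

end Functional

section Triplet

theorem toDual_apply_apply {H V : Type*} [NormedAddCommGroup H] [InnerProductSpace ℝ H]
    [NormedAddCommGroup V] [NormedSpace ℝ V] (ι : V →L[ℝ] H) (h : H) (v : V) :
    toDual ι h v = inner ℝ h (ι v) := rfl

variable {H V : Type*} [NormedAddCommGroup H] [InnerProductSpace ℝ H] [CompleteSpace H]
  [TopologicalSpace.SeparableSpace H] [NormedAddCommGroup V] [NormedSpace ℝ V] {ι : V →L[ℝ] H}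

/-- By reflexivity, a functional on `V*` that annihilates the range is evaluation at some `v` with
`ι v` orthogonal to all of `H`, so `v = 0`. -/
theorem IsGelfandTriplet.denseRange_toDual (h : IsGelfandTriplet ι) : DenseRange (toDual ι) := by
  have : Dense ((LinearMap.range (toDual ι).toLinearMap : Submodule ℝ (StrongDual ℝ V)) :
      Set (StrongDual ℝ V)) := by
    refine dense_of_forall_dual_eq_zero fun f hf => ?_
    obtain ⟨v, rfl⟩ := h.reflexive f
    have h1 : ι v = 0 := by
      refine ext_inner_left ℝ fun w => ?_
      have := hf (toDual ι w) ⟨w, rfl⟩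
      rw [NormedSpace.dual_def, toDual_apply_apply] at this
      rw [this, inner_zero_right]
    have h2 : v = 0 := h.injective (by rw [h1, map_zero])
    rw [h2, map_zero]
  exact this

/-- Separability is assumed for `H` only; it passes to `V*` through the dense image of `H`, and from
`V*` to `V`. -/
theorem IsGelfandTriplet.separableSpace_dual (h : IsGelfandTriplet ι) :
    TopologicalSpace.SeparableSpace (StrongDual ℝ V) :=
  h.denseRange_toDual.separableSpace (toDual ι).continuous

theorem IsGelfandTriplet.separableSpace (h : IsGelfandTriplet ι) :
    TopologicalSpace.SeparableSpace V :=
  have := h.separableSpace_dual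
  separableSpace_of_dual

end Triplet

/-! ### Averages and lower limits in L^r -/

section Average

/-- Uniform probability measure on `(0, h]`. -/
noncomputable def avgMeasure (h : ℝ) : Measure ℝ := ENNReal.ofReal h⁻¹ • volume.restrict (Ioc 0 h)

theorem isProbabilityMeasure_avgMeasure {h : ℝ} (hh : 0 < h) :
    IsProbabilityMeasure (avgMeasure h) := by
  refine ⟨?_⟩
  rw [avgMeasure, Measure.smul_apply, Measure.restrict_apply_univ, Real.volume_Ioc, sub_zero,
    smul_eq_mul, ← ENNReal.ofReal_mul (by positivity), inv_mul_cancel₀ hh.ne', ENNReal.ofReal_one]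

theorem lintegral_avgMeasure (h t : ℝ) (F : ℝ → ℝ≥0∞) :
    ∫⁻ θ, F (t + θ) ∂(avgMeasure h) = ENNReal.ofReal h⁻¹ * ∫⁻ s in Ioc t (t + h), F s := by
  rw [avgMeasure, lintegral_smul_measure, smul_eq_mul]
  congr 1
  have h1 := (measurePreserving_add_left volume t).setLIntegral_comp_emb
    (measurableEmbedding_addLeft t) F (Ioc 0 h)
  rw [h1]
  simp [image_const_add_Ioc, add_comm]

/-- Jensen's inequality, then Fubini's theorem and translation invariance: averaging is a
contraction of `L^r`. -/
theorem lintegral_avg_rpow_le {F : ℝ → ℝ≥0∞} (hF : Measurable F) {h : ℝ} (hh : 0 < h) {r : ℝ}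
    (hr : 1 ≤ r) :
    ∫⁻ t, (∫⁻ θ, F (t + θ) ∂(avgMeasure h)) ^ r ≤ ∫⁻ t, F t ^ r := by
  have := isProbabilityMeasure_avgMeasure hh
  have hr0 : 0 < r := by positivity
  have h1 : ∀ t, (∫⁻ θ, F (t + θ) ∂(avgMeasure h)) ^ r ≤ ∫⁻ θ, F (t + θ) ^ r ∂(avgMeasure h) := by
    intro t
    have hm : Measurable fun θ => F (t + θ) := hF.comp (by fun_prop)
    have h2 := eLpNorm'_le_eLpNorm'_of_exponent_le (f := fun θ => F (t + θ)) one_pos hr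
      (avgMeasure h) hm.aestronglyMeasurable
    simp only [eLpNorm', enorm_eq_self, ENNReal.rpow_one, ne_eq, one_ne_zero, not_false_eq_true,
      div_self, one_div] at h2
    calc (∫⁻ θ, F (t + θ) ∂(avgMeasure h)) ^ r
        ≤ ((∫⁻ θ, F (t + θ) ^ r ∂(avgMeasure h)) ^ r⁻¹) ^ r := by gcongr
      _ = _ := by rw [← ENNReal.rpow_mul, inv_mul_cancel₀ hr0.ne', ENNReal.rpow_one]
  refine (lintegral_mono h1).trans ?_
  rw [lintegral_lintegral_swap]
  · have h3 : ∀ θ, ∫⁻ t, F (t + θ) ^ r = ∫⁻ t, F t ^ r := fun θ =>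
      lintegral_add_right_eq_self (fun t => F t ^ r) θ
    simp_rw [h3]
    simp
  · have : Measurable (Function.uncurry fun t θ : ℝ => F (t + θ) ^ r) := by
      have : Measurable fun z : ℝ × ℝ => F (z.1 + z.2) := hF.comp (by fun_prop)
      exact this.pow_const r
    exact this.aemeasurable

theorem measurable_avg {F : ℝ → ℝ≥0∞} (hF : Measurable F) {h : ℝ} (hh : 0 < h) :
    Measurable fun t => ∫⁻ θ, F (t + θ) ∂(avgMeasure h) := by
  have := isProbabilityMeasure_avgMeasure hh
  have h1 : Measurable fun z : ℝ × ℝ => F (z.1 + z.2) := hF.comp (by fun_prop)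
  exact h1.lintegral_prod_right'

theorem lintegral_liminf_rpow_le {μ : Measure ℝ} {F : ℕ → ℝ → ℝ≥0∞} (hF : ∀ n, Measurable (F n))
    {r : ℝ} (hr : 0 < r) {C : ℝ≥0∞} (hC : ∀ n, ∫⁻ t, F n t ^ r ∂μ ≤ C) :
    ∫⁻ t, (liminf (fun n => F n t) atTop) ^ r ∂μ ≤ C := by
  have h1 : ∀ t, (liminf (fun n => F n t) atTop) ^ r = liminf (fun n => F n t ^ r) atTop := by
    intro t
    exact (ENNReal.monotone_rpow_of_nonneg hr.le).map_liminf_of_continuousAt _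
      (ENNReal.continuous_rpow_const.continuousAt) (by isBoundedDefault) (by isBoundedDefault)
  simp_rw [h1]
  refine (lintegral_liminf_le fun n => (hF n).pow_const r).trans ?_
  exact liminf_le_of_le (by isBoundedDefault) fun b hb => by
    obtain ⟨n, hn⟩ := hb.exists
    exact hn.trans (hC n)

end Average

/-! ### Weak derivatives of weak limits -/

section WeakDerivative

variable {H V : Type*} [NormedAddCommGroup H] [InnerProductSpace ℝ H]
  [NormedAddCommGroup V] [NormedSpace ℝ V] {p q : ℝ≥0∞} [ENNReal.HolderTriple q p 1]
  {T : ℝ} {ι : V →L[ℝ] H}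

theorem setLIntegral_apply_const_le {G : ℝ → StrongDual ℝ V} {M k : ℝ → ℝ}
    (hb : MixedBound (timeMeasure T) ι G M k) (hM : AEStronglyMeasurable M (timeMeasure T))
    (hk : Integrable k (timeMeasure T)) {C : ℝ≥0∞} (hC : eLpNorm M q (timeMeasure T) ≤ C)
    (hp0 : p ≠ 0) (hp : p ≠ ∞) (v : V) (S : Set ℝ) :
    ∫⁻ s in S, ‖G s v‖ₑ ∂(timeMeasure T)
      ≤ C * (‖v‖ₑ * timeMeasure T S ^ (1 / p.toReal))
        + (∫⁻ s in S, ‖k s‖ₑ ∂(timeMeasure T)) * ‖ι v‖ₑ := by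
  have hle : (timeMeasure T).restrict S ≤ timeMeasure T := Measure.restrict_le_self
  refine (MixedBound.lintegral_le (ae_mono hle hb) (p := p) (q := q) (hM.mono_measure hle)
    (z := fun _ => v) aestronglyMeasurable_const).trans ?_
  rw [eLpNorm_const' v hp0 hp, lintegral_mul_const'' _ (hk.1.mono_measure hle).enorm,
    Measure.restrict_apply_univ]
  gcongr
  exact (eLpNorm_mono_measure _ hle).trans hC

theorem enorm_intervalIntegral_le {f : ℝ → ℝ} {a b : ℝ} (ha : a ∈ Icc 0 T) (hb : b ∈ Icc 0 T) :
    ‖∫ s in a..b, f s‖ₑ ≤ ∫⁻ s in uIoc a b, ‖f s‖ₑ ∂(timeMeasure T) := by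
  have : (timeMeasure T).restrict (uIoc a b) = volume.restrict (uIoc a b) := by
    rw [timeMeasure, Measure.restrict_restrict_of_subset
      (uIoc_subset_uIcc.trans (uIcc_subset_Icc ha hb))]
  rw [this, ← ofReal_norm, intervalIntegral.norm_intervalIntegral_eq, ofReal_norm]
  exact enorm_integral_le_lintegral_enorm _

/-- The primitives of `G n s v` are absolutely continuous uniformly in `n`, by Hölder's inequality
for `M n` and smallness of `∫ |k|` on small sets. This uniform estimate passes to pointwise limits.
-/
theorem absolutelyContinuous_of_tendsto (hT : 0 ≤ T) {G : ℕ → ℝ → StrongDual ℝ V} {M : ℕ → ℝ → ℝ}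
    {k : ℝ → ℝ} (hG : ∀ n, AEStronglyMeasurable (G n) (timeMeasure T))
    (hb : ∀ n, MixedBound (timeMeasure T) ι (G n) (M n) k)
    (hM : ∀ n, AEStronglyMeasurable (M n) (timeMeasure T))
    (hk : Integrable k (timeMeasure T)) {C : ℝ≥0∞} (hC : ∀ n, eLpNorm (M n) q (timeMeasure T) ≤ C)
    (hCt : C ≠ ∞) (hp0 : p ≠ 0) (hp : p ≠ ∞) {v : V} {f : ℝ → ℝ}
    (hf : ∀ t ∈ Icc 0 T, Tendsto (fun n => ∫ s in (0 : ℝ)..t, G n s v) atTop (𝓝 (f t))) :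
    AbsolutelyContinuousOnInterval f 0 T := by
  have hp' : 0 < p.toReal := ENNReal.toReal_pos hp0 hp
  have hint : ∀ n, Integrable (fun s => G n s v) (timeMeasure T) := fun n =>
    (hb n).integrable (p := p) (q := q) (hG n) ⟨hM n, (hC n).trans_lt hCt.lt_top⟩ hk (memLp_const v)
      (R := ‖ι v‖) (Eventually.of_forall fun _ => le_rfl)
  have h0 : (0 : ℝ) ∈ Icc 0 T := ⟨le_rfl, hT⟩
  set U : ℕ × (ℕ → ℝ × ℝ) → Set ℝ := fun E => ⋃ i ∈ Finset.range E.1, uIoc (E.2 i).1 (E.2 i).2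
    with hU
  set Θ : ℕ × (ℕ → ℝ × ℝ) → ℝ≥0∞ := fun E => C * (‖v‖ₑ * timeMeasure T (U E) ^ (1 / p.toReal))
        + (∫⁻ s in U E, ‖k s‖ₑ ∂(timeMeasure T)) * ‖ι v‖ₑ with hΘ
  have hvol : Tendsto (fun E => timeMeasure T (U E))
      (AbsolutelyContinuousOnInterval.totalLengthFilter ⊓
        𝓟 (AbsolutelyContinuousOnInterval.disjWithin 0 T)) (𝓝 0) := by
    refine tendsto_of_tendsto_of_tendsto_of_le_of_le tendsto_const_nhds
      (AbsolutelyContinuousOnInterval.tendsto_volume_totalLengthFilter_nhds_zero.mono_left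
        inf_le_left) (fun _ => zero_le) fun E => ?_
    exact Measure.restrict_apply_le _ _
  have hΘ0 : Tendsto Θ (AbsolutelyContinuousOnInterval.totalLengthFilter ⊓
        𝓟 (AbsolutelyContinuousOnInterval.disjWithin 0 T)) (𝓝 0) := by
    have l1 := hvol.ennrpow_const (1 / p.toReal)
    rw [ENNReal.zero_rpow_of_pos (by positivity)] at l1
    have l2 := ENNReal.Tendsto.const_mul (a := C)
      (ENNReal.Tendsto.const_mul (a := ‖v‖ₑ) l1 (Or.inr (by simp))) (Or.inr hCt)
    have l3 := ENNReal.Tendsto.mul_const (b := ‖ι v‖ₑ)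
      (tendsto_setLIntegral_zero (μ := timeMeasure T) (f := fun s => ‖k s‖ₑ) hk.2.ne hvol)
      (Or.inr (by simp))
    have l4 := l2.add l3
    simp only [mul_zero, zero_mul, add_zero] at l4
    exact l4
  have hΘt : ∀ E, Θ E ≠ ∞ := by
    intro E
    refine ENNReal.add_ne_top.2 ⟨ENNReal.mul_ne_top hCt (ENNReal.mul_ne_top (by simp) ?_),
      ENNReal.mul_ne_top ?_ (by simp)⟩
    · exact ENNReal.rpow_ne_top_of_nonneg (by positivity) (measure_ne_top _ _)
    · exact ((setLIntegral_le_lintegral _ _).trans_lt hk.2).ne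
  refine squeeze_zero' (Eventually.of_forall fun _ => Finset.sum_nonneg fun i _ => dist_nonneg)
    ?_ ((ENNReal.tendsto_toReal (by simp)).comp hΘ0)
  rw [eventually_inf_principal]
  filter_upwards with E hE
  have hIcc : ∀ i ∈ Finset.range E.1, (E.2 i).1 ∈ Icc 0 T ∧ (E.2 i).2 ∈ Icc 0 T := by
    intro i hi
    have := hE.1 i hi
    rwa [uIcc_of_le hT] at this
  have hlim : Tendsto (fun n => ∑ i ∈ Finset.range E.1,
      dist (∫ s in (0 : ℝ)..(E.2 i).1, G n s v) (∫ s in (0 : ℝ)..(E.2 i).2, G n s v)) atTop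
      (𝓝 (∑ i ∈ Finset.range E.1, dist (f (E.2 i).1) (f (E.2 i).2))) :=
    tendsto_finsetSum _ fun i hi => (hf _ (hIcc i hi).1).dist (hf _ (hIcc i hi).2)
  refine le_of_tendsto hlim (Eventually.of_forall fun n => ?_)
  simp only [Function.comp]
  rw [← ENNReal.ofReal_le_iff_le_toReal (hΘt E),
    ENNReal.ofReal_sum_of_nonneg fun _ _ => dist_nonneg]
  refine le_trans ?_ (setLIntegral_apply_const_le (q := q) (hb n) (hM n) hk (hC n) hp0 hp v (U E))
  rw [hU, lintegral_biUnion_finset (fun i hi j hj hij => hE.2 hi hj hij)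
    (fun i _ => measurableSet_uIoc)]
  refine Finset.sum_le_sum fun i hi => ?_
  rw [Real.dist_eq, abs_sub_comm, ← Real.norm_eq_abs, ofReal_norm,
    intervalIntegral.integral_interval_sub_left
      (intervalIntegrable_of_timeMeasure (hint n) h0 (hIcc i hi).2)
      (intervalIntegrable_of_timeMeasure (hint n) h0 (hIcc i hi).1)]
  exact enorm_intervalIntegral_le (hIcc i hi).1 (hIcc i hi).2

end WeakDerivative

section WeakDerivative

variable {H V : Type*} [NormedAddCommGroup H] [InnerProductSpace ℝ H]
  [NormedAddCommGroup V] [NormedSpace ℝ V] {p q : ℝ≥0∞}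
  {T : ℝ} {ι : V →L[ℝ] H}

/-- Meant for a single time, with `Q m` the difference quotients and `a m` the size of their part in
`V*`. Along the indices with `a m < b` Banach–Alaoglu yields a functional; its values on `D`
determine it, so it does not depend on `b`, and `b` may decrease to the liminf. -/
theorem exists_functional_of_liminf_lt_top {D : ℕ → V} (hD : DenseRange D)
    {Q : ℕ → StrongDual ℝ V} {a : ℕ → ℝ≥0∞} {κ : ℕ → ℝ} {κ' : ℝ} {d : ℕ → ℝ}
    (hκ : Tendsto κ atTop (𝓝 κ')) (hd : ∀ j, Tendsto (fun m => Q m (D j)) atTop (𝓝 (d j)))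
    (ha : liminf a atTop < ∞)
    (hQ : ∀ᶠ m in atTop, ∀ b : ℝ≥0, a m < b → ∀ v, ‖Q m v‖ ≤ b * ‖v‖ + κ m * ‖ι v‖) :
    ∃ ξ : StrongDual ℝ V, (∀ j, ξ (D j) = d j) ∧
      ∀ v, ‖ξ v‖ ≤ (liminf a atTop).toReal * ‖v‖ + κ' * ‖ι v‖ := by
  have key : ∀ b : ℝ≥0, liminf a atTop < b → ∃ ξ : StrongDual ℝ V, (∀ j, ξ (D j) = d j) ∧
      ∀ v, ‖ξ v‖ ≤ b * ‖v‖ + κ' * ‖ι v‖ := by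
    intro b hb
    have hfr := frequently_lt_of_liminf_lt (by isBoundedDefault) hb
    set l : Filter ℕ := atTop ⊓ 𝓟 {m | a m < b} with hl
    have hne : l.NeBot := by
      rw [hl, inf_principal_neBot_iff]
      intro U hU
      obtain ⟨m, hm⟩ := (hfr.and_eventually hU).exists
      exact ⟨m, hm.2, hm.1⟩
    have hle : l ≤ atTop := inf_le_left
    have hbd : ∀ᶠ m in l, ∀ v, ‖Q m v‖ ≤ b * ‖v‖ + κ m * ‖ι v‖ := by
      rw [hl, eventually_inf_principal]
      filter_upwards [hQ] with m hm hm' using hm b hm'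
    have hbd2 : ∀ᶠ m in l, ‖Q m‖ ≤ b + (|κ'| + 1) * ‖ι‖ := by
      have : ∀ᶠ m in l, κ m < |κ'| + 1 :=
        hle (hκ.eventually (gt_mem_nhds (by linarith [le_abs_self κ'])))
      filter_upwards [hbd, this] with m h1 h2
      refine ContinuousLinearMap.opNorm_le_bound _ (by positivity) fun v => (h1 v).trans ?_
      have := ι.le_opNorm v
      calc b * ‖v‖ + κ m * ‖ι v‖ ≤ b * ‖v‖ + (|κ'| + 1) * (‖ι‖ * ‖v‖) := by gcongr
        _ = _ := by ring
    obtain ⟨U, ξ, hU, hξ⟩ := exists_dual_limit hbd2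
    refine ⟨ξ, fun j => tendsto_nhds_unique (hξ (D j)) ((hd j).mono_left (hU.trans hle)),
      fun v => ?_⟩
    refine le_of_tendsto_of_tendsto (hξ v).norm
      (tendsto_const_nhds.add ((hκ.mono_left (hU.trans hle)).mul_const _)) (hU ?_)
    filter_upwards [hbd] with m hm using hm v
  set A := (liminf a atTop).toNNReal with hA
  have hAe : liminf a atTop = A := (ENNReal.coe_toNNReal ha.ne).symm
  rw [hAe] at key ⊢
  obtain ⟨ξ, hξ, -⟩ := key (A + 1) (by exact_mod_cast lt_add_one A)
  refine ⟨ξ, hξ, fun v => ?_⟩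
  rw [ENNReal.coe_toReal]
  refine le_of_forall_pos_le_add fun ε hε => ?_
  have hpos : 0 < ε / (‖v‖ + 1) := by positivity
  obtain ⟨ξ', h1, h2⟩ := key (A + Real.toNNReal (ε / (‖v‖ + 1))) (by
    have : A < A + Real.toNNReal (ε / (‖v‖ + 1)) :=
      lt_add_of_pos_right _ (Real.toNNReal_pos.2 hpos)
    exact_mod_cast this)
  have : ξ' = ξ := ContinuousLinearMap.coeFn_injective
    (hD.equalizer ξ'.continuous ξ.continuous (funext fun j => by simp [h1, hξ]))
  rw [this] at h2
  refine (h2 v).trans ?_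
  have h3 : ε / (‖v‖ + 1) * ‖v‖ ≤ ε := by
    rw [div_mul_eq_mul_div, div_le_iff₀ (by positivity)]
    nlinarith
  rw [NNReal.coe_add, Real.coe_toNNReal _ hpos.le]
  linarith

theorem MixedBound.integrable_self {μ : Measure ℝ} [IsFiniteMeasure μ] {ξ : ℝ → StrongDual ℝ V}
    {M k : ℝ → ℝ} (h : MixedBound μ ι ξ M k) (hξ : AEStronglyMeasurable ξ μ) (hq : 1 ≤ q)
    (hM : MemLp M q μ) (hk : Integrable k μ) : Integrable ξ μ := by
  refine Integrable.mono' (g := fun t => ‖M t‖ + ‖k t‖ * ‖ι‖)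
    ((hM.integrable hq).norm.add (hk.norm.mul_const _)) hξ ?_
  filter_upwards [h] with t ht
  refine ContinuousLinearMap.opNorm_le_bound _ (by positivity) fun v => (ht v).trans ?_
  have := ι.le_opNorm v
  calc ‖M t‖ * ‖v‖ + ‖k t‖ * ‖ι v‖ ≤ ‖M t‖ * ‖v‖ + ‖k t‖ * (‖ι‖ * ‖v‖) := by gcongr
    _ = _ := by ring

/-- The left side is a limit over all `n`, so it suffices that the bound on `∫ |M n|` hold for
infinitely many `n`, which is what a liminf in `n` provides. -/
theorem enorm_inner_sub_le_of_frequently (p : ℝ≥0∞) [ENNReal.HolderTriple q p 1] (hT : 0 ≤ T)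
    {Y : ℝ → H} {D : ℕ → V}
    (hD : DenseRange D) {G : ℕ → ℝ → StrongDual ℝ V} {M : ℕ → ℝ → ℝ}
    {k : ℝ → ℝ} (hG : ∀ n, AEStronglyMeasurable (G n) (timeMeasure T))
    (hb : ∀ n, MixedBound (timeMeasure T) ι (G n) (M n) k)
    (hM : ∀ n, MemLp (M n) q (timeMeasure T))
    (hk : Integrable k (timeMeasure T))
    (hf : ∀ j, ∀ t ∈ Icc 0 T, Tendsto (fun n => ∫ s in (0 : ℝ)..t, G n s (D j)) atTop
      (𝓝 (inner ℝ (Y t - Y 0) (ι (D j))))) {a b : ℝ} (ha : a ∈ Icc 0 T) (hb' : b ∈ Icc 0 T)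
    (hab : a ≤ b) {K : ℝ≥0∞} (hK : K ≠ ∞)
    (hfr : ∃ᶠ n in atTop, ∫⁻ s in Ioc a b, ‖M n s‖ₑ ∂(timeMeasure T) ≤ K) (v : V) :
    ‖inner ℝ (Y b - Y a) (ι v)‖ₑ
      ≤ K * ‖v‖ₑ + (∫⁻ s in Ioc a b, ‖k s‖ₑ ∂(timeMeasure T)) * ‖ι v‖ₑ := by
  have h0 : (0 : ℝ) ∈ Icc 0 T := ⟨le_rfl, hT⟩
  have hkt : ∫⁻ s in Ioc a b, ‖k s‖ₑ ∂(timeMeasure T) ≠ ∞ :=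
    ((setLIntegral_le_lintegral _ _).trans_lt hk.2).ne
  refine hD.induction_on (p := fun v => ‖inner ℝ (Y b - Y a) (ι v)‖ₑ
      ≤ K * ‖v‖ₑ + (∫⁻ s in Ioc a b, ‖k s‖ₑ ∂(timeMeasure T)) * ‖ι v‖ₑ) v ?_ fun j => ?_
  · refine isClosed_le (by fun_prop) ?_
    exact ((ENNReal.continuous_const_mul hK).comp continuous_enorm).add
      ((ENNReal.continuous_const_mul hkt).comp (continuous_enorm.comp ι.continuous))
  · have hint : ∀ n, Integrable (fun s => G n s (D j)) (timeMeasure T) := fun n =>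
      (hb n).integrable (p := p) (q := q) (hG n) (hM n) hk (memLp_const _)
        (R := ‖ι (D j)‖) (Eventually.of_forall fun _ => le_rfl)
    have hlim : Tendsto (fun n => ‖∫ s in a..b, G n s (D j)‖ₑ) atTop
        (𝓝 ‖inner ℝ (Y b - Y a) (ι (D j))‖ₑ) := by
      refine (continuous_enorm.tendsto _).comp ?_
      have h1 := (hf j b hb').sub (hf j a ha)
      rw [← inner_sub_left, sub_sub_sub_cancel_right] at h1
      refine h1.congr fun n => ?_
      exact intervalIntegral.integral_interval_sub_left
        (intervalIntegrable_of_timeMeasure (hint n) h0 hb')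
        (intervalIntegrable_of_timeMeasure (hint n) h0 ha)
    refine le_of_tendsto_of_frequently hlim (hfr.mono fun n hn => ?_)
    refine (enorm_intervalIntegral_le ha hb').trans ?_
    rw [uIoc_of_le hab]
    have hkm : AEMeasurable (fun s => ‖k s‖ₑ) ((timeMeasure T).restrict (Ioc a b)) :=
      hk.1.enorm.restrict
    have hMm : AEMeasurable (fun s => ‖M n s‖ₑ) ((timeMeasure T).restrict (Ioc a b)) :=
      (hM n).1.enorm.restrict
    calc ∫⁻ s in Ioc a b, ‖G n s (D j)‖ₑ ∂(timeMeasure T)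
        ≤ ∫⁻ s in Ioc a b, (‖M n s‖ₑ * ‖D j‖ₑ + ‖k s‖ₑ * ‖ι (D j)‖ₑ) ∂(timeMeasure T) := by
          refine lintegral_mono_ae (ae_restrict_of_ae ?_)
          filter_upwards [hb n] with s hs
          have := ENNReal.ofReal_le_ofReal (hs (D j))
          rwa [ENNReal.ofReal_add (by positivity) (by positivity),
            ENNReal.ofReal_mul (by positivity), ENNReal.ofReal_mul (by positivity), ofReal_norm,
            ofReal_norm, ofReal_norm, ofReal_norm, ofReal_norm] at this
      _ = (∫⁻ s in Ioc a b, ‖M n s‖ₑ ∂(timeMeasure T)) * ‖D j‖ₑ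
          + (∫⁻ s in Ioc a b, ‖k s‖ₑ ∂(timeMeasure T)) * ‖ι (D j)‖ₑ := by
          rw [lintegral_add_left' (hMm.mul_const _), lintegral_mul_const'' _ hMm,
            lintegral_mul_const'' _ hkm]
      _ ≤ _ := by gcongr

end WeakDerivative

section WeakDerivative

variable {H V : Type*} [NormedAddCommGroup H] [InnerProductSpace ℝ H]
  [NormedAddCommGroup V] [NormedSpace ℝ V] {q : ℝ≥0∞}
  {T : ℝ} {ι : V →L[ℝ] H}

theorem exists_measurable_enorm_version {M : ℝ → ℝ} (hM : MemLp M q (timeMeasure T)) (hq0 : q ≠ 0)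
    (hq : q ≠ ∞) {C : ℝ≥0∞} (hC : eLpNorm M q (timeMeasure T) ≤ C) :
    ∃ F : ℝ → ℝ≥0∞, Measurable F ∧ (∀ᵐ t ∂(timeMeasure T), F t = ‖M t‖ₑ) ∧
      ∫⁻ t, F t ^ q.toReal ≤ C ^ q.toReal := by
  have hq' : 0 < q.toReal := ENNReal.toReal_pos hq0 hq
  have hm : Measurable fun t => ‖hM.1.mk M t‖ₑ := hM.1.stronglyMeasurable_mk.enorm
  refine ⟨(Icc 0 T).indicator fun t => ‖hM.1.mk M t‖ₑ, hm.indicator measurableSet_Icc, ?_, ?_⟩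
  · filter_upwards [hM.1.ae_eq_mk, ae_restrict_mem measurableSet_Icc] with t h1 h2
    rw [indicator_of_mem h2, ← h1]
  · have h1 : ∀ t, (Icc 0 T).indicator (fun t => ‖hM.1.mk M t‖ₑ) t ^ q.toReal
        = (Icc 0 T).indicator (fun t => ‖hM.1.mk M t‖ₑ ^ q.toReal) t := by
      intro t
      by_cases ht : t ∈ Icc 0 T
      · simp only [indicator_of_mem ht]
      · simp only [indicator_of_notMem ht, ENNReal.zero_rpow_of_pos hq']
    simp_rw [h1]
    rw [lintegral_indicator measurableSet_Icc]
    rw [eLpNorm_congr_ae hM.1.ae_eq_mk, eLpNorm_eq_lintegral_rpow_enorm_toReal hq0 hq] at hC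
    have := ENNReal.rpow_le_rpow hC hq'.le
    rwa [← ENNReal.rpow_mul, one_div, inv_mul_cancel₀ hq'.ne', ENNReal.rpow_one] at this

theorem ae_tendsto_avg {k : ℝ → ℝ} (hk : Integrable k (timeMeasure T)) {h : ℕ → ℝ}
    (h0 : ∀ m, 0 < h m) (hlim : Tendsto h atTop (𝓝 0)) :
    ∀ᵐ t ∂(timeMeasure T),
      Tendsto (fun m => (h m)⁻¹ * ∫ s in t..t + h m, (Icc 0 T).indicator k s) atTop (𝓝 (k t)) := by
  have hk' : Integrable ((Icc 0 T).indicator k) volume :=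
    (integrable_indicator_iff measurableSet_Icc).2 hk
  have h1 := ae_restrict_of_ae (s := Icc 0 T)
    (LocallyIntegrable.ae_hasDerivAt_integral hk'.locallyIntegrable)
  filter_upwards [h1, ae_restrict_mem measurableSet_Icc] with t ht htm
  have h2 := hasDerivAt_iff_tendsto_slope_zero.1 (ht 0)
  rw [indicator_of_mem htm] at h2
  have h3 : Tendsto h atTop (𝓝[≠] 0) :=
    tendsto_nhdsWithin_iff.2 ⟨hlim, Eventually.of_forall fun m => (h0 m).ne'⟩
  refine (h2.comp h3).congr fun m => ?_
  simp only [Function.comp, smul_eq_mul]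
  rw [intervalIntegral.integral_interval_sub_left hk'.intervalIntegrable hk'.intervalIntegrable]

/-- A weak limit of functions whose weak derivatives satisfy a uniform mixed bound has a weak
derivative with a mixed bound. -/
theorem exists_weak_derivative (p : ℝ≥0∞) [ENNReal.HolderTriple q p 1] (hT : 0 < T) (hq1 : 1 ≤ q)
    (hq : q ≠ ∞) (hp0 : p ≠ 0) (hp : p ≠ ∞) [SecondCountableTopology (StrongDual ℝ V)] {Y : ℝ → H}
    {D : ℕ → V} (hD : DenseRange D) {G : ℕ → ℝ → StrongDual ℝ V} {M : ℕ → ℝ → ℝ}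
    {k : ℝ → ℝ} (hG : ∀ n, AEStronglyMeasurable (G n) (timeMeasure T))
    (hb : ∀ n, MixedBound (timeMeasure T) ι (G n) (M n) k)
    (hM : ∀ n, MemLp (M n) q (timeMeasure T))
    (hk : Integrable k (timeMeasure T)) {C : ℝ≥0∞} (hC : ∀ n, eLpNorm (M n) q (timeMeasure T) ≤ C)
    (hCt : C ≠ ∞)
    (hf : ∀ j, ∀ t ∈ Icc 0 T, Tendsto (fun n => ∫ s in (0 : ℝ)..t, G n s (D j)) atTop
      (𝓝 (inner ℝ (Y t - Y 0) (ι (D j))))) :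
    ∃ (ξ : ℝ → StrongDual ℝ V) (M' : ℝ → ℝ), AEStronglyMeasurable ξ (timeMeasure T) ∧
      MemLp M' q (timeMeasure T) ∧ MixedBound (timeMeasure T) ι ξ M' k ∧
      ∀ t ∈ Icc 0 T, ∀ v, inner ℝ (Y t) (ι v) = inner ℝ (Y 0) (ι v) + ∫ s in (0 : ℝ)..t, ξ s v := by
  have hq0 : q ≠ 0 := (zero_lt_one.trans_le hq1).ne'
  have hq' : 0 < q.toReal := ENNReal.toReal_pos hq0 hq
  have hq1' : 1 ≤ q.toReal := by
    rw [← ENNReal.toReal_one]; exact ENNReal.toReal_mono hq hq1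
  have h0 : (0 : ℝ) ∈ Icc 0 T := ⟨le_rfl, hT.le⟩
  set f : ℕ → ℝ → ℝ := fun j t => inner ℝ (Y t - Y 0) (ι (D j)) with hfdef
  have hac : ∀ j, AbsolutelyContinuousOnInterval (f j) 0 T := fun j =>
    absolutelyContinuous_of_tendsto (p := p) (q := q) hT.le hG hb (fun n => (hM n).1) hk hC hCt
      hp0 hp (hf j)
  choose F hFm hFe hFr using fun n => exists_measurable_enorm_version (hM n) hq0 hq (hC n)
  set h : ℕ → ℝ := fun m => 1 / ((m : ℝ) + 1) with hh
  have hpos : ∀ m, 0 < h m := fun m => by positivity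
  have hlim : Tendsto h atTop (𝓝 0) := tendsto_one_div_add_atTop_nhds_zero_nat
  -- The liminf in `n` of the means of `|M n|` over `(t, t + h m]`; below, `B` is its liminf in `m`.
  -- Jensen's inequality and two uses of Fatou's lemma keep both in `L^q`, in place of weak
  -- compactness in `L^q(V*)`.
  set A : ℕ → ℝ → ℝ≥0∞ := fun m t =>
    liminf (fun n => ∫⁻ θ, F n (t + θ) ∂(avgMeasure (h m))) atTop with hA
  have hAm : ∀ m, Measurable (A m) := fun m =>
    Measurable.liminf fun n => measurable_avg (hFm n) (hpos m)
  have hAr : ∀ m, ∫⁻ t, A m t ^ q.toReal ≤ C ^ q.toReal := fun m =>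
    lintegral_liminf_rpow_le (fun n => measurable_avg (hFm n) (hpos m)) hq' fun n =>
      (lintegral_avg_rpow_le (hFm n) (hpos m) hq1').trans (hFr n)
  set B : ℝ → ℝ≥0∞ := fun t => liminf (fun m => A m t) atTop with hB
  have hBm : Measurable B := Measurable.liminf hAm
  have hBr : ∫⁻ t, B t ^ q.toReal ≤ C ^ q.toReal := lintegral_liminf_rpow_le hAm hq' hAr
  have hCr : C ^ q.toReal < ∞ := ENNReal.rpow_lt_top_of_nonneg hq'.le hCt
  have hBt : ∀ᵐ t, B t < ∞ := by
    filter_upwards [ae_lt_top (hBm.pow_const _) (hBr.trans_lt hCr).ne] with t ht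
    exact (ENNReal.rpow_lt_top_iff_of_pos hq').1 ht
  have hdiff : ∀ᵐ t ∂(timeMeasure T), ∀ j, DifferentiableAt ℝ (f j) t := by
    rw [ae_all_iff]
    intro j
    refine (ae_restrict_iff' measurableSet_Icc).2 ?_
    have := (hac j).ae_differentiableAt
    rwa [uIcc_of_le hT.le] at this
  have hneT : ∀ᵐ t ∂(timeMeasure T), t ≠ T :=
    ae_restrict_of_ae (by simp [ae_iff, measure_singleton])
  have hpt : ∀ᵐ t ∂(timeMeasure T), ∃ ξ : StrongDual ℝ V, (∀ j, ξ (D j) = deriv (f j) t) ∧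
      ∀ v, ‖ξ v‖ ≤ (B t).toReal * ‖v‖ + ‖k t‖ * ‖ι v‖ := by
    filter_upwards [hdiff, ae_restrict_of_ae hBt, ae_tendsto_avg hk.norm hpos hlim, hneT,
      ae_restrict_mem measurableSet_Icc] with t h1 h2 h3 h4 h5
    have htT : t < T := lt_of_le_of_ne h5.2 h4
    refine exists_functional_of_liminf_lt_top hD
      (Q := fun m => toDual ι ((h m)⁻¹ • (Y (t + h m) - Y t))) h3 ?_ h2 ?_
    · intro j
      have h6 : Tendsto h atTop (𝓝[≠] 0) :=
        tendsto_nhdsWithin_iff.2 ⟨hlim, Eventually.of_forall fun m => (hpos m).ne'⟩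
      refine ((hasDerivAt_iff_tendsto_slope_zero.1 (h1 j).hasDerivAt).comp h6).congr fun m => ?_
      simp only [Function.comp, hfdef, smul_eq_mul]
      rw [toDual_apply_apply, inner_smul_left, ← inner_sub_left, sub_sub_sub_cancel_right]
      rfl
    · filter_upwards [hlim.eventually (gt_mem_nhds (sub_pos.2 htT))] with m hm b hb' v
      have h7 : t + h m ∈ Icc 0 T := ⟨add_nonneg h5.1 (hpos m).le, by linarith⟩
      have hsub : Ioc t (t + h m) ⊆ Icc 0 T := fun s hs => ⟨h5.1.trans hs.1.le, hs.2.trans h7.2⟩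
      have hres : (timeMeasure T).restrict (Ioc t (t + h m))
          = volume.restrict (Ioc t (t + h m)) := by
        rw [timeMeasure, Measure.restrict_restrict_of_subset hsub]
      have hfr := frequently_lt_of_liminf_lt (by isBoundedDefault) hb'
      have hK : ENNReal.ofReal (h m) * b ≠ ∞ := ENNReal.mul_ne_top (by simp) (by simp)
      have h8 := enorm_inner_sub_le_of_frequently p hT.le hD hG hb hM hk hf h5 h7
        (by linarith [hpos m]) hK (hfr.mono fun n hn => ?_) v
      · have e1 : ∫⁻ s in Ioc t (t + h m), ‖k s‖ₑ ∂(timeMeasure T)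
            = ENNReal.ofReal (∫ s in t..t + h m, (Icc 0 T).indicator (fun s => ‖k s‖) s) := by
          rw [hres, intervalIntegral.integral_of_le (by linarith [hpos m]),
            setIntegral_congr_fun measurableSet_Ioc
              (fun s hs => indicator_of_mem (hsub hs) (fun s => ‖k s‖)),
            ← ofReal_integral_norm_eq_lintegral_enorm]
          have : IntegrableOn k (Icc 0 T) volume := hk
          exact this.mono_set hsub
        have e2 : 0 ≤ ∫ s in t..t + h m, (Icc 0 T).indicator (fun s => ‖k s‖) s :=
          intervalIntegral.integral_nonneg (by linarith [hpos m]) fun s _ =>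
            indicator_nonneg (fun _ _ => norm_nonneg _) _
        have e3 : ENNReal.ofReal (h m) * b = ENNReal.ofReal (h m * b) := by
          rw [ENNReal.ofReal_mul (hpos m).le, ENNReal.ofReal_coe_nnreal]
        rw [e1, e3, ← ofReal_norm, ← ofReal_norm v, ← ofReal_norm (ι v),
          ← ENNReal.ofReal_mul (by have := hpos m; positivity), ← ENNReal.ofReal_mul e2,
          ← ENNReal.ofReal_add (by have := hpos m; positivity) (by positivity),
          ENNReal.ofReal_le_ofReal_iff (by have := hpos m; positivity)] at h8
        rw [toDual_apply_apply, real_inner_smul_left, norm_mul, norm_inv,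
          Real.norm_of_nonneg (hpos m).le, inv_mul_le_iff₀ (hpos m)]
        refine h8.trans (le_of_eq ?_)
        rw [mul_add, ← mul_assoc, ← mul_assoc, ← mul_assoc, mul_inv_cancel₀ (hpos m).ne', one_mul]
      · rw [lintegral_avgMeasure, ENNReal.ofReal_inv_of_pos (hpos m)] at hn
        have e4 : ∫⁻ s in Ioc t (t + h m), ‖M n s‖ₑ ∂(timeMeasure T)
            = ∫⁻ s in Ioc t (t + h m), F n s := by
          rw [← hres]
          refine lintegral_congr_ae (ae_restrict_of_ae ?_)
          filter_upwards [hFe n] with s hs using hs.symm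
        rw [e4]
        have h9 : ENNReal.ofReal (h m) ≠ 0 := by simpa using hpos m
        calc ∫⁻ s in Ioc t (t + h m), F n s
            = ENNReal.ofReal (h m) * ((ENNReal.ofReal (h m))⁻¹
                * ∫⁻ s in Ioc t (t + h m), F n s) := by
              rw [← mul_assoc, ENNReal.mul_inv_cancel h9 (by simp), one_mul]
          _ ≤ _ := by gcongr
  classical
  -- Off a measurable null set the chosen functionals take the values `deriv (f j) t` on `D`; being
  -- zero on that set, the choice is weakly measurable, hence measurable.
  obtain ⟨S, hS, hSm, hSn⟩ := exists_measurable_superset_of_null (ae_iff.1 hpt)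
  have hSc : ∀ t ∉ S, ∃ ξ : StrongDual ℝ V, (∀ j, ξ (D j) = deriv (f j) t) ∧
      ∀ v, ‖ξ v‖ ≤ (B t).toReal * ‖v‖ + ‖k t‖ * ‖ι v‖ := by
    intro t ht
    by_contra hcon
    exact ht (hS hcon)
  choose! ξ₀ h1 h2 using hSc
  set ξ : ℝ → StrongDual ℝ V := fun t => if t ∈ S then 0 else ξ₀ t with hξ
  have hSae : ∀ᵐ t ∂(timeMeasure T), t ∉ S := measure_eq_zero_iff_ae_notMem.1 hSn
  have hξm : Measurable ξ := by
    refine measurable_dual_of_denseRange hD fun j => ?_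
    have : (fun t => ξ t (D j)) = fun t => if t ∈ S then 0 else deriv (f j) t := by
      funext t
      by_cases ht : t ∈ S
      · simp [hξ, ht]
      · simp [hξ, ht, h1]
    rw [this]
    exact Measurable.ite hSm measurable_const (measurable_deriv _)
  have hM' : MemLp (fun t => (B t).toReal) q (timeMeasure T) := by
    refine ⟨hBm.ennreal_toReal.aestronglyMeasurable, ?_⟩
    rw [eLpNorm_lt_top_iff_lintegral_rpow_enorm_lt_top hq0 hq]
    refine lt_of_le_of_lt (lintegral_mono (g := fun t => B t ^ q.toReal) fun t => ?_)
      (((lintegral_mono' Measure.restrict_le_self le_rfl).trans hBr).trans_lt hCr)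
    refine ENNReal.rpow_le_rpow ?_ hq'.le
    rw [Real.enorm_of_nonneg ENNReal.toReal_nonneg]
    exact ENNReal.ofReal_toReal_le
  have hmix : MixedBound (timeMeasure T) ι ξ (fun t => (B t).toReal) k := by
    filter_upwards [hSae] with t ht v
    have := h2 t ht v
    rw [Real.norm_of_nonneg ENNReal.toReal_nonneg]
    simpa [hξ, ht] using this
  have hξs : AEStronglyMeasurable ξ (timeMeasure T) := hξm.aestronglyMeasurable
  refine ⟨ξ, _, hξs, hM', hmix, fun t ht v => ?_⟩
  have hi := intervalIntegrable_of_timeMeasure (hmix.integrable_self hξs hq1 hM' hk) h0 ht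
  rw [← sub_eq_iff_eq_add', ← inner_sub_left, ← ContinuousLinearMap.intervalIntegral_apply hi]
  have hc1 : Continuous fun v => inner ℝ (Y t - Y 0) (ι v) := by fun_prop
  have hc2 : Continuous fun v => (∫ s in (0 : ℝ)..t, ξ s) v := by fun_prop
  -- On `D` the identity is the fundamental theorem of calculus for the absolutely continuous `f j`;
  -- both sides are continuous in `v`.
  refine congrFun (DenseRange.equalizer hD hc1 hc2 (funext fun j => ?_)) v
  have h3 := ((hac j).mono (c := 0) (d := t) (by
    rw [uIcc_of_le hT.le]; exact uIcc_subset_Icc h0 ht)).integral_deriv_eq_sub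
  have h4 : f j 0 = 0 := by simp [hfdef]
  rw [h4, sub_zero] at h3
  simp only [Function.comp]
  rw [ContinuousLinearMap.intervalIntegral_apply hi]
  change f j t = _
  rw [← h3]
  refine intervalIntegral.integral_congr_ae ?_
  have := (ae_restrict_iff' measurableSet_Icc).1 hSae
  filter_upwards [this] with s hs hs'
  have hs2 := hs (uIcc_subset_Icc h0 ht (uIoc_subset_uIcc hs'))
  simp [hξ, hs2, h1]

end WeakDerivative

/-! ### Functionals whose primitives tend to zero uniformly -/

theorem tendsto_eLpNorm_zero_of_dominated {α E F : Type*} [MeasurableSpace α]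
    [NormedAddCommGroup E] [NormedAddCommGroup F] {μ : Measure α} {p : ℝ≥0∞} (hp0 : p ≠ 0)
    (hp : p ≠ ∞) {f : ℕ → α → E} {b : α → F} (hf : ∀ n, AEStronglyMeasurable (f n) μ)
    (hb : MemLp b p μ) (hle : ∀ n, ∀ᵐ x ∂μ, ‖f n x‖ ≤ ‖b x‖)
    (hlim : ∀ᵐ x ∂μ, Tendsto (fun n => f n x) atTop (𝓝 0)) :
    Tendsto (fun n => eLpNorm (f n) p μ) atTop (𝓝 0) := by
  have hp' : 0 < p.toReal := ENNReal.toReal_pos hp0 hp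
  simp_rw [eLpNorm_eq_lintegral_rpow_enorm_toReal hp0 hp]
  have h1 : Tendsto (fun n => ∫⁻ x, ‖f n x‖ₑ ^ p.toReal ∂μ) atTop (𝓝 (∫⁻ _, 0 ∂μ)) := by
    refine tendsto_lintegral_of_dominated_convergence' (fun x => ‖b x‖ₑ ^ p.toReal)
      (fun n => (hf n).enorm.pow_const _) (fun n => ?_) ?_ ?_
    · filter_upwards [hle n] with x hx
      exact ENNReal.rpow_le_rpow (enorm_le_iff_norm_le.2 hx) hp'.le
    · exact (lintegral_rpow_enorm_lt_top_of_eLpNorm_lt_top hp0 hp hb.2).ne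
    · filter_upwards [hlim] with x hx
      have := (hx.enorm).ennrpow_const p.toReal
      simpa [hp'] using this
  have h2 := h1.ennrpow_const (1 / p.toReal)
  simpa [hp'] using h2

theorem tendsto_zero_of_forall_le_mul {κ : Type*} {l : Filter κ} {f : κ → ℝ≥0∞} {K : ℝ≥0∞}
    (hK : K ≠ ∞) (h : ∀ ε : ℝ≥0∞, ε ≠ 0 → ε ≠ ∞ → ∀ᶠ i in l, f i ≤ ε * K) :
    Tendsto f l (𝓝 0) := by
  rw [ENNReal.tendsto_nhds_zero]
  intro δ hδ
  rcases eq_or_ne δ ∞ with rfl | hδt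
  · simp
  filter_upwards [h (δ / (K + 1)) (ENNReal.div_pos hδ.ne' (by simp [hK])).ne'
    (ENNReal.div_lt_top hδt (by simp)).ne] with i hi
  refine hi.trans ?_
  calc δ / (K + 1) * K ≤ δ / (K + 1) * (K + 1) := by gcongr; exact le_self_add
    _ = δ := ENNReal.div_mul_cancel (by simp) (by simp [hK])

/-- The primitives of the functions `φ n` tend to zero uniformly on `[0, T]`. -/
def SmallPrimitive (T : ℝ) (φ : ℕ → ℝ → ℝ) : Prop :=
  ∀ ε > 0, ∀ᶠ n in atTop, ∀ t ∈ Icc 0 T, |∫ s in (0 : ℝ)..t, φ n s| ≤ ε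

section SmallPrimitive

variable {T : ℝ} {φ ψ : ℕ → ℝ → ℝ}

theorem abs_intervalIntegral_le_of_lintegral_le {f : ℝ → ℝ} {t : ℝ} (ht : t ∈ Icc 0 T) {c : ℝ}
    (hc : 0 ≤ c) (h : ∫⁻ s, ‖f s‖ₑ ∂(timeMeasure T) ≤ ENNReal.ofReal c) :
    |∫ s in (0 : ℝ)..t, f s| ≤ c := by
  have h1 := (enorm_intervalIntegral_le (f := f) (T := T) ⟨le_rfl, ht.1.trans ht.2⟩ ht).trans
    ((setLIntegral_le_lintegral _ _).trans h)
  rw [← ofReal_norm, Real.norm_eq_abs] at h1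
  exact (ENNReal.ofReal_le_ofReal_iff hc).1 h1

theorem SmallPrimitive.add (hφi : ∀ n, Integrable (φ n) (timeMeasure T))
    (hψi : ∀ n, Integrable (ψ n) (timeMeasure T)) (hφ : SmallPrimitive T φ)
    (hψ : SmallPrimitive T ψ) : SmallPrimitive T fun n s => φ n s + ψ n s := by
  intro ε hε
  filter_upwards [hφ (ε / 2) (by positivity), hψ (ε / 2) (by positivity)] with n h1 h2 t ht
  have h0 : (0 : ℝ) ∈ Icc 0 T := ⟨le_rfl, ht.1.trans ht.2⟩
  rw [intervalIntegral.integral_add (intervalIntegrable_of_timeMeasure (hφi n) h0 ht)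
    (intervalIntegrable_of_timeMeasure (hψi n) h0 ht)]
  exact (abs_add_le _ _).trans (by linarith [h1 t ht, h2 t ht])

theorem SmallPrimitive.of_tendsto
    (h : Tendsto (fun n => ∫⁻ s, ‖φ n s‖ₑ ∂(timeMeasure T)) atTop (𝓝 0)) : SmallPrimitive T φ := by
  intro ε hε
  filter_upwards [ENNReal.tendsto_nhds_zero.1 h (ENNReal.ofReal ε) (by simpa using hε)]
    with n hn t ht
  exact abs_intervalIntegral_le_of_lintegral_le ht hε.le hn

/-- `SmallPrimitive` is stable under approximation in `L¹`, uniformly in `n`. -/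
theorem SmallPrimitive.of_approx {κ : Type*} {l : Filter κ} [l.NeBot] {Φ : κ → ℕ → ℝ → ℝ}
    (hφi : ∀ n, Integrable (φ n) (timeMeasure T))
    (hΦi : ∀ i n, Integrable (Φ i n) (timeMeasure T)) (hΦ : ∀ i, SmallPrimitive T (Φ i))
    {e : κ → ℝ≥0∞} (he : Tendsto e l (𝓝 0))
    (h : ∀ i n, ∫⁻ s, ‖φ n s - Φ i n s‖ₑ ∂(timeMeasure T) ≤ e i) : SmallPrimitive T φ := by
  intro ε hε
  obtain ⟨i, hi⟩ := (ENNReal.tendsto_nhds_zero.1 he (ENNReal.ofReal (ε / 2))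
    (by simpa using hε)).exists
  filter_upwards [hΦ i (ε / 2) (by positivity)] with n h1 t ht
  have h0 : (0 : ℝ) ∈ Icc 0 T := ⟨le_rfl, ht.1.trans ht.2⟩
  have h2 := abs_intervalIntegral_le_of_lintegral_le ht (by positivity) ((h i n).trans hi)
  rw [intervalIntegral.integral_sub (intervalIntegrable_of_timeMeasure (hφi n) h0 ht)
    (intervalIntegrable_of_timeMeasure (hΦi i n) h0 ht)] at h2
  have h3 := h1 t ht
  rw [abs_le] at *
  constructor <;> linarith

end SmallPrimitive

section WeakStar

variable {H V : Type*} [NormedAddCommGroup H] [InnerProductSpace ℝ H]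
  [NormedAddCommGroup V] [NormedSpace ℝ V] {p q : ℝ≥0∞} [ENNReal.HolderTriple q p 1]
  {T : ℝ} {ι : V →L[ℝ] H} {η : ℕ → ℝ → StrongDual ℝ V} {N : ℕ → ℝ → ℝ} {κ : ℝ → ℝ} {C : ℝ≥0∞}

/-- Induction over the Borel sets generated by half-lines. For `Iic a` with `a ≥ 0`, the primitive
at `t` is that of `η n s v` at `min t a`. Complements follow by linearity. A disjoint union is
approximated by finite ones, the tails being small in `L¹` uniformly in `n` thanks to the mixed
bound. -/
theorem smallPrimitive_indicator_const (hT : 0 ≤ T)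
    (hη : ∀ n, AEStronglyMeasurable (η n) (timeMeasure T))
    (hb : ∀ n, MixedBound (timeMeasure T) ι (η n) (N n) κ) (hN : ∀ n, MemLp (N n) q (timeMeasure T))
    (hκ : Integrable κ (timeMeasure T)) (hC : ∀ n, eLpNorm (N n) q (timeMeasure T) ≤ C)
    (hCt : C ≠ ∞) (hp0 : p ≠ 0) (hp : p ≠ ∞) {v : V}
    (hv : SmallPrimitive T fun n s => η n s v) {S : Set ℝ} (hS : MeasurableSet S) :
    SmallPrimitive T fun n s => η n s (S.indicator (fun _ => v) s) := by
  have hp' : 0 < p.toReal := ENNReal.toReal_pos hp0 hp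
  have hi : ∀ n, Integrable (fun s => η n s v) (timeMeasure T) := fun n =>
    (hb n).integrable (p := p) (q := q) (hη n) (hN n) hκ (memLp_const _)
      (R := ‖ι v‖) (Eventually.of_forall fun _ => le_rfl)
  have hind : ∀ (S : Set ℝ) n, (fun s => η n s (S.indicator (fun _ => v) s))
      = S.indicator fun s => η n s v := by
    intro S n
    funext s
    by_cases hs : s ∈ S <;> simp [hs]
  have hiS : ∀ S : Set ℝ, MeasurableSet S → ∀ n,
      Integrable (fun s => η n s (S.indicator (fun _ => v) s)) (timeMeasure T) := by
    intro S hS n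
    rw [hind]
    exact (hi n).indicator hS
  induction S, hS using MeasurableSpace.induction_on_inter
    ((BorelSpace.measurable_eq (α := ℝ)).trans (borel_eq_generateFrom_Iic ℝ)) isPiSystem_Iic with
  | empty => intro ε hε; simp [hε.le]
  | basic S hS =>
    obtain ⟨a, rfl⟩ := hS
    intro ε hε
    filter_upwards [hv ε hε] with n hn t ht
    simp_rw [hind]
    rw [intervalIntegral.integral_of_le ht.1, setIntegral_indicator measurableSet_Iic]
    rcases le_total 0 a with ha | ha
    · have : Ioc 0 t ∩ Iic a = Ioc 0 (min t a) := by ext; simp [and_assoc]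
      rw [this, ← intervalIntegral.integral_of_le (le_min ht.1 ha)]
      exact hn _ ⟨le_min ht.1 ha, (min_le_left _ _).trans ht.2⟩
    · have : Ioc 0 t ∩ Iic a = ∅ := by
        ext x
        simp only [mem_inter_iff, mem_Ioc, mem_Iic, mem_empty_iff_false, iff_false]
        intro h
        linarith [h.1.1, h.2]
      rw [this]
      simpa using hε.le
  | compl S hS ih =>
    intro ε hε
    filter_upwards [hv (ε / 2) (by positivity), ih (ε / 2) (by positivity)] with n h1 h2 t ht
    have h0 : (0 : ℝ) ∈ Icc 0 T := ⟨le_rfl, hT⟩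
    have e : ∀ s, η n s (Sᶜ.indicator (fun _ => v) s)
        = η n s v - η n s (S.indicator (fun _ => v) s) := by
      intro s
      by_cases hs : s ∈ S <;> simp [hs]
    simp_rw [e]
    rw [intervalIntegral.integral_sub (intervalIntegrable_of_timeMeasure (hi n) h0 ht)
      (intervalIntegrable_of_timeMeasure (hiS S hS n) h0 ht)]
    exact (abs_sub _ _).trans (by linarith [h1 t ht, h2 t ht])
  | iUnion f hd hf ih =>
    have hlim := tendsto_measure_biUnion_Ici_zero_of_pairwise_disjoint (μ := timeMeasure T)
      (fun i => (hf i).nullMeasurableSet) hd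
    have hp1 : ∀ m, SmallPrimitive T fun n s =>
        η n s ((⋃ i ∈ Finset.range m, f i).indicator (fun _ => v) s) := by
      intro m
      induction m with
      | zero => intro ε hε; simp [hε.le]
      | succ m ihm =>
        have hdis : Disjoint (⋃ i ∈ Finset.range m, f i) (f m) := by
          rw [disjoint_iUnion₂_left]
          intro i hi
          exact hd (Finset.mem_range.1 hi).ne
        have e : ∀ n s, η n s ((⋃ i ∈ Finset.range (m + 1), f i).indicator (fun _ => v) s)
            = η n s ((⋃ i ∈ Finset.range m, f i).indicator (fun _ => v) s)
              + η n s ((f m).indicator (fun _ => v) s) := by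
          intro n s
          rw [← map_add, Finset.range_add_one, Finset.set_biUnion_insert, union_comm,
            indicator_union_of_disjoint hdis]
        simp_rw [e]
        exact SmallPrimitive.add (hiS _ (Finset.measurableSet_biUnion _ fun i _ => hf i))
          (hiS _ (hf m)) ihm (ih m)
    set e : ℕ → ℝ≥0∞ := fun m => C * (‖v‖ₑ * timeMeasure T (⋃ i ≥ m, f i) ^ (1 / p.toReal))
        + (∫⁻ s in ⋃ i ≥ m, f i, ‖κ s‖ₑ ∂(timeMeasure T)) * ‖ι v‖ₑ with he
    have he0 : Tendsto e atTop (𝓝 0) := by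
      have l1 := hlim.ennrpow_const (1 / p.toReal)
      rw [ENNReal.zero_rpow_of_pos (by positivity)] at l1
      have l2 := ENNReal.Tendsto.const_mul (a := C)
        (ENNReal.Tendsto.const_mul (a := ‖v‖ₑ) l1 (Or.inr (by simp))) (Or.inr hCt)
      have l3 := ENNReal.Tendsto.mul_const (b := ‖ι v‖ₑ)
        (tendsto_setLIntegral_zero (μ := timeMeasure T) (f := fun s => ‖κ s‖ₑ) hκ.2.ne hlim)
        (Or.inr (by simp))
      have l4 := l2.add l3
      simp only [mul_zero, zero_mul, add_zero] at l4
      exact l4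
    refine SmallPrimitive.of_approx (l := atTop) (hiS _ (MeasurableSet.iUnion hf))
      (fun m n => hiS _ (Finset.measurableSet_biUnion _ fun i _ => hf i) n) hp1 he0 fun m n => ?_
    refine le_trans (le_of_eq ?_) (setLIntegral_apply_const_le (q := q) (hb n) (hN n).1 hκ (hC n)
      hp0 hp v (⋃ i ≥ m, f i))
    have hm : MeasurableSet (⋃ i ≥ m, f i) :=
      MeasurableSet.iUnion fun i => MeasurableSet.iUnion fun _ => hf i
    rw [← lintegral_indicator hm]
    refine lintegral_congr fun s => ?_
    by_cases h1 : s ∈ ⋃ i ∈ Finset.range m, f i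
    · have h2 : s ∈ ⋃ i, f i := by
        simp only [mem_iUnion] at h1 ⊢
        obtain ⟨i, -, hi⟩ := h1
        exact ⟨i, hi⟩
      have h3 : s ∉ ⋃ i ≥ m, f i := by
        simp only [mem_iUnion, Finset.mem_range, not_exists] at h1 ⊢
        obtain ⟨i, him, hi⟩ := h1
        intro j hj hsj
        exact disjoint_left.1 (hd (him.trans_le hj).ne) hi hsj
      rw [indicator_of_mem h1, indicator_of_mem h2, indicator_of_notMem h3, sub_self, enorm_zero]
    · by_cases h3 : s ∈ ⋃ i ≥ m, f i
      · have h2 : s ∈ ⋃ i, f i := by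
          simp only [mem_iUnion] at h3 ⊢
          obtain ⟨i, -, hi⟩ := h3
          exact ⟨i, hi⟩
        rw [indicator_of_notMem h1, indicator_of_mem h2, indicator_of_mem h3, map_zero, sub_zero]
      · have h2 : s ∉ ⋃ i, f i := by
          simp only [mem_iUnion, Finset.mem_range, not_exists] at h1 h3 ⊢
          intro i hi
          rcases lt_or_ge i m with h | h
          · exact h1 i h hi
          · exact h3 i h hi
        rw [indicator_of_notMem h1, indicator_of_notMem h2, indicator_of_notMem h3, sub_self,
          enorm_zero]

end WeakStar

section WeakStar

variable {H V : Type*} [NormedAddCommGroup H] [InnerProductSpace ℝ H]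
  [NormedAddCommGroup V] [NormedSpace ℝ V] {p q : ℝ≥0∞} [ENNReal.HolderTriple q p 1]
  {T : ℝ} {ι : V →L[ℝ] H} {η : ℕ → ℝ → StrongDual ℝ V} {N : ℕ → ℝ → ℝ} {κ : ℝ → ℝ} {C : ℝ≥0∞}

/-- The mixed bound makes the pairing continuous in `v`, uniformly in `n`. -/
theorem smallPrimitive_const_of_denseRange
    (hη : ∀ n, AEStronglyMeasurable (η n) (timeMeasure T))
    (hb : ∀ n, MixedBound (timeMeasure T) ι (η n) (N n) κ) (hN : ∀ n, MemLp (N n) q (timeMeasure T))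
    (hκ : Integrable κ (timeMeasure T)) (hC : ∀ n, eLpNorm (N n) q (timeMeasure T) ≤ C)
    (hCt : C ≠ ∞) (hp0 : p ≠ 0) (hp : p ≠ ∞) {D : ℕ → V} (hD : DenseRange D)
    (hDs : ∀ j, SmallPrimitive T fun n s => η n s (D j)) (v : V) :
    SmallPrimitive T fun n s => η n s v := by
  have hp' : 0 < p.toReal := ENNReal.toReal_pos hp0 hp
  have hi : ∀ v n, Integrable (fun s => η n s v) (timeMeasure T) := fun v n =>
    (hb n).integrable (p := p) (q := q) (hη n) (hN n) hκ (memLp_const _)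
      (R := ‖ι v‖) (Eventually.of_forall fun _ => le_rfl)
  have hcl : v ∈ closure (range D) := hD v
  obtain ⟨x, hx, hxv⟩ := mem_closure_iff_seq_limit.1 hcl
  choose j hj using hx
  set e : ℕ → ℝ≥0∞ := fun i => C * (‖v - x i‖ₑ * timeMeasure T univ ^ (1 / p.toReal))
        + (∫⁻ s in univ, ‖κ s‖ₑ ∂(timeMeasure T)) * ‖ι (v - x i)‖ₑ with he
  have h1 : Tendsto (fun i => v - x i) atTop (𝓝 0) := by simpa using hxv.const_sub v
  have he0 : Tendsto e atTop (𝓝 0) := by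
    have l1 : Tendsto (fun i => ‖v - x i‖ₑ) atTop (𝓝 0) := by simpa using h1.enorm
    have l2 : Tendsto (fun i => ‖ι (v - x i)‖ₑ) atTop (𝓝 0) := by
      have := ((ι.continuous.tendsto 0).comp h1).enorm
      simpa using this
    have l3 := ENNReal.Tendsto.const_mul (a := C)
        (ENNReal.Tendsto.mul_const (b := timeMeasure T univ ^ (1 / p.toReal)) l1
          (Or.inr (ENNReal.rpow_ne_top_of_nonneg (by positivity) (measure_ne_top _ _))))
        (Or.inr hCt)
    have l4 := ENNReal.Tendsto.const_mul (a := ∫⁻ s in univ, ‖κ s‖ₑ ∂(timeMeasure T)) l2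
      (Or.inr ((setLIntegral_le_lintegral _ _).trans_lt hκ.2).ne)
    have l5 := l3.add l4
    simp only [mul_zero, zero_mul, add_zero] at l5
    exact l5
  refine SmallPrimitive.of_approx (l := atTop) (Φ := fun i n s => η n s (x i)) (hi v)
    (fun i => hi (x i)) (fun i => ?_) he0 fun i n => ?_
  · rw [← hj i]; exact hDs _
  · simp_rw [← map_sub]
    rw [← setLIntegral_univ]
    exact setLIntegral_apply_const_le (q := q) (hb n) (hN n).1 hκ (hC n) hp0 hp _ _

/-- Test functions converging in `L^p(V)` and staying bounded in `H` change the pairing by an error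
small in `L¹`, uniformly in `n`: the first property serves `N n`, the second serves `κ` through
dominated convergence. -/
theorem smallPrimitive_of_dominated
    (hη : ∀ n, AEStronglyMeasurable (η n) (timeMeasure T))
    (hb : ∀ n, MixedBound (timeMeasure T) ι (η n) (N n) κ) (hN : ∀ n, MemLp (N n) q (timeMeasure T))
    (hκ : Integrable κ (timeMeasure T)) (hC : ∀ n, eLpNorm (N n) q (timeMeasure T) ≤ C)
    (hCt : C ≠ ∞) (hp0 : p ≠ 0) (hp : p ≠ ∞) {z : ℝ → V} {Z : ℕ → ℝ → V} {b : ℝ → ℝ} {R : ℝ}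
    (hZm : ∀ i, AEStronglyMeasurable (Z i) (timeMeasure T)) (hb' : MemLp b p (timeMeasure T))
    (hZb : ∀ i, ∀ᵐ s ∂(timeMeasure T), ‖Z i s‖ ≤ b s)
    (hZR : ∀ i, ∀ᵐ s ∂(timeMeasure T), ‖ι (Z i s)‖ ≤ R)
    (hlim : ∀ᵐ s ∂(timeMeasure T), Tendsto (fun i => Z i s) atTop (𝓝 (z s)))
    (hZ : ∀ i, SmallPrimitive T fun n s => η n s (Z i s)) :
    SmallPrimitive T fun n s => η n s (z s) := by
  have hzm : AEStronglyMeasurable z (timeMeasure T) := aestronglyMeasurable_of_tendsto_ae _ hZm hlim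
  have hzb : ∀ᵐ s ∂(timeMeasure T), ‖z s‖ ≤ b s := by
    filter_upwards [hlim, ae_all_iff.2 hZb] with s h1 h2
    exact le_of_tendsto h1.norm (Eventually.of_forall h2)
  have hzR : ∀ᵐ s ∂(timeMeasure T), ‖ι (z s)‖ ≤ R := by
    filter_upwards [hlim, ae_all_iff.2 hZR] with s h1 h2
    exact le_of_tendsto ((ι.continuous.tendsto _).comp h1).norm (Eventually.of_forall h2)
  have hLp : ∀ {w : ℝ → V}, AEStronglyMeasurable w (timeMeasure T) →
      (∀ᵐ s ∂(timeMeasure T), ‖w s‖ ≤ b s) → MemLp w p (timeMeasure T) := fun hw h =>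
    hb'.mono hw (by filter_upwards [h] with s hs using hs.trans (le_abs_self _))
  have l1 : Tendsto (fun i => eLpNorm (fun s => z s - Z i s) p (timeMeasure T)) atTop (𝓝 0) := by
    refine tendsto_eLpNorm_zero_of_dominated hp0 hp (b := fun s => 2 * b s)
      (fun i => hzm.sub (hZm i)) (hb'.const_mul 2) (fun i => ?_) ?_
    · filter_upwards [hzb, hZb i] with s h1 h2
      refine (norm_sub_le _ _).trans ((add_le_add h1 h2).trans ?_)
      rw [← two_mul]
      exact le_abs_self _
    · filter_upwards [hlim] with s hs
      simpa using hs.const_sub (z s)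
  have l2 : Tendsto (fun i => ∫⁻ s, ‖κ s‖ₑ * ‖ι (z s - Z i s)‖ₑ ∂(timeMeasure T)) atTop (𝓝 0) := by
    rw [← lintegral_zero (μ := timeMeasure T)]
    refine tendsto_lintegral_of_dominated_convergence'
      (fun s => ‖κ s‖ₑ * ENNReal.ofReal (2 * R)) (fun i => ?_) (fun i => ?_) ?_ ?_
    · exact hκ.1.enorm.mul (ι.continuous.comp_aestronglyMeasurable (hzm.sub (hZm i))).enorm
    · filter_upwards [hzR, hZR i] with s h1 h2
      gcongr
      rw [← ofReal_norm, map_sub]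
      exact ENNReal.ofReal_le_ofReal ((norm_sub_le _ _).trans (by linarith))
    · rw [lintegral_mul_const'' _ hκ.1.enorm]
      exact ENNReal.mul_ne_top hκ.2.ne ENNReal.ofReal_ne_top
    · filter_upwards [hlim] with s hs
      have h1 : Tendsto (fun i => z s - Z i s) atTop (𝓝 0) := by simpa using hs.const_sub (z s)
      have h2 := ((ι.continuous.tendsto 0).comp h1).enorm
      have h3 := ENNReal.Tendsto.const_mul (a := ‖κ s‖ₑ) h2 (Or.inr (by simp))
      simpa using h3
  have l3 := (ENNReal.Tendsto.const_mul (a := C) l1 (Or.inr hCt)).add l2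
  simp only [mul_zero, add_zero] at l3
  refine SmallPrimitive.of_approx (l := atTop) (Φ := fun i n s => η n s (Z i s))
    (fun n => (hb n).integrable (p := p) (q := q) (hη n) (hN n) hκ (hLp hzm hzb) hzR)
    (fun i n => (hb n).integrable (p := p) (q := q) (hη n) (hN n) hκ (hLp (hZm i) (hZb i)) (hZR i))
    hZ l3 fun i n => ?_
  simp_rw [← map_sub]
  refine ((hb n).lintegral_le (p := p) (q := q) (hN n).1 (hzm.sub (hZm i))).trans ?_
  exact add_le_add (mul_le_mul' (hC n) le_rfl) le_rfl

theorem smallPrimitive_simpleFunc (p : ℝ≥0∞) [ENNReal.HolderTriple q p 1]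
    (hη : ∀ n, AEStronglyMeasurable (η n) (timeMeasure T))
    (hb : ∀ n, MixedBound (timeMeasure T) ι (η n) (N n) κ) (hN : ∀ n, MemLp (N n) q (timeMeasure T))
    (hκ : Integrable κ (timeMeasure T))
    (hv : ∀ v S, MeasurableSet S → SmallPrimitive T fun n s => η n s (S.indicator (fun _ => v) s))
    (z : SimpleFunc ℝ V) : SmallPrimitive T fun n s => η n s (z s) := by
  have hi : ∀ (z : SimpleFunc ℝ V) n, Integrable (fun s => η n s (z s)) (timeMeasure T) := by
    intro z n
    obtain ⟨c, hc⟩ := z.exists_forall_norm_le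
    refine (hb n).integrable (p := p) (q := q) (hη n) (hN n) hκ
      (MemLp.of_bound z.aestronglyMeasurable c (Eventually.of_forall hc))
      (R := ‖ι‖ * c) (Eventually.of_forall fun s => ?_)
    exact (ι.le_opNorm _).trans (by gcongr; exact hc s)
  induction z using SimpleFunc.induction with
  | @const v S hS =>
    have := hv v S hS
    have e : ⇑(SimpleFunc.piecewise S hS (SimpleFunc.const ℝ v) (SimpleFunc.const ℝ 0))
        = S.indicator fun _ => v := by
      funext s
      by_cases hs : s ∈ S <;> simp [hs]
    rwa [← e] at this
  | @add f g hd hf hg =>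
    have := SmallPrimitive.add (hi f) (hi g) hf hg
    simpa using this

/-- Convergence against the `D j` spreads to constants, to indicators, to simple functions, to
bounded functions, and finally to `z` through its truncations at level `c`. -/
theorem smallPrimitive_apply (hT : 0 ≤ T)
    (hη : ∀ n, AEStronglyMeasurable (η n) (timeMeasure T))
    (hb : ∀ n, MixedBound (timeMeasure T) ι (η n) (N n) κ) (hN : ∀ n, MemLp (N n) q (timeMeasure T))
    (hκ : Integrable κ (timeMeasure T)) (hC : ∀ n, eLpNorm (N n) q (timeMeasure T) ≤ C)
    (hCt : C ≠ ∞) (hp0 : p ≠ 0) (hp : p ≠ ∞) {D : ℕ → V} (hD : DenseRange D)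
    (hDs : ∀ j, SmallPrimitive T fun n s => η n s (D j)) {z : ℝ → V} {R : ℝ}
    (hz : MemLp z p (timeMeasure T)) (hR : ∀ᵐ s ∂(timeMeasure T), ‖ι (z s)‖ ≤ R) :
    SmallPrimitive T fun n s => η n s (z s) := by
  have hsimple := smallPrimitive_simpleFunc p hη hb hN hκ fun v S hS =>
    smallPrimitive_indicator_const hT hη hb hN hκ hC hCt hp0 hp
      (smallPrimitive_const_of_denseRange hη hb hN hκ hC hCt hp0 hp hD hDs v) hS
  set w := hz.1.mk z with hw
  have hws : StronglyMeasurable w := hz.1.stronglyMeasurable_mk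
  have hwz : z =ᵐ[timeMeasure T] w := hz.1.ae_eq_mk
  have hS : ∀ c : ℕ, MeasurableSet {s | ‖w s‖ ≤ c} := fun c =>
    hws.norm.measurable measurableSet_Iic
  have hbdd : ∀ c : ℕ, SmallPrimitive T fun n s => η n s ({s | ‖w s‖ ≤ c}.indicator w s) := by
    intro c
    have hwc : StronglyMeasurable ({s | ‖w s‖ ≤ c}.indicator w) := hws.indicator (hS c)
    have hle : ∀ s, ‖{s | ‖w s‖ ≤ c}.indicator w s‖ ≤ c := by
      intro s
      by_cases hs : s ∈ {s | ‖w s‖ ≤ c}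
      · rw [indicator_of_mem hs]; exact hs
      · rw [indicator_of_notMem hs]; simp
    refine smallPrimitive_of_dominated hη hb hN hκ hC hCt hp0 hp
      (Z := fun i => hwc.approxBounded c i) (b := fun _ => c) (R := ‖ι‖ * c)
      (fun i => (hwc.approxBounded c i).aestronglyMeasurable) (memLp_const _)
      (fun i => Eventually.of_forall fun s => hwc.norm_approxBounded_le (by positivity) i s)
      (fun i => Eventually.of_forall fun s => (ι.le_opNorm _).trans ?_)
      (hwc.tendsto_approxBounded_ae (Eventually.of_forall hle)) fun i => hsimple _
    gcongr
    exact hwc.norm_approxBounded_le (by positivity) i s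
  refine smallPrimitive_of_dominated hη hb hN hκ hC hCt hp0 hp
    (Z := fun c => {s | ‖w s‖ ≤ (c : ℕ)}.indicator w) (b := fun s => ‖w s‖) (R := R)
    (fun c => (hws.indicator (hS c)).aestronglyMeasurable) (hz.ae_eq hwz).norm
    (fun c => Eventually.of_forall fun s => norm_indicator_le_norm_self _ _)
    (fun c => ?_) ?_ hbdd
  · filter_upwards [hR, hwz] with s h1 h2
    rw [h2] at h1
    by_cases hs : s ∈ {s | ‖w s‖ ≤ c}
    · rwa [indicator_of_mem hs]
    · rw [indicator_of_notMem hs, map_zero, norm_zero]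
      exact (norm_nonneg _).trans h1
  · filter_upwards [hwz] with s h2
    rw [h2]
    refine tendsto_const_nhds.congr' ?_
    filter_upwards [eventually_ge_atTop ⌈‖w s‖⌉₊] with c hc
    have : s ∈ {s | ‖w s‖ ≤ c} := (Nat.le_ceil ‖w s‖).trans (Nat.cast_le.2 hc)
    rw [indicator_of_mem this]

end WeakStar

/-! ### Pairing a fixed functional with weakly convergent functions -/

section WeakConvergence

variable {H V : Type*} [NormedAddCommGroup H] [InnerProductSpace ℝ H]
  [NormedAddCommGroup V] [NormedSpace ℝ V] {p q : ℝ≥0∞}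
  {T : ℝ} {ι : V →L[ℝ] H}

/-- Simple functions are dense in `L^q(V*)`, and each of their values can be moved into the dense
image of `H`. -/
theorem exists_toDual_approx_memLp (hd : DenseRange (toDual ι)) (hq0 : q ≠ 0) (hq : q ≠ ∞)
    {f : ℝ → StrongDual ℝ V} (hf : MemLp f q (timeMeasure T)) {ε : ℝ≥0∞} (hε : ε ≠ 0) :
    ∃ (h : ℝ → H) (K : ℝ), AEStronglyMeasurable h (timeMeasure T) ∧ (∀ s, ‖h s‖ ≤ K) ∧
      eLpNorm (fun s => f s - toDual ι (h s)) q (timeMeasure T) ≤ ε := by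
  suffices hind : ∃ g, eLpNorm (f - g) q (timeMeasure T) ≤ ε ∧ ∃ (h : ℝ → H) (K : ℝ),
      AEStronglyMeasurable h (timeMeasure T) ∧ (∀ s, ‖h s‖ ≤ K) ∧ g = fun s => toDual ι (h s) by
    obtain ⟨g, hg, h, K, h1, h2, rfl⟩ := hind
    exact ⟨h, K, h1, h2, hg⟩
  refine MemLp.induction_dense hq _ ?_ ?_ ?_ hf hε
  · intro c s hs _ ε hε
    have hlim : Tendsto (fun w : H => ‖toDual ι w - c‖ₑ
        * timeMeasure T univ ^ (1 / q.toReal)) (comap (toDual ι) (𝓝 c)) (𝓝 0) := by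
      have h1 : Tendsto (fun w : H => toDual ι w - c) (comap (toDual ι) (𝓝 c)) (𝓝 0) := by
        have := (tendsto_comap (f := toDual ι) (x := 𝓝 c)).sub_const c
        simpa using this
      have h0 : ‖(0 : StrongDual ℝ V)‖ₑ = 0 := by rw [← ofReal_norm, norm_zero, ENNReal.ofReal_zero]
      have h2 := ENNReal.Tendsto.mul_const (b := timeMeasure T univ ^ (1 / q.toReal))
        (h1.enorm.trans (le_of_eq (congrArg 𝓝 h0)))
        (Or.inr (ENNReal.rpow_ne_top_of_nonneg (by positivity) (measure_ne_top _ _)))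
      rwa [zero_mul] at h2
    have hne : (comap (toDual ι) (𝓝 c)).NeBot := 
      comap_neBot_iff_frequently.2 (mem_closure_iff_frequently.1 (hd c))
    obtain ⟨w, hw⟩ := (ENNReal.tendsto_nhds_zero.1 hlim ε (pos_iff_ne_zero.2 hε)).exists
    refine ⟨fun t => toDual ι (s.indicator (fun _ => w) t), ?_, s.indicator fun _ => w, ‖w‖,
      aestronglyMeasurable_const.indicator hs, fun t => norm_indicator_le_norm_self (fun _ => w) t,
      rfl⟩
    refine le_trans ?_ hw
    rw [← eLpNorm_const' _ hq0 hq]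
    refine eLpNorm_mono fun t => ?_
    by_cases ht : t ∈ s <;> simp [ht]
  · rintro f g ⟨h, K, h1, h2, rfl⟩ ⟨h', K', h1', h2', rfl⟩
    refine ⟨fun s => h s + h' s, K + K', h1.add h1', fun s =>
      (norm_add_le _ _).trans (add_le_add (h2 s) (h2' s)), ?_⟩
    funext s
    simp
  · rintro f ⟨h, K, h1, h2, rfl⟩
    exact (toDual ι).continuous.comp_aestronglyMeasurable h1

/-- The functional itself need not lie in `L^q(V*)`, so it is cut at norm `c`. The part above `c`
keeps its mixed bound, which is small for large `c`; the part below is bounded and can be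
approximated in `L^q(V*)`. -/
theorem MixedBound.exists_toDual_approx {g : ℝ → StrongDual ℝ V} {M k : ℝ → ℝ}
    (hb : MixedBound (timeMeasure T) ι g M k) (hg : AEStronglyMeasurable g (timeMeasure T))
    (hM : MemLp M q (timeMeasure T)) (hk : Integrable k (timeMeasure T))
    (hd : DenseRange (toDual ι)) (hq1 : 1 ≤ q) (hq : q ≠ ∞) {ε : ℝ≥0∞} (hε : ε ≠ 0) :
    ∃ (h : ℝ → H) (K : ℝ) (M' k' : ℝ → ℝ), AEStronglyMeasurable h (timeMeasure T) ∧
      (∀ s, ‖h s‖ ≤ K) ∧ MixedBound (timeMeasure T) ι (fun s => g s - toDual ι (h s)) M' k' ∧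
      AEStronglyMeasurable M' (timeMeasure T) ∧ eLpNorm M' q (timeMeasure T) ≤ ε ∧
      AEStronglyMeasurable k' (timeMeasure T) ∧ ∫⁻ s, ‖k' s‖ₑ ∂(timeMeasure T) ≤ ε := by
  have hq0 : q ≠ 0 := (zero_lt_one.trans_le hq1).ne'
  set w := hg.mk g with hw
  have hws : StronglyMeasurable w := hg.stronglyMeasurable_mk
  have hwg : g =ᵐ[timeMeasure T] w := hg.ae_eq_mk
  have hS : ∀ c : ℕ, MeasurableSet {s | (c : ℝ) < ‖w s‖} := fun c =>
    hws.norm.measurable measurableSet_Ioi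
  have hpt : ∀ (f : ℝ → ℝ) s,
      Tendsto (fun c : ℕ => {s | (c : ℝ) < ‖w s‖}.indicator f s) atTop (𝓝 0) := by
    intro f s
    refine tendsto_const_nhds.congr' ?_
    filter_upwards [eventually_ge_atTop ⌈‖w s‖⌉₊] with c hc
    have : s ∉ {s | (c : ℝ) < ‖w s‖} := not_lt.2 ((Nat.le_ceil ‖w s‖).trans (Nat.cast_le.2 hc))
    rw [indicator_of_notMem this]
  have l1 := tendsto_eLpNorm_zero_of_dominated hq0 hq (b := M)
    (f := fun c : ℕ => {s | (c : ℝ) < ‖w s‖}.indicator M) (fun c => hM.1.indicator (hS c)) hM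
    (fun c => Eventually.of_forall fun s => norm_indicator_le_norm_self _ _)
    (Eventually.of_forall (hpt M))
  have l2 := tendsto_eLpNorm_zero_of_dominated one_ne_zero ENNReal.one_ne_top (b := k)
    (f := fun c : ℕ => {s | (c : ℝ) < ‖w s‖}.indicator k) (fun c => hk.1.indicator (hS c))
    (memLp_one_iff_integrable.2 hk)
    (fun c => Eventually.of_forall fun s => norm_indicator_le_norm_self _ _)
    (Eventually.of_forall (hpt k))
  simp_rw [eLpNorm_one_eq_lintegral_enorm] at l2
  obtain ⟨c, hc1, hc2⟩ := ((ENNReal.tendsto_nhds_zero.1 l1 (ε / 2) (ENNReal.half_pos hε)).and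
    (ENNReal.tendsto_nhds_zero.1 l2 ε (pos_iff_ne_zero.2 hε))).exists
  have hgN : MemLp ({s | (c : ℝ) < ‖w s‖}ᶜ.indicator w) q (timeMeasure T) := by
    refine MemLp.of_bound (hws.indicator (hS c).compl).aestronglyMeasurable c
      (Eventually.of_forall fun s => ?_)
    by_cases hs : s ∈ {s | (c : ℝ) < ‖w s‖}ᶜ
    · rw [indicator_of_mem hs]; exact not_lt.1 hs
    · rw [indicator_of_notMem hs]; simp
  obtain ⟨h, K, h1, h2, h3⟩ := exists_toDual_approx_memLp hd hq0 hq hgN (ENNReal.half_pos hε).ne'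
  have hrm : AEStronglyMeasurable
      (fun s => ‖{s | (c : ℝ) < ‖w s‖}ᶜ.indicator w s - toDual ι (h s)‖) (timeMeasure T) :=
    (hgN.1.sub ((toDual ι).continuous.comp_aestronglyMeasurable h1)).norm
  have hMm : AEStronglyMeasurable (fun s => ‖{s | (c : ℝ) < ‖w s‖}.indicator M s‖)
      (timeMeasure T) := (hM.1.indicator (hS c)).norm
  refine ⟨h, K, fun s => ‖{s | (c : ℝ) < ‖w s‖}ᶜ.indicator w s - toDual ι (h s)‖
    + ‖{s | (c : ℝ) < ‖w s‖}.indicator M s‖, {s | (c : ℝ) < ‖w s‖}.indicator k, h1, h2, ?_,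
    hrm.add hMm, ?_, hk.1.indicator (hS c), hc2⟩
  · filter_upwards [hb, hwg] with s h4 h5 v
    have e : g s - toDual ι (h s) = ({s | (c : ℝ) < ‖w s‖}ᶜ.indicator w s - toDual ι (h s))
        + {s | (c : ℝ) < ‖w s‖}.indicator w s := by
      rw [h5]
      have := congrFun (indicator_compl_add_self {s | (c : ℝ) < ‖w s‖} w) s
      simp only [Pi.add_apply] at this
      rw [← this]
      abel
    have e2 : ‖({s | (c : ℝ) < ‖w s‖}.indicator w s) v‖
        ≤ ‖{s | (c : ℝ) < ‖w s‖}.indicator M s‖ * ‖v‖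
          + ‖{s | (c : ℝ) < ‖w s‖}.indicator k s‖ * ‖ι v‖ := by
      by_cases hs : s ∈ {s | (c : ℝ) < ‖w s‖}
      · simp only [indicator_of_mem hs]
        rw [← h5]
        exact h4 v
      · simp [indicator_of_notMem hs]
    rw [e, add_apply, Real.norm_of_nonneg (add_nonneg (norm_nonneg _) (norm_nonneg _)), add_mul]
    refine (norm_add_le _ _).trans ?_
    rw [add_assoc]
    exact add_le_add (ContinuousLinearMap.le_opNorm _ _) e2
  · refine (eLpNorm_add_le hrm hMm hq1).trans ?_
    rw [eLpNorm_norm, eLpNorm_norm, ← ENNReal.add_halves ε]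
    exact add_le_add h3 hc1

/-- A sequence bounded in `L^p(V)` and in `L^∞(H)`, converging weakly in `H` to zero at almost every
time, converges to zero when tested against a functional with a mixed bound. -/
theorem MixedBound.tendsto_lintegral_apply [ENNReal.HolderTriple q p 1]
    {g : ℝ → StrongDual ℝ V} {M k : ℝ → ℝ}
    (hb : MixedBound (timeMeasure T) ι g M k) (hg : AEStronglyMeasurable g (timeMeasure T))
    (hM : MemLp M q (timeMeasure T)) (hk : Integrable k (timeMeasure T))
    (hd : DenseRange (toDual ι)) (hq1 : 1 ≤ q) (hq : q ≠ ∞)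
    {z : ℕ → ℝ → V} (hz : ∀ n, AEStronglyMeasurable (z n) (timeMeasure T)) {C : ℝ≥0∞}
    (hC : ∀ n, eLpNorm (z n) p (timeMeasure T) ≤ C) (hCt : C ≠ ∞) {R : ℝ}
    (hR : ∀ n, ∀ᵐ s ∂(timeMeasure T), ‖ι (z n s)‖ ≤ R)
    (hlim : ∀ᵐ s ∂(timeMeasure T), ∀ w, Tendsto (fun n => inner ℝ (ι (z n s)) w) atTop (𝓝 0)) :
    Tendsto (fun n => ∫⁻ s, ‖g s (z n s)‖ₑ ∂(timeMeasure T)) atTop (𝓝 0) := by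
  -- Replacing `g` by a bounded `H`-valued function costs `ε (C + R)` uniformly in `n`; against that
  -- function weak convergence and dominated convergence suffice.
  refine tendsto_zero_of_forall_le_mul (K := C + ENNReal.ofReal R + 1)
    (by simp [hCt]) fun ε hε hεt => ?_
  obtain ⟨h, K, M', k', h1, h2, h3, h4, h5, h6, h7⟩ := hb.exists_toDual_approx hg hM hk hd hq1 hq hε
  have hK : 0 ≤ K := (norm_nonneg _).trans (h2 0)
  have hlim2 : Tendsto (fun n => ∫⁻ s, ‖toDual ι (h s) (z n s)‖ₑ ∂(timeMeasure T)) atTop (𝓝 0) := by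
    rw [← lintegral_zero (μ := timeMeasure T)]
    refine tendsto_lintegral_of_dominated_convergence' (fun _ => ENNReal.ofReal (K * R))
      (fun n => ?_) (fun n => ?_) ?_ ?_
    · exact (aestronglyMeasurable_clm_apply ((toDual ι).continuous.comp_aestronglyMeasurable h1)
        (hz n)).enorm
    · filter_upwards [hR n] with s hs
      rw [← ofReal_norm, toDual_apply_apply]
      refine ENNReal.ofReal_le_ofReal ((norm_inner_le_norm _ _).trans ?_)
      gcongr
      exact h2 s
    · simp only [lintegral_const]
      exact ENNReal.mul_ne_top ENNReal.ofReal_ne_top (measure_ne_top _ _)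
    · filter_upwards [hlim] with s hs
      have := (hs (h s)).enorm
      simp_rw [toDual_apply_apply]
      simp_rw [real_inner_comm] at this ⊢
      simpa using this
  filter_upwards [ENNReal.tendsto_nhds_zero.1 hlim2 ε (pos_iff_ne_zero.2 hε)] with n hn
  have e1 : ∫⁻ s, ‖(g s - toDual ι (h s)) (z n s)‖ₑ ∂(timeMeasure T)
      ≤ ε * C + ε * ENNReal.ofReal R := by
    refine (h3.lintegral_le (p := p) (q := q) h4 (hz n)).trans ?_
    gcongr
    · exact hC n
    · calc ∫⁻ s, ‖k' s‖ₑ * ‖ι (z n s)‖ₑ ∂(timeMeasure T)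
          ≤ ∫⁻ s, ‖k' s‖ₑ * ENNReal.ofReal R ∂(timeMeasure T) := by
            refine lintegral_mono_ae ?_
            filter_upwards [hR n] with s hs
            gcongr
            rw [← ofReal_norm]
            exact ENNReal.ofReal_le_ofReal hs
        _ ≤ _ := by
            rw [lintegral_mul_const'' _ h6.enorm]
            gcongr
  calc ∫⁻ s, ‖g s (z n s)‖ₑ ∂(timeMeasure T)
      ≤ ∫⁻ s, (‖(g s - toDual ι (h s)) (z n s)‖ₑ + ‖toDual ι (h s) (z n s)‖ₑ) ∂(timeMeasure T) := by
        refine lintegral_mono fun s => ?_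
        have : g s (z n s) = (g s - toDual ι (h s)) (z n s) + toDual ι (h s) (z n s) := by
          rw [← add_apply, sub_add_cancel]
        rw [this]
        exact enorm_add_le _ _
    _ = ∫⁻ s, ‖(g s - toDual ι (h s)) (z n s)‖ₑ ∂(timeMeasure T)
        + ∫⁻ s, ‖toDual ι (h s) (z n s)‖ₑ ∂(timeMeasure T) :=
        lintegral_add_left' (aestronglyMeasurable_clm_apply
          (hg.sub ((toDual ι).continuous.comp_aestronglyMeasurable h1)) (hz n)).enorm _
    _ ≤ (ε * C + ε * ENNReal.ofReal R) + ε := add_le_add e1 hn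
    _ = ε * (C + ENNReal.ofReal R + 1) := by ring

end WeakConvergence

/-! ### Extraction of uniformly convergent subsequences -/

section Extraction

variable {T : ℝ} {E : Type*} [NormedAddCommGroup E] [ProperSpace E]

/-- Arzelà–Ascoli. The modulus `ω s` gives equicontinuity at `s`, and, because it forces continuity,
it also makes the set closed among all functions with the topology of pointwise convergence. -/
theorem isCompact_setOf_modulus {X : Type*} [TopologicalSpace X] {R : ℝ} {ω : X → X → ℝ}
    (hω : ∀ s, Tendsto (ω s) (𝓝 s) (𝓝 0)) :
    IsCompact {f : C(X, E) | (∀ t, ‖f t‖ ≤ R) ∧ ∀ s t, ‖f t - f s‖ ≤ ω s t} := by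
  refine ArzelaAscoli.isCompact_of_equicontinuous _ ?_ ?_
  · have himg : ContinuousMap.toFun '' {f : C(X, E) | (∀ t, ‖f t‖ ≤ R) ∧ ∀ s t, ‖f t - f s‖ ≤ ω s t}
        = (Set.univ.pi fun _ => Metric.closedBall (0 : E) R)
          ∩ ⋂ s, ⋂ t, {f : X → E | ‖f t - f s‖ ≤ ω s t} := by
      ext f
      simp only [mem_image, mem_ofPred_eq, mem_inter_iff, mem_univ_pi, Metric.mem_closedBall,
        dist_zero_right, mem_iInter]
      constructor
      · rintro ⟨g, ⟨h1, h2⟩, rfl⟩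
        exact ⟨h1, h2⟩
      · rintro ⟨h1, h2⟩
        have hc : Continuous f := by
          rw [continuous_iff_continuousAt]
          intro s
          rw [ContinuousAt, tendsto_iff_norm_sub_tendsto_zero]
          exact squeeze_zero (fun _ => norm_nonneg _) (h2 s) (hω s)
        exact ⟨⟨f, hc⟩, ⟨h1, h2⟩, rfl⟩
    rw [himg]
    refine (isCompact_univ_pi fun _ => isCompact_closedBall _ _).inter_right ?_
    exact isClosed_iInter fun s => isClosed_iInter fun t =>
      isClosed_le (by fun_prop) continuous_const
  · intro s
    rw [Metric.equicontinuousAt_iff_right]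
    intro ε hε
    filter_upwards [(hω s).eventually (gt_mem_nhds hε)] with t ht f
    rw [dist_comm, dist_eq_norm]
    exact (f.2.2 s t).trans_lt ht

/-- A countable product of compact metrisable sets is sequentially compact, so one subsequence
serves every `j` without a diagonal argument. -/
theorem exists_subseq_tendstoUniformlyOn {F : ℕ → ℕ → ℝ → E} {R : ℕ → ℝ} {ω : ℕ → ℝ → ℝ → ℝ}
    (hR : ∀ j n, ∀ t ∈ Icc 0 T, ‖F j n t‖ ≤ R j)
    (hω : ∀ j n, ∀ s ∈ Icc 0 T, ∀ t ∈ Icc 0 T, ‖F j n t - F j n s‖ ≤ ω j s t)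
    (hω0 : ∀ j, ∀ s ∈ Icc 0 T, Tendsto (ω j s) (𝓝[Icc 0 T] s) (𝓝 0)) :
    ∃ φ : ℕ → ℕ, StrictMono φ ∧ ∃ f : ℕ → ℝ → E, ∀ j,
      TendstoUniformlyOn (fun n => F j (φ n)) (f j) atTop (Icc 0 T) := by
  have hω1 : ∀ j, ∀ s : Icc 0 T, Tendsto (fun t : Icc 0 T => ω j s t) (𝓝 s) (𝓝 0) := by
    intro j s
    have := hω0 j s s.2
    rw [nhdsWithin_eq_map_subtype_coe s.2] at this
    exact this
  have hcont : ∀ j n, Continuous fun t : Icc 0 T => F j n t := by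
    intro j n
    rw [continuous_iff_continuousAt]
    intro s
    rw [ContinuousAt, tendsto_iff_norm_sub_tendsto_zero]
    exact squeeze_zero (fun _ => norm_nonneg _) (fun t => hω j n s s.2 t t.2) (hω1 j s)
  have hK : IsCompact (Set.univ.pi fun j => {f : C(Icc 0 T, E) | (∀ t, ‖f t‖ ≤ R j) ∧
      ∀ s t : Icc 0 T, ‖f t - f s‖ ≤ ω j s t}) :=
    isCompact_univ_pi fun j => isCompact_setOf_modulus (hω1 j)
  obtain ⟨g, -, φ, hφ, hg⟩ := hK.isSeqCompact (x := fun n j => ⟨_, hcont j n⟩)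
    fun n j _ => ⟨fun t => hR j n t t.2, fun s t => hω j n s s.2 t t.2⟩
  refine ⟨φ, hφ, fun j t => if h : t ∈ Icc 0 T then g j ⟨t, h⟩ else 0, fun j => ?_⟩
  have hj := (tendsto_pi_nhds.1 hg) j
  rw [ContinuousMap.tendsto_iff_tendstoUniformly, Metric.tendstoUniformly_iff] at hj
  rw [Metric.tendstoUniformlyOn_iff]
  intro ε hε
  filter_upwards [hj ε hε] with n hn t ht
  rw [dif_pos ht]
  exact hn ⟨t, ht⟩

end Extraction

/-! ### Carathéodory differential equations -/

section ODE

variable {T : ℝ} {E : Type*} [NormedAddCommGroup E] [InnerProductSpace ℝ E] [FiniteDimensional ℝ E]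
  [MeasurableSpace E] [BorelSpace E]

/-- Method of steps: with delay `δ`, the Picard iterates no longer change on `t ≤ n δ` after `n`
steps. Vanishing of `g` at negative times keeps them constant there and starts the induction. -/
theorem exists_delay_solution {g : ℝ → E → E} (hg : Measurable (Function.uncurry g)) {m : ℝ → ℝ}
    (hm : Integrable m volume) (hgm : ∀ᵐ t, ∀ c, ‖g t c‖ ≤ m t)
    (hg0 : ∀ t < 0, ∀ c, g t c = 0) (x₀ : E) {δ : ℝ} (hδ : 0 < δ) :
    ∃ X : ℝ → E, Continuous X ∧
      ∀ t ≤ T, X t = x₀ + ∫ s in (0 : ℝ)..t, g s (X (s - δ)) := by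
  have hint : ∀ X : ℝ → E, Continuous X → Integrable (fun s => g s (X (s - δ))) volume := by
    intro X hX
    have h1 : Measurable fun s => g s (X (s - δ)) :=
      hg.comp (measurable_id.prodMk (hX.comp (by fun_prop)).measurable)
    refine hm.mono' h1.aestronglyMeasurable ?_
    filter_upwards [hgm] with t ht using ht _
  have hstep : ∀ X : ℝ → E, Continuous X →
      Continuous fun t => x₀ + ∫ s in (0 : ℝ)..t, g s (X (s - δ)) := fun X hX =>
    continuous_const.add (intervalIntegral.continuous_primitive
      (fun a b => (hint X hX).intervalIntegrable) 0)
  let S : ℕ → {X : ℝ → E // Continuous X} := fun n =>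
    Nat.rec ⟨fun _ => x₀, continuous_const⟩
      (fun _ X => ⟨fun t => x₀ + ∫ s in (0 : ℝ)..t, g s (X.1 (s - δ)), hstep X.1 X.2⟩) n
  have hS : ∀ n t, (S (n + 1)).1 t = x₀ + ∫ s in (0 : ℝ)..t, g s ((S n).1 (s - δ)) :=
    fun n t => rfl
  have hneg : ∀ (X : ℝ → E) t, t ≤ 0 → ∫ s in (0 : ℝ)..t, g s (X (s - δ)) = 0 := by
    intro X t ht
    refine intervalIntegral.integral_zero_ae ?_
    have n1 : ∀ᵐ t : ℝ, t ≠ 0 := by simp [ae_iff, measure_singleton]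
    filter_upwards [n1] with s hs hs'
    rw [uIoc_of_ge ht] at hs'
    exact hg0 s (lt_of_le_of_ne hs'.2 hs) _
  have hagree : ∀ n : ℕ, ∀ t ≤ n * δ, (S (n + 1)).1 t = (S n).1 t := by
    intro n
    induction n with
    | zero =>
      intro t ht
      rw [hS, hneg _ _ (by simpa using ht), add_zero]
      rfl
    | succ n ih =>
      intro t ht
      rw [hS (n + 1), hS n]
      rcases le_total t 0 with h0 | h0
      · rw [hneg _ _ h0, hneg _ _ h0]
      · congr 1
        refine intervalIntegral.integral_congr fun s hs => ?_
        rw [uIcc_of_le h0] at hs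
        rw [ih]
        push_cast at ht
        linarith [hs.2]
  obtain ⟨n, hn⟩ := exists_nat_ge (T / δ)
  rw [div_le_iff₀ hδ] at hn
  refine ⟨(S n).1, (S n).2, fun t ht => ?_⟩
  rw [← hagree n t (ht.trans hn), hS]

/-- Carathéodory's existence theorem for a right-hand side with an integrable bound. -/
theorem exists_solution_of_bounded (hT : 0 ≤ T) {g : ℝ → E → E}
    (hg : Measurable (Function.uncurry g)) {m : ℝ → ℝ}
    (hm : Integrable m (timeMeasure T)) (hgm : ∀ᵐ t ∂(timeMeasure T), ∀ c, ‖g t c‖ ≤ m t)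
    (hgc : ∀ᵐ t ∂(timeMeasure T), Continuous (g t)) (x₀ : E) :
    ∃ X : ℝ → E, ContinuousOn X (Icc 0 T) ∧
      ∀ t ∈ Icc 0 T, X t = x₀ + ∫ s in (0 : ℝ)..t, g s (X s) := by
  have h0 : (0 : ℝ) ∈ Icc 0 T := ⟨le_rfl, hT⟩
  set g₁ : ℝ → E → E := fun t c => (Icc 0 T).indicator (fun t => g t c) t with hg₁
  set m₁ : ℝ → ℝ := (Icc 0 T).indicator m with hm₁
  have hg₁m : Measurable (Function.uncurry g₁) := by
    have : Function.uncurry g₁ = (Prod.fst ⁻¹' Icc 0 T).indicator (Function.uncurry g) := by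
      funext ⟨t, c⟩
      by_cases ht : t ∈ Icc 0 T
      · rw [indicator_of_mem (show (t, c) ∈ Prod.fst ⁻¹' Icc 0 T from ht)]
        simp only [hg₁, Function.uncurry_apply_pair, indicator_of_mem ht]
      · rw [indicator_of_notMem (show (t, c) ∉ Prod.fst ⁻¹' Icc 0 T from ht)]
        simp only [hg₁, Function.uncurry_apply_pair, indicator_of_notMem ht]
    rw [this]
    exact hg.indicator (measurable_fst measurableSet_Icc)
  have hm₁i : Integrable m₁ volume := (integrable_indicator_iff measurableSet_Icc).2 hm
  have hgm₁ : ∀ᵐ t, ∀ c, ‖g₁ t c‖ ≤ m₁ t := by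
    filter_upwards [(ae_restrict_iff' measurableSet_Icc).1 hgm] with t ht c
    by_cases h : t ∈ Icc 0 T
    · simpa [hg₁, hm₁, h] using ht h c
    · simp [hg₁, hm₁, h]
  have hgc₁ : ∀ᵐ t, Continuous (g₁ t) := by
    filter_upwards [(ae_restrict_iff' measurableSet_Icc).1 hgc] with t ht
    by_cases h : t ∈ Icc 0 T
    · simpa [hg₁, h] using ht h
    · simpa [hg₁, h] using continuous_const
  have hg₁0 : ∀ t < 0, ∀ c, g₁ t c = 0 := fun t ht c => by
    have : t ∉ Icc 0 T := fun h => absurd h.1 (not_le.2 ht)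
    simp [hg₁, this]
  set δ : ℕ → ℝ := fun n => 1 / ((n : ℝ) + 1) with hδ
  have hδpos : ∀ n, 0 < δ n := fun n => by positivity
  have hδ0 : Tendsto δ atTop (𝓝 0) := tendsto_one_div_add_atTop_nhds_zero_nat
  choose X hXc hX using fun n => exists_delay_solution (T := T) hg₁m hm₁i hgm₁ hg₁0 x₀ (hδpos n)
  have hint : ∀ n, Integrable (fun s => g₁ s (X n (s - δ n))) volume := by
    intro n
    have h1 : Measurable fun s => g₁ s (X n (s - δ n)) :=
      hg₁m.comp (measurable_id.prodMk ((hXc n).comp (by fun_prop)).measurable)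
    refine hm₁i.mono' h1.aestronglyMeasurable ?_
    filter_upwards [hgm₁] with t ht using ht _
  set P : ℝ → ℝ := fun t => ∫ s in (0 : ℝ)..t, m₁ s with hP
  have hPc : Continuous P := intervalIntegral.continuous_primitive
    (fun a b => hm₁i.intervalIntegrable) 0
  -- One modulus of continuity serves all delays; it also compares `X n (t - δ n)` with `X n t`.
  have hmod : ∀ n, ∀ s ≤ T, ∀ t ≤ T, ‖X n t - X n s‖ ≤ |P t - P s| := by
    intro n s hs t ht
    rw [hX n t ht, hX n s hs, add_sub_add_left_eq_sub,
      intervalIntegral.integral_interval_sub_left (hint n).intervalIntegrable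
        (hint n).intervalIntegrable, hP]
    simp only
    rw [intervalIntegral.integral_interval_sub_left hm₁i.intervalIntegrable
        hm₁i.intervalIntegrable]
    refine intervalIntegral.norm_integral_le_abs_of_norm_le ?_ hm₁i.intervalIntegrable
    filter_upwards [ae_restrict_of_ae hgm₁] with r hr using hr _
  have hX0 : ∀ n, X n 0 = x₀ := fun n => by rw [hX n 0 hT]; simp
  obtain ⟨B, hB⟩ := isCompact_Icc.exists_bound_of_continuousOn (s := Icc 0 T) hPc.continuousOn
  have hbd : ∀ n, ∀ t ∈ Icc 0 T, ‖X n t‖ ≤ ‖x₀‖ + (B + B) := by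
    intro n t ht
    have h1 := hmod n 0 hT t ht.2
    rw [hX0] at h1
    have h2 : ‖X n t‖ ≤ ‖x₀‖ + ‖X n t - x₀‖ := by
      have := norm_add_le x₀ (X n t - x₀)
      simpa using this
    have h3 := abs_sub (P t) (P 0)
    have h4 := hB t ht
    have h5 := hB 0 h0
    rw [Real.norm_eq_abs] at h4 h5
    linarith
  have hP0 : ∀ s ∈ Icc 0 T, Tendsto (fun t => |P t - P s|) (𝓝[Icc 0 T] s) (𝓝 0) := by
    intro s hs
    have := ((hPc.tendsto s).sub_const (P s)).abs
    rw [sub_self, abs_zero] at this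
    exact this.mono_left nhdsWithin_le_nhds
  obtain ⟨φ, hφ, f, hf⟩ := exists_subseq_tendstoUniformlyOn (T := T) (F := fun _ => X)
    (R := fun _ => ‖x₀‖ + (B + B)) (ω := fun _ s t => |P t - P s|) (fun _ => hbd)
    (fun _ n s hs t ht => hmod n s hs.2 t ht.2) (fun _ => hP0)
  have hf0 := hf 0
  have hpt : ∀ t ∈ Icc 0 T, Tendsto (fun n => X (φ n) t) atTop (𝓝 (f 0 t)) := fun t ht =>
    hf0.tendsto_at ht
  refine ⟨f 0, hf0.continuousOn (Frequently.of_forall fun n => (hXc _).continuousOn),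
    fun t ht => ?_⟩
  have hshift : ∀ t ∈ Icc 0 T, Tendsto (fun n => X (φ n) (t - δ (φ n))) atTop (𝓝 (f 0 t)) := by
    intro t ht
    have h1 : Tendsto (fun n => t - δ (φ n)) atTop (𝓝 t) := by
      have := (hδ0.comp hφ.tendsto_atTop).const_sub t
      simpa using this
    have h2 : Tendsto (fun n => |P (t - δ (φ n)) - P t|) atTop (𝓝 0) := by
      have := (((hPc.tendsto t).comp h1).sub_const (P t)).abs
      simpa using this
    have h3 : Tendsto (fun n => X (φ n) (t - δ (φ n)) - X (φ n) t) atTop (𝓝 0) :=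
      squeeze_zero_norm (fun n => hmod _ t ht.2 _ (by linarith [hδpos (φ n), ht.2])) h2
    simpa using h3.add (hpt t ht)
  have e : ∀ n, X (φ n) t = x₀ + ∫ s in (0 : ℝ)..t, g₁ s (X (φ n) (s - δ (φ n))) :=
    fun n => hX _ t ht.2
  have hlim : Tendsto (fun n => x₀ + ∫ s in (0 : ℝ)..t, g₁ s (X (φ n) (s - δ (φ n)))) atTop
      (𝓝 (x₀ + ∫ s in (0 : ℝ)..t, g s (f 0 s))) := by
    refine Tendsto.const_add x₀ ?_
    refine intervalIntegral.tendsto_integral_filter_of_dominated_convergence m₁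
      (Eventually.of_forall fun n => (hint _).1.restrict)
      (Eventually.of_forall fun n => ?_) hm₁i.intervalIntegrable ?_
    · filter_upwards [hgm₁] with s hs _ using hs _
    · filter_upwards [hgc₁] with s hs hs'
      have hs2 : s ∈ Icc 0 T := uIcc_subset_Icc h0 ht (uIoc_subset_uIcc hs')
      have := (hs.tendsto (f 0 s)).comp (hshift s hs2)
      simpa [hg₁, hs2, Function.comp_def] using this
  refine tendsto_nhds_unique (hpt t ht) (hlim.congr fun n => (e n).symm)

end ODE

/-! ### Evolutions with an integrable derivative in H -/

section Evolution

variable {H V : Type*} [NormedAddCommGroup H] [InnerProductSpace ℝ H] [CompleteSpace H]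
  [NormedAddCommGroup V] [NormedSpace ℝ V] {p q : ℝ≥0∞} {T : ℝ} {ι : V →L[ℝ] H}

theorem continuousOn_of_eq_add_integral {E : Type*} [NormedAddCommGroup E] [NormedSpace ℝ E]
    {X g : ℝ → E} {x₀ : E} (hg : Integrable g (timeMeasure T))
    (hX : ∀ t ∈ Icc 0 T, X t = x₀ + ∫ s in (0 : ℝ)..t, g s) : ContinuousOn X (Icc 0 T) := by
  have h1 : IntegrableOn g (Icc 0 T) volume := hg
  refine ((continuousOn_const (c := x₀)).add (intervalIntegral.continuousOn_primitive h1)).congr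
    fun s hs => ?_
  rw [hX s hs, intervalIntegral.integral_of_le hs.1]
  rfl

theorem Evol.of_eq_add_integral {X g : ℝ → H} {x₀ : H} {y : ℝ → V} (hT : 0 ≤ T)
    (hg : Integrable g (timeMeasure T)) (hX : ∀ t ∈ Icc 0 T, X t = x₀ + ∫ s in (0 : ℝ)..t, g s)
    (hy : MemLp y p (timeMeasure T)) (hv : ∀ᵐ t ∂(timeMeasure T), ι (y t) = X t) :
    Evol T p q ι X y fun s => toDual ι (g s) where
  memLp := hy
  version := hv
  bdd := isCompact_Icc.exists_bound_of_continuousOn (continuousOn_of_eq_add_integral hg hX)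
  meas := (toDual ι).continuous.comp_aestronglyMeasurable hg.1
  mixed := by
    refine ⟨fun _ => 0, fun s => ‖g s‖, MemLp.zero', hg.norm,
      Eventually.of_forall fun s v => ?_⟩
    rw [toDual_apply_apply, norm_zero, zero_mul, zero_add, norm_norm]
    exact norm_inner_le_norm _ _
  eq := by
    intro t ht v
    have h0 : (0 : ℝ) ∈ Icc 0 T := ⟨le_rfl, hT⟩
    have hX0 : X 0 = x₀ := by rw [hX 0 h0]; simp
    have hi := intervalIntegrable_of_timeMeasure hg h0 ht
    rw [hX t ht, hX0, inner_add_left]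
    congr 1
    have := ((innerSL ℝ (E := H)).flip (ι v)).intervalIntegral_comp_comm hi
    exact this.symm

end Evolution

section ODE

variable {T : ℝ} {E : Type*} [NormedAddCommGroup E] [InnerProductSpace ℝ E] [FiniteDimensional ℝ E]
  [MeasurableSpace E] [BorelSpace E]

/-- The energy equality for the trivial triplet `V = H`, with `p = q = 2`. -/
theorem norm_sq_eq_add_integral {H : Type*} [NormedAddCommGroup H] [InnerProductSpace ℝ H]
    [CompleteSpace H] (hT : 0 < T) {X g : ℝ → H} {x₀ : H}
    (hg : Integrable g (timeMeasure T)) (hX : ∀ t ∈ Icc 0 T, X t = x₀ + ∫ s in (0 : ℝ)..t, g s)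
    {t : ℝ} (ht : t ∈ Icc 0 T) :
    ‖X t‖ ^ 2 = ‖x₀‖ ^ 2 + 2 * ∫ s in (0 : ℝ)..t, inner ℝ (g s) (X s) := by
  have h0 : (0 : ℝ) ∈ Icc 0 T := ⟨le_rfl, hT.le⟩
  have hX0 : X 0 = x₀ := by rw [hX 0 h0]; simp
  have hc := continuousOn_of_eq_add_integral hg hX
  obtain ⟨R, hR⟩ := isCompact_Icc.exists_bound_of_continuousOn hc
  have hXL : MemLp X 2 (timeMeasure T) := by
    refine MemLp.of_bound (hc.aestronglyMeasurable_of_isCompact isCompact_Icc measurableSet_Icc)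
        R ?_
    exact (ae_restrict_iff' measurableSet_Icc).2 (Eventually.of_forall hR)
  have hE : Evol T 2 2 (ContinuousLinearMap.id ℝ H) X X fun s => toDual _ (g s) :=
    Evol.of_eq_add_integral hT.le hg hX hXL (Eventually.of_forall fun _ => rfl)
  have := hE.energy hT (by norm_num) (by norm_num) (by simpa using denseRange_id) ht
  rw [hX0] at this
  exact this

/-- The right-hand side is evaluated at the radial projection onto a ball, which makes it bounded by
an integrable function. Coercivity survives up to a factor, and Grönwall's inequality keeps the
solution inside the ball, where the projection does nothing. -/
theorem exists_solution_of_coercive (hT : 0 < T) {g : ℝ → E → E}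
    (hg : Measurable (Function.uncurry g))
    (hgm : ∀ R : ℝ, ∃ m : ℝ → ℝ, Integrable m (timeMeasure T) ∧
      ∀ᵐ t ∂(timeMeasure T), ∀ c, ‖c‖ ≤ R → ‖g t c‖ ≤ m t)
    (hgc : ∀ᵐ t ∂(timeMeasure T), Continuous (g t)) {κ : ℝ → ℝ} (hκ : Integrable κ (timeMeasure T))
    (hκ0 : ∀ᵐ t ∂(timeMeasure T), 0 ≤ κ t)
    (hco : ∀ᵐ t ∂(timeMeasure T), ∀ c, inner ℝ (g t c) c ≤ κ t * (1 + ‖c‖ ^ 2)) (x₀ : E) :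
    ∃ X : ℝ → E, ContinuousOn X (Icc 0 T) ∧ Integrable (fun s => g s (X s)) (timeMeasure T) ∧
      ∀ t ∈ Icc 0 T, X t = x₀ + ∫ s in (0 : ℝ)..t, g s (X s) := by
  have h0 : (0 : ℝ) ∈ Icc 0 T := ⟨le_rfl, hT.le⟩
  -- The Grönwall bound for `1 + ‖X‖ ^ 2`. The four is the two of the energy equality times the two
  -- lost in `hcoer`. A radius `B + 1` is enough, since `‖X‖ ^ 2 ≤ B` gives `‖X‖ ≤ B + 1`.
  set B : ℝ := (1 + ‖x₀‖ ^ 2) * Real.exp (∫ s, 4 * κ s ∂(timeMeasure T)) with hB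
  have hB0 : 0 < B := by positivity
  set R : ℝ := B + 1 with hR
  have hR1 : 1 ≤ R := by linarith
  have hRpos : 0 < R := by linarith
  set r : E → E := fun c => (R / max R ‖c‖) • c with hr
  have hmax : ∀ c : E, 0 < max R ‖c‖ := fun c => lt_max_of_lt_left hRpos
  have hrc : Continuous r := by
    refine Continuous.smul (continuous_const.div (by fun_prop) fun c => (hmax c).ne') continuous_id
  have hrn : ∀ c, ‖r c‖ ≤ R := by
    intro c
    rw [hr, norm_smul, Real.norm_of_nonneg (by have := hmax c; positivity), div_mul_eq_mul_div,
      div_le_iff₀ (hmax c)]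
    exact mul_le_mul_of_nonneg_left (le_max_right _ _) hRpos.le
  have hrid : ∀ c, ‖c‖ ≤ R → r c = c := by
    intro c hc
    rw [hr]
    simp only
    rw [max_eq_left hc, div_self hRpos.ne', one_smul]
  obtain ⟨m, hm, hgm⟩ := hgm R
  have hgr : Measurable (Function.uncurry fun t c => g t (r c)) :=
    hg.comp (measurable_fst.prodMk (hrc.measurable.comp measurable_snd))
  have hgrm : ∀ᵐ t ∂(timeMeasure T), ∀ c, ‖g t (r c)‖ ≤ m t := by
    filter_upwards [hgm] with t ht c using ht _ (hrn c)
  obtain ⟨X, hXc, hX⟩ := exists_solution_of_bounded hT.le (g := fun t c => g t (r c)) hgr hm hgrm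
    (by filter_upwards [hgc] with t ht using ht.comp hrc) x₀
  have hXm : AEStronglyMeasurable X (timeMeasure T) :=
    hXc.aestronglyMeasurable_of_isCompact isCompact_Icc measurableSet_Icc
  have hint : Integrable (fun s => g s (r (X s))) (timeMeasure T) := by
    refine hm.mono' ?_ (by filter_upwards [hgrm] with t ht using ht _)
    have h1 : AEMeasurable (fun s => (s, X s)) (timeMeasure T) :=
      aemeasurable_id.prodMk hXm.aemeasurable
    exact (hgr.comp_aemeasurable h1).aestronglyMeasurable
  -- Outside the ball `(g (r c), c) = (‖c‖ / R) (g (r c), r c)`, and `1 ≤ R ≤ ‖c‖` bounds `(1 + R ^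
  -- 2) ‖c‖ / R` by `2 (1 + ‖c‖ ^ 2)`.
  have hcoer : ∀ᵐ t ∂(timeMeasure T), ∀ c, inner ℝ (g t (r c)) c ≤ 2 * κ t * (1 + ‖c‖ ^ 2) := by
    filter_upwards [hco, hκ0] with t ht hk c
    rcases le_total ‖c‖ R with hc | hc
    · rw [hrid c hc]
      refine (ht c).trans ?_
      nlinarith [mul_nonneg hk (show 0 ≤ 1 + ‖c‖ ^ 2 by positivity)]
    · have h1 : 0 < ‖c‖ := hRpos.trans_le hc
      have e : r c = (R / ‖c‖) • c := by rw [hr]; simp only; rw [max_eq_right hc]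
      have h2 := ht (r c)
      have h3 : ‖r c‖ = R := by
        rw [e, norm_smul, Real.norm_of_nonneg (by positivity), div_mul_cancel₀ _ h1.ne']
      have h4 : inner ℝ (g t (r c)) (r c) = R / ‖c‖ * inner ℝ (g t (r c)) c := by
        conv_lhs => rw [e]
        rw [inner_smul_right, ← e]
      rw [h3, h4, div_mul_eq_mul_div, div_le_iff₀ h1] at h2
      have h5 : inner ℝ (g t (r c)) c ≤ κ t * (1 + R ^ 2) * ‖c‖ / R := by
        rw [le_div_iff₀ hRpos]; linarith
      refine h5.trans ?_
      rw [div_le_iff₀ hRpos]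
      have h6 : (1 + R ^ 2) * ‖c‖ ≤ 2 * (1 + ‖c‖ ^ 2) * R := by
        have a1 : 1 + R ^ 2 ≤ 2 * R ^ 2 := by nlinarith
        have a2 := mul_le_mul_of_nonneg_right a1 h1.le
        have a3 := mul_le_mul_of_nonneg_left hc (mul_nonneg hRpos.le h1.le)
        nlinarith
      calc κ t * (1 + R ^ 2) * ‖c‖ = κ t * ((1 + R ^ 2) * ‖c‖) := by ring
        _ ≤ κ t * (2 * (1 + ‖c‖ ^ 2) * R) := by gcongr
        _ = _ := by ring
  have hfc : ContinuousOn (fun t => 1 + ‖X t‖ ^ 2) (Icc 0 T) := continuousOn_const.add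
      (hXc.norm.pow 2)
  have hκ4 : Integrable (fun s => 4 * κ s) (timeMeasure T) := hκ.const_mul 4
  have hκ40 : ∀ᵐ s ∂(timeMeasure T), 0 ≤ 4 * κ s := by
    filter_upwards [hκ0] with s hs; positivity
  obtain ⟨K, hK⟩ := isCompact_Icc.exists_bound_of_continuousOn hXc
  have hbound : ∀ t ∈ Icc 0 T, ‖X t‖ ≤ R := by
    intro t ht
    have h1 : 1 + ‖X t‖ ^ 2 ≤ (1 + ‖x₀‖ ^ 2) * Real.exp (∫ s in (0 : ℝ)..t, 4 * κ s) := by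
      refine le_mul_exp_of_le_add_integral hfc hκ4 hκ40 (by positivity) (fun t ht => ?_) ht
      rw [norm_sq_eq_add_integral hT hint hX ht, add_assoc]
      gcongr 1 + (_ + ?_)
      rw [← intervalIntegral.integral_const_mul]
      have hi1 : Integrable (fun s => 2 * inner ℝ (g s (r (X s))) (X s)) (timeMeasure T) := by
        refine Integrable.const_mul ?_ 2
        refine (hint.norm.mul_const K).mono' (hint.1.inner hXm) ?_
        refine (ae_restrict_iff' measurableSet_Icc).2 (Eventually.of_forall fun s hs => ?_)
        exact (norm_inner_le_norm _ _).trans (mul_le_mul_of_nonneg_left (hK s hs) (norm_nonneg _))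
      have hi2 : Integrable (fun s => 4 * κ s * (1 + ‖X s‖ ^ 2)) (timeMeasure T) := by
        have : IntegrableOn (fun s => 4 * κ s) (Icc 0 T) volume := hκ4
        exact this.mul_continuousOn hfc isCompact_Icc
      refine intervalIntegral.integral_mono_ae_restrict ht.1
        (intervalIntegrable_of_timeMeasure hi1 h0 ht)
            (intervalIntegrable_of_timeMeasure hi2 h0 ht) ?_
      refine ae_restrict_of_ae_restrict_of_subset (Icc_subset_Icc_right ht.2) ?_
      filter_upwards [hcoer] with s hs
      have := hs (X s)
      linarith
    have h2 : ∫ s in (0 : ℝ)..t, 4 * κ s ≤ ∫ s, 4 * κ s ∂(timeMeasure T) := by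
      rw [intervalIntegral.integral_of_le ht.1, timeMeasure]
      refine setIntegral_mono_set hκ4 hκ40 ?_
      exact (Ioc_subset_Icc_self.trans (Icc_subset_Icc_right ht.2)).eventuallyLE
    have h3 : ‖X t‖ ^ 2 ≤ B := by
      have : (1 + ‖x₀‖ ^ 2) * Real.exp (∫ s in (0 : ℝ)..t, 4 * κ s) ≤ B := by
        rw [hB]; gcongr
      linarith
    nlinarith [norm_nonneg (X t)]
  have heq : ∀ t ∈ Icc 0 T, g t (r (X t)) = g t (X t) := fun t ht => by rw [hrid _ (hbound t ht)]
  refine ⟨X, hXc, ?_, fun t ht => ?_⟩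
  · refine hint.congr ?_
    exact (ae_restrict_iff' measurableSet_Icc).2 (Eventually.of_forall heq)
  · rw [hX t ht]
    congr 1
    exact intervalIntegral.integral_congr fun s hs => heq s (uIcc_subset_Icc h0 ht hs)

end ODE

/-! ### Demicontinuity -/

section Demicontinuity

variable {V : Type*} [NormedAddCommGroup V] [NormedSpace ℝ V]

/-- A locally bounded, hemicontinuous and locally monotone operator is demicontinuous. -/
theorem continuous_apply_of_locally_monotone {𝒜 : V → StrongDual ℝ V}
    (hemi : ∀ x y z, Continuous fun r : ℝ => 𝒜 (x + r • y) z)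
    (hbd : ∀ n : ℕ, ∃ C : ℝ, ∀ x, ‖x‖ ≤ n → ‖𝒜 x‖ ≤ C)
    (hmono : ∀ n : ℕ, ∃ C : ℝ, ∀ x y, ‖x‖ ≤ n → ‖y‖ ≤ n →
      (𝒜 x - 𝒜 y) (x - y) ≤ C * ‖x - y‖ ^ 2) (v : V) :
    Continuous fun x => 𝒜 x v := by
  rw [continuous_iff_continuousAt]
  intro x
  -- Along an ultrafilter tending to `x` the bounded functionals `𝒜 y` have a weak-* limit `ξ`;
  -- Minty's argument shows `ξ = 𝒜 x`.
  rw [ContinuousAt, tendsto_iff_ultrafilter]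
  intro g hg
  have hgx : Tendsto (fun y : V => y) g (𝓝 x) := hg
  obtain ⟨n, hn⟩ := exists_nat_ge (‖x‖ + 1)
  have hev : ∀ᶠ y in (g : Filter V), ‖y‖ ≤ n := by
    filter_upwards [hgx.norm.eventually (gt_mem_nhds (lt_add_one ‖x‖))] with y hy
    exact hy.le.trans hn
  obtain ⟨C, hC⟩ := hbd n
  obtain ⟨U, ξ, hU, hξ⟩ := exists_dual_limit (l := (g : Filter V)) (Q := 𝒜)
    (hev.mono fun y hy => hC y hy)
  have hUg : U = g := Ultrafilter.coe_le_coe.1 hU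
  rw [hUg] at hξ
  have key : ∀ v, (ξ - 𝒜 x) v ≤ 0 := by
    intro v
    obtain ⟨k, hk⟩ := exists_nat_ge (‖x‖ + 1 + ‖v‖)
    obtain ⟨C', hC'⟩ := hmono k
    -- Monotonicity between `y → x` and `w = x - r v` leaves an error `C' ‖x - w‖ ^ 2`, of second
    -- order in `r`, whereas the pairing is of first order.
    have hr : ∀ r : ℝ, 0 < r → r ≤ 1 → (ξ - 𝒜 (x + r • (-v))) v ≤ C' * r * ‖v‖ ^ 2 := by
      intro r h0 h1
      set w := x + r • (-v) with hw
      have hwn : ‖w‖ ≤ k := by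
        refine (norm_add_le _ _).trans ?_
        rw [norm_smul, norm_neg, Real.norm_of_nonneg h0.le]
        nlinarith [norm_nonneg v]
      have hlim1 : Tendsto (fun y => 𝒜 y (y - x)) g (𝓝 0) := by
        have h2 : Tendsto (fun y => C * ‖y - x‖) g (𝓝 0) := by
          have := (hgx.sub_const x).norm.const_mul C
          simpa using this
        refine squeeze_zero_norm' ?_ h2
        filter_upwards [hev] with y hy
        refine (ContinuousLinearMap.le_opNorm _ _).trans ?_
        gcongr
        exact hC y hy
      have hlim2 : Tendsto (fun y => (𝒜 y - 𝒜 w) (y - w)) g (𝓝 ((ξ - 𝒜 w) (x - w))) := by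
        have h2 := (hlim1.add (hξ (x - w))).sub
          (((𝒜 w).continuous.tendsto _).comp (hgx.sub_const w))
        rw [zero_add, ← sub_apply] at h2
        refine h2.congr fun y => ?_
        simp only [Function.comp, ← map_add, sub_add_sub_cancel, sub_apply]
      have hlim3 : Tendsto (fun y => C' * ‖y - w‖ ^ 2) g (𝓝 (C' * ‖x - w‖ ^ 2)) :=
        (((hgx.sub_const w).norm).pow 2).const_mul C'
      have hle := le_of_tendsto_of_tendsto hlim2 hlim3 (by
        filter_upwards [hgx.norm.eventually (gt_mem_nhds (lt_add_one ‖x‖))] with y hy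
        exact hC' y w (by linarith [norm_nonneg v]) hwn)
      have e : x - w = r • v := by rw [hw]; simp
      rw [e, map_smul, smul_eq_mul, norm_smul, Real.norm_of_nonneg h0.le] at hle
      have : r * (ξ - 𝒜 w) v ≤ r * (C' * r * ‖v‖ ^ 2) := by
        refine hle.trans (le_of_eq (by ring))
      exact le_of_mul_le_mul_left this h0
    have l1 : Tendsto (fun r : ℝ => (ξ - 𝒜 (x + r • (-v))) v) (𝓝[>] 0) (𝓝 ((ξ - 𝒜 x) v)) := by
      have h1 := ((hemi x (-v) v).tendsto 0).const_sub (ξ v)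
      rw [zero_smul, add_zero] at h1
      exact h1.mono_left nhdsWithin_le_nhds
    have l2 : Tendsto (fun r : ℝ => C' * r * ‖v‖ ^ 2) (𝓝[>] 0) (𝓝 0) := by
      have : Continuous fun r : ℝ => C' * r * ‖v‖ ^ 2 := by fun_prop
      have h1 := this.tendsto 0
      rw [mul_zero, zero_mul] at h1
      exact h1.mono_left nhdsWithin_le_nhds
    refine le_of_tendsto_of_tendsto l1 l2 ?_
    filter_upwards [Ioc_mem_nhdsGT (zero_lt_one' ℝ)] with r hr'
    exact hr r hr'.1 hr'.2
  have h1 := key v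
  have h2 := key (-v)
  rw [map_neg] at h2
  have h3 : 𝒜 x v = ξ v := by
    simp only [sub_apply] at h1 h2
    linarith
  rw [h3]
  exact hξ v

end Demicontinuity

/-! ### The abstract equation and its Galerkin approximation -/

section Core

variable {H V : Type*} [NormedAddCommGroup H] [InnerProductSpace ℝ H]
  [NormedAddCommGroup V] [NormedSpace ℝ V] [MeasurableSpace V]

/-- Locally monotone, coercive operators on a Gelfand triplet, with growth measured in the sum of
`V*` and `H`. -/
structure CoreHyp (T β : ℝ) (ι : V →L[ℝ] H) (κ : ℝ → ℝ) (L : ℝ) (𝒢 : ℝ → V → StrongDual ℝ V) :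
    Prop where
  meas : Measurable (Function.uncurry 𝒢)
  integrable : Integrable κ (timeMeasure T)
  one_le : ∀ᵐ t ∂(timeMeasure T), 1 ≤ κ t
  hemi : ∀ᵐ t ∂(timeMeasure T), ∀ x y z, Continuous fun r : ℝ => 𝒢 t (x + r • y) z
  mono : ∀ R : ℝ, ∃ C : ℝ, 0 ≤ C ∧ ∀ᵐ t ∂(timeMeasure T), ∀ x y, ‖ι x‖ ≤ R → ‖ι y‖ ≤ R →
    2 * (𝒢 t x - 𝒢 t y) (x - y) ≤ C * (κ t + ‖x‖ ^ β + ‖y‖ ^ β) * ‖ι x - ι y‖ ^ 2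
  pos : 0 < L
  coer : ∀ᵐ t ∂(timeMeasure T), ∀ x, 𝒢 t x x ≤ κ t * (1 + ‖ι x‖ ^ 2) - L * ‖x‖ ^ β
  growth : ∀ R : ℝ, ∃ C : ℝ, 0 ≤ C ∧ ∀ᵐ t ∂(timeMeasure T), ∀ x, ‖ι x‖ ≤ R → ∀ v,
    ‖𝒢 t x v‖ ≤ (C * (κ t + ‖x‖ ^ β)) ^ ((β - 1) / β) * ‖v‖ + C * κ t * ‖ι v‖

variable {T β : ℝ} {ι : V →L[ℝ] H} {κ : ℝ → ℝ} {L : ℝ} {𝒢 : ℝ → V → StrongDual ℝ V}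

theorem rpow_le_one_add {a θ : ℝ} (ha : 0 ≤ a) (h0 : 0 ≤ θ) (h1 : θ ≤ 1) : a ^ θ ≤ 1 + a := by
  rcases le_total a 1 with h | h
  · exact (Real.rpow_le_one ha h h0).trans (by linarith)
  · calc a ^ θ ≤ a ^ (1 : ℝ) := Real.rpow_le_rpow_of_exponent_le h h1
      _ ≤ 1 + a := by rw [Real.rpow_one]; linarith

/-- A power with exponent below one is bounded by one plus its base, and `1 ≤ κ` absorbs the one. -/
theorem CoreHyp.exists_norm_le (h : CoreHyp T β ι κ L 𝒢) (hβ : 1 < β) (R : ℝ) :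
    ∃ C : ℝ, 0 ≤ C ∧ ∀ᵐ t ∂(timeMeasure T), ∀ x, ‖ι x‖ ≤ R →
      ‖𝒢 t x‖ ≤ C * (κ t + ‖x‖ ^ β) := by
  obtain ⟨C, hC, hg⟩ := h.growth R
  refine ⟨1 + C + C * ‖ι‖, by positivity, ?_⟩
  filter_upwards [hg, h.one_le] with t ht h1 x hx
  have hb : 0 ≤ ‖x‖ ^ β := by positivity
  refine ContinuousLinearMap.opNorm_le_bound _ (by positivity) fun v => (ht x hx v).trans ?_
  have h2 : (C * (κ t + ‖x‖ ^ β)) ^ ((β - 1) / β) ≤ 1 + C * (κ t + ‖x‖ ^ β) :=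
    rpow_le_one_add (by positivity) (div_nonneg (by linarith) (by linarith))
      ((div_le_one (by linarith)).2 (by linarith))
  have h3 := ι.le_opNorm v
  calc (C * (κ t + ‖x‖ ^ β)) ^ ((β - 1) / β) * ‖v‖ + C * κ t * ‖ι v‖
      ≤ (1 + C * (κ t + ‖x‖ ^ β)) * ‖v‖ + C * κ t * (‖ι‖ * ‖v‖) := by gcongr
    _ = (1 + C * (κ t + ‖x‖ ^ β) + C * ‖ι‖ * κ t) * ‖v‖ := by ring
    _ ≤ ((1 + C + C * ‖ι‖) * (κ t + ‖x‖ ^ β)) * ‖v‖ := by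
      gcongr
      have : 0 ≤ C * ‖ι‖ * ‖x‖ ^ β := by positivity
      nlinarith

theorem CoreHyp.ae_demicontinuous (h : CoreHyp T β ι κ L 𝒢) (hβ : 1 < β) :
    ∀ᵐ t ∂(timeMeasure T), ∀ v, Continuous fun x => 𝒢 t x v := by
  choose C hC hCb using fun n : ℕ => h.exists_norm_le hβ (‖ι‖ * n)
  choose C' hC' hCb' using fun n : ℕ => h.mono (‖ι‖ * n)
  filter_upwards [h.hemi, ae_all_iff.2 hCb, ae_all_iff.2 hCb', h.one_le] with t h1 h2 h3 h4 v
  have hι : ∀ (n : ℕ) (x : V), ‖x‖ ≤ n → ‖ι x‖ ≤ ‖ι‖ * n := fun n x hx =>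
    (ι.le_opNorm x).trans (by gcongr)
  refine continuous_apply_of_locally_monotone h1 (fun n => ⟨C n * (κ t + (n : ℝ) ^ β), ?_⟩)
    (fun n => ⟨C' n * (κ t + (n : ℝ) ^ β + (n : ℝ) ^ β) * ‖ι‖ ^ 2, ?_⟩) v
  · intro x hx
    refine (h2 n x (hι n x hx)).trans ?_
    have := hC n
    gcongr
  · intro x y hx hy
    have h5 := h3 n x y (hι n x hx) (hι n y hy)
    have h6 : ‖ι x - ι y‖ ≤ ‖ι‖ * ‖x - y‖ := by rw [← map_sub]; exact ι.le_opNorm _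
    have h7 := hC' n
    have h8 : C' n * (κ t + ‖x‖ ^ β + ‖y‖ ^ β) * ‖ι x - ι y‖ ^ 2
        ≤ C' n * (κ t + (n : ℝ) ^ β + (n : ℝ) ^ β) * (‖ι‖ * ‖x - y‖) ^ 2 := by gcongr
    have h9 : 0 ≤ C' n * (κ t + (n : ℝ) ^ β + (n : ℝ) ^ β) * (‖ι‖ * ‖x - y‖) ^ 2 := by positivity
    rw [mul_pow, ← mul_assoc] at h8 h9
    linarith

variable [CompleteSpace H] [BorelSpace V]

/-- Galerkin approximation in a finite-dimensional subspace. -/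
theorem CoreHyp.exists_galerkin (h : CoreHyp T β ι κ L 𝒢) (hT : 0 < T) (hβ : 1 < β)
    (hinj : Function.Injective ι) (W : Submodule ℝ V) [FiniteDimensional ℝ W] (x : H) :
    ∃ (Y : ℝ → H) (y : ℝ → V) (g : ℝ → H) (x₀ : H) (R : ℝ),
      (∀ t, y t ∈ W) ∧ (∀ t, ι (y t) = Y t) ∧ AEStronglyMeasurable y (timeMeasure T) ∧
      (∀ t ∈ Icc 0 T, ‖y t‖ ≤ R) ∧ Integrable g (timeMeasure T) ∧
      (∀ t ∈ Icc 0 T, Y t = x₀ + ∫ s in (0 : ℝ)..t, g s) ∧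
      (∀ s, ∀ v ∈ W, inner ℝ (g s) (ι v) = 𝒢 s (y s) v) ∧ ∀ v ∈ W, ‖x - x₀‖ ≤ ‖x - ι v‖ := by
  -- The subspace `W` is moved to `E = ι W` with the inner product of `H`. There `j` inverts `ι`,
  -- `G` is the Riesz representative of `𝒢` restricted to `W`, and the initial value is the
  -- orthogonal projection of `x`.
  set E : Submodule ℝ H := W.map ι.toLinearMap with hE
  have : FiniteDimensional ℝ E := inferInstance
  let e := Submodule.equivMapOfInjective ι.toLinearMap hinj W
  let j : E →L[ℝ] V := LinearMap.toContinuousLinearMap (W.subtype ∘ₗ e.symm.toLinearMap)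
  have hj : ∀ c : E, ι (j c) = c := by
    intro c
    have h1 : ((e (e.symm c) : E) : H) = ι (e.symm c : V) :=
      Submodule.coe_equivMapOfInjective_apply _ _ _ _
    rw [e.apply_symm_apply] at h1
    exact h1.symm
  have hjW : ∀ c : E, j c ∈ W := fun c => (e.symm c).2
  have hjs : ∀ v ∈ W, ∃ c : E, j c = v := by
    intro v hv
    refine ⟨e ⟨v, hv⟩, ?_⟩
    change ((e.symm (e ⟨v, hv⟩) : W) : V) = v
    rw [e.symm_apply_apply]
  have hjn : ∀ c : E, ‖ι (j c)‖ = ‖c‖ := fun c => by rw [hj]; rfl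
  let : MeasurableSpace E := borel E
  have : BorelSpace E := ⟨rfl⟩
  let Φ : ℝ → E → StrongDual ℝ E := fun t c => (𝒢 t (j c)).comp j
  let G : ℝ → E → E := fun t c => (InnerProductSpace.toDual ℝ E).symm (Φ t c)
  have hG : ∀ t c d, inner ℝ (G t c) d = 𝒢 t (j c) (j d) := by
    intro t c d
    simp only [G, InnerProductSpace.toDual_symm_apply]
    rfl
  have hGm : Measurable (Function.uncurry G) := by
    have h1 : Measurable fun z : ℝ × E => 𝒢 z.1 (j z.2) :=
      h.meas.comp (measurable_fst.prodMk (j.continuous.measurable.comp measurable_snd))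
    have h2 : Continuous fun f : StrongDual ℝ V => (InnerProductSpace.toDual ℝ E).symm (f.comp j) :=
      (InnerProductSpace.toDual ℝ E).symm.continuous.comp
        ((ContinuousLinearMap.compL ℝ E V ℝ).flip j).continuous
    exact h2.measurable.comp h1
  have hGn : ∀ t c, ‖G t c‖ ≤ ‖𝒢 t (j c)‖ * ‖j‖ := by
    intro t c
    simp only [G, LinearIsometryEquiv.norm_map]
    exact ContinuousLinearMap.opNorm_comp_le _ _
  have hGb : ∀ R : ℝ, ∃ m : ℝ → ℝ, Integrable m (timeMeasure T) ∧
      ∀ᵐ t ∂(timeMeasure T), ∀ c, ‖c‖ ≤ R → ‖G t c‖ ≤ m t := by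
    intro R
    obtain ⟨C, hC, hCb⟩ := h.exists_norm_le hβ R
    refine ⟨fun t => C * (κ t + (‖j‖ * R) ^ β) * ‖j‖,
      ((h.integrable.add (integrable_const _)).const_mul _).mul_const _, ?_⟩
    filter_upwards [hCb] with t ht c hc
    refine (hGn t c).trans ?_
    gcongr
    refine (ht (j c) (by rw [hjn]; exact hc)).trans ?_
    have : ‖j c‖ ≤ ‖j‖ * R := (j.le_opNorm c).trans (by gcongr)
    gcongr
  have hGc : ∀ᵐ t ∂(timeMeasure T), Continuous (G t) := by
    filter_upwards [h.ae_demicontinuous hβ] with t ht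
    refine (InnerProductSpace.toDual ℝ E).symm.continuous.comp ?_
    rw [continuous_clm_apply]
    intro d
    exact (ht (j d)).comp j.continuous
  have hGco : ∀ᵐ t ∂(timeMeasure T), ∀ c, inner ℝ (G t c) c ≤ κ t * (1 + ‖c‖ ^ 2) := by
    filter_upwards [h.coer] with t ht c
    rw [hG, ← hjn]
    refine (ht (j c)).trans ?_
    have : 0 ≤ L * ‖j c‖ ^ β := mul_nonneg h.pos.le (by positivity)
    linarith
  obtain ⟨X, hXc, hXi, hX⟩ := exists_solution_of_coercive hT hGm hGb hGc h.integrable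
    (by filter_upwards [h.one_le] with t ht; linarith) hGco (E.orthogonalProjectionOnto x)
  have hjX : ContinuousOn (fun t => j (X t)) (Icc 0 T) := j.continuous.comp_continuousOn hXc
  obtain ⟨R, hR⟩ := isCompact_Icc.exists_bound_of_continuousOn hjX
  have hXm : AEStronglyMeasurable X (timeMeasure T) :=
    hXc.aestronglyMeasurable_of_isCompact isCompact_Icc measurableSet_Icc
  refine ⟨fun t => X t, fun t => j (X t), fun s => G s (X s), E.orthogonalProjectionOnto x, R,
    fun t => hjW _, fun t => hj _, j.continuous.comp_aestronglyMeasurable hXm, hR,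
    E.subtypeL.integrable_comp hXi, fun t ht => ?_, fun s v hv => ?_, fun v hv => ?_⟩
  · have h0 : (0 : ℝ) ∈ Icc 0 T := ⟨le_rfl, hT.le⟩
    beta_reduce
    rw [hX t ht, Submodule.coe_add]
    congr 1
    exact (E.subtypeL.intervalIntegral_comp_comm (intervalIntegrable_of_timeMeasure hXi h0 ht)).symm
  · obtain ⟨c, rfl⟩ := hjs v hv
    rw [hj, ← hG]
    rfl
  · have hmem : ι v ∈ E := ⟨v, hv, rfl⟩
    change ‖x - E.starProjection x‖ ≤ _
    rw [E.starProjection_minimal x]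
    exact ciInf_le ⟨0, by rintro _ ⟨w, rfl⟩; exact norm_nonneg _⟩ (⟨ι v, hmem⟩ : E)

end Core

theorem holderTriple_ofReal {β : ℝ} (hβ : 1 < β) :
    ENNReal.HolderTriple (ENNReal.ofReal (β / (β - 1))) (ENNReal.ofReal β) 1 := by
  have h : (β / (β - 1)).HolderConjugate β :=
    (Real.HolderConjugate.conjExponent hβ).symm
  exact h.ennrealOfReal

/-- To be used with `f = ‖Y‖ ^ 2` and `u = ‖y‖ ^ β`. Grönwall's inequality for `1 + f` with
coefficient `2 κ` gives the first bound; inserted into the energy inequality at time `T`, it gives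
the second. -/
theorem energy_bound {T : ℝ} {κ f u ψ : ℝ → ℝ} {b L : ℝ} (hT : 0 ≤ T) (hb : 0 ≤ b) (hL : 0 ≤ L)
    (hκ : Integrable κ (timeMeasure T)) (hκ0 : ∀ᵐ t ∂(timeMeasure T), 0 ≤ κ t)
    (hf : ContinuousOn f (Icc 0 T)) (hf0 : ∀ t ∈ Icc 0 T, 0 ≤ f t)
    (hu : Integrable u (timeMeasure T))
    (hu0 : ∀ᵐ t ∂(timeMeasure T), 0 ≤ u t) (hψ : Integrable ψ (timeMeasure T))
    (heq : ∀ t ∈ Icc 0 T, f t = b + 2 * ∫ s in (0 : ℝ)..t, ψ s)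
    (hle : ∀ᵐ t ∂(timeMeasure T), ψ t ≤ κ t * (1 + f t) - L * u t) {K : ℝ}
    (hK : K = 2 * ∫ s, κ s ∂(timeMeasure T)) :
    (∀ t ∈ Icc 0 T, f t ≤ (1 + b) * Real.exp K) ∧
      2 * L * ∫ s, u s ∂(timeMeasure T) ≤ (1 + b) * (1 + K * Real.exp K) := by
  have h0 : (0 : ℝ) ∈ Icc 0 T := ⟨le_rfl, hT⟩
  have hTm : T ∈ Icc 0 T := ⟨hT, le_rfl⟩
  have hfc : ContinuousOn (fun t => 1 + f t) (Icc 0 T) := continuousOn_const.add hf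
  have hκ2 : Integrable (fun s => 2 * κ s) (timeMeasure T) := hκ.const_mul 2
  have hκ20 : ∀ᵐ s ∂(timeMeasure T), 0 ≤ 2 * κ s := by filter_upwards [hκ0] with s hs; positivity
  have hi2 : Integrable (fun s => 2 * κ s * (1 + f s)) (timeMeasure T) := by
    have : IntegrableOn (fun s => 2 * κ s) (Icc 0 T) volume := hκ2
    exact this.mul_continuousOn hfc isCompact_Icc
  have hi1 : Integrable (fun s => 2 * ψ s + 2 * L * u s) (timeMeasure T) :=
    (hψ.const_mul 2).add (hu.const_mul _)
  have hmain : ∀ t ∈ Icc 0 T, f t + 2 * L * ∫ s in (0 : ℝ)..t, u s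
      ≤ b + ∫ s in (0 : ℝ)..t, 2 * κ s * (1 + f s) := by
    intro t ht
    have h1 : ∫ s in (0 : ℝ)..t, (2 * ψ s + 2 * L * u s)
        ≤ ∫ s in (0 : ℝ)..t, 2 * κ s * (1 + f s) := by
      refine intervalIntegral.integral_mono_ae_restrict ht.1
        (intervalIntegrable_of_timeMeasure hi1 h0 ht)
            (intervalIntegrable_of_timeMeasure hi2 h0 ht) ?_
      refine ae_restrict_of_ae_restrict_of_subset (Icc_subset_Icc_right ht.2) ?_
      filter_upwards [hle] with s hs
      linarith
    rw [intervalIntegral.integral_add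
      (intervalIntegrable_of_timeMeasure (hψ.const_mul 2) h0 ht)
      (intervalIntegrable_of_timeMeasure (hu.const_mul _) h0 ht),
      intervalIntegral.integral_const_mul, intervalIntegral.integral_const_mul] at h1
    rw [heq t ht]
    linarith
  have hunn : ∀ t ∈ Icc 0 T, 0 ≤ ∫ s in (0 : ℝ)..t, u s := by
    intro t ht
    refine intervalIntegral.integral_nonneg_of_ae_restrict ht.1 ?_
    exact ae_restrict_of_ae_restrict_of_subset (Icc_subset_Icc_right ht.2) hu0
  have hκle : ∀ t ∈ Icc 0 T, ∫ s in (0 : ℝ)..t, 2 * κ s ≤ K := by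
    intro t ht
    rw [intervalIntegral.integral_of_le ht.1, hK, ← integral_const_mul, timeMeasure]
    refine setIntegral_mono_set hκ2 hκ20 ?_
    exact (Ioc_subset_Icc_self.trans (Icc_subset_Icc_right ht.2)).eventuallyLE
  have hg : ∀ t ∈ Icc 0 T, 1 + f t ≤ (1 + b) * Real.exp K := by
    intro t ht
    have h1 : 1 + f t ≤ (1 + b) * Real.exp (∫ s in (0 : ℝ)..t, 2 * κ s) := by
      refine le_mul_exp_of_le_add_integral hfc hκ2 hκ20 (by positivity) (fun t ht => ?_) ht
      have := hmain t ht
      have := mul_nonneg (mul_nonneg zero_le_two hL) (hunn t ht)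
      linarith
    refine h1.trans ?_
    gcongr
    exact hκle t ht
  refine ⟨fun t ht => by linarith [hg t ht], ?_⟩
  have h1 := hmain T hTm
  have h2 : ∫ s in (0 : ℝ)..T, u s = ∫ s, u s ∂(timeMeasure T) := by
    rw [intervalIntegral.integral_of_le hT, ← integral_Icc_eq_integral_Ioc]; rfl
  have h3 : ∫ s in (0 : ℝ)..T, 2 * κ s * (1 + f s) ≤ K * ((1 + b) * Real.exp K) := by
    have h4 : ∫ s in (0 : ℝ)..T, 2 * κ s * (1 + f s)
        ≤ ∫ s in (0 : ℝ)..T, 2 * κ s * ((1 + b) * Real.exp K) := by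
      refine intervalIntegral.integral_mono_ae_restrict hT
        (intervalIntegrable_of_timeMeasure hi2 h0 hTm)
        (intervalIntegrable_of_timeMeasure (hκ2.mul_const _) h0 hTm) ?_
      filter_upwards [hκ20, ae_restrict_mem measurableSet_Icc] with s hs hs'
      exact mul_le_mul_of_nonneg_left (hg s hs') hs
    rw [intervalIntegral.integral_mul_const] at h4
    refine h4.trans ?_
    gcongr
    exact hκle T hTm
  rw [h2] at h1
  have := hf0 T hTm
  nlinarith

/-! ### A priori bounds for the Galerkin approximations -/

section Core

variable {H V : Type*} [NormedAddCommGroup H] [InnerProductSpace ℝ H]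
  [NormedAddCommGroup V] [NormedSpace ℝ V] [MeasurableSpace V]
  {T β : ℝ} {ι : V →L[ℝ] H} {κ : ℝ → ℝ} {L : ℝ} {𝒢 : ℝ → V → StrongDual ℝ V}

theorem integrable_norm_rpow {β : ℝ} (hβ : 0 < β) {y : ℝ → V}
    (hy : MemLp y (ENNReal.ofReal β) (timeMeasure T)) :
    Integrable (fun s => ‖y s‖ ^ β) (timeMeasure T) := by
  have := hy.integrable_norm_rpow (by simpa using hβ) ENNReal.ofReal_ne_top
  rwa [ENNReal.toReal_ofReal hβ.le] at this

theorem CoreHyp.aestronglyMeasurable_apply [BorelSpace V]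
    [SecondCountableTopology (StrongDual ℝ V)] (h : CoreHyp T β ι κ L 𝒢) {y : ℝ → V}
    (hy : AEStronglyMeasurable y (timeMeasure T)) :
    AEStronglyMeasurable (fun s => 𝒢 s (y s)) (timeMeasure T) :=
  (h.meas.comp_aemeasurable (aemeasurable_id.prodMk hy.aemeasurable)).aestronglyMeasurable

/-- The exponent `(β - 1) / β` in the growth condition is the inverse of `q = β / (β - 1)`: the
`q`-th power of `M` is `C (κ + ‖y‖ ^ β)`, which is integrable. The constant depends on `y` only
through its bound in `H`. -/
theorem CoreHyp.exists_mixedBound (h : CoreHyp T β ι κ L 𝒢) (hβ : 1 < β) (R : ℝ) :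
    ∃ C : ℝ, 0 ≤ C ∧ ∀ y : ℝ → V, MemLp y (ENNReal.ofReal β) (timeMeasure T) →
      (∀ᵐ s ∂(timeMeasure T), ‖ι (y s)‖ ≤ R) → ∃ M : ℝ → ℝ,
        MixedBound (timeMeasure T) ι (fun s => 𝒢 s (y s)) M (fun s => C * κ s) ∧
        MemLp M (ENNReal.ofReal (β / (β - 1))) (timeMeasure T) ∧
        eLpNorm M (ENNReal.ofReal (β / (β - 1))) (timeMeasure T)
          ≤ ENNReal.ofReal (C * (∫ s, κ s ∂(timeMeasure T) + ∫ s, ‖y s‖ ^ β ∂(timeMeasure T)))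
            ^ ((β - 1) / β) := by
  obtain ⟨C, hC, hg⟩ := h.growth R
  refine ⟨C, hC, fun y hy hR => ?_⟩
  have hβ0 : 0 < β := by linarith
  have hβ1 : 0 < β - 1 := by linarith
  have hyi := integrable_norm_rpow hβ0 hy
  have hq0 : ENNReal.ofReal (β / (β - 1)) ≠ 0 := by
    simp only [ne_eq, ENNReal.ofReal_eq_zero, not_le]; positivity
  have hqr : (ENNReal.ofReal (β / (β - 1))).toReal = β / (β - 1) :=
    ENNReal.toReal_ofReal (by positivity)
  set M : ℝ → ℝ := fun s => (C * (κ s + ‖y s‖ ^ β)) ^ ((β - 1) / β) with hM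
  have hint : Integrable (fun s => C * (κ s + ‖y s‖ ^ β)) (timeMeasure T) :=
    (h.integrable.add hyi).const_mul C
  have hnn : ∀ᵐ s ∂(timeMeasure T), 0 ≤ C * (κ s + ‖y s‖ ^ β) := by
    filter_upwards [h.one_le] with s hs
    positivity
  have hMm : AEStronglyMeasurable M (timeMeasure T) :=
    (hint.1.aemeasurable.pow_const _).aestronglyMeasurable
  have hnorm : eLpNorm M (ENNReal.ofReal (β / (β - 1))) (timeMeasure T)
      = ENNReal.ofReal (C * (∫ s, κ s ∂(timeMeasure T) + ∫ s, ‖y s‖ ^ β ∂(timeMeasure T)))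
            ^ ((β - 1) / β) := by
    rw [eLpNorm_eq_lintegral_rpow_enorm_toReal hq0 ENNReal.ofReal_ne_top, hqr, one_div_div]
    congr 1
    rw [← integral_add h.integrable hyi, ← integral_const_mul,
      ofReal_integral_eq_lintegral_ofReal hint hnn]
    refine lintegral_congr_ae ?_
    filter_upwards [hnn] with s hs
    have h1 : 0 ≤ M s := Real.rpow_nonneg hs _
    rw [Real.enorm_of_nonneg h1, ENNReal.ofReal_rpow_of_nonneg h1 (by positivity), hM]
    simp only
    rw [← Real.rpow_mul hs]
    congr 1
    have : (β - 1) / β * (β / (β - 1)) = 1 := by field_simp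
    rw [this, Real.rpow_one]
  refine ⟨M, ?_, ⟨hMm, ?_⟩, hnorm.le⟩
  · filter_upwards [hg, hR, hnn, h.one_le] with s h1 h2 h3 h4 v
    rw [Real.norm_of_nonneg (Real.rpow_nonneg h3 _ : 0 ≤ M s),
      Real.norm_of_nonneg (by positivity : 0 ≤ C * κ s)]
    exact h1 (y s) h2 v
  · rw [hnorm]
    exact ENNReal.rpow_lt_top_of_nonneg (by positivity) ENNReal.ofReal_ne_top

variable [CompleteSpace H]

/-- A sequence of Galerkin approximations, in an increasing sequence of subspaces `W n`. -/
structure GalerkinSeq (T β : ℝ) (ι : V →L[ℝ] H) (𝒢 : ℝ → V → StrongDual ℝ V) (D : ℕ → V) (x : H)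
    (W : ℕ → Submodule ℝ V) (Y : ℕ → ℝ → H) (y : ℕ → ℝ → V) (g : ℕ → ℝ → H) : Prop where
  mono : Monotone W
  eventually_mem : ∀ j, ∀ᶠ n in atTop, D j ∈ W n
  mem : ∀ n t, y n t ∈ W n
  version : ∀ n t, ι (y n t) = Y n t
  memLp : ∀ n, MemLp (y n) (ENNReal.ofReal β) (timeMeasure T)
  integrable : ∀ n, Integrable (g n) (timeMeasure T)
  eq : ∀ n, ∀ t ∈ Icc 0 T, Y n t = Y n 0 + ∫ s in (0 : ℝ)..t, g n s
  pair : ∀ n s, ∀ v ∈ W n, inner ℝ (g n s) (ι v) = 𝒢 s (y n s) v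
  init : Tendsto (fun n => Y n 0) atTop (𝓝 x)

variable {D : ℕ → V} {x : H} {W : ℕ → Submodule ℝ V} {Y : ℕ → ℝ → H} {y : ℕ → ℝ → V} {g : ℕ → ℝ → H}

theorem GalerkinSeq.subseq (h : GalerkinSeq T β ι 𝒢 D x W Y y g) {φ : ℕ → ℕ} (hφ : StrictMono φ) :
    GalerkinSeq T β ι 𝒢 D x (fun n => W (φ n)) (fun n => Y (φ n)) (fun n => y (φ n))
      fun n => g (φ n) where
  mono := h.mono.comp hφ.monotone
  eventually_mem j := hφ.tendsto_atTop.eventually (h.eventually_mem j)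
  mem n := h.mem _
  version n := h.version _
  memLp n := h.memLp _
  integrable n := h.integrable _
  eq n := h.eq _
  pair n := h.pair _
  init := h.init.comp hφ.tendsto_atTop

/-- The subspaces are spanned by initial segments of `D`. As `ι ∘ D` has dense range, the projected
initial data converge to `x`. -/
theorem CoreHyp.exists_galerkinSeq [BorelSpace V] (h : CoreHyp T β ι κ L 𝒢) (hT : 0 < T)
    (hβ : 1 < β) (hinj : Function.Injective ι) (hι : DenseRange ι) (hD : DenseRange D) (x : H) :
    ∃ W Y y g, GalerkinSeq T β ι 𝒢 D x W Y y g := by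
  set W : ℕ → Submodule ℝ V := fun n => Submodule.span ℝ (D '' Iio n) with hW
  have hfd : ∀ n, FiniteDimensional ℝ (W n) := fun n =>
    FiniteDimensional.span_of_finite ℝ ((finite_Iio n).image D)
  choose Y y g x₀ R h1 h2 h3 h4 h5 h6 h7 h8 using fun n =>
    h.exists_galerkin hT hβ hinj (W n) x
  have h0 : (0 : ℝ) ∈ Icc 0 T := ⟨le_rfl, hT.le⟩
  have hY0 : ∀ n, Y n 0 = x₀ n := fun n => by rw [h6 n 0 h0]; simp
  have hmem : ∀ j n, j < n → D j ∈ W n := fun j n hjn => Submodule.subset_span ⟨j, hjn, rfl⟩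
  refine ⟨W, Y, y, g, fun m n hmn => Submodule.span_mono (image_mono (Iio_subset_Iio hmn)),
    fun j => (eventually_gt_atTop j).mono fun n hn => hmem j n hn, h1, h2, fun n => ?_, h5,
    fun n t ht => by rw [hY0]; exact h6 n t ht, h7, ?_⟩
  · exact MemLp.of_bound (h3 n) (R n)
      ((ae_restrict_iff' measurableSet_Icc).2 (Eventually.of_forall (h4 n)))
  · rw [Metric.tendsto_atTop]
    intro ε hε
    obtain ⟨j, hj⟩ := (hι.comp hD ι.continuous).exists_dist_lt x hε
    refine ⟨j + 1, fun n hn => ?_⟩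
    rw [hY0, dist_comm, dist_eq_norm]
    rw [dist_eq_norm] at hj
    exact (h8 n (D j) (hmem j n hn)).trans_lt hj

theorem GalerkinSeq.evol {q : ℝ≥0∞} (h : GalerkinSeq T β ι 𝒢 D x W Y y g) (hT : 0 ≤ T) (n : ℕ) :
    Evol T (ENNReal.ofReal β) q ι (Y n) (y n) fun s => toDual ι (g n s) :=
  Evol.of_eq_add_integral hT (h.integrable n) (h.eq n) (h.memLp n)
    (Eventually.of_forall (h.version n))

/-- Since `y n s` lies in `W n`, the Galerkin equation may be tested with it, and the pairing is
exactly the one that coercivity bounds. -/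
theorem GalerkinSeq.exists_bound (h : GalerkinSeq T β ι 𝒢 D x W Y y g) (hc : CoreHyp T β ι κ L 𝒢)
    (hT : 0 < T) (hβ : 1 < β) :
    ∃ R K : ℝ, 0 ≤ R ∧ 0 ≤ K ∧ (∀ n, ∀ t ∈ Icc 0 T, ‖Y n t‖ ≤ R) ∧
      ∀ n, ∫ s, ‖y n s‖ ^ β ∂(timeMeasure T) ≤ K := by
  obtain ⟨B, hB⟩ := h.init.norm.bddAbove_range
  have hB' : ∀ n, ‖Y n 0‖ ≤ B := fun n => hB ⟨n, rfl⟩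
  have hB0 : 0 ≤ B := (norm_nonneg _).trans (hB' 0)
  set K₀ : ℝ := 2 * ∫ s, κ s ∂(timeMeasure T) with hK₀
  have hκ0 : ∀ᵐ t ∂(timeMeasure T), 0 ≤ κ t := by filter_upwards [hc.one_le] with t ht; linarith
  have hK0 : 0 ≤ K₀ := mul_nonneg zero_le_two (integral_nonneg_of_ae hκ0)
  have key : ∀ n, (∀ t ∈ Icc 0 T, ‖Y n t‖ ^ 2 ≤ (1 + ‖Y n 0‖ ^ 2) * Real.exp K₀) ∧
      2 * L * ∫ s, ‖y n s‖ ^ β ∂(timeMeasure T)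
        ≤ (1 + ‖Y n 0‖ ^ 2) * (1 + K₀ * Real.exp K₀) := by
    intro n
    have hYc := continuousOn_of_eq_add_integral (h.integrable n) (h.eq n)
    obtain ⟨b, hb⟩ := isCompact_Icc.exists_bound_of_continuousOn hYc
    have hYm : AEStronglyMeasurable (Y n) (timeMeasure T) :=
      hYc.aestronglyMeasurable_of_isCompact isCompact_Icc measurableSet_Icc
    have hψ : Integrable (fun s => inner ℝ (g n s) (Y n s)) (timeMeasure T) := by
      refine ((h.integrable n).norm.mul_const b).mono' ((h.integrable n).1.inner hYm) ?_
      refine (ae_restrict_iff' measurableSet_Icc).2 (Eventually.of_forall fun s hs => ?_)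
      exact (norm_inner_le_norm _ _).trans (mul_le_mul_of_nonneg_left (hb s hs) (norm_nonneg _))
    refine energy_bound (f := fun t => ‖Y n t‖ ^ 2) (u := fun s => ‖y n s‖ ^ β) hT.le
        (by positivity) hc.pos.le hc.integrable
      hκ0 (hYc.norm.pow 2)
      (fun _ _ => by positivity) (integrable_norm_rpow (by linarith) (h.memLp n))
      (Eventually.of_forall fun _ => by positivity) hψ
      (fun t ht => norm_sq_eq_add_integral hT (h.integrable n) (h.eq n) ht) ?_ hK₀
    filter_upwards [hc.coer] with s hs
    have := hs (y n s)
    rw [← h.pair n s _ (h.mem n s), h.version] at this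
    exact this
  refine ⟨√((1 + B ^ 2) * Real.exp K₀), (1 + B ^ 2) * (1 + K₀ * Real.exp K₀) / (2 * L),
    Real.sqrt_nonneg _, ?_, fun n t ht => ?_, fun n => ?_⟩
  · have := hc.pos; positivity
  · refine Real.le_sqrt_of_sq_le (((key n).1 t ht).trans ?_)
    gcongr
    exact hB' n
  · have := hc.pos
    rw [le_div_iff₀ (by positivity), mul_comm]
    refine (key n).2.trans ?_
    gcongr
    exact hB' n

end Core

/-! ### Weak limits of the Galerkin approximations -/

section Core

variable {H V : Type*} [NormedAddCommGroup H] [InnerProductSpace ℝ H]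
  [NormedAddCommGroup V] [NormedSpace ℝ V]
  {T β : ℝ} {ι : V →L[ℝ] H} {κ : ℝ → ℝ} {L : ℝ} {𝒢 : ℝ → V → StrongDual ℝ V}

theorem eq_of_forall_inner_eq {D : ℕ → V} (hD : DenseRange fun j => ι (D j)) {x y : H}
    (h : ∀ j, inner ℝ x (ι (D j)) = inner ℝ y (ι (D j))) : x = y := by
  have h1 : Continuous fun w => inner ℝ x w := by fun_prop
  have h2 : Continuous fun w => inner ℝ y w := by fun_prop
  exact ext_inner_right ℝ fun w => congrFun (DenseRange.equalizer hD h1 h2 (funext h)) w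

theorem norm_le_of_tendsto_inner {Y : ℕ → H} {x : H} {R : ℝ} (hR : ∀ᶠ n in atTop, ‖Y n‖ ≤ R)
    (h : Tendsto (fun n => inner ℝ (Y n) x) atTop (𝓝 (inner ℝ x x))) : ‖x‖ ≤ R := by
  have hR0 : 0 ≤ R := by
    obtain ⟨n, hn⟩ := hR.exists
    exact (norm_nonneg _).trans hn
  have h1 : inner ℝ x x ≤ R * ‖x‖ := le_of_tendsto h (hR.mono fun n hn =>
    (real_inner_le_norm _ _).trans (by gcongr))
  rw [real_inner_self_eq_norm_mul_norm] at h1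
  rcases (norm_nonneg x).eq_or_lt with h0 | h0
  · rw [← h0]; exact hR0
  · exact le_of_mul_le_mul_right h1 h0

theorem exists_eq_of_tendsto_inner [CompleteSpace H] {D : ℕ → V} {Y : ℕ → H} {R : ℝ}
    (hR : ∀ n, ‖Y n‖ ≤ R) {c : ℕ → ℝ}
    (h : ∀ j, Tendsto (fun n => inner ℝ (Y n) (ι (D j))) atTop (𝓝 (c j))) :
    ∃ x : H, ∀ j, inner ℝ x (ι (D j)) = c j := by
  obtain ⟨U, ξ, hU, hξ⟩ := exists_dual_limit (l := atTop) (Q := fun n => innerSL ℝ (Y n)) (C := R)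
    (Eventually.of_forall fun n => by simpa using hR n)
  refine ⟨(InnerProductSpace.toDual ℝ H).symm ξ, fun j => ?_⟩
  rw [InnerProductSpace.toDual_symm_apply]
  exact tendsto_nhds_unique (hξ _) ((h j).mono_left hU)

theorem measurable_of_inner_denseRange [CompleteSpace H] [MeasurableSpace H] [BorelSpace H]
    [SecondCountableTopology H] {D : ℕ → H} (hD : DenseRange D) {Y : ℝ → H}
    (h : ∀ j, Measurable fun t => inner ℝ (Y t) (D j)) : Measurable Y := by
  have : SecondCountableTopology (StrongDual ℝ H) :=
    (InnerProductSpace.toDual ℝ H).toHomeomorph.symm.isEmbedding.secondCountableTopology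
  have h1 : Measurable fun t => InnerProductSpace.toDual ℝ H (Y t) :=
    measurable_dual_of_denseRange hD fun j => by simpa using h j
  have h2 := (InnerProductSpace.toDual ℝ H).symm.continuous.measurable.comp h1
  simpa [Function.comp_def] using h2

theorem abs_intervalIntegral_apply_le {p q : ℝ≥0∞} [ENNReal.HolderTriple q p 1]
    {G : ℝ → StrongDual ℝ V} {M k : ℝ → ℝ}
    (hb : MixedBound (timeMeasure T) ι G M k) (hM : AEStronglyMeasurable M (timeMeasure T))
    (hk : Integrable k (timeMeasure T)) {C : ℝ≥0∞} (hC : eLpNorm M q (timeMeasure T) ≤ C)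
    (hCt : C ≠ ∞) (hp0 : p ≠ 0) (hp : p ≠ ∞) (v : V) {s t : ℝ} (hs : s ∈ Icc 0 T)
    (ht : t ∈ Icc 0 T) :
    |∫ r in s..t, G r v| ≤ (C * (‖v‖ₑ * timeMeasure T (uIoc s t) ^ (1 / p.toReal))
        + (∫⁻ r in uIoc s t, ‖k r‖ₑ ∂(timeMeasure T)) * ‖ι v‖ₑ).toReal := by
  have hfin : C * (‖v‖ₑ * timeMeasure T (uIoc s t) ^ (1 / p.toReal))
        + (∫⁻ r in uIoc s t, ‖k r‖ₑ ∂(timeMeasure T)) * ‖ι v‖ₑ ≠ ∞ := by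
    refine ENNReal.add_ne_top.2 ⟨ENNReal.mul_ne_top hCt (ENNReal.mul_ne_top (by simp) ?_),
      ENNReal.mul_ne_top ?_ (by simp)⟩
    · exact ENNReal.rpow_ne_top_of_nonneg (by positivity) (measure_ne_top _ _)
    · exact ((setLIntegral_le_lintegral _ _).trans_lt hk.2).ne
  rw [← ENNReal.ofReal_le_iff_le_toReal hfin, ← Real.norm_eq_abs, ofReal_norm]
  exact (enorm_intervalIntegral_le hs ht).trans
    (setLIntegral_apply_const_le (q := q) hb hM hk hC hp0 hp v _)

theorem tendsto_modulus {p : ℝ≥0∞} {k : ℝ → ℝ} (hk : Integrable k (timeMeasure T)) {C : ℝ≥0∞}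
    (hCt : C ≠ ∞) (hp0 : p ≠ 0) (hp : p ≠ ∞) (v : V) (s : ℝ) :
    Tendsto (fun t => (C * (‖v‖ₑ * timeMeasure T (uIoc s t) ^ (1 / p.toReal))
        + (∫⁻ r in uIoc s t, ‖k r‖ₑ ∂(timeMeasure T)) * ‖ι v‖ₑ).toReal) (𝓝 s) (𝓝 0) := by
  have hp' : 0 < p.toReal := ENNReal.toReal_pos hp0 hp
  have hvol : Tendsto (fun t => timeMeasure T (uIoc s t)) (𝓝 s) (𝓝 0) := by
    have h1 : Tendsto (fun t => ENNReal.ofReal |t - s|) (𝓝 s) (𝓝 0) := by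
      have : Continuous fun t => ENNReal.ofReal |t - s| :=
        ENNReal.continuous_ofReal.comp (by fun_prop)
      simpa using this.tendsto s
    refine tendsto_of_tendsto_of_tendsto_of_le_of_le tendsto_const_nhds h1 (fun _ => zero_le)
      fun t => ?_
    exact (Measure.restrict_apply_le _ _).trans (le_of_eq (by rw [Real.volume_uIoc]))
  have l1 := hvol.ennrpow_const (1 / p.toReal)
  rw [ENNReal.zero_rpow_of_pos (by positivity)] at l1
  have l2 := ENNReal.Tendsto.const_mul (a := C)
    (ENNReal.Tendsto.const_mul (a := ‖v‖ₑ) l1 (Or.inr (by simp))) (Or.inr hCt)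
  have l3 := ENNReal.Tendsto.mul_const (b := ‖ι v‖ₑ)
    (tendsto_setLIntegral_zero (μ := timeMeasure T) (f := fun s => ‖k s‖ₑ) hk.2.ne hvol)
    (Or.inr (by simp))
  have l4 := l2.add l3
  simp only [mul_zero, zero_mul, add_zero] at l4
  exact (ENNReal.tendsto_toReal (by simp)).comp l4

variable [MeasurableSpace V] [CompleteSpace H] {D : ℕ → V} {x : H} {W : ℕ → Submodule ℝ V}
  {Y : ℕ → ℝ → H} {y : ℕ → ℝ → V} {g : ℕ → ℝ → H}

theorem GalerkinSeq.inner_sub_eq (h : GalerkinSeq T β ι 𝒢 D x W Y y g) {n : ℕ} {v : V}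
    (hv : v ∈ W n) {s t : ℝ} (hs : s ∈ Icc 0 T) (ht : t ∈ Icc 0 T) :
    inner ℝ (Y n t - Y n s) (ι v) = ∫ r in s..t, 𝒢 r (y n r) v := by
  have h0 : (0 : ℝ) ∈ Icc 0 T := ⟨le_rfl, hs.1.trans hs.2⟩
  have hi := h.integrable n
  rw [h.eq n t ht, h.eq n s hs, add_sub_add_left_eq_sub, intervalIntegral.integral_interval_sub_left
    (intervalIntegrable_of_timeMeasure hi h0 ht) (intervalIntegrable_of_timeMeasure hi h0 hs)]
  have := ((innerSL ℝ (E := H)).flip (ι v)).intervalIntegral_comp_comm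
    (intervalIntegrable_of_timeMeasure hi hs ht)
  refine this.symm.trans (intervalIntegral.integral_congr fun r _ => ?_)
  exact h.pair n r v hv

/-- Extraction of a subsequence along which the Galerkin approximations converge weakly in `H`,
uniformly in time against each element of a dense sequence. -/
theorem GalerkinSeq.exists_subseq_weak [BorelSpace V] [SecondCountableTopology (StrongDual ℝ V)]
    (h : GalerkinSeq T β ι 𝒢 D x W Y y g) (hc : CoreHyp T β ι κ L 𝒢) (hT : 0 < T) (hβ : 1 < β)
    (hι : DenseRange ι) (hD : DenseRange D) {R K : ℝ} (hR : ∀ n, ∀ t ∈ Icc 0 T, ‖Y n t‖ ≤ R)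
    (hK : ∀ n, ∫ s, ‖y n s‖ ^ β ∂(timeMeasure T) ≤ K) :
    ∃ φ : ℕ → ℕ, StrictMono φ ∧ ∃ Yl : ℝ → H, (∀ t ∉ Icc 0 T, Yl t = 0) ∧ Yl 0 = x ∧
      ∀ j, TendstoUniformlyOn (fun n t => inner ℝ (Y (φ n) t) (ι (D j)))
        (fun t => inner ℝ (Yl t) (ι (D j))) atTop (Icc 0 T) := by
  have := holderTriple_ofReal hβ
  have hp0 : ENNReal.ofReal β ≠ 0 := by simp only [ne_eq, ENNReal.ofReal_eq_zero]; linarith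
  have h0 : (0 : ℝ) ∈ Icc 0 T := ⟨le_rfl, hT.le⟩
  have hιD : DenseRange fun j => ι (D j) := hι.comp hD ι.continuous
  obtain ⟨C, hC, hmix⟩ := hc.exists_mixedBound hβ R
  choose M hM1 hM2 hM3 using fun n => hmix (y n) (h.memLp n)
    ((ae_restrict_iff' measurableSet_Icc).2 (Eventually.of_forall fun t ht => by
      rw [h.version]; exact hR n t ht))
  set B : ℝ≥0∞ := ENNReal.ofReal (C * (∫ s, κ s ∂(timeMeasure T) + K)) ^ ((β - 1) / β) with hB
  have hBt : B ≠ ∞ := ENNReal.rpow_ne_top_of_nonneg (div_nonneg (by linarith) (by linarith))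
    ENNReal.ofReal_ne_top
  have hMB : ∀ n, eLpNorm (M n) (ENNReal.ofReal (β / (β - 1))) (timeMeasure T) ≤ B := by
    intro n
    refine (hM3 n).trans ?_
    refine ENNReal.rpow_le_rpow (ENNReal.ofReal_le_ofReal ?_)
        (div_nonneg (by linarith) (by linarith))
    gcongr
    exact hK n
  have hk : Integrable (fun s => C * κ s) (timeMeasure T) := hc.integrable.const_mul C
  classical
  -- The equation can be tested with `D j` only once `D j ∈ W n`. The value zero before that keeps
  -- the modulus of continuity valid for every `n` and concerns finitely many `n`.
  obtain ⟨φ, hφ, f, hf⟩ := exists_subseq_tendstoUniformlyOn (T := T)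
    (F := fun j n t => if D j ∈ W n then inner ℝ (Y n t) (ι (D j)) else 0)
    (R := fun j => R * ‖ι (D j)‖) (ω := fun j s t =>
      (B * (‖D j‖ₑ * timeMeasure T (uIoc s t) ^ (1 / (ENNReal.ofReal β).toReal))
        + (∫⁻ r in uIoc s t, ‖C * κ r‖ₑ ∂(timeMeasure T)) * ‖ι (D j)‖ₑ).toReal)
    (fun j n t ht => by
      have hRn : 0 ≤ R := (norm_nonneg _).trans (hR n t ht)
      split_ifs with hj
      · exact (norm_inner_le_norm _ _).trans (by gcongr; exact hR n t ht)
      · rw [norm_zero]; positivity)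
    (fun j n s hs t ht => by
      split_ifs with hj
      · rw [← inner_sub_left, h.inner_sub_eq hj hs ht, Real.norm_eq_abs]
        exact abs_intervalIntegral_apply_le (q := ENNReal.ofReal (β / (β - 1))) (hM1 n) (hM2 n).1 hk
          (hMB n) hBt hp0 ENNReal.ofReal_ne_top _ hs ht
      · rw [sub_zero, norm_zero]; positivity)
    (fun j s hs => (tendsto_modulus hk hBt hp0 ENNReal.ofReal_ne_top _ _).mono_left
      nhdsWithin_le_nhds)
  have hf' : ∀ j, TendstoUniformlyOn (fun n t => inner ℝ (Y (φ n) t) (ι (D j))) (f j) atTop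
      (Icc 0 T) := by
    intro j
    refine (hf j).congr ?_
    filter_upwards [hφ.tendsto_atTop.eventually (h.eventually_mem j)] with n hn t ht
    exact if_pos hn
  have hex : ∀ t ∈ Icc 0 T, ∃ z : H, ∀ j, inner ℝ z (ι (D j)) = f j t := fun t ht =>
    exists_eq_of_tendsto_inner (fun n => hR (φ n) t ht) fun j => (hf' j).tendsto_at ht
  choose! Z hZ using hex
  set Yl : ℝ → H := (Icc 0 T).indicator Z with hYl
  have hYl2 : ∀ t ∈ Icc 0 T, ∀ j, inner ℝ (Yl t) (ι (D j)) = f j t := by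
    intro t ht j
    rw [hYl, indicator_of_mem ht, hZ t ht]
  refine ⟨φ, hφ, Yl, fun t ht => indicator_of_notMem ht _, ?_, fun j => ?_⟩
  · refine eq_of_forall_inner_eq hιD fun j => ?_
    rw [hYl2 0 h0]
    refine tendsto_nhds_unique ((hf' j).tendsto_at h0) ?_
    exact (h.init.comp hφ.tendsto_atTop).inner tendsto_const_nhds
  · exact (hf' j).congr_right fun t ht => (hYl2 t ht j).symm

end Core

/-! ### Regularity of the weak limit -/

section Core

variable {H V : Type*} [NormedAddCommGroup H] [InnerProductSpace ℝ H] [CompleteSpace H]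
  [NormedAddCommGroup V] [NormedSpace ℝ V] [MeasurableSpace V]
  {T β : ℝ} {ι : V →L[ℝ] H} {κ : ℝ → ℝ} {L : ℝ} {𝒢 : ℝ → V → StrongDual ℝ V}
  {D : ℕ → V} {x : H} {W : ℕ → Submodule ℝ V}
  {Y : ℕ → ℝ → H} {y : ℕ → ℝ → V} {g : ℕ → ℝ → H} {Yl : ℝ → H}

theorem GalerkinSeq.tendsto_inner (h : GalerkinSeq T β ι 𝒢 D x W Y y g)
    (hι : DenseRange ι) (hD : DenseRange D) {R : ℝ} (hR : ∀ n, ∀ t ∈ Icc 0 T, ‖Y n t‖ ≤ R)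
    (hw : ∀ j, TendstoUniformlyOn (fun n t => inner ℝ (Y n t) (ι (D j)))
      (fun t => inner ℝ (Yl t) (ι (D j))) atTop (Icc 0 T)) {t : ℝ} (ht : t ∈ Icc 0 T) (w : H) :
    Tendsto (fun n => inner ℝ (Y n t) w) atTop (𝓝 (inner ℝ (Yl t) w)) :=
  tendsto_inner_of_denseRange (ι := fun j => ι (D j)) (hι.comp hD ι.continuous)
    (Eventually.of_forall fun n => hR n t ht) (fun j => (hw j).tendsto_at ht) w

theorem lintegral_enorm_rpow_le (hβ : 0 < β) {z : ℝ → V}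
    (hz : MemLp z (ENNReal.ofReal β) (timeMeasure T)) {K : ℝ}
    (hK : ∫ s, ‖z s‖ ^ β ∂(timeMeasure T) ≤ K) :
    ∫⁻ s, ‖z s‖ₑ ^ β ∂(timeMeasure T) ≤ ENNReal.ofReal K := by
  refine le_trans (le_of_eq ?_) (ENNReal.ofReal_le_ofReal hK)
  rw [ofReal_integral_eq_lintegral_ofReal (integrable_norm_rpow hβ hz)
    (Eventually.of_forall fun _ => by positivity)]
  refine lintegral_congr fun s => ?_
  rw [← ENNReal.ofReal_rpow_of_nonneg (norm_nonneg _) hβ.le, ofReal_norm]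

/-- By Fatou's lemma the liminf of `‖y n t‖` is finite at almost every `t`, which puts the weak
limit in the image of `V`. The version is measurable by the Lusin–Souslin theorem: a continuous
injection of Polish spaces is a measurable embedding, so its inverse is measurable. -/
theorem GalerkinSeq.exists_version [BorelSpace V] [CompleteSpace V]
    [TopologicalSpace.SeparableSpace H] [TopologicalSpace.SeparableSpace V]
    (h : GalerkinSeq T β ι 𝒢 D x W Y y g) (hβ : 1 < β)
    (hinj : Function.Injective ι) (hι : DenseRange ι)
    (hrefl : Function.Surjective (NormedSpace.inclusionInDoubleDual ℝ V))
    (hD : DenseRange D) {R K : ℝ} (hR : ∀ n, ∀ t ∈ Icc 0 T, ‖Y n t‖ ≤ R)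
    (hK : ∀ n, ∫ s, ‖y n s‖ ^ β ∂(timeMeasure T) ≤ K) (hY0 : ∀ t ∉ Icc 0 T, Yl t = 0)
    (hw : ∀ j, TendstoUniformlyOn (fun n t => inner ℝ (Y n t) (ι (D j)))
      (fun t => inner ℝ (Yl t) (ι (D j))) atTop (Icc 0 T)) :
    ∃ yl : ℝ → V, MemLp yl (ENNReal.ofReal β) (timeMeasure T) ∧
      ∀ᵐ t ∂(timeMeasure T), ι (yl t) = Yl t := by
  have hβ0 : 0 < β := by linarith
  borelize H
  have : SecondCountableTopology H := UniformSpace.secondCountable_of_separable H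
  have : SecondCountableTopology V := UniformSpace.secondCountable_of_separable V
  have hιD : DenseRange fun j => ι (D j) := hι.comp hD ι.continuous
  have hYm : Measurable Yl := by
    refine measurable_of_inner_denseRange hιD fun j => ?_
    have hc : ContinuousOn (fun t => inner ℝ (Yl t) (ι (D j))) (Icc 0 T) := by
      refine (hw j).continuousOn (Frequently.of_forall fun n => ?_)
      exact (continuousOn_of_eq_add_integral (h.integrable n) (h.eq n)).inner continuousOn_const
    have e : (fun t => inner ℝ (Yl t) (ι (D j)))
        = (Icc 0 T).indicator fun t => inner ℝ (Yl t) (ι (D j)) := by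
      funext t
      by_cases ht : t ∈ Icc 0 T
      · rw [indicator_of_mem ht]
      · rw [indicator_of_notMem ht, hY0 t ht, inner_zero_left]
    rw [e, ← piecewise_eq_indicator]
    exact hc.measurable_piecewise continuousOn_const measurableSet_Icc
  have hliminf : ∫⁻ t, liminf (fun n => ‖y n t‖ₑ ^ β) atTop ∂(timeMeasure T)
      ≤ ENNReal.ofReal K := by
    refine (lintegral_liminf_le' fun n => (h.memLp n).1.enorm.pow_const _).trans ?_
    exact liminf_le_of_le (by isBoundedDefault) fun b hb => by
      obtain ⟨n, hn⟩ := hb.exists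
      exact hn.trans (lintegral_enorm_rpow_le hβ0 (h.memLp n) (hK n))
  have hpow : ∀ t, (liminf (fun n => ‖y n t‖ₑ) atTop) ^ β
      = liminf (fun n => ‖y n t‖ₑ ^ β) atTop := fun t =>
    (ENNReal.monotone_rpow_of_nonneg hβ0.le).map_liminf_of_continuousAt _
      (ENNReal.continuous_rpow_const.continuousAt) (by isBoundedDefault) (by isBoundedDefault)
  have hmeas : AEMeasurable (fun t => liminf (fun n => ‖y n t‖ₑ ^ β) atTop) (timeMeasure T) := by
    simp_rw [liminf_eq_iSup_iInf_of_nat]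
    exact AEMeasurable.iSup fun n => AEMeasurable.biInf _ (to_countable {i | i ≥ n})
      fun i _ => (h.memLp i).1.enorm.pow_const _
  have hlt : ∀ᵐ t ∂(timeMeasure T), liminf (fun n => ‖y n t‖ₑ) atTop < ∞ := by
    filter_upwards [ae_lt_top' hmeas (hliminf.trans_lt ENNReal.ofReal_lt_top).ne] with t ht
    rw [← hpow] at ht
    exact (ENNReal.rpow_lt_top_iff_of_pos hβ0).1 ht
  have hemb : MeasurableEmbedding ι := ι.continuous.measurableEmbedding hinj
  set r : H → V := Function.extend ι id fun _ => 0 with hr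
  have hrm : Measurable r := hemb.measurable_extend measurable_id measurable_const
  have hrι : ∀ v, r (ι v) = v := fun v => hinj.extend_apply _ _ _
  have hae : ∀ᵐ t ∂(timeMeasure T), ι (r (Yl t)) = Yl t ∧
      ‖r (Yl t)‖ₑ ≤ liminf (fun n => ‖y n t‖ₑ) atTop := by
    filter_upwards [hlt, ae_restrict_mem measurableSet_Icc] with t h1 h2
    obtain ⟨v, hv, hle⟩ := exists_preimage_of_liminf hrefl hinj (x := fun n => y n t) (h := Yl t)
      (fun w => by simpa only [h.version] using h.tendsto_inner hι hD hR hw h2 w) h1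
    rw [← hv, hrι]
    exact ⟨rfl, hle⟩
  refine ⟨fun t => r (Yl t), ⟨(hrm.comp hYm).aestronglyMeasurable, ?_⟩, hae.mono fun t ht => ht.1⟩
  have hb0 : ENNReal.ofReal β ≠ 0 := by simpa using hβ0
  rw [eLpNorm_lt_top_iff_lintegral_rpow_enorm_lt_top hb0 ENNReal.ofReal_ne_top,
    ENNReal.toReal_ofReal hβ0.le]
  refine lt_of_le_of_lt (lintegral_mono_ae ?_) (hliminf.trans_lt ENNReal.ofReal_lt_top)
  filter_upwards [hae] with t ht
  rw [← hpow]
  exact ENNReal.rpow_le_rpow ht.2 hβ0.le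

/-- The Galerkin equation holds only on `W n`, but for each `j` it may be tested with `D j` from
some index on, which is all that `exists_weak_derivative` asks. -/
theorem GalerkinSeq.exists_evol [BorelSpace V] [CompleteSpace V]
    [SecondCountableTopology (StrongDual ℝ V)]
    [TopologicalSpace.SeparableSpace H] [TopologicalSpace.SeparableSpace V]
    (h : GalerkinSeq T β ι 𝒢 D x W Y y g) (hc : CoreHyp T β ι κ L 𝒢) (hT : 0 < T) (hβ : 1 < β)
    (hinj : Function.Injective ι) (hι : DenseRange ι)
    (hrefl : Function.Surjective (NormedSpace.inclusionInDoubleDual ℝ V))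
    (hD : DenseRange D) {R K : ℝ} (hR : ∀ n, ∀ t ∈ Icc 0 T, ‖Y n t‖ ≤ R)
    (hK : ∀ n, ∫ s, ‖y n s‖ ^ β ∂(timeMeasure T) ≤ K) (hY0 : ∀ t ∉ Icc 0 T, Yl t = 0)
    (hw : ∀ j, TendstoUniformlyOn (fun n t => inner ℝ (Y n t) (ι (D j)))
      (fun t => inner ℝ (Yl t) (ι (D j))) atTop (Icc 0 T)) :
    ∃ (yl : ℝ → V) (ξ : ℝ → StrongDual ℝ V) (M : ℕ → ℝ → ℝ) (M' k : ℝ → ℝ) (B : ℝ≥0∞),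
      Evol T (ENNReal.ofReal β) (ENNReal.ofReal (β / (β - 1))) ι Yl yl ξ ∧
      (∀ n, MixedBound (timeMeasure T) ι (fun s => 𝒢 s (y n s)) (M n) k) ∧
      (∀ n, MemLp (M n) (ENNReal.ofReal (β / (β - 1))) (timeMeasure T)) ∧
      (∀ n, eLpNorm (M n) (ENNReal.ofReal (β / (β - 1))) (timeMeasure T) ≤ B) ∧
      MixedBound (timeMeasure T) ι ξ M' k ∧
      MemLp M' (ENNReal.ofReal (β / (β - 1))) (timeMeasure T) ∧
      Integrable k (timeMeasure T) ∧ B ≠ ∞ := by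
  have := holderTriple_ofReal hβ
  have hp0 : ENNReal.ofReal β ≠ 0 := by simp only [ne_eq, ENNReal.ofReal_eq_zero]; linarith
  have hq1 : 1 ≤ ENNReal.ofReal (β / (β - 1)) := by
    rw [ENNReal.one_le_ofReal, le_div_iff₀ (by linarith)]; linarith
  have h0 : (0 : ℝ) ∈ Icc 0 T := ⟨le_rfl, hT.le⟩
  obtain ⟨yl, hyl, hv⟩ := h.exists_version hβ hinj hι hrefl hD hR hK hY0 hw
  obtain ⟨C, hC, hmix⟩ := hc.exists_mixedBound hβ R
  choose M hM1 hM2 hM3 using fun n => hmix (y n) (h.memLp n)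
    ((ae_restrict_iff' measurableSet_Icc).2 (Eventually.of_forall fun t ht => by
      rw [h.version]; exact hR n t ht))
  set B : ℝ≥0∞ := ENNReal.ofReal (C * (∫ s, κ s ∂(timeMeasure T) + K)) ^ ((β - 1) / β) with hB
  have hBt : B ≠ ∞ := ENNReal.rpow_ne_top_of_nonneg (div_nonneg (by linarith) (by linarith))
    ENNReal.ofReal_ne_top
  have hMB : ∀ n, eLpNorm (M n) (ENNReal.ofReal (β / (β - 1))) (timeMeasure T) ≤ B := by
    intro n
    refine (hM3 n).trans ?_
    refine ENNReal.rpow_le_rpow (ENNReal.ofReal_le_ofReal ?_)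
        (div_nonneg (by linarith) (by linarith))
    gcongr
    exact hK n
  have hk : Integrable (fun s => C * κ s) (timeMeasure T) := hc.integrable.const_mul C
  obtain ⟨ξ, M', hξ, hM', hmix', heq⟩ := exists_weak_derivative (ENNReal.ofReal β) hT hq1
    ENNReal.ofReal_ne_top hp0 ENNReal.ofReal_ne_top (Y := Yl) hD
    (G := fun n s => 𝒢 s (y n s)) (fun n => hc.aestronglyMeasurable_apply (h.memLp n).1) hM1 hM2 hk
    hMB hBt (fun j t ht => by
      have h1 := ((hw j).tendsto_at ht).sub ((hw j).tendsto_at h0)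
      rw [← inner_sub_left] at h1
      refine h1.congr' ?_
      filter_upwards [h.eventually_mem j] with n hn
      rw [← inner_sub_left, h.inner_sub_eq hn h0 ht])
  refine ⟨yl, ξ, M, M', _, B, ⟨hyl, hv, ⟨R, fun t ht => ?_⟩, hξ, ⟨M', _, hM', hk, hmix'⟩, heq⟩,
    hM1, hM2, hMB, hmix', hM', hk, hBt⟩
  exact norm_le_of_tendsto_inner (Eventually.of_forall fun n => hR n t ht)
      (h.tendsto_inner hι hD hR hw ht _)

end Core

/-- The image of `[0, T]` under `Y` is compact, so finitely many `d j` approximate all its points at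
once. -/
theorem eventually_abs_inner_le_of_denseRange {H : Type*} [NormedAddCommGroup H]
    [InnerProductSpace ℝ H] {T : ℝ} {Z : ℕ → ℝ → H} {R : ℝ} {d : ℕ → H} (hd : DenseRange d)
    (hR : ∀ n, ∀ t ∈ Icc 0 T, ‖Z n t‖ ≤ R)
    (hw : ∀ j, TendstoUniformlyOn (fun n t => inner ℝ (Z n t) (d j)) (fun _ => 0) atTop (Icc 0 T))
    {Y : ℝ → H} (hY : ContinuousOn Y (Icc 0 T)) {ε : ℝ} (hε : 0 < ε) :
    ∀ᶠ n in atTop, ∀ t ∈ Icc 0 T, |inner ℝ (Z n t) (Y t)| ≤ ε := by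
  set δ : ℝ := ε / (2 * (|R| + 1)) with hδ
  have hδ0 : 0 < δ := by positivity
  obtain ⟨J, hJ⟩ := (isCompact_Icc.image_of_continuousOn hY).elim_finite_subcover
    (fun j => Metric.ball (d j) δ) (fun _ => Metric.isOpen_ball) (fun w _ => by
      obtain ⟨j, hj⟩ := hd.exists_dist_lt w hδ0
      exact mem_iUnion.2 ⟨j, hj⟩)
  have hev : ∀ᶠ n in atTop, ∀ j ∈ J, ∀ t ∈ Icc 0 T, |inner ℝ (Z n t) (d j)| < ε / 2 := by
    rw [Filter.eventually_all_finset]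
    intro j _
    filter_upwards [Metric.tendstoUniformlyOn_iff.1 (hw j) (ε / 2) (by positivity)] with n hn t ht
    have := hn t ht
    rwa [dist_comm, Real.dist_eq, sub_zero] at this
  filter_upwards [hev] with n hn t ht
  have h1 := hJ (mem_image_of_mem Y ht)
  simp only [mem_iUnion, Metric.mem_ball, exists_prop] at h1
  obtain ⟨j, hj, hdist⟩ := h1
  rw [dist_eq_norm] at hdist
  have e : inner ℝ (Z n t) (Y t) = inner ℝ (Z n t) (d j) + inner ℝ (Z n t) (Y t - d j) := by
    rw [← inner_add_right, add_sub_cancel]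
  have h2 : |inner ℝ (Z n t) (Y t - d j)| ≤ ε / 2 := by
    calc |inner ℝ (Z n t) (Y t - d j)| ≤ ‖Z n t‖ * ‖Y t - d j‖ := abs_real_inner_le_norm _ _
      _ ≤ (|R| + 1) * δ := by
        gcongr
        linarith [hR n t ht, le_abs_self R]
      _ = ε / 2 := by rw [hδ]; field_simp
  rw [e]
  exact (abs_add_le _ _).trans (by linarith [hn j hj t ht])

/-! ### Passage to the limit in pairings -/

section Core

variable {H V : Type*} [NormedAddCommGroup H] [InnerProductSpace ℝ H] [CompleteSpace H]
  [NormedAddCommGroup V] [NormedSpace ℝ V] [MeasurableSpace V]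
  {T β : ℝ} {ι : V →L[ℝ] H} {κ : ℝ → ℝ} {L : ℝ} {𝒢 : ℝ → V → StrongDual ℝ V}
  {D : ℕ → V} {x : H} {W : ℕ → Submodule ℝ V}
  {Y : ℕ → ℝ → H} {y : ℕ → ℝ → V} {g : ℕ → ℝ → H} {Yl : ℝ → H} {yl : ℝ → V}
  {ξ : ℝ → StrongDual ℝ V} {M : ℕ → ℝ → ℝ} {M' k : ℝ → ℝ} {B : ℝ≥0∞} {R K : ℝ}

theorem MixedBound.sub {μ : Measure ℝ} {ξ ξ' : ℝ → StrongDual ℝ V} {M M' k k' : ℝ → ℝ}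
    (h : MixedBound μ ι ξ M k) (h' : MixedBound μ ι ξ' M' k') :
    MixedBound μ ι (fun s => ξ s - ξ' s) (fun s => ‖M s‖ + ‖M' s‖) fun s => ‖k s‖ + ‖k' s‖ := by
  filter_upwards [h, h'] with s h1 h2 v
  rw [Real.norm_of_nonneg (show 0 ≤ ‖M s‖ + ‖M' s‖ by positivity),
    Real.norm_of_nonneg (show 0 ≤ ‖k s‖ + ‖k' s‖ by positivity), sub_apply]
  refine (norm_sub_le _ _).trans ((add_le_add (h1 v) (h2 v)).trans (le_of_eq ?_))
  ring

theorem mixedBound_toDual {μ : Measure ℝ} (g : ℝ → H) :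
    MixedBound μ ι (fun s => toDual ι (g s)) (fun _ => 0) fun s => ‖g s‖ := by
  refine Eventually.of_forall fun s v => ?_
  rw [toDual_apply_apply, norm_zero, zero_mul, zero_add, norm_norm]
  exact norm_inner_le_norm _ _

/-- Against `D j` the primitive is the increment of `(Y n - Yl, ι (D j))`, which is uniformly small;
`smallPrimitive_apply` extends this to other test functions. -/
theorem GalerkinSeq.smallPrimitive_sub_apply [BorelSpace V]
    [SecondCountableTopology (StrongDual ℝ V)]
    (h : GalerkinSeq T β ι 𝒢 D x W Y y g) (hc : CoreHyp T β ι κ L 𝒢) (hT : 0 < T) (hβ : 1 < β)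
    (hD : DenseRange D)
    (hw : ∀ j, TendstoUniformlyOn (fun n t => inner ℝ (Y n t) (ι (D j)))
      (fun t => inner ℝ (Yl t) (ι (D j))) atTop (Icc 0 T))
    (hev : Evol T (ENNReal.ofReal β) (ENNReal.ofReal (β / (β - 1))) ι Yl yl ξ)
    (hmix : ∀ n, MixedBound (timeMeasure T) ι (fun s => 𝒢 s (y n s)) (M n) k)
    (hM : ∀ n, MemLp (M n) (ENNReal.ofReal (β / (β - 1))) (timeMeasure T))
    (hMB : ∀ n, eLpNorm (M n) (ENNReal.ofReal (β / (β - 1))) (timeMeasure T) ≤ B)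
    (hmix' : MixedBound (timeMeasure T) ι ξ M' k)
    (hM' : MemLp M' (ENNReal.ofReal (β / (β - 1))) (timeMeasure T))
    (hk : Integrable k (timeMeasure T)) (hB : B ≠ ∞) {z : ℝ → V} {R' : ℝ}
    (hz : MemLp z (ENNReal.ofReal β) (timeMeasure T))
    (hR' : ∀ᵐ s ∂(timeMeasure T), ‖ι (z s)‖ ≤ R') :
    SmallPrimitive T fun n s => (𝒢 s (y n s) - ξ s) (z s) := by
  have := holderTriple_ofReal hβ
  have hp0 : ENNReal.ofReal β ≠ 0 := by simp only [ne_eq, ENNReal.ofReal_eq_zero]; linarith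
  have hq1 : 1 ≤ ENNReal.ofReal (β / (β - 1)) := by
    rw [ENNReal.one_le_ofReal, le_div_iff₀ (by linarith)]; linarith
  have h0 : (0 : ℝ) ∈ Icc 0 T := ⟨le_rfl, hT.le⟩
  have hGm := fun n => hc.aestronglyMeasurable_apply (h.memLp n).1
  refine smallPrimitive_apply (η := fun n s => 𝒢 s (y n s) - ξ s)
    (C := B + eLpNorm M' (ENNReal.ofReal (β / (β - 1))) (timeMeasure T)) hT.le
    (fun n => (hGm n).sub hev.meas) (fun n => (hmix n).sub hmix')
    (fun n => (hM n).norm.add hM'.norm) (hk.norm.add hk.norm) (fun n => ?_)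
    (ENNReal.add_ne_top.2 ⟨hB, hM'.2.ne⟩) hp0 ENNReal.ofReal_ne_top hD (fun j => ?_) hz hR'
  · refine (eLpNorm_add_le (hM n).1.norm hM'.1.norm hq1).trans ?_
    rw [eLpNorm_norm, eLpNorm_norm]
    gcongr
    exact hMB n
  · intro ε hε
    have h1 := Metric.tendstoUniformlyOn_iff.1 (hw j) (ε / 2) (by positivity)
    filter_upwards [h1, h.eventually_mem j] with n hn hnj t ht
    have hi1 : Integrable (fun s => 𝒢 s (y n s) (D j)) (timeMeasure T) :=
      (hmix n).integrable (p := ENNReal.ofReal β) (hGm n) (hM n) hk (memLp_const _)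
        (R := ‖ι (D j)‖) (Eventually.of_forall fun _ => le_rfl)
    simp only [sub_apply]
    rw [intervalIntegral.integral_sub (intervalIntegrable_of_timeMeasure hi1 h0 ht)
      (intervalIntegrable_of_timeMeasure (hev.integrable_const_apply _) h0 ht),
      ← h.inner_sub_eq hnj h0 ht, ← hev.eq_sub h0 ht, inner_sub_left, inner_sub_left]
    have h2 := hn t ht
    have h3 := hn 0 h0
    rw [Real.dist_eq, abs_sub_comm] at h2
    rw [Real.dist_eq] at h3
    have e : (inner ℝ (Y n t) (ι (D j)) - inner ℝ (Y n 0) (ι (D j)))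
        - (inner ℝ (Yl t) (ι (D j)) - inner ℝ (Yl 0) (ι (D j)))
        = (inner ℝ (Y n t) (ι (D j)) - inner ℝ (Yl t) (ι (D j)))
          + (inner ℝ (Yl 0) (ι (D j)) - inner ℝ (Y n 0) (ι (D j))) := by ring
    rw [e]
    exact (abs_add_le _ _).trans (by linarith)

/-- Complements `GalerkinSeq.smallPrimitive_sub_apply`: there the functionals vary and the argument
is fixed, here the functional is fixed and the argument converges weakly. -/
theorem GalerkinSeq.tendsto_lintegral_sub
    (h : GalerkinSeq T β ι 𝒢 D x W Y y g) (hβ : 1 < β)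
    (hι : DenseRange ι) (hd : DenseRange (toDual ι)) (hD : DenseRange D)
    (hR : ∀ n, ∀ t ∈ Icc 0 T, ‖Y n t‖ ≤ R)
    (hK : ∀ n, ∫ s, ‖y n s‖ ^ β ∂(timeMeasure T) ≤ K)
    (hw : ∀ j, TendstoUniformlyOn (fun n t => inner ℝ (Y n t) (ι (D j)))
      (fun t => inner ℝ (Yl t) (ι (D j))) atTop (Icc 0 T))
    (hev : Evol T (ENNReal.ofReal β) (ENNReal.ofReal (β / (β - 1))) ι Yl yl ξ)
    {f : ℝ → StrongDual ℝ V} {N l : ℝ → ℝ} (hb : MixedBound (timeMeasure T) ι f N l)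
    (hf : AEStronglyMeasurable f (timeMeasure T))
    (hN : MemLp N (ENNReal.ofReal (β / (β - 1))) (timeMeasure T))
    (hl : Integrable l (timeMeasure T)) :
    Tendsto (fun n => ∫⁻ s, ‖f s (y n s - yl s)‖ₑ ∂(timeMeasure T)) atTop (𝓝 0) := by
  have := holderTriple_ofReal hβ
  have hβ0 : 0 < β := by linarith
  have hp0 : ENNReal.ofReal β ≠ 0 := by simp only [ne_eq, ENNReal.ofReal_eq_zero]; linarith
  have hp1 : 1 ≤ ENNReal.ofReal β := by rw [ENNReal.one_le_ofReal]; linarith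
  have hq1 : 1 ≤ ENNReal.ofReal (β / (β - 1)) := by
    rw [ENNReal.one_le_ofReal, le_div_iff₀ (by linarith)]; linarith
  obtain ⟨R₂, hR₂⟩ := hev.bdd
  have hyn : ∀ n, eLpNorm (y n) (ENNReal.ofReal β) (timeMeasure T)
      ≤ ENNReal.ofReal K ^ (1 / β) := by
    intro n
    rw [eLpNorm_eq_lintegral_rpow_enorm_toReal hp0 ENNReal.ofReal_ne_top,
      ENNReal.toReal_ofReal hβ0.le]
    exact ENNReal.rpow_le_rpow (lintegral_enorm_rpow_le hβ0 (h.memLp n) (hK n)) (by positivity)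
  refine hb.tendsto_lintegral_apply (p := ENNReal.ofReal β) hf hN hl hd hq1 ENNReal.ofReal_ne_top
    (C := ENNReal.ofReal K ^ (1 / β) + eLpNorm yl (ENNReal.ofReal β) (timeMeasure T))
    (fun n => (h.memLp n).1.sub hev.memLp.1) (fun n => ?_)
    (ENNReal.add_ne_top.2 ⟨ENNReal.rpow_ne_top_of_nonneg (by positivity) ENNReal.ofReal_ne_top,
      hev.memLp.2.ne⟩) (R := R + R₂) (fun n => ?_) ?_
  · refine (eLpNorm_sub_le (h.memLp n).1 hev.memLp.1 hp1).trans ?_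
    gcongr
    exact hyn n
  · filter_upwards [hev.version, ae_restrict_mem measurableSet_Icc] with s h1 h2
    rw [map_sub, h.version, h1]
    exact (norm_sub_le _ _).trans (add_le_add (hR n s h2) (hR₂ s h2))
  · filter_upwards [hev.version, ae_restrict_mem measurableSet_Icc] with s h1 h2 w
    have h3 := (h.tendsto_inner hι hD hR hw h2 w).sub_const (inner ℝ (Yl s) w)
    rw [sub_self] at h3
    refine h3.congr fun n => ?_
    rw [map_sub, h.version, h1, inner_sub_left]

end Core

/-! ### Strong convergence in C([0, T]; H) -/

section Core

variable {H V : Type*} [NormedAddCommGroup H] [InnerProductSpace ℝ H] [CompleteSpace H]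
  [NormedAddCommGroup V] [NormedSpace ℝ V] [MeasurableSpace V]
  {T β : ℝ} {ι : V →L[ℝ] H} {κ : ℝ → ℝ} {L : ℝ} {𝒢 : ℝ → V → StrongDual ℝ V}
  {D : ℕ → V} {x : H} {W : ℕ → Submodule ℝ V}
  {Y : ℕ → ℝ → H} {y : ℕ → ℝ → V} {g : ℕ → ℝ → H} {Yl : ℝ → H} {yl : ℝ → V}
  {ξ : ℝ → StrongDual ℝ V} {M : ℕ → ℝ → ℝ} {M' k : ℝ → ℝ} {B : ℝ≥0∞} {R K : ℝ}

/-- A sequence of Galerkin approximations, with uniform bounds, converging weakly to `Yl`, whose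
weak derivative is `ξ`. -/
structure GalerkinLimit (T β : ℝ) (ι : V →L[ℝ] H) (κ : ℝ → ℝ) (L : ℝ)
    (𝒢 : ℝ → V → StrongDual ℝ V) (D : ℕ → V) (x : H) (W : ℕ → Submodule ℝ V)
    (Y : ℕ → ℝ → H) (y : ℕ → ℝ → V) (g : ℕ → ℝ → H) (Yl : ℝ → H) (yl : ℝ → V)
    (ξ : ℝ → StrongDual ℝ V) (R K : ℝ) : Prop where
  seq : GalerkinSeq T β ι 𝒢 D x W Y y g
  core : CoreHyp T β ι κ L 𝒢
  pos : 0 < T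
  one_lt : 1 < β
  dense : DenseRange ι
  dense_toDual : DenseRange (toDual ι)
  dense_seq : DenseRange D
  norm_le : ∀ n, ∀ t ∈ Icc 0 T, ‖Y n t‖ ≤ R
  integral_le : ∀ n, ∫ s, ‖y n s‖ ^ β ∂(timeMeasure T) ≤ K
  weak : ∀ j, TendstoUniformlyOn (fun n t => inner ℝ (Y n t) (ι (D j)))
    (fun t => inner ℝ (Yl t) (ι (D j))) atTop (Icc 0 T)
  start : Yl 0 = x
  evol : Evol T (ENNReal.ofReal β) (ENNReal.ofReal (β / (β - 1))) ι Yl yl ξ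
  mixed : ∃ (M : ℕ → ℝ → ℝ) (M' k : ℝ → ℝ) (B : ℝ≥0∞),
    (∀ n, MixedBound (timeMeasure T) ι (fun s => 𝒢 s (y n s)) (M n) k) ∧
    (∀ n, MemLp (M n) (ENNReal.ofReal (β / (β - 1))) (timeMeasure T)) ∧
    (∀ n, eLpNorm (M n) (ENNReal.ofReal (β / (β - 1))) (timeMeasure T) ≤ B) ∧
    MixedBound (timeMeasure T) ι ξ M' k ∧
    MemLp M' (ENNReal.ofReal (β / (β - 1))) (timeMeasure T) ∧
    Integrable k (timeMeasure T) ∧ B ≠ ∞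

theorem GalerkinLimit.smallPrimitive_sub_apply [BorelSpace V]
    [SecondCountableTopology (StrongDual ℝ V)]
    (h : GalerkinLimit T β ι κ L 𝒢 D x W Y y g Yl yl ξ R K) {z : ℝ → V} {R' : ℝ}
    (hz : MemLp z (ENNReal.ofReal β) (timeMeasure T))
    (hR' : ∀ᵐ s ∂(timeMeasure T), ‖ι (z s)‖ ≤ R') :
    SmallPrimitive T fun n s => (𝒢 s (y n s) - ξ s) (z s) := by
  obtain ⟨M, M', k, B, h1, h2, h3, h4, h5, h6, h7⟩ := h.mixed
  exact h.seq.smallPrimitive_sub_apply h.core h.pos h.one_lt h.dense_seq h.weak h.evol h1 h2 h3 h4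
    h5 h6 h7 hz hR'

theorem GalerkinLimit.tendsto_lintegral_sub
    (h : GalerkinLimit T β ι κ L 𝒢 D x W Y y g Yl yl ξ R K)
    {f : ℝ → StrongDual ℝ V} {N l : ℝ → ℝ} (hb : MixedBound (timeMeasure T) ι f N l)
    (hf : AEStronglyMeasurable f (timeMeasure T))
    (hN : MemLp N (ENNReal.ofReal (β / (β - 1))) (timeMeasure T))
    (hl : Integrable l (timeMeasure T)) :
    Tendsto (fun n => ∫⁻ s, ‖f s (y n s - yl s)‖ₑ ∂(timeMeasure T)) atTop (𝓝 0) :=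
  h.seq.tendsto_lintegral_sub h.one_lt h.dense h.dense_toDual h.dense_seq h.norm_le h.integral_le
    h.weak h.evol hb hf hN hl

theorem GalerkinLimit.one_le_ofReal (h : GalerkinLimit T β ι κ L 𝒢 D x W Y y g Yl yl ξ R K) :
    1 ≤ ENNReal.ofReal β := by
  rw [ENNReal.one_le_ofReal]; exact h.one_lt.le

theorem GalerkinLimit.evol_seq (h : GalerkinLimit T β ι κ L 𝒢 D x W Y y g Yl yl ξ R K) (n : ℕ) :
    Evol T (ENNReal.ofReal β) (ENNReal.ofReal (β / (β - 1))) ι (Y n) (y n)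
      fun s => toDual ι (g n s) :=
  h.seq.evol h.pos.le n

theorem GalerkinLimit.ae_norm_le (h : GalerkinLimit T β ι κ L 𝒢 D x W Y y g Yl yl ξ R K) (n : ℕ) :
    ∀ᵐ s ∂(timeMeasure T), ‖ι (y n s)‖ ≤ R :=
  (h.evol_seq n).ae_norm_le (h.norm_le n)

/-- The projection defect of the Galerkin approximations, tested against the limit, is small. -/
theorem GalerkinLimit.smallPrimitive_defect [BorelSpace V]
    [SecondCountableTopology (StrongDual ℝ V)]
    (h : GalerkinLimit T β ι κ L 𝒢 D x W Y y g Yl yl ξ R K) :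
    SmallPrimitive T fun n s => (𝒢 s (y n s) - toDual ι (g n s)) (yl s) := by
  have := holderTriple_ofReal h.one_lt
  have h0 : (0 : ℝ) ∈ Icc 0 T := ⟨le_rfl, h.pos.le⟩
  obtain ⟨M, M', k, B, h1, h2, -, h4, h5, h6, -⟩ := h.mixed
  obtain ⟨R', hR'⟩ := h.evol.bdd
  have hGm := fun n => h.core.aestronglyMeasurable_apply (h.seq.memLp n).1
  have hi1 : ∀ n, Integrable (fun s => (𝒢 s (y n s) - ξ s) (yl s)) (timeMeasure T) := fun n =>
    ((h1 n).sub h4).integrable (p := ENNReal.ofReal β) ((hGm n).sub h.evol.meas)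
      ((h2 n).norm.add h5.norm) (h6.norm.add h6.norm) h.evol.memLp (h.evol.ae_norm_le hR')
  have hi2 : ∀ n, Integrable (fun s => ξ s (y n s - yl s)) (timeMeasure T) := fun n => by
    simp only [map_sub]
    exact (h.evol.integrable_cross (h.evol_seq n)).sub h.evol.integrable_apply
  -- Integration by parts and the energy equality for `Yl` split the defect into four small terms:
  -- the integrals of `(𝒢 (y n) - ξ) yl` and of `ξ (y n - yl)`, and the products `-(Y n t - Yl t, Yl
  -- t)` and `(Y n 0 - x, x)`.
  have hs1 := h.smallPrimitive_sub_apply h.evol.memLp (h.evol.ae_norm_le hR')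
  have hs2 : SmallPrimitive T fun n s => ξ s (y n s - yl s) :=
    SmallPrimitive.of_tendsto (h.tendsto_lintegral_sub h4 h.evol.meas h5 h6)
  have hYc := h.evol.continuousOn h.pos h.one_le_ofReal ENNReal.ofReal_ne_top h.dense
  intro ε hε
  have hev := eventually_abs_inner_le_of_denseRange (T := T) (Z := fun n t => Y n t - Yl t)
    (R := R + R') (h.dense.comp h.dense_seq ι.continuous)
    (fun n t ht => (norm_sub_le _ _).trans (add_le_add (h.norm_le n t ht) (hR' t ht)))
    (fun j => by
      have e := Metric.tendstoUniformlyOn_iff.1 (h.weak j)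
      rw [Metric.tendstoUniformlyOn_iff]
      intro η hη
      filter_upwards [e η hη] with n hn t ht
      have e2 := hn t ht
      rw [Real.dist_eq] at e2
      rw [Real.dist_eq, zero_sub, abs_neg, Function.comp_apply, inner_sub_left, abs_sub_comm]
      exact e2) hYc (ε := ε / 4) (by positivity)
  have hinit : ∀ᶠ n in atTop, |inner ℝ (Y n 0 - x) x| ≤ ε / 4 := by
    have e1 : Tendsto (fun n => inner ℝ (Y n 0 - x) x) atTop (𝓝 (inner ℝ (x - x) x)) :=
      (h.seq.init.sub_const x).inner tendsto_const_nhds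
    rw [sub_self, inner_zero_left] at e1
    have e2 := e1.abs
    rw [abs_zero] at e2
    exact e2.eventually_le_const (by positivity)
  filter_upwards [hs1 (ε / 4) (by positivity), hs2 (ε / 4) (by positivity), hev, hinit]
    with n a1 a2 a3 a4 t ht
  have e1 := (h.evol_seq n).inner_eq h.evol h.pos h.one_le_ofReal ENNReal.ofReal_ne_top h.dense ht
  have e2 := h.evol.energy h.pos h.one_le_ofReal ENNReal.ofReal_ne_top h.dense ht
  have j1 := intervalIntegrable_of_timeMeasure (hi1 n) h0 ht
  have j2 := intervalIntegrable_of_timeMeasure h.evol.integrable_apply h0 ht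
  have j3 := intervalIntegrable_of_timeMeasure ((h.evol_seq n).integrable_cross h.evol) h0 ht
  have j4 := intervalIntegrable_of_timeMeasure (h.evol.integrable_cross (h.evol_seq n)) h0 ht
  have e3 : ∫ s in (0 : ℝ)..t, (𝒢 s (y n s) - toDual ι (g n s)) (yl s)
      = (∫ s in (0 : ℝ)..t, (𝒢 s (y n s) - ξ s) (yl s)) + (∫ s in (0 : ℝ)..t, ξ s (yl s))
        - ∫ s in (0 : ℝ)..t, toDual ι (g n s) (yl s) := by
    rw [← intervalIntegral.integral_add j1 j2, ← intervalIntegral.integral_sub (j1.add j2) j3]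
    refine intervalIntegral.integral_congr fun s _ => ?_
    simp only [sub_apply]
    ring
  have e4 : ∫ s in (0 : ℝ)..t, ξ s (y n s - yl s)
      = (∫ s in (0 : ℝ)..t, ξ s (y n s)) - ∫ s in (0 : ℝ)..t, ξ s (yl s) := by
    rw [← intervalIntegral.integral_sub j4 j2]
    exact intervalIntegral.integral_congr fun s _ => map_sub _ _ _
  have b1 := abs_le.1 (a1 t ht)
  have b2 := abs_le.1 (a2 t ht)
  have b3 := abs_le.1 (a3 t ht)
  have b4 := abs_le.1 a4
  rw [inner_sub_left, real_inner_self_eq_norm_sq] at b3 b4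
  rw [h.start] at e1 e2
  rw [abs_le, e3]
  constructor <;> linarith [b1.1, b1.2, b2.1, b2.2, b3.1, b3.2, b4.1, b4.2]

/-- For `n ≤ m` the inclusion `W n ≤ W m` makes `g m` agree with `𝒢 (y m)` on both `y n` and `y m`,
while `g n` agrees with `𝒢 (y n)` on `y n` only. So a single defect term, `(𝒢 (y n) - g n) (y m)`,
spoils the monotonicity estimate. The exponent in Grönwall's inequality is bounded independently of
`n` and `m`, because the integrals of `‖y n‖ ^ β` and `‖y m‖ ^ β` are. -/
theorem GalerkinSeq.exists_norm_sub_sq_le (h : GalerkinSeq T β ι 𝒢 D x W Y y g)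
    (hc : CoreHyp T β ι κ L 𝒢) (hT : 0 < T) (hβ : 1 < β) (hR : ∀ n, ∀ t ∈ Icc 0 T, ‖Y n t‖ ≤ R)
    (hK : ∀ n, ∫ s, ‖y n s‖ ^ β ∂(timeMeasure T) ≤ K)
    (hi : ∀ n m, Integrable (fun s => (𝒢 s (y n s) - toDual ι (g n s)) (y m s)) (timeMeasure T)) :
    ∃ A : ℝ, ∀ n m, n ≤ m → ∀ δ, 0 ≤ δ →
      (∀ t ∈ Icc 0 T, |∫ s in (0 : ℝ)..t, (𝒢 s (y n s) - toDual ι (g n s)) (y m s)| ≤ δ) →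
      ∀ t ∈ Icc 0 T, ‖Y n t - Y m t‖ ^ 2 ≤ (‖Y n 0 - Y m 0‖ ^ 2 + 2 * δ) * Real.exp A := by
  obtain ⟨C, hC, hmono⟩ := hc.mono R
  refine ⟨C * ((∫ s, κ s ∂(timeMeasure T)) + K + K), fun n m hnm δ hδ0 hδ t ht => ?_⟩
  have h0 : (0 : ℝ) ∈ Icc 0 T := ⟨le_rfl, hT.le⟩
  have hyi := fun n => integrable_norm_rpow (zero_lt_one.trans hβ) (h.memLp n)
  set c : ℝ → ℝ := fun s => C * (κ s + ‖y n s‖ ^ β + ‖y m s‖ ^ β) with hcdef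
  have hci : Integrable c (timeMeasure T) := ((hc.integrable.add (hyi n)).add (hyi m)).const_mul C
  have hc0 : ∀ᵐ s ∂(timeMeasure T), 0 ≤ c s := by
    filter_upwards [hc.one_le] with s hs
    positivity
  have hXe : ∀ t ∈ Icc 0 T, Y n t - Y m t
      = (Y n 0 - Y m 0) + ∫ s in (0 : ℝ)..t, (g n s - g m s) := by
    intro t ht
    rw [intervalIntegral.integral_sub (intervalIntegrable_of_timeMeasure (h.integrable n) h0 ht)
      (intervalIntegrable_of_timeMeasure (h.integrable m) h0 ht), h.eq n t ht, h.eq m t ht]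
    abel
  have hgi : Integrable (fun s => g n s - g m s) (timeMeasure T) :=
    (h.integrable n).sub (h.integrable m)
  have hXc : ContinuousOn (fun t => Y n t - Y m t) (Icc 0 T) := continuousOn_of_eq_add_integral
      hgi hXe
  have hXm : AEStronglyMeasurable (fun t => Y n t - Y m t) (timeMeasure T) :=
    hXc.aestronglyMeasurable_of_isCompact isCompact_Icc measurableSet_Icc
  have hcX : Integrable (fun s => c s * ‖Y n s - Y m s‖ ^ 2) (timeMeasure T) := by
    have : IntegrableOn c (Icc 0 T) volume := hci
    exact this.mul_continuousOn (hXc.norm.pow 2) isCompact_Icc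
  have hψ : Integrable (fun s => inner ℝ (g n s - g m s) (Y n s - Y m s)) (timeMeasure T) := by
    refine (hgi.norm.mul_const (R + R)).mono' (hgi.1.inner hXm) ?_
    refine (ae_restrict_iff' measurableSet_Icc).2 (Eventually.of_forall fun s hs => ?_)
    exact (norm_inner_le_norm _ _).trans (mul_le_mul_of_nonneg_left
      ((norm_sub_le _ _).trans (add_le_add (hR n s hs) (hR m s hs))) (norm_nonneg _))
  have hid : ∀ s, inner ℝ (g n s - g m s) (Y n s - Y m s)
      = (𝒢 s (y n s) - 𝒢 s (y m s)) (y n s - y m s)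
        + (𝒢 s (y n s) - toDual ι (g n s)) (y m s) := by
    intro s
    have p1 := h.pair n s _ (h.mem n s)
    have p2 := h.pair m s _ (h.mono hnm (h.mem n s))
    have p3 := h.pair m s _ (h.mem m s)
    rw [h.version] at p1 p2 p3
    simp only [sub_apply, map_sub, inner_sub_left, inner_sub_right, toDual_apply_apply, h.version,
      p1, p2, p3]
    ring
  have hgron : ‖Y n t - Y m t‖ ^ 2
      ≤ (‖Y n 0 - Y m 0‖ ^ 2 + 2 * δ) * Real.exp (∫ s in (0 : ℝ)..t, c s) := by
    refine le_mul_exp_of_le_add_integral (f := fun t => ‖Y n t - Y m t‖ ^ 2) (hXc.norm.pow 2) hci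
        hc0 (by positivity) (fun t ht => ?_) ht
    have e1 := norm_sq_eq_add_integral hT hgi hXe ht
    have e2 : 2 * ∫ s in (0 : ℝ)..t, inner ℝ (g n s - g m s) (Y n s - Y m s)
        ≤ ∫ s in (0 : ℝ)..t, (c s * ‖Y n s - Y m s‖ ^ 2
          + 2 * (𝒢 s (y n s) - toDual ι (g n s)) (y m s)) := by
      rw [← intervalIntegral.integral_const_mul]
      refine intervalIntegral.integral_mono_ae_restrict ht.1
        (intervalIntegrable_of_timeMeasure (hψ.const_mul 2) h0 ht)
        (intervalIntegrable_of_timeMeasure (hcX.add ((hi n m).const_mul 2)) h0 ht) ?_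
      refine ae_restrict_of_ae_restrict_of_subset (Icc_subset_Icc_right ht.2) ?_
      filter_upwards [hmono, ae_restrict_mem measurableSet_Icc] with s hs hs'
      have e3 := hs (y n s) (y m s) (by rw [h.version]; exact hR n s hs')
        (by rw [h.version]; exact hR m s hs')
      rw [h.version, h.version] at e3
      rw [hid]
      simp only [hcdef]
      linarith
    rw [intervalIntegral.integral_add (intervalIntegrable_of_timeMeasure hcX h0 ht)
      (intervalIntegrable_of_timeMeasure ((hi n m).const_mul 2) h0 ht),
      intervalIntegral.integral_const_mul] at e2
    have e4 := (abs_le.1 (hδ t ht)).2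
    linarith
  refine hgron.trans ?_
  gcongr
  calc ∫ s in (0 : ℝ)..t, c s ≤ ∫ s, c s ∂(timeMeasure T) := by
        rw [intervalIntegral.integral_of_le ht.1, timeMeasure]
        refine setIntegral_mono_set hci hc0 ?_
        exact (Ioc_subset_Icc_self.trans (Icc_subset_Icc_right ht.2)).eventuallyLE
    _ = C * ((∫ s, κ s ∂(timeMeasure T)) + (∫ s, ‖y n s‖ ^ β ∂(timeMeasure T))
          + ∫ s, ‖y m s‖ ^ β ∂(timeMeasure T)) := by
        have e1 : Integrable (fun s => κ s + ‖y n s‖ ^ β) (timeMeasure T) :=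
          hc.integrable.add (hyi n)
        rw [hcdef, integral_const_mul, integral_add e1 (hyi m),
          integral_add hc.integrable (hyi n)]
    _ ≤ _ := by
        gcongr
        · exact hK n
        · exact hK m

/-- The Galerkin approximations converge strongly in `C([0, T]; H)`. -/
theorem GalerkinLimit.tendstoUniformlyOn [BorelSpace V]
    [SecondCountableTopology (StrongDual ℝ V)]
    (h : GalerkinLimit T β ι κ L 𝒢 D x W Y y g Yl yl ξ R K) :
    TendstoUniformlyOn Y Yl atTop (Icc 0 T) := by
  have := holderTriple_ofReal h.one_lt
  have h0 : (0 : ℝ) ∈ Icc 0 T := ⟨le_rfl, h.pos.le⟩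
  obtain ⟨M, M', k, B, h1, h2, -, h4, h5, h6, -⟩ := h.mixed
  obtain ⟨R', hR'⟩ := h.evol.bdd
  have hGm := fun n => h.core.aestronglyMeasurable_apply (h.seq.memLp n).1
  have hmix := fun n => (h1 n).sub (mixedBound_toDual (ι := ι) (μ := timeMeasure T) (g n))
  have hdm := fun n => (hGm n).sub ((toDual ι).continuous.comp_aestronglyMeasurable
    (h.seq.integrable n).1)
  have hM := fun n => (h2 n).norm.add (MemLp.zero' (ε := ℝ) (p := ENNReal.ofReal (β / (β - 1)))
    (μ := timeMeasure T)).norm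
  have hk := fun n => h6.norm.add (h.seq.integrable n).norm.norm
  have hi : ∀ n m, Integrable (fun s => (𝒢 s (y n s) - toDual ι (g n s)) (y m s))
      (timeMeasure T) := fun n m =>
    (hmix n).integrable (p := ENNReal.ofReal β) (hdm n) (hM n) (hk n) (h.seq.memLp m)
      (h.ae_norm_le m)
  have hil : ∀ n, Integrable (fun s => (𝒢 s (y n s) - toDual ι (g n s)) (yl s))
      (timeMeasure T) := fun n =>
    (hmix n).integrable (p := ENNReal.ofReal β) (hdm n) (hM n) (hk n) h.evol.memLp
      (h.evol.ae_norm_le hR')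
  obtain ⟨A, hA⟩ := h.seq.exists_norm_sub_sq_le h.core h.pos h.one_lt h.norm_le h.integral_le hi
  rw [Metric.tendstoUniformlyOn_iff]
  intro ε hε
  -- Chosen so that `6 δ exp A = (ε / 2) ^ 2`: a share `2 δ` for the initial values and `2 (2 δ)`
  -- for the defect.
  set δ : ℝ := (ε / 2) ^ 2 / (6 * Real.exp A) with hδ
  have hδ0 : 0 < δ := by positivity
  have hinit : ∀ᶠ n in atTop, ‖Y n 0 - x‖ ^ 2 < 2 * δ := by
    have e1 := ((h.seq.init.sub_const x).norm.pow 2)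
    rw [sub_self, norm_zero, zero_pow two_ne_zero] at e1
    exact e1.eventually_lt_const (by positivity)
  filter_upwards [h.smallPrimitive_defect δ hδ0, hinit] with n hn hn0 t ht
  -- With `n` fixed and `m → ∞`, the defect at `y m` approaches the defect at `yl`, already small;
  -- then weak lower semicontinuity of the norm carries the bound from `Y m` to `Yl`.
  have hs : SmallPrimitive T fun m s => (𝒢 s (y n s) - toDual ι (g n s)) (y m s - yl s) :=
    SmallPrimitive.of_tendsto (h.tendsto_lintegral_sub (hmix n) (hdm n) (hM n) (hk n))
  have hm0 : ∀ᶠ m in atTop, ‖Y n 0 - Y m 0‖ ^ 2 < 2 * δ :=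
    ((tendsto_const_nhds.sub h.seq.init).norm.pow 2).eventually_lt_const hn0
  have hev : ∀ᶠ m in atTop, ‖Y n t - Y m t‖ ≤ ε / 2 := by
    filter_upwards [hs δ hδ0, hm0, eventually_ge_atTop n] with m a1 a2 a3
    have e1 := hA n m a3 (2 * δ) (by positivity) (fun t ht => by
      have e2 : ∫ s in (0 : ℝ)..t, (𝒢 s (y n s) - toDual ι (g n s)) (y m s)
          = (∫ s in (0 : ℝ)..t, (𝒢 s (y n s) - toDual ι (g n s)) (y m s - yl s))
            + ∫ s in (0 : ℝ)..t, (𝒢 s (y n s) - toDual ι (g n s)) (yl s) := by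
        have e4 : Integrable (fun s => (𝒢 s (y n s) - toDual ι (g n s)) (y m s - yl s))
            (timeMeasure T) := by
          simp only [map_sub]
          exact (hi n m).sub (hil n)
        rw [← intervalIntegral.integral_add (intervalIntegrable_of_timeMeasure e4 h0 ht)
          (intervalIntegrable_of_timeMeasure (hil n) h0 ht)]
        refine intervalIntegral.integral_congr fun s _ => ?_
        simp only [map_sub, sub_add_cancel]
      rw [e2]
      refine (abs_add_le _ _).trans ?_
      linarith [a1 t ht, hn t ht]) t ht
    have e3 : (‖Y n 0 - Y m 0‖ ^ 2 + 2 * (2 * δ)) * Real.exp A ≤ (ε / 2) ^ 2 := by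
      calc (‖Y n 0 - Y m 0‖ ^ 2 + 2 * (2 * δ)) * Real.exp A ≤ (6 * δ) * Real.exp A := by
            gcongr
            linarith
        _ = (ε / 2) ^ 2 := by rw [hδ]; field_simp
    exact (sq_le_sq₀ (norm_nonneg _) (by positivity)).1 (e1.trans e3)
  have hle : ‖Y n t - Yl t‖ ≤ ε / 2 := by
    refine norm_le_of_tendsto_inner hev ?_
    have e1 := (h.seq.tendsto_inner h.dense h.dense_seq h.norm_le h.weak ht
      (Y n t - Yl t)).const_sub (inner ℝ (Y n t) (Y n t - Yl t))
    rw [← inner_sub_left] at e1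
    exact e1.congr fun m => by rw [inner_sub_left]
  rw [dist_comm, dist_eq_norm]
  linarith

end Core

theorem SmallPrimitive.tendsto {T : ℝ} {φ : ℕ → ℝ → ℝ} (h : SmallPrimitive T φ) {t : ℝ}
    (ht : t ∈ Icc 0 T) : Tendsto (fun n => ∫ s in (0 : ℝ)..t, φ n s) atTop (𝓝 0) := by
  rw [Metric.tendsto_nhds]
  intro ε hε
  filter_upwards [h (ε / 2) (by positivity)] with n hn
  rw [Real.dist_eq, sub_zero]
  exact (hn t ht).trans_lt (by linarith)

theorem intervalIntegral_le_integral_timeMeasure {T : ℝ} {f : ℝ → ℝ}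
    (hf : Integrable f (timeMeasure T)) (hf0 : ∀ᵐ s ∂(timeMeasure T), 0 ≤ f s) {t : ℝ}
    (ht : t ∈ Icc 0 T) : ∫ s in (0 : ℝ)..t, f s ≤ ∫ s, f s ∂(timeMeasure T) := by
  rw [intervalIntegral.integral_of_le ht.1, timeMeasure]
  refine setIntegral_mono_set hf hf0 ?_
  exact (Ioc_subset_Icc_self.trans (Icc_subset_Icc_right ht.2)).eventuallyLE

/-! ### Identification of the weak derivative -/

section Core

variable {H V : Type*} [NormedAddCommGroup H] [InnerProductSpace ℝ H] [CompleteSpace H]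
  [NormedAddCommGroup V] [NormedSpace ℝ V] [MeasurableSpace V]
  {T β : ℝ} {ι : V →L[ℝ] H} {κ : ℝ → ℝ} {L : ℝ} {𝒢 : ℝ → V → StrongDual ℝ V}
  {D : ℕ → V} {x : H} {W : ℕ → Submodule ℝ V}
  {Y : ℕ → ℝ → H} {y : ℕ → ℝ → V} {g : ℕ → ℝ → H} {Yl : ℝ → H} {yl : ℝ → V}
  {ξ : ℝ → StrongDual ℝ V} {R K : ℝ}

theorem CoreHyp.integrable_apply [BorelSpace V] [SecondCountableTopology (StrongDual ℝ V)]
    (hc : CoreHyp T β ι κ L 𝒢) (hβ : 1 < β) {w z : ℝ → V} {R R' : ℝ}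
    (hw : MemLp w (ENNReal.ofReal β) (timeMeasure T))
    (hwR : ∀ᵐ s ∂(timeMeasure T), ‖ι (w s)‖ ≤ R)
    (hz : MemLp z (ENNReal.ofReal β) (timeMeasure T))
    (hzR : ∀ᵐ s ∂(timeMeasure T), ‖ι (z s)‖ ≤ R') :
    Integrable (fun s => 𝒢 s (w s) (z s)) (timeMeasure T) := by
  have := holderTriple_ofReal hβ
  obtain ⟨C, -, hmix⟩ := hc.exists_mixedBound hβ R
  obtain ⟨M, h1, h2, -⟩ := hmix w hw hwR
  exact h1.integrable (p := ENNReal.ofReal β) (hc.aestronglyMeasurable_apply hw.1) h2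
    (hc.integrable.const_mul C) hz hzR

/-- Minty's inequality for the limit of the Galerkin approximations. -/
theorem GalerkinLimit.exists_minty_le [BorelSpace V] [SecondCountableTopology (StrongDual ℝ V)]
    (h : GalerkinLimit T β ι κ L 𝒢 D x W Y y g Yl yl ξ R K) :
    ∃ C : ℝ, 0 ≤ C ∧ ∀ (w : ℝ → V) (r : ℝ), MemLp w (ENNReal.ofReal β) (timeMeasure T) → 0 ≤ r →
      r ≤ 1 → (∀ᵐ s ∂(timeMeasure T), ‖ι (w s) - Yl s‖ ≤ r) → ∀ t ∈ Icc 0 T,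
      2 * ∫ s in (0 : ℝ)..t, (ξ s - 𝒢 s (w s)) (yl s - w s)
        ≤ r ^ 2 * (C * ((∫ s, κ s ∂(timeMeasure T)) + K + ∫ s, ‖w s‖ ^ β ∂(timeMeasure T))) := by
  have := holderTriple_ofReal h.one_lt
  have h0 : (0 : ℝ) ∈ Icc 0 T := ⟨le_rfl, h.pos.le⟩
  have hβ0 : 0 < β := zero_lt_one.trans h.one_lt
  obtain ⟨R', hR'⟩ := h.evol.bdd
  obtain ⟨C, hC, hmono⟩ := h.core.mono (max R (R' + 1))
  refine ⟨C, hC, fun w r hw hr0 hr1 hwr t ht => ?_⟩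
  have hwR : ∀ᵐ s ∂(timeMeasure T), ‖ι (w s)‖ ≤ R' + 1 := by
    filter_upwards [hwr, ae_restrict_mem measurableSet_Icc] with s h1 h2
    have := norm_le_norm_add_norm_sub' (ι (w s)) (Yl s)
    linarith [hR' s h2]
  obtain ⟨C₁, -, hmix⟩ := h.core.exists_mixedBound h.one_lt (R' + 1)
  obtain ⟨Mw, hw1, hw2, -⟩ := hmix w hw hwR
  have hwm := h.core.aestronglyMeasurable_apply hw.1
  have hylR := h.evol.ae_norm_le hR'
  have i1 := fun n => h.core.integrable_apply h.one_lt (h.seq.memLp n) (h.ae_norm_le n)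
    (h.seq.memLp n) (h.ae_norm_le n)
  have i2 := fun n => h.core.integrable_apply h.one_lt (h.seq.memLp n) (h.ae_norm_le n) hw hwR
  have i3 := fun n => h.core.integrable_apply h.one_lt hw hwR (h.seq.memLp n) (h.ae_norm_le n)
  have i4 := h.core.integrable_apply h.one_lt hw hwR hw hwR
  have i5 := h.core.integrable_apply h.one_lt hw hwR h.evol.memLp hylR
  obtain ⟨_, Mξ, kξ, _, -, -, -, hξ1, hξ2, hξ3, -⟩ := h.mixed
  have i6 : Integrable (fun s => ξ s (w s)) (timeMeasure T) :=
    hξ1.integrable (p := ENNReal.ofReal β) h.evol.meas hξ2 hξ3 hw hwR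
  have hII : ∀ {f : ℝ → ℝ}, Integrable f (timeMeasure T) → IntervalIntegrable f volume 0 t :=
    fun hf => intervalIntegrable_of_timeMeasure hf h0 ht
  have hstrong := h.tendstoUniformlyOn
  -- The only pairing in which both factors merely converge weakly. The energy equalities express it
  -- through norms, and strong convergence applies.
  have l1 : Tendsto (fun n => ∫ s in (0 : ℝ)..t, 𝒢 s (y n s) (y n s)) atTop
      (𝓝 (∫ s in (0 : ℝ)..t, ξ s (yl s))) := by
    have e1 : ∀ n, ∫ s in (0 : ℝ)..t, 𝒢 s (y n s) (y n s)
        = (‖Y n t‖ ^ 2 - ‖Y n 0‖ ^ 2) / 2 := by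
      intro n
      rw [norm_sq_eq_add_integral h.pos (h.seq.integrable n) (h.seq.eq n) ht]
      have : ∫ s in (0 : ℝ)..t, inner ℝ (g n s) (Y n s) = ∫ s in (0 : ℝ)..t, 𝒢 s (y n s)
          (y n s) := by
        refine intervalIntegral.integral_congr fun s _ => ?_
        rw [← h.seq.pair n s _ (h.seq.mem n s), h.seq.version]
      rw [this]
      ring
    have e2 := h.evol.energy h.pos h.one_le_ofReal ENNReal.ofReal_ne_top h.dense ht
    rw [show ∫ s in (0 : ℝ)..t, ξ s (yl s) = (‖Yl t‖ ^ 2 - ‖Yl 0‖ ^ 2) / 2 by linarith]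
    simp_rw [e1]
    exact ((((hstrong.tendsto_at ht).norm.pow 2).sub ((hstrong.tendsto_at h0).norm.pow 2)).div_const
      2)
  have l2 : Tendsto (fun n => ∫ s in (0 : ℝ)..t, 𝒢 s (y n s) (w s)) atTop
      (𝓝 (∫ s in (0 : ℝ)..t, ξ s (w s))) := by
    have e1 := ((h.smallPrimitive_sub_apply hw hwR).tendsto ht).add_const
      (∫ s in (0 : ℝ)..t, ξ s (w s))
    rw [zero_add] at e1
    refine e1.congr fun n => ?_
    simp only [sub_apply]
    rw [intervalIntegral.integral_sub (hII (i2 n)) (hII i6), sub_add_cancel]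
  have l3 : Tendsto (fun n => ∫ s in (0 : ℝ)..t, 𝒢 s (w s) (y n s)) atTop
      (𝓝 (∫ s in (0 : ℝ)..t, 𝒢 s (w s) (yl s))) := by
    have e1 := ((SmallPrimitive.of_tendsto (h.tendsto_lintegral_sub hw1 hwm hw2
      (h.core.integrable.const_mul C₁))).tendsto ht).add_const
      (∫ s in (0 : ℝ)..t, 𝒢 s (w s) (yl s))
    rw [zero_add] at e1
    refine e1.congr fun n => ?_
    simp only [map_sub]
    rw [intervalIntegral.integral_sub (hII (i3 n)) (hII i5), sub_add_cancel]
  have hsplit : ∀ (F : ℝ → StrongDual ℝ V) (z : ℝ → V),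
      Integrable (fun s => F s (z s)) (timeMeasure T) →
      Integrable (fun s => F s (w s)) (timeMeasure T) →
      Integrable (fun s => 𝒢 s (w s) (z s)) (timeMeasure T) →
      ∫ s in (0 : ℝ)..t, (F s - 𝒢 s (w s)) (z s - w s)
        = (∫ s in (0 : ℝ)..t, F s (z s)) - (∫ s in (0 : ℝ)..t, F s (w s))
          - (∫ s in (0 : ℝ)..t, 𝒢 s (w s) (z s)) + ∫ s in (0 : ℝ)..t, 𝒢 s (w s) (w s) := by
    intro F z a1 a2 a3
    rw [← intervalIntegral.integral_sub (hII a1) (hII a2),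
      ← intervalIntegral.integral_sub ((hII a1).sub (hII a2)) (hII a3),
      ← intervalIntegral.integral_add (((hII a1).sub (hII a2)).sub (hII a3)) (hII i4)]
    refine intervalIntegral.integral_congr fun s _ => ?_
    simp only [sub_apply, map_sub]
    ring
  have hlim : Tendsto (fun n => 2 * ∫ s in (0 : ℝ)..t, (𝒢 s (y n s) - 𝒢 s (w s)) (y n s - w s))
      atTop
      (𝓝 (2 * ∫ s in (0 : ℝ)..t, (ξ s - 𝒢 s (w s)) (yl s - w s))) := by
    rw [hsplit ξ yl h.evol.integrable_apply i6 i5]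
    simp_rw [fun n => hsplit (fun s => 𝒢 s (y n s)) (y n) (i1 n) (i2 n) (i3 n)]
    exact (((l1.sub l2).sub l3).add_const _).const_mul 2
  set Q : ℝ := C * ((∫ s, κ s ∂(timeMeasure T)) + K + ∫ s, ‖w s‖ ^ β ∂(timeMeasure T)) with hQ
  have hwi := integrable_norm_rpow hβ0 hw
  -- By strong convergence `‖ι (y n) - ι w‖ ≤ η + r` eventually, at almost every time, so the error,
  -- though weighted by `‖y n‖ ^ β`, is at most `(η + r) ^ 2 Q`.
  have hη : ∀ η : ℝ, 0 < η →
      2 * ∫ s in (0 : ℝ)..t, (ξ s - 𝒢 s (w s)) (yl s - w s) ≤ (η + r) ^ 2 * Q := by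
    intro η hη
    refine le_of_tendsto hlim ?_
    filter_upwards [Metric.tendstoUniformlyOn_iff.1 hstrong η hη] with n hn
    have hyi := integrable_norm_rpow hβ0 (h.seq.memLp n)
    have hκi : Integrable (fun s => κ s + ‖y n s‖ ^ β) (timeMeasure T) := h.core.integrable.add hyi
    have hci : Integrable (fun s => C * (κ s + ‖y n s‖ ^ β + ‖w s‖ ^ β)) (timeMeasure T) :=
      (hκi.add hwi).const_mul C
    have hc0 : ∀ᵐ s ∂(timeMeasure T), 0 ≤ C * (κ s + ‖y n s‖ ^ β + ‖w s‖ ^ β) := by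
      filter_upwards [h.core.one_le] with s hs
      positivity
    have hi : Integrable (fun s => (𝒢 s (y n s) - 𝒢 s (w s)) (y n s - w s)) (timeMeasure T) := by
      simp only [sub_apply, map_sub]
      exact ((i1 n).sub (i3 n)).sub ((i2 n).sub i4)
    calc 2 * ∫ s in (0 : ℝ)..t, (𝒢 s (y n s) - 𝒢 s (w s)) (y n s - w s)
        ≤ ∫ s in (0 : ℝ)..t, (η + r) ^ 2 * (C * (κ s + ‖y n s‖ ^ β + ‖w s‖ ^ β)) := by
          rw [← intervalIntegral.integral_const_mul]
          refine intervalIntegral.integral_mono_ae_restrict ht.1 (hII (hi.const_mul 2))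
            (hII (hci.const_mul _)) ?_
          refine ae_restrict_of_ae_restrict_of_subset (Icc_subset_Icc_right ht.2) ?_
          filter_upwards [hmono, ae_restrict_mem measurableSet_Icc, hwr, hwR, hc0]
            with s a1 a2 a3 a4 a5
          have a6 := a1 (y n s) (w s)
            (by rw [h.seq.version]; exact (h.norm_le n s a2).trans (le_max_left _ _))
            (a4.trans (le_max_right _ _))
          have a7 : ‖ι (y n s) - ι (w s)‖ ≤ η + r := by
            rw [h.seq.version, ← sub_add_sub_cancel _ (Yl s)]
            refine (norm_add_le _ _).trans (add_le_add ?_ ?_)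
            · rw [← dist_eq_norm, dist_comm]; exact (hn s a2).le
            · rw [norm_sub_rev]; exact a3
          refine a6.trans ?_
          rw [mul_comm]
          gcongr
      _ ≤ (η + r) ^ 2 * Q := by
          rw [intervalIntegral.integral_const_mul]
          gcongr
          refine (intervalIntegral_le_integral_timeMeasure hci hc0 ht).trans ?_
          rw [integral_const_mul, integral_add hκi hwi, integral_add h.core.integrable hyi, hQ]
          gcongr
          exact h.integral_le n
  have hcont : Tendsto (fun η : ℝ => (η + r) ^ 2 * Q) (𝓝[>] 0) (𝓝 ((0 + r) ^ 2 * Q)) :=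
    (Continuous.tendsto (by fun_prop) 0).mono_left nhdsWithin_le_nhds
  rw [zero_add] at hcont
  exact ge_of_tendsto hcont (by filter_upwards [self_mem_nhdsWithin] with η hη' using hη η hη')

/-- Minty's inequality with `w = yl - r v`: the left side carries a factor `r`, the right side `r ^
2`. Divide by `r` and let `r` tend to zero, using hemicontinuity and dominated convergence. -/
theorem GalerkinLimit.integral_sub_apply_le [BorelSpace V]
    [SecondCountableTopology (StrongDual ℝ V)]
    (h : GalerkinLimit T β ι κ L 𝒢 D x W Y y g Yl yl ξ R K) (v : V) {t : ℝ} (ht : t ∈ Icc 0 T) :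
    ∫ s in (0 : ℝ)..t, (ξ s - 𝒢 s (yl s)) v ≤ 0 := by
  have := holderTriple_ofReal h.one_lt
  have h0 : (0 : ℝ) ∈ Icc 0 T := ⟨le_rfl, h.pos.le⟩
  have hβ0 : 0 < β := zero_lt_one.trans h.one_lt
  obtain ⟨C, hC, hM⟩ := h.exists_minty_le
  obtain ⟨R', hR'⟩ := h.evol.bdd
  have hylR := h.evol.ae_norm_le hR'
  obtain ⟨C₁, hC₁, hb⟩ := h.core.exists_norm_le h.one_lt (R' + 1)
  have hvL : MemLp (fun _ : ℝ => v) (ENNReal.ofReal β) (timeMeasure T) := memLp_const v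
  have hw : ∀ r : ℝ, MemLp (fun s => yl s + r • (-v)) (ENNReal.ofReal β) (timeMeasure T) :=
    fun r => h.evol.memLp.add (memLp_const _)
  have hbd := integrable_norm_rpow hβ0 (h.evol.memLp.norm.add hvL.norm)
  set b : ℝ → ℝ := fun s => ‖‖yl s‖ + ‖v‖‖ ^ β with hbdef
  have hbd' : Integrable b (timeMeasure T) := hbd
  have hwle : ∀ r : ℝ, 0 ≤ r → r ≤ 1 → ∀ s, ‖yl s + r • (-v)‖ ^ β ≤ b s := by
    intro r hr0 hr1 s
    simp only [hbdef]
    rw [Real.norm_of_nonneg (show 0 ≤ ‖yl s‖ + ‖v‖ by positivity)]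
    refine Real.rpow_le_rpow (norm_nonneg _) ((norm_add_le _ _).trans ?_) hβ0.le
    gcongr
    rw [norm_smul, norm_neg, Real.norm_of_nonneg hr0]
    exact mul_le_of_le_one_left (norm_nonneg _) hr1
  set Q : ℝ := C * ((∫ s, κ s ∂(timeMeasure T)) + K + ∫ s, b s ∂(timeMeasure T)) with hQ
  have hsmall : ∀ᶠ r : ℝ in 𝓝[>] 0, 0 < r ∧ r ≤ 1 ∧ r * ‖ι v‖ ≤ 1 := by
    have e1 : Tendsto (fun r : ℝ => r * ‖ι v‖) (𝓝[>] 0) (𝓝 (0 * ‖ι v‖)) :=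
      (Continuous.tendsto (by fun_prop) 0).mono_left nhdsWithin_le_nhds
    rw [zero_mul] at e1
    filter_upwards [Ioc_mem_nhdsGT (zero_lt_one' ℝ), e1.eventually_le_const zero_lt_one]
      with r hr hr' using ⟨hr.1, hr.2, hr'⟩
  have hwv : ∀ r : ℝ, 0 < r → ∀ᵐ s ∂(timeMeasure T), ‖ι (yl s + r • (-v)) - Yl s‖ ≤ r * ‖ι v‖ := by
    intro r hr
    filter_upwards [h.evol.version] with s hs
    rw [map_add, hs, add_sub_cancel_left, map_smul, map_neg, norm_smul, norm_neg,
      Real.norm_of_nonneg hr.le]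
  have hle : ∀ᶠ r : ℝ in 𝓝[>] 0,
      ∫ s in (0 : ℝ)..t, (ξ s - 𝒢 s (yl s + r • (-v))) v ≤ r * (‖ι v‖ ^ 2 * Q / 2) := by
    filter_upwards [hsmall] with r hr
    have e1 := hM _ (r * ‖ι v‖) (hw r) (by have := hr.1; positivity) hr.2.2 (hwv r hr.1) t ht
    have e2 : ∫ s in (0 : ℝ)..t, (ξ s - 𝒢 s (yl s + r • (-v))) (yl s - (yl s + r • (-v)))
        = r * ∫ s in (0 : ℝ)..t, (ξ s - 𝒢 s (yl s + r • (-v))) v := by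
      rw [← intervalIntegral.integral_const_mul]
      refine intervalIntegral.integral_congr fun s _ => ?_
      rw [show yl s - (yl s + r • (-v)) = r • v by simp, map_smul, smul_eq_mul]
    rw [e2] at e1
    have e3 : ∫ s, ‖yl s + r • (-v)‖ ^ β ∂(timeMeasure T) ≤ ∫ s, b s ∂(timeMeasure T) :=
      integral_mono (integrable_norm_rpow hβ0 (hw r)) hbd' (hwle r hr.1.le hr.2.1)
    have e4 : (r * ‖ι v‖) ^ 2 * (C * ((∫ s, κ s ∂(timeMeasure T)) + K
        + ∫ s, ‖yl s + r • (-v)‖ ^ β ∂(timeMeasure T))) ≤ (r * ‖ι v‖) ^ 2 * Q := by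
      rw [hQ]; gcongr
    have e5 : r * ∫ s in (0 : ℝ)..t, (ξ s - 𝒢 s (yl s + r • (-v))) v
        ≤ r * (r * (‖ι v‖ ^ 2 * Q / 2)) := by
      calc _ ≤ (r * ‖ι v‖) ^ 2 * Q / 2 := by linarith
        _ = _ := by ring
    exact le_of_mul_le_mul_left e5 hr.1
  have hlim : Tendsto (fun r : ℝ => ∫ s in (0 : ℝ)..t, (ξ s - 𝒢 s (yl s + r • (-v))) v) (𝓝[>] 0)
      (𝓝 (∫ s in (0 : ℝ)..t, (ξ s - 𝒢 s (yl s)) v)) := by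
    have hsub : uIoc 0 t ⊆ Icc 0 T := by
      rw [uIoc_of_le ht.1]
      exact Ioc_subset_Icc_self.trans (Icc_subset_Icc_right ht.2)
    have hres : ∀ {P : ℝ → Prop}, (∀ᵐ s ∂(timeMeasure T), P s) →
        ∀ᵐ s, s ∈ uIoc 0 t → P s := by
      intro P hP
      have := (ae_restrict_iff' measurableSet_Icc).1 hP
      filter_upwards [this] with s hs hs' using hs (hsub hs')
    refine intervalIntegral.tendsto_integral_filter_of_dominated_convergence
      (fun s => ‖ξ s v‖ + C₁ * (κ s + b s) * ‖v‖) ?_ ?_ ?_ ?_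
    · refine Eventually.of_forall fun r => ?_
      have e1 := aestronglyMeasurable_clm_apply (h.evol.meas.sub
        (h.core.aestronglyMeasurable_apply (hw r).1)) hvL.1
      exact e1.mono_measure (Measure.restrict_mono hsub le_rfl)
    · filter_upwards [hsmall] with r hr
      refine hres ?_
      filter_upwards [hb, hwv r hr.1, ae_restrict_mem measurableSet_Icc] with s a1 a2 a3
      have a4 : ‖ι (yl s + r • (-v))‖ ≤ R' + 1 := by
        have := norm_le_norm_add_norm_sub' (ι (yl s + r • (-v))) (Yl s)
        linarith [hR' s a3, hr.2.2]
      rw [sub_apply]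
      refine (norm_sub_le _ _).trans ?_
      gcongr
      refine (ContinuousLinearMap.le_opNorm _ _).trans ?_
      gcongr
      refine (a1 _ a4).trans ?_
      gcongr
      exact hwle r hr.1.le hr.2.1 s
    · refine intervalIntegrable_of_timeMeasure ?_ h0 ht
      exact (h.evol.integrable_const_apply v).norm.add
        (((h.core.integrable.add hbd').const_mul C₁).mul_const _)
    · refine hres ?_
      filter_upwards [h.core.hemi] with s hs
      simp only [sub_apply]
      have e1 := ((hs (yl s) (-v) v).tendsto 0).const_sub (ξ s v)
      rw [zero_smul, add_zero] at e1
      exact e1.mono_left nhdsWithin_le_nhds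
  have hlim0 : Tendsto (fun r : ℝ => r * (‖ι v‖ ^ 2 * Q / 2)) (𝓝[>] 0)
      (𝓝 (0 * (‖ι v‖ ^ 2 * Q / 2))) :=
    (Continuous.tendsto (by fun_prop) 0).mono_left nhdsWithin_le_nhds
  rw [zero_mul] at hlim0
  exact le_of_tendsto_of_tendsto hlim hlim0 hle

theorem GalerkinLimit.integral_eq [BorelSpace V] [SecondCountableTopology (StrongDual ℝ V)]
    (h : GalerkinLimit T β ι κ L 𝒢 D x W Y y g Yl yl ξ R K) (v : V) {t : ℝ} (ht : t ∈ Icc 0 T) :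
    ∫ s in (0 : ℝ)..t, ξ s v = ∫ s in (0 : ℝ)..t, 𝒢 s (yl s) v := by
  have := holderTriple_ofReal h.one_lt
  have h0 : (0 : ℝ) ∈ Icc 0 T := ⟨le_rfl, h.pos.le⟩
  obtain ⟨R', hR'⟩ := h.evol.bdd
  have e1 := h.integral_sub_apply_le v ht
  have e2 := h.integral_sub_apply_le (-v) ht
  simp only [map_neg, intervalIntegral.integral_neg] at e2
  have e3 : ∫ s in (0 : ℝ)..t, (ξ s - 𝒢 s (yl s)) v
      = (∫ s in (0 : ℝ)..t, ξ s v) - ∫ s in (0 : ℝ)..t, 𝒢 s (yl s) v := by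
    rw [← intervalIntegral.integral_sub
      (intervalIntegrable_of_timeMeasure (h.evol.integrable_const_apply v) h0 ht)
      (intervalIntegrable_of_timeMeasure (h.core.integrable_apply h.one_lt h.evol.memLp
        (h.evol.ae_norm_le hR') (memLp_const v) (Eventually.of_forall fun _ => le_rfl)) h0 ht)]
    rfl
  linarith

end Core

/-! ### Existence, uniqueness and energy bound for the abstract equation -/

section Core

variable {H V : Type*} [NormedAddCommGroup H] [InnerProductSpace ℝ H] [CompleteSpace H]
  [NormedAddCommGroup V] [NormedSpace ℝ V] [MeasurableSpace V]
  {T β : ℝ} {ι : V →L[ℝ] H} {κ : ℝ → ℝ} {L : ℝ} {𝒢 : ℝ → V → StrongDual ℝ V} {x : H}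
  {Y Y' : ℝ → H} {y y' : ℝ → V}

theorem toDual_injective (hι : DenseRange ι) : Function.Injective (toDual ι) := by
  intro x y hxy
  have h1 : inner ℝ x = (inner ℝ y : H → ℝ) := by
    refine hι.equalizer (by fun_prop) (by fun_prop) (funext fun v => ?_)
    have := DFunLike.congr_fun hxy v
    simpa only [toDual_apply_apply, Function.comp_apply] using this
  exact ext_inner_right ℝ fun w => congrFun h1 w

/-- `Y` solves `Y' = 𝒢(t, Y)`, `Y(0) = x`, with the `V`-valued version `y`. -/
structure CoreSol (T β : ℝ) (ι : V →L[ℝ] H) (𝒢 : ℝ → V → StrongDual ℝ V) (x : H) (Y : ℝ → H)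
    (y : ℝ → V) : Prop where
  continuousOn : ContinuousOn Y (Icc 0 T)
  memLp : MemLp y (ENNReal.ofReal β) (timeMeasure T)
  version : ∀ᵐ t ∂(timeMeasure T), ι (y t) = Y t
  integrable : Integrable (fun s => 𝒢 s (y s)) (timeMeasure T)
  eq : ∀ t ∈ Icc 0 T, toDual ι (Y t) = toDual ι x + ∫ s in (0 : ℝ)..t, 𝒢 s (y s)

theorem CoreSol.start (h : CoreSol T β ι 𝒢 x Y y) (hT : 0 < T) (hι : DenseRange ι) : Y 0 = x := by
  refine toDual_injective hι ?_
  rw [h.eq 0 ⟨le_rfl, hT.le⟩]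
  simp

theorem CoreSol.exists_norm_le (h : CoreSol T β ι 𝒢 x Y y) :
    ∃ R, (∀ t ∈ Icc 0 T, ‖Y t‖ ≤ R) ∧ ∀ᵐ t ∂(timeMeasure T), ‖ι (y t)‖ ≤ R := by
  obtain ⟨R, hR⟩ := isCompact_Icc.exists_bound_of_continuousOn h.continuousOn
  refine ⟨R, hR, ?_⟩
  filter_upwards [h.version, ae_restrict_mem measurableSet_Icc] with t h1 h2
  rw [h1]
  exact hR t h2

theorem CoreSol.evol (h : CoreSol T β ι 𝒢 x Y y) (hc : CoreHyp T β ι κ L 𝒢) (hT : 0 < T)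
    (hβ : 1 < β) (hι : DenseRange ι) :
    Evol T (ENNReal.ofReal β) (ENNReal.ofReal (β / (β - 1))) ι Y y fun s => 𝒢 s (y s) where
  memLp := h.memLp
  version := h.version
  bdd := h.exists_norm_le.imp fun _ h => h.1
  meas := h.integrable.1
  mixed := by
    obtain ⟨R, -, hR⟩ := h.exists_norm_le
    obtain ⟨C, -, hC⟩ := hc.exists_mixedBound hβ R
    obtain ⟨M, h1, h2, -⟩ := hC y h.memLp hR
    exact ⟨M, _, h2, hc.integrable.const_mul C, h1⟩
  eq t ht v := by
    have h0 : (0 : ℝ) ∈ Icc 0 T := ⟨le_rfl, hT.le⟩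
    have e := DFunLike.congr_fun (h.eq t ht) v
    rw [add_apply, toDual_apply_apply, toDual_apply_apply,
      ContinuousLinearMap.intervalIntegral_apply
        (intervalIntegrable_of_timeMeasure h.integrable h0 ht)] at e
    rw [e, h.start hT hι]

/-- Energy equality for the difference, then Grönwall's inequality. Both solutions are bounded in
`H`, which fixes the constant of local monotonicity, and lie in `L^β(V)`, which makes the weight
integrable. -/
theorem CoreSol.eqOn (h : CoreSol T β ι 𝒢 x Y y) (h' : CoreSol T β ι 𝒢 x Y' y')
    (hc : CoreHyp T β ι κ L 𝒢) (hT : 0 < T) (hβ : 1 < β) (hι : DenseRange ι)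
    (hinj : Function.Injective ι) : EqOn Y' Y (Icc 0 T) ∧ y' =ᵐ[timeMeasure T] y := by
  suffices hE : EqOn Y' Y (Icc 0 T) by
    refine ⟨hE, ?_⟩
    filter_upwards [h.version, h'.version, ae_restrict_mem measurableSet_Icc] with t h1 h2 h3
    exact hinj (by rw [h1, h2, hE h3])
  have := holderTriple_ofReal hβ
  have h0 : (0 : ℝ) ∈ Icc 0 T := ⟨le_rfl, hT.le⟩
  obtain ⟨R, hR, hRy⟩ := h.exists_norm_le
  obtain ⟨R', hR', hRy'⟩ := h'.exists_norm_le
  obtain ⟨C, hC, hmono⟩ := hc.mono (max R R')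
  have hyi := integrable_norm_rpow (zero_lt_one.trans hβ) h.memLp
  have hyi' := integrable_norm_rpow (zero_lt_one.trans hβ) h'.memLp
  set c : ℝ → ℝ := fun s => C * (κ s + ‖y s‖ ^ β + ‖y' s‖ ^ β) with hcdef
  have hci : Integrable c (timeMeasure T) :=
    ((hc.integrable.add hyi).add hyi').const_mul C
  have hc0 : ∀ᵐ s ∂(timeMeasure T), 0 ≤ c s := by
    filter_upwards [hc.one_le] with s hs
    positivity
  have hE := (h.evol hc hT hβ hι).sub (h'.evol hc hT hβ hι)
  have hcont : ContinuousOn (fun t => ‖Y t - Y' t‖ ^ 2) (Icc 0 T) :=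
    (h.continuousOn.sub h'.continuousOn).norm.pow 2
  have hcX : Integrable (fun s => c s * ‖Y s - Y' s‖ ^ 2) (timeMeasure T) := by
    have : IntegrableOn c (Icc 0 T) volume := hci
    exact this.mul_continuousOn hcont isCompact_Icc
  intro t ht
  have key : ‖Y t - Y' t‖ ^ 2 ≤ 0 * Real.exp (∫ s in (0 : ℝ)..t, c s) := by
    refine le_mul_exp_of_le_add_integral (f := fun t => ‖Y t - Y' t‖ ^ 2) hcont hci hc0 le_rfl
      (fun t ht => ?_) ht
    rw [hE.energy hT (by rw [ENNReal.one_le_ofReal]; exact hβ.le) ENNReal.ofReal_ne_top hι ht,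
      h.start hT hι, h'.start hT hι, sub_self, norm_zero, zero_pow two_ne_zero, zero_add, zero_add,
      ← intervalIntegral.integral_const_mul]
    refine intervalIntegral.integral_mono_ae_restrict ht.1
      (intervalIntegrable_of_timeMeasure (hE.integrable_apply.const_mul 2) h0 ht)
      (intervalIntegrable_of_timeMeasure hcX h0 ht) ?_
    refine ae_restrict_of_ae_restrict_of_subset (Icc_subset_Icc_right ht.2) ?_
    filter_upwards [hmono, hRy, hRy', h.version, h'.version] with s a1 a2 a3 a4 a5
    have a6 := a1 _ _ (a2.trans (le_max_left _ _)) (a3.trans (le_max_right _ _))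
    rw [a4, a5] at a6
    exact a6
  rw [zero_mul] at key
  have : ‖Y t - Y' t‖ = 0 := by nlinarith [norm_nonneg (Y t - Y' t)]
  exact (sub_eq_zero.1 (norm_eq_zero.1 this)).symm

/-- Only an upper bound `K` for `2 ∫ κ` enters, so one constant will serve all controls in a ball.
-/
theorem CoreSol.energy_le (h : CoreSol T β ι 𝒢 x Y y) (hc : CoreHyp T β ι κ L 𝒢) (hT : 0 < T)
    (hβ : 1 < β) (hι : DenseRange ι) {K : ℝ} (hK : 2 * ∫ s, κ s ∂(timeMeasure T) ≤ K) :
    energy T β Y y ≤ ENNReal.ofReal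
      ((Real.exp K + (1 + K * Real.exp K) / (2 * L)) * (1 + ‖x‖ ^ 2)) := by
  have := holderTriple_ofReal hβ
  have hL := hc.pos
  have hκ0 : ∀ᵐ t ∂(timeMeasure T), 0 ≤ κ t := by filter_upwards [hc.one_le] with t ht; linarith
  have hE := h.evol hc hT hβ hι
  have hyi := integrable_norm_rpow (zero_lt_one.trans hβ) h.memLp
  set K₀ : ℝ := 2 * ∫ s, κ s ∂(timeMeasure T) with hK₀
  have hK0 : 0 ≤ K₀ := mul_nonneg zero_le_two (integral_nonneg_of_ae hκ0)
  obtain ⟨e1, e2⟩ := energy_bound (f := fun t => ‖Y t‖ ^ 2) (u := fun s => ‖y s‖ ^ β)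
    (b := ‖x‖ ^ 2) hT.le (by positivity) hc.pos.le hc.integrable hκ0 (h.continuousOn.norm.pow 2)
    (fun _ _ => by positivity) hyi (Eventually.of_forall fun _ => by positivity) hE.integrable_apply
    (fun t ht => by
      rw [hE.energy hT (by rw [ENNReal.one_le_ofReal]; exact hβ.le) ENNReal.ofReal_ne_top hι ht,
        h.start hT hι])
    (by
      filter_upwards [hc.coer, h.version] with s a1 a2
      have := a1 (y s)
      rwa [a2] at this) hK₀
  have hK' : 0 ≤ K := hK0.trans hK
  have f1 : ∀ t ∈ Icc 0 T, ‖Y t‖ ^ 2 ≤ Real.exp K * (1 + ‖x‖ ^ 2) := fun t ht => by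
    refine (e1 t ht).trans ?_
    rw [mul_comm]
    gcongr
  have f2 : ∫ s, ‖y s‖ ^ β ∂(timeMeasure T)
      ≤ (1 + K * Real.exp K) / (2 * L) * (1 + ‖x‖ ^ 2) := by
    rw [div_mul_eq_mul_div, le_div_iff₀ (by positivity), mul_comm]
    refine e2.trans ?_
    rw [mul_comm]
    gcongr
  rw [energy, add_mul, ENNReal.ofReal_add (by positivity) (by positivity)]
  refine add_le_add (iSup₂_le fun t ht => ?_)
    (lintegral_enorm_rpow_le (zero_lt_one.trans hβ) h.memLp f2)
  rw [← ofReal_norm, ← ENNReal.ofReal_pow (norm_nonneg _)]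
  exact ENNReal.ofReal_le_ofReal (f1 t ht)

theorem CoreHyp.exists_coreSol [BorelSpace V] [CompleteSpace V]
    [TopologicalSpace.SeparableSpace H] (hc : CoreHyp T β ι κ L 𝒢) (hT : 0 < T)
    (hβ : 1 < β) (hι : IsGelfandTriplet ι) (x : H) : ∃ Y y, CoreSol T β ι 𝒢 x Y y := by
  have := holderTriple_ofReal hβ
  have h0 : (0 : ℝ) ∈ Icc 0 T := ⟨le_rfl, hT.le⟩
  have := hι.separableSpace
  have := hι.separableSpace_dual
  have : SecondCountableTopology (StrongDual ℝ V) :=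
    UniformSpace.secondCountable_of_separable _
  obtain ⟨D, hD⟩ := TopologicalSpace.exists_dense_seq V
  obtain ⟨W, Y, y, g, hseq⟩ := hc.exists_galerkinSeq hT hβ hι.injective hι.denseRange hD x
  obtain ⟨R, K, -, -, hR, hK⟩ := hseq.exists_bound hc hT hβ
  obtain ⟨φ, hφ, Yl, hYl0, hYlx, hw⟩ := hseq.exists_subseq_weak hc hT hβ hι.denseRange hD hR hK
  obtain ⟨yl, ξ, M, M', k, B, hev, hm⟩ := (hseq.subseq hφ).exists_evol hc hT hβ hι.injective
    hι.denseRange hι.reflexive hD (fun n => hR (φ n)) (fun n => hK (φ n)) hYl0 hw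
  have hG : GalerkinLimit T β ι κ L 𝒢 D x (fun n => W (φ n)) (fun n => Y (φ n))
      (fun n => y (φ n)) (fun n => g (φ n)) Yl yl ξ R K :=
    ⟨hseq.subseq hφ, hc, hT, hβ, hι.denseRange, hι.denseRange_toDual, hD, fun n => hR (φ n),
      fun n => hK (φ n), hw, hYlx, hev, M, M', k, B, hm⟩
  obtain ⟨R', hR'⟩ := hev.bdd
  obtain ⟨C, -, hC⟩ := hc.exists_mixedBound hβ R'
  obtain ⟨N, h1, h2, -⟩ := hC yl hev.memLp (hev.ae_norm_le hR')
  have hint : Integrable (fun s => 𝒢 s (yl s)) (timeMeasure T) := by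
    refine h1.integrable_self (hc.aestronglyMeasurable_apply hev.memLp.1)
      (q := ENNReal.ofReal (β / (β - 1))) ?_ h2 (hc.integrable.const_mul C)
    rw [ENNReal.one_le_ofReal, le_div_iff₀ (by linarith)]; linarith
  refine ⟨Yl, yl, hev.continuousOn hT hG.one_le_ofReal ENNReal.ofReal_ne_top hι.denseRange,
    hev.memLp, hev.version, hint, fun t ht => ?_⟩
  ext v
  rw [add_apply, toDual_apply_apply, toDual_apply_apply,
    ContinuousLinearMap.intervalIntegral_apply (intervalIntegrable_of_timeMeasure hint h0 ht),
    hev.eq t ht v, hYlx, hG.integral_eq v ht]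

end Core

/-! ### Entropy bounds for the jump controls -/

theorem sq_sqrt_sub_one_le_klFun {g : ℝ} (hg : 0 ≤ g) :
    (√g - 1) ^ 2 ≤ InformationTheory.klFun g := by
  rw [InformationTheory.klFun_apply]
  rcases hg.eq_or_lt with rfl | hg
  · simp
  · have hs : 0 < √g := Real.sqrt_pos.2 hg
    -- Multiplying `log g = 2 log √g ≥ 2 (1 - 1 / √g)` by `g` gives the claim.
    have h1 := Real.one_sub_inv_le_log_of_pos hs
    have h2 : Real.log g = 2 * Real.log (√g) := by
      rw [Real.log_sqrt hg.le]; ring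
    have h3 : √g ^ 2 = g := Real.sq_sqrt hg.le
    have h4 : √g ^ 2 * (√g)⁻¹ = √g := by field_simp
    rw [h2]
    nlinarith [mul_le_mul_of_nonneg_left h1 hg.le]

/-- Young's inequality for the conjugate functions `g log g - g` and `exp`, from `s + 1 ≤ exp s` at
`s = u - log g`. -/
theorem mul_le_klFun_add_exp {g u : ℝ} (hg : 0 ≤ g) :
    g * u ≤ InformationTheory.klFun g + Real.exp u := by
  rw [InformationTheory.klFun_apply]
  rcases hg.eq_or_lt with rfl | hg
  · simp only [zero_mul]; positivity
  · have h1 := Real.add_one_le_exp (u - Real.log g)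
    rw [Real.exp_sub, Real.exp_log hg, le_div_iff₀ hg] at h1
    linarith

/-- Three regimes. For `g ≤ 2`, `6 klFun g` dominates `(g - 1) ^ 2`, because `(√g + 1) ^ 2 ≤ 6`. For
`g ≥ 2` and `h ≤ 1` it dominates `g - 1`. For `g ≥ 2` and `h > 1`, Young's inequality is applied to
`g` and `δ h`. The exponential is thus needed only where `h > 1`. -/
theorem abs_sub_one_mul_le {g h δ : ℝ} (hg : 0 ≤ g) (hδ : 0 < δ) :
    |g - 1| * h ≤ (12 + 1 / δ) * InformationTheory.klFun g + h ^ 2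
      + (if 1 < h then 1 / δ * Real.exp (δ * h) else 0) := by
  have h1 := sq_sqrt_sub_one_le_klFun hg
  have hk := InformationTheory.klFun_nonneg hg
  have hs := Real.sqrt_nonneg g
  have h3 : √g ^ 2 = g := Real.sq_sqrt hg
  have hδ' : 0 ≤ 1 / δ * InformationTheory.klFun g := by positivity
  have hite : 0 ≤ (if 1 < h then 1 / δ * Real.exp (δ * h) else 0) := by
    split_ifs <;> positivity
  rcases le_total g 2 with hg2 | hg2
  · have h4 : (g - 1) ^ 2 ≤ 6 * InformationTheory.klFun g := by
      have h5 : (√g + 1) ^ 2 ≤ 6 := by nlinarith [sq_nonneg (√g - 3 / 2)]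
      calc (g - 1) ^ 2 = (√g - 1) ^ 2 * (√g + 1) ^ 2 := by
            rw [← mul_pow, ← h3, Real.sqrt_sq hs]; ring
        _ ≤ InformationTheory.klFun g * 6 := by gcongr
        _ = _ := by ring
    have h6 : |g - 1| * h ≤ (g - 1) ^ 2 + h ^ 2 := by
      rw [← sq_abs (g - 1)]
      nlinarith [sq_nonneg (|g - 1| - h), sq_nonneg |g - 1|, sq_nonneg h]
    nlinarith
  · rw [abs_of_nonneg (by linarith)]
    rcases le_or_gt h 1 with hh1 | hh1
    · have h4 : g - 1 ≤ 6 * InformationTheory.klFun g := by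
        have h5 : 7 / 5 ≤ √g := Real.le_sqrt_of_sq_le (by norm_num; linarith)
        nlinarith
      have h6 : (g - 1) * h ≤ g - 1 := mul_le_of_le_one_right (by linarith) hh1
      nlinarith [sq_nonneg h]
    · rw [if_pos hh1]
      have h4 := mul_le_klFun_add_exp (u := δ * h) hg
      have h5 : g * h ≤ 1 / δ * InformationTheory.klFun g + 1 / δ * Real.exp (δ * h) := by
        rw [← mul_add, one_div, ← div_eq_inv_mul, le_div_iff₀ hδ]
        linarith
      nlinarith [sq_nonneg h]

/-- By Chebyshev's inequality in `L²`, the set `h > 1` has finite measure, so the exponential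
integrability may be invoked on it. Since `h ≤ h ^ p` there, any `p ≥ 1` will do. -/
theorem exists_lintegral_enorm_sub_one_mul_le {X : Type*} [MeasurableSpace X] {μ : Measure X}
    {h : X → ℝ} {p δ : ℝ} (hL : MemLp h 2 μ) (h0 : ∀ᵐ q ∂μ, 0 ≤ h q) (hp : 1 ≤ p) (hδ : 0 < δ)
    (hexp : ∀ E : Set X, MeasurableSet E → μ E < ∞ →
      ∫⁻ q in E, ENNReal.ofReal (Real.exp (δ * h q ^ p)) ∂μ < ∞) (Υ : ℕ) :
    ∃ C : ℝ, 0 ≤ C ∧ ∀ g : X → ℝ≥0, AEMeasurable g μ →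
      ∫⁻ q, ENNReal.ofReal (InformationTheory.klFun (g q)) ∂μ ≤ Υ →
      ∫⁻ q, ‖(g q : ℝ) - 1‖ₑ * ‖h q‖ₑ ∂μ ≤ ENNReal.ofReal C := by
  set h' := hL.1.mk h with hh'
  have hm : Measurable h' := hL.1.stronglyMeasurable_mk.measurable
  have hae : h =ᵐ[μ] h' := hL.1.ae_eq_mk
  set E : Set X := {q | 1 < h' q} with hE
  have hEm : MeasurableSet E := measurableSet_lt measurable_const hm
  have hI : ∫⁻ q, ‖h q‖ₑ ^ 2 ∂μ < ∞ := by
    have := lintegral_rpow_enorm_lt_top_of_eLpNorm_lt_top two_ne_zero ENNReal.ofNat_ne_top hL.2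
    simpa using this
  have hEf : μ E < ∞ := by
    refine lt_of_le_of_lt ?_ hI
    calc μ E = ∫⁻ _ in E, 1 ∂μ := by simp
      _ ≤ ∫⁻ q in E, ‖h q‖ₑ ^ 2 ∂μ := by
        refine lintegral_mono_ae ?_
        filter_upwards [ae_restrict_mem hEm, ae_restrict_of_ae hae] with q h1 h2
        have h3 : (1 : ℝ) ≤ ‖h q‖ := by
          rw [h2]; exact (le_of_lt h1).trans (le_abs_self _)
        have h4 : (1 : ℝ≥0∞) ≤ ‖h q‖ₑ := by
          rw [← ofReal_norm, ← ENNReal.ofReal_one]; exact ENNReal.ofReal_le_ofReal h3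
        exact one_le_pow₀ h4
      _ ≤ _ := setLIntegral_le_lintegral _ _
  have hJ := hexp E hEm hEf
  set C : ℝ≥0∞ := ENNReal.ofReal (12 + 1 / δ) * Υ + ∫⁻ q, ‖h q‖ₑ ^ 2 ∂μ
    + ENNReal.ofReal (1 / δ) * ∫⁻ q in E, ENNReal.ofReal (Real.exp (δ * h q ^ p)) ∂μ with hC
  have hCt : C ≠ ∞ := by
    refine ENNReal.add_ne_top.2 ⟨ENNReal.add_ne_top.2 ⟨?_, hI.ne⟩, ?_⟩
    · exact ENNReal.mul_ne_top ENNReal.ofReal_ne_top (ENNReal.natCast_ne_top _)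
    · exact ENNReal.mul_ne_top ENNReal.ofReal_ne_top hJ.ne
  refine ⟨C.toReal, ENNReal.toReal_nonneg, fun g hg hΥ => ?_⟩
  rw [ENNReal.ofReal_toReal hCt]
  calc ∫⁻ q, ‖(g q : ℝ) - 1‖ₑ * ‖h q‖ₑ ∂μ
      ≤ ∫⁻ q, (ENNReal.ofReal (12 + 1 / δ) * ENNReal.ofReal (InformationTheory.klFun (g q))
          + ‖h q‖ₑ ^ 2 + ENNReal.ofReal (1 / δ)
            * E.indicator (fun q => ENNReal.ofReal (Real.exp (δ * h q ^ p))) q) ∂μ := by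
        refine lintegral_mono_ae ?_
        filter_upwards [h0, hae] with q h1 h2
        have hkl := InformationTheory.klFun_nonneg (g q).coe_nonneg
        have h3 := abs_sub_one_mul_le (h := h q) (g q).coe_nonneg hδ
        have h4 : ‖(g q : ℝ) - 1‖ₑ * ‖h q‖ₑ = ENNReal.ofReal (|(g q : ℝ) - 1| * h q) := by
          rw [ENNReal.ofReal_mul (abs_nonneg _), ← ofReal_norm, ← ofReal_norm, Real.norm_eq_abs,
            Real.norm_of_nonneg h1]
        rw [h4]
        refine (ENNReal.ofReal_le_ofReal h3).trans ?_
        have hite : 0 ≤ (if 1 < h q then 1 / δ * Real.exp (δ * h q) else 0) := by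
          split_ifs <;> positivity
        have e1 : 0 ≤ (12 + 1 / δ) * InformationTheory.klFun ((g q : ℝ)) := by positivity
        rw [ENNReal.ofReal_add (by positivity) hite, ENNReal.ofReal_add e1 (by positivity),
          ENNReal.ofReal_mul (by positivity)]
        refine add_le_add (add_le_add le_rfl ?_) ?_
        · rw [ENNReal.ofReal_pow h1, ← ofReal_norm, Real.norm_of_nonneg h1]
        · by_cases hq : 1 < h q
          · have hqE : q ∈ E := by rw [h2] at hq; exact hq
            rw [if_pos hq, indicator_of_mem hqE, ENNReal.ofReal_mul (by positivity)]
            gcongr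
            exact Real.self_le_rpow_of_one_le hq.le hp
          · rw [if_neg hq, ENNReal.ofReal_zero]
            exact zero_le
    _ ≤ C := by
        have m1 : AEMeasurable (fun q => ENNReal.ofReal (12 + 1 / δ)
            * ENNReal.ofReal (InformationTheory.klFun (g q))) μ :=
          ((InformationTheory.measurable_klFun.comp_aemeasurable
            hg.coe_nnreal_real).ennreal_ofReal).const_mul _
        have m2 : AEMeasurable (fun q => ‖h q‖ₑ ^ 2) μ := hL.1.enorm.pow_const _
        have m12 : AEMeasurable (fun q => ENNReal.ofReal (12 + 1 / δ)
            * ENNReal.ofReal (InformationTheory.klFun (g q)) + ‖h q‖ₑ ^ 2) μ := m1.add m2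
        rw [lintegral_add_left' m12, lintegral_add_left' m1,
          lintegral_const_mul' _ _ ENNReal.ofReal_ne_top,
          lintegral_const_mul' _ _ ENNReal.ofReal_ne_top, lintegral_indicator hEm, hC]
        gcongr

/-! ### Hilbert–Schmidt bounds, extension in time, integrals over Z -/

section HilbertSchmidt

variable {H : Type*} [NormedAddCommGroup H] [InnerProductSpace ℝ H] [CompleteSpace H]

/-- Expand `S x` in a Hilbert basis, move `S` to the basis vectors as its adjoint, and apply
Cauchy–Schwarz to each coordinate; the adjoint has the same Hilbert–Schmidt norm. -/
theorem enorm_apply_sq_le_hsNormSq (S : H →L[ℝ] H) (x : H) :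
    ‖S x‖ₑ ^ 2 ≤ hsNormSq S * ‖x‖ₑ ^ 2 := by
  rw [enorm_sq_eq_tsum (someBasis H) (S x), hsNormSq,
    tsum_eq_tsum_adjoint (someBasis H) (someBasis H) S, ← ENNReal.tsum_mul_right]
  refine ENNReal.tsum_le_tsum fun i => ?_
  rw [← mul_pow, ← ContinuousLinearMap.adjoint_inner_left]
  gcongr
  rw [← ofReal_norm, ← ofReal_norm, ← ofReal_norm, ← ENNReal.ofReal_mul (norm_nonneg _)]
  exact ENNReal.ofReal_le_ofReal (norm_inner_le_norm _ _)

/-- From `√b ‖x‖ ≤ b + ‖x‖ ^ 2`. With `x = f t` the right side is integrable in time as soon as `b`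
is integrable and `f` square integrable. -/
theorem norm_apply_le_of_hsNormSq_le {S : H →L[ℝ] H} {b m : ℝ} (hb : 0 ≤ b) (hm : 0 ≤ m)
    (h : hsNormSq S ≤ ENNReal.ofReal (b * m ^ 2)) (x : H) : ‖S x‖ ≤ (b + ‖x‖ ^ 2) * m := by
  have h1 := (enorm_apply_sq_le_hsNormSq S x).trans (mul_le_mul_left h _)
  rw [← ofReal_norm, ← ofReal_norm, ← ENNReal.ofReal_pow (norm_nonneg _),
    ← ENNReal.ofReal_pow (norm_nonneg _), ← ENNReal.ofReal_mul (by positivity)] at h1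
  have h2 := (ENNReal.ofReal_le_ofReal_iff (by positivity)).1 h1
  refine abs_le_of_sq_le_sq' ?_ (by positivity) |>.2
  refine h2.trans ?_
  have h3 : b * ‖x‖ ^ 2 ≤ (b + ‖x‖ ^ 2) ^ 2 := by
    nlinarith [sq_nonneg b, sq_nonneg (‖x‖ ^ 2), mul_nonneg hb (sq_nonneg ‖x‖)]
  calc b * m ^ 2 * ‖x‖ ^ 2 = b * ‖x‖ ^ 2 * m ^ 2 := by ring
    _ ≤ (b + ‖x‖ ^ 2) ^ 2 * m ^ 2 := by gcongr
    _ = _ := by ring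

end HilbertSchmidt

section Extension

variable {X E : Type*} [MeasurableSpace X] [Zero E] [MeasurableSpace E] {T : ℝ}

/-- Extension by zero to times outside `[0, T]`. -/
noncomputable def onIcc (T : ℝ) (F : ℝ → X → E) (t : ℝ) (x : X) : E :=
  (Icc 0 T).indicator (fun s => F s x) t

theorem onIcc_of_mem {F : ℝ → X → E} {t : ℝ} (ht : t ∈ Icc 0 T) : onIcc T F t = F t :=
  funext fun _ => indicator_of_mem ht _

/-- The coefficients are measurable only for times in `[0, T]`; extending by zero gives joint
measurability on the line. -/
theorem measurable_onIcc {F : ℝ → X → E}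
    (h : Measurable fun q : Icc (0 : ℝ) T × X => F q.1 q.2) :
    Measurable (Function.uncurry (onIcc T F)) := by
  have hS : MeasurableSet {q : ℝ × X | q.1 ∈ Icc 0 T} := measurable_fst measurableSet_Icc
  refine measurable_of_restrict_of_restrict_compl hS ?_ ?_
  · have h1 : Measurable fun q : {q : ℝ × X | q.1 ∈ Icc 0 T} =>
        ((⟨q.1.1, q.2⟩, q.1.2) : Icc (0 : ℝ) T × X) :=
      ((measurable_fst.comp measurable_subtype_coe).subtype_mk).prodMk
        (measurable_snd.comp measurable_subtype_coe)
    convert h.comp h1 using 1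
    funext q
    exact congrFun (onIcc_of_mem q.2) _
  · refine measurable_const' fun q q' => ?_
    have h0 : ∀ r : ({q : ℝ × X | q.1 ∈ Icc 0 T}ᶜ : Set (ℝ × X)),
        onIcc T F r.1.1 r.1.2 = 0 := fun r =>
      indicator_of_notMem (s := Icc 0 T) (a := r.1.1) r.2 fun s => F s r.1.2
    exact (h0 q).trans (h0 q').symm

end Extension

section Integral

variable {H Z : Type*} [NormedAddCommGroup H] [NormedSpace ℝ H] [MeasurableSpace Z]
  {ν : Measure Z}

theorem norm_integral_smul_le {G h : Z → ℝ} {w : Z → H} {c k : ℝ} (hG : AEStronglyMeasurable G ν)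
    (hw : AEStronglyMeasurable w ν) (hc : 0 ≤ c) (hle : ∀ z, ‖w z‖ ≤ h z * c) (hk0 : 0 ≤ k)
    (hk : ∫⁻ z, ‖G z‖ₑ * ‖h z‖ₑ ∂ν = ENNReal.ofReal k) :
    Integrable (fun z => G z • w z) ν ∧ ‖∫ z, G z • w z ∂ν‖ ≤ k * c := by
  have h1 : ∫⁻ z, ‖G z • w z‖ₑ ∂ν ≤ ENNReal.ofReal (k * c) := by
    calc ∫⁻ z, ‖G z • w z‖ₑ ∂ν ≤ ∫⁻ z, ‖G z‖ₑ * ‖h z‖ₑ * ENNReal.ofReal c ∂ν := by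
          refine lintegral_mono fun z => ?_
          rw [enorm_smul, mul_assoc]
          gcongr
          rw [← ofReal_norm, ← ofReal_norm, ← ENNReal.ofReal_mul (norm_nonneg _)]
          refine ENNReal.ofReal_le_ofReal ((hle z).trans ?_)
          gcongr
          exact Real.le_norm_self _
      _ = ENNReal.ofReal (k * c) := by
          rw [lintegral_mul_const' _ _ ENNReal.ofReal_ne_top, hk, ENNReal.ofReal_mul hk0]
  refine ⟨⟨hG.smul hw, h1.trans_lt ENNReal.ofReal_lt_top⟩, ?_⟩
  have h2 := (enorm_integral_le_lintegral_enorm _).trans h1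
  rw [← ofReal_norm] at h2
  exact (ENNReal.ofReal_le_ofReal_iff (by positivity)).1 h2

/-- Tonelli's theorem turns the entropy bound on `[0, T] × Z` into a modulus `k t` integrable in
time. -/
theorem exists_integrable_eq_lintegral [SFinite ν] {T : ℝ} {G h : ℝ × Z → ℝ}
    (hG : AEStronglyMeasurable G (prodMeasure T ν)) (hh : AEStronglyMeasurable h (prodMeasure T ν))
    {C : ℝ} (hC0 : 0 ≤ C) (hC : ∫⁻ q, ‖G q‖ₑ * ‖h q‖ₑ ∂(prodMeasure T ν) ≤ ENNReal.ofReal C) :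
    ∃ k : ℝ → ℝ, Integrable k (timeMeasure T) ∧ (∀ t, 0 ≤ k t) ∧
      ∫ t, k t ∂(timeMeasure T) ≤ C ∧ ∀ᵐ t ∂(timeMeasure T),
        ∫⁻ z, ‖G (t, z)‖ₑ * ‖h (t, z)‖ₑ ∂ν = ENNReal.ofReal (k t) := by
  have hm : AEMeasurable (fun q => ‖G q‖ₑ * ‖h q‖ₑ) ((timeMeasure T).prod ν) :=
    hG.enorm.mul hh.enorm
  have hm' := hm.lintegral_prod_right'
  rw [prodMeasure, lintegral_prod _ hm] at hC
  have hne := (hC.trans_lt ENNReal.ofReal_lt_top).ne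
  have hfin := ae_lt_top' hm' hne
  refine ⟨fun t => (∫⁻ z, ‖G (t, z)‖ₑ * ‖h (t, z)‖ₑ ∂ν).toReal,
    integrable_toReal_of_lintegral_ne_top hm' hne, fun t => ENNReal.toReal_nonneg, ?_, ?_⟩
  · rw [integral_toReal hm' hfin]
    exact ENNReal.toReal_le_of_le_ofReal hC0 hC
  · filter_upwards [hfin] with t ht
    rw [ENNReal.ofReal_toReal ht.ne]

end Integral

/-! ### The forcing produced by a control -/

section Forcing

variable {H V Z : Type*} [NormedAddCommGroup H] [InnerProductSpace ℝ H] [CompleteSpace H]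
  [TopologicalSpace.SeparableSpace H] [MeasurableSpace H] [BorelSpace H]
  [NormedAddCommGroup V] [NormedSpace ℝ V] [MeasurableSpace V]
  [MeasurableSpace Z] {ν : Measure Z} {T β α : ℝ} {ι : V →L[ℝ] H}
  {A : ℝ → V → StrongDual ℝ V} {B : ℝ → V → H →L[ℝ] H} {γ : ℝ → V → Z → H} {a : ℝ → ℝ}

/-- The forcing `F(t, x) = B(t, x) f(t) + ∫ γ(t, x, z) (g(t, z) - 1) ν(dz)` associated with the
control `(f, g)`, with its growth and Lipschitz moduli. -/
structure Forcing (T : ℝ) (ν : Measure Z) (ι : V →L[ℝ] H) (B : ℝ → V → H →L[ℝ] H)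
    (γ : ℝ → V → Z → H) (p : (ℝ → H) × (ℝ × Z → ℝ≥0)) (F : ℝ → V → H) (k l : ℝ → ℝ) : Prop where
  meas : Measurable (Function.uncurry F)
  integrable_growth : Integrable k (timeMeasure T)
  nonneg_growth : ∀ᵐ t ∂(timeMeasure T), 0 ≤ k t
  integrable_lipschitz : Integrable l (timeMeasure T)
  nonneg_lipschitz : ∀ᵐ t ∂(timeMeasure T), 0 ≤ l t
  growth : ∀ᵐ t ∂(timeMeasure T), ∀ x, ‖F t x‖ ≤ k t * (1 + ‖ι x‖)
  lipschitz : ∀ᵐ t ∂(timeMeasure T), ∀ x y, ‖F t x - F t y‖ ≤ l t * ‖ι x - ι y‖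
  eq : ∀ᵐ t ∂(timeMeasure T), ∀ x,
    F t x = B t x (p.1 t) + ∫ z, ((p.2 (t, z) : ℝ) - 1) • γ t x z ∂ν

theorem MeasurableCoefficients.measurable_B_apply (h : MeasurableCoefficients T A B γ) :
    Measurable (Function.uncurry (onIcc T fun t (q : V × H) => B t q.1 q.2)) := by
  have : SecondCountableTopology H := UniformSpace.secondCountable_of_separable H
  refine measurable_onIcc ?_
  have h1 := measurable_uncurry_of_continuous_of_measurable
    (u := fun (v : H) (q : Icc (0 : ℝ) T × V) => B q.1 q.2 v)
    (fun q => (B q.1 q.2).continuous) h.measurable_B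
  exact h1.comp (f := fun q : Icc (0 : ℝ) T × (V × H) => (q.2.2, (q.1, q.2.1))) (by fun_prop)

theorem MeasurableCoefficients.measurable_jump (h : MeasurableCoefficients T A B γ) :
    Measurable (Function.uncurry (onIcc T fun t (q : V × Z) => γ t q.1 q.2)) :=
  measurable_onIcc h.measurable_γ

theorem StructuralHypothesis.exists_growth_B (h : StructuralHypothesis T β α ν ι A B γ a) :
    ∃ b : ℝ → ℝ, Integrable b (timeMeasure T) ∧ (∀ t ∈ Icc 0 T, 0 ≤ b t) ∧
      ∀ᵐ t ∂(timeMeasure T), ∀ x v, ‖B t x v‖ ≤ (b t + ‖v‖ ^ 2) * (1 + ‖ι x‖) := by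
  obtain ⟨b, hb, hb0, h1⟩ := h.growth_B
  refine ⟨b, hb, hb0, ?_⟩
  filter_upwards [h1, ae_restrict_mem measurableSet_Icc] with t ht ht' x v
  refine norm_apply_le_of_hsNormSq_le (hb0 t ht') (by positivity) ((ht x).trans ?_) v
  have := hb0 t ht'
  refine ENNReal.ofReal_le_ofReal ?_
  gcongr
  nlinarith [norm_nonneg (ι x)]

/-- The cost of a control dominates its action on the moduli of the jump coefficient. -/
theorem exists_lintegral_control_le {h : ℝ × Z → ℝ} [SFinite ν]
    (hL : MemLp h 2 (prodMeasure T ν)) {p : ℝ} (hp : 1 ≤ p) (hexp : h ∈ ExpClass T ν p) (Υ : ℕ) :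
    ∃ C : ℝ, 0 ≤ C ∧ ∀ p ∈ controlBall H T ν Υ,
      ∫⁻ q, ‖(p.2 q : ℝ) - 1‖ₑ * ‖h q‖ₑ ∂(prodMeasure T ν) ≤ ENNReal.ofReal C := by
  obtain ⟨h0, δ, hδ, hE⟩ := hexp
  have h0' : ∀ᵐ q ∂(prodMeasure T ν), 0 ≤ h q := by
    have h1 : ∀ᵐ q ∂(prodMeasure T ν), q.1 ∈ Icc 0 T :=
      Measure.quasiMeasurePreserving_fst.ae (ae_restrict_mem measurableSet_Icc)
    filter_upwards [h1] with q hq using h0 q.1 hq q.2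
  obtain ⟨C, hC0, hC⟩ := exists_lintegral_enorm_sub_one_mul_le hL h0' hp hδ hE Υ
  exact ⟨C, hC0, fun p hp => hC p.2 hp.2.1 hp.2.2⟩

/-- The growth modulus is `b + ‖f‖ ^ 2 + ∫ |g - 1| Lγ dν` and the Lipschitz modulus is `lB + ‖f‖ ^ 2
+ ∫ |g - 1| Rγ dν`; on the ball of controls `∫ ‖f‖ ^ 2` is at most `2 Υ`, and the entropy estimate
bounds the jump terms. -/
theorem StructuralHypothesis.exists_forcing [SFinite ν] (h : StructuralHypothesis T β α ν ι A B γ a)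
    (hm : MeasurableCoefficients T A B γ) (hn : NoiseHypothesis T β α ν ι B γ) (Υ : ℕ) :
    ∃ C : ℝ, 0 ≤ C ∧ ∀ p ∈ controlBall H T ν Υ, ∃ F k l, Forcing T ν ι B γ p F k l ∧
      ∫ t, k t ∂(timeMeasure T) ≤ C ∧ ∫ t, l t ∂(timeMeasure T) ≤ C := by
  have : SecondCountableTopology H := UniformSpace.secondCountable_of_separable H
  obtain ⟨b, hb, hb0, hB⟩ := h.exists_growth_B
  obtain ⟨lB, hlB, hlB0, hBl⟩ := hn.lipschitz_B
  obtain ⟨η₀, p₀, Lγ, -, -, hp₀, hL2, -, -, -, -, hLe, hLγ⟩ := hn.linear_growth_γ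
  obtain ⟨Rγ, hR2, hRe, hRγ⟩ := hn.lipschitz_γ
  have hp1 : 1 ≤ p₀ := by
    have : 4 ≤ exponentM α β η₀ := (le_max_right _ _).trans (le_max_left _ _)
    linarith
  obtain ⟨C₁, hC₁, h1⟩ := exists_lintegral_control_le (H := H) hL2 hp1 hLe Υ
  obtain ⟨C₂, hC₂, h2⟩ := exists_lintegral_control_le (H := H) hR2 one_le_two hRe Υ
  have hbI : 0 ≤ ∫ t, b t ∂(timeMeasure T) :=
    setIntegral_nonneg measurableSet_Icc hb0
  have hlI : 0 ≤ ∫ t, lB t ∂(timeMeasure T) :=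
    setIntegral_nonneg measurableSet_Icc hlB0
  refine ⟨(∫ t, b t ∂(timeMeasure T)) + (∫ t, lB t ∂(timeMeasure T)) + 2 * Υ + C₁ + C₂,
    by positivity, ?_⟩
  rintro ⟨f, g⟩ hp
  obtain ⟨⟨hfL, hfΥ⟩, hg, -⟩ := id hp
  -- Measurable versions of `f` and `g` are used so that `F` is jointly measurable; `heq` returns to
  -- the control itself for almost every time.
  set f' := hfL.1.mk f with hf'
  have hf'm : Measurable f' := hfL.1.stronglyMeasurable_mk.measurable
  have hff' : f =ᵐ[timeMeasure T] f' := hfL.1.ae_eq_mk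
  set g' := hg.mk g with hg'
  have hg'm : Measurable g' := hg.measurable_mk
  have hgg' : ∀ᵐ t ∂(timeMeasure T), ∀ᵐ z ∂ν, g (t, z) = g' (t, z) :=
    Measure.ae_ae_of_ae_prod hg.ae_eq_mk
  have hgm : AEStronglyMeasurable (fun q => (g q : ℝ) - 1) (prodMeasure T ν) :=
    (hg.coe_nnreal_real.sub_const 1).aestronglyMeasurable
  obtain ⟨k₁, hk₁, hk₁0, hk₁C, hk₁e⟩ := exists_integrable_eq_lintegral hgm hL2.1 hC₁ (h1 _ hp)
  obtain ⟨k₂, hk₂, hk₂0, hk₂C, hk₂e⟩ := exists_integrable_eq_lintegral hgm hR2.1 hC₂ (h2 _ hp)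
  have hfi : Integrable (fun t => ‖f t‖ ^ 2) (timeMeasure T) := hfL.integrable_norm_pow (by simp)
  set F : ℝ → V → H := fun t x => onIcc T (fun t (q : V × H) => B t q.1 q.2) t (x, f' t)
    + ∫ z, ((g' (t, z) : ℝ) - 1) • onIcc T (fun t (q : V × Z) => γ t q.1 q.2) t (x, z) ∂ν with hF
  have hFm : Measurable (Function.uncurry F) := by
    have m1 : Measurable fun q : ℝ × V =>
        onIcc T (fun t (q : V × H) => B t q.1 q.2) q.1 (q.2, f' q.1) :=
      hm.measurable_B_apply.comp (f := fun q : ℝ × V => (q.1, (q.2, f' q.1))) (by fun_prop)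
    have m2 : Measurable fun q : (ℝ × V) × Z =>
        onIcc T (fun t (q : V × Z) => γ t q.1 q.2) q.1.1 (q.1.2, q.2) :=
      hm.measurable_jump.comp (f := fun q : (ℝ × V) × Z => (q.1.1, (q.1.2, q.2))) (by fun_prop)
    have m3 : Measurable fun q : (ℝ × V) × Z => ((g' (q.1.1, q.2) : ℝ) - 1) •
        onIcc T (fun t (q : V × Z) => γ t q.1 q.2) q.1.1 (q.1.2, q.2) := by
      refine Measurable.smul ?_ m2
      have : Measurable fun q : (ℝ × V) × Z => g' (q.1.1, q.2) := hg'm.comp (by fun_prop)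
      fun_prop
    exact m1.add (m3.stronglyMeasurable.integral_prod_right').measurable
  have heq : ∀ᵐ t ∂(timeMeasure T), ∀ x,
      F t x = B t x (f t) + ∫ z, ((g (t, z) : ℝ) - 1) • γ t x z ∂ν := by
    filter_upwards [hff', hgg', ae_restrict_mem measurableSet_Icc] with t a1 a2 a3 x
    simp only [hF]
    rw [onIcc_of_mem a3, onIcc_of_mem a3, a1]
    congr 1
    refine integral_congr_ae ?_
    filter_upwards [a2] with z hz
    rw [hz]
  have hgt : ∀ᵐ t ∂(timeMeasure T), AEStronglyMeasurable (fun z => (g (t, z) : ℝ) - 1) ν := by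
    filter_upwards [hgg'] with t ht
    have m1 : Measurable fun z => (g' (t, z) : ℝ) - 1 := by
      have : Measurable fun z => g' (t, z) := hg'm.comp (by fun_prop)
      fun_prop
    refine m1.aestronglyMeasurable.congr ?_
    filter_upwards [ht] with z hz
    rw [hz]
  have hγm : ∀ t ∈ Icc 0 T, ∀ x, AEStronglyMeasurable (γ t x) ν := by
    intro t ht x
    have m1 : Measurable fun z => onIcc T (fun t (q : V × Z) => γ t q.1 q.2) t (x, z) :=
      hm.measurable_jump.comp (f := fun z : Z => (t, (x, z))) (by fun_prop)
    rw [onIcc_of_mem ht] at m1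
    exact m1.aestronglyMeasurable
  have hfI : ∫ t, ‖f t‖ ^ 2 ∂(timeMeasure T) ≤ 2 * Υ := by linarith
  have hbi : Integrable (fun t => b t + ‖f t‖ ^ 2) (timeMeasure T) := hb.add hfi
  have hli : Integrable (fun t => lB t + ‖f t‖ ^ 2) (timeMeasure T) := hlB.add hfi
  refine ⟨F, fun t => b t + ‖f t‖ ^ 2 + k₁ t, fun t => lB t + ‖f t‖ ^ 2 + k₂ t,
    ⟨hFm, hbi.add hk₁, ?_, hli.add hk₂, ?_, ?_, ?_, heq⟩, ?_, ?_⟩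
  · filter_upwards [ae_restrict_mem measurableSet_Icc] with t ht
    have := hb0 t ht; have := hk₁0 t
    positivity
  · filter_upwards [ae_restrict_mem measurableSet_Icc] with t ht
    have := hlB0 t ht; have := hk₂0 t
    positivity
  · filter_upwards [heq, hB, hk₁e, hgt, ae_restrict_mem measurableSet_Icc] with t a1 a2 a3 a4 a5 x
    rw [a1, add_mul]
    exact (norm_add_le _ _).trans (add_le_add (a2 x _)
      (norm_integral_smul_le a4 (hγm t a5 x) (by positivity) (hLγ t a5 x) (hk₁0 t) a3).2)
  · filter_upwards [heq, hk₁e, hk₂e, hgt, ae_restrict_mem measurableSet_Icc]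
      with t a1 a2 a3 a4 a5 x y
    have i1 := fun x => (norm_integral_smul_le a4 (hγm t a5 x) (by positivity) (hLγ t a5 x)
      (hk₁0 t) a2).1
    have e1 := (norm_integral_smul_le a4 ((hγm t a5 x).sub (hγm t a5 y)) (norm_nonneg (ι x - ι y))
      (fun z => hRγ t a5 z x y) (hk₂0 t) a3).2
    have e2 : F t x - F t y = (B t x - B t y) (f t)
        + ∫ z, ((g (t, z) : ℝ) - 1) • (γ t x - γ t y) z ∂ν := by
      simp only [Pi.sub_apply, smul_sub]
      rw [integral_sub (i1 x) (i1 y), a1, a1, sub_apply]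
      abel
    rw [e2, add_mul]
    exact (norm_add_le _ _).trans (add_le_add (norm_apply_le_of_hsNormSq_le (hlB0 t a5)
      (norm_nonneg _) (hBl t a5 x y) _) e1)
  · rw [integral_add hbi hk₁, integral_add hb hfi]
    linarith
  · rw [integral_add hli hk₂, integral_add hlB hfi]
    linarith

theorem MeasurableCoefficients.integrable_B_apply [BorelSpace V]
    (hm : MeasurableCoefficients T A B γ)
    (h : StructuralHypothesis T β α ν ι A B γ a) {f : ℝ → H} (hf : MemLp f 2 (timeMeasure T))
    {y : ℝ → V} (hy : AEStronglyMeasurable y (timeMeasure T)) {R : ℝ}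
    (hR : ∀ᵐ t ∂(timeMeasure T), ‖ι (y t)‖ ≤ R) :
    Integrable (fun s => B s (y s) (f s)) (timeMeasure T) := by
  have : SecondCountableTopology H := UniformSpace.secondCountable_of_separable H
  obtain ⟨b, hb, hb0, hB⟩ := h.exists_growth_B
  have hfi : Integrable (fun t => ‖f t‖ ^ 2) (timeMeasure T) := hf.integrable_norm_pow (by simp)
  refine ((hb.add hfi).mul_const (1 + R)).mono' ?_ ?_
  · have m1 : AEMeasurable (fun s => (s, (y s, f s))) (timeMeasure T) :=
      aemeasurable_id.prodMk (hy.aemeasurable.prodMk hf.1.aemeasurable)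
    refine (hm.measurable_B_apply.comp_aemeasurable m1).aestronglyMeasurable.congr ?_
    filter_upwards [ae_restrict_mem measurableSet_Icc] with t ht
    simp only [Function.comp_apply, Function.uncurry_apply_pair]
    rw [onIcc_of_mem ht]
  · filter_upwards [hB, hR, ae_restrict_mem measurableSet_Icc] with t a1 a2 a3
    have := hb0 t a3
    refine (a1 _ _).trans ?_
    simp only [Pi.add_apply]
    gcongr

theorem MeasurableCoefficients.integrable_jump_apply [SFinite ν] [BorelSpace V]
    (hm : MeasurableCoefficients T A B γ)
    (hn : NoiseHypothesis T β α ν ι B γ) {Υ : ℕ} {p : (ℝ → H) × (ℝ × Z → ℝ≥0)}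
    (hp : p ∈ controlBall H T ν Υ)
    {y : ℝ → V} (hy : AEStronglyMeasurable y (timeMeasure T)) {R : ℝ}
    (hR : ∀ᵐ t ∂(timeMeasure T), ‖ι (y t)‖ ≤ R) :
    Integrable (fun q : ℝ × Z => ((p.2 q : ℝ) - 1) • γ q.1 (y q.1) q.2) (prodMeasure T ν) := by
  have : SecondCountableTopology H := UniformSpace.secondCountable_of_separable H
  obtain ⟨η₀, p₀, Lγ, -, -, hp₀, hL2, -, -, -, -, hLe, hLγ⟩ := hn.linear_growth_γ
  have hp1 : 1 ≤ p₀ := by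
    have : 4 ≤ exponentM α β η₀ := (le_max_right _ _).trans (le_max_left _ _)
    linarith
  obtain ⟨C, hC, h1⟩ := exists_lintegral_control_le (H := H) hL2 hp1 hLe Υ
  have hfst : Measure.QuasiMeasurePreserving Prod.fst (prodMeasure T ν) (timeMeasure T) :=
    Measure.quasiMeasurePreserving_fst
  have hIcc : ∀ᵐ q ∂(prodMeasure T ν), q.1 ∈ Icc 0 T :=
    hfst.ae (ae_restrict_mem measurableSet_Icc)
  have hRq : ∀ᵐ q ∂(prodMeasure T ν), ‖ι (y q.1)‖ ≤ R := hfst.ae hR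
  have hym : AEMeasurable (fun q : ℝ × Z => y q.1) (prodMeasure T ν) :=
    hy.aemeasurable.comp_quasiMeasurePreserving hfst
  have hγm : AEStronglyMeasurable (fun q : ℝ × Z => γ q.1 (y q.1) q.2) (prodMeasure T ν) := by
    have m1 : AEMeasurable (fun q : ℝ × Z => (q.1, (y q.1, q.2))) (prodMeasure T ν) :=
      measurable_fst.aemeasurable.prodMk (hym.prodMk measurable_snd.aemeasurable)
    refine (hm.measurable_jump.comp_aemeasurable m1).aestronglyMeasurable.congr ?_
    filter_upwards [hIcc] with q hq
    simp only [Function.comp_apply, Function.uncurry_apply_pair]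
    rw [onIcc_of_mem hq]
  have hgm : AEStronglyMeasurable (fun q => (p.2 q : ℝ) - 1) (prodMeasure T ν) :=
    (hp.2.1.coe_nnreal_real.sub_const 1).aestronglyMeasurable
  refine ⟨hgm.smul hγm, ?_⟩
  calc ∫⁻ q, ‖((p.2 q : ℝ) - 1) • γ q.1 (y q.1) q.2‖ₑ ∂(prodMeasure T ν)
      ≤ ∫⁻ q, ‖(p.2 q : ℝ) - 1‖ₑ * ‖Lγ q‖ₑ * ENNReal.ofReal (1 + R) ∂(prodMeasure T ν) := by
        refine lintegral_mono_ae ?_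
        filter_upwards [hIcc, hRq] with q a1 a2
        rw [enorm_smul, mul_assoc]
        gcongr
        rw [← ofReal_norm, ← ofReal_norm, ← ENNReal.ofReal_mul (norm_nonneg _)]
        refine ENNReal.ofReal_le_ofReal ((hLγ q.1 a1 _ _).trans ?_)
        gcongr
        exact Real.le_norm_self _
    _ = (∫⁻ q, ‖(p.2 q : ℝ) - 1‖ₑ * ‖Lγ q‖ₑ ∂(prodMeasure T ν)) * ENNReal.ofReal (1 + R) :=
        lintegral_mul_const' _ _ ENNReal.ofReal_ne_top
    _ < ∞ := ENNReal.mul_lt_top ((h1 p hp).trans_lt ENNReal.ofReal_lt_top) ENNReal.ofReal_lt_top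

end Forcing

/-! ### The skeleton equation as an abstract equation -/

section Main

variable {H V Z : Type*} [NormedAddCommGroup H] [InnerProductSpace ℝ H] [CompleteSpace H]
  [TopologicalSpace.SeparableSpace H] [MeasurableSpace H] [BorelSpace H]
  [NormedAddCommGroup V] [NormedSpace ℝ V] [MeasurableSpace V]
  [MeasurableSpace Z] {ν : Measure Z} {T β α : ℝ} {ι : V →L[ℝ] H}
  {A : ℝ → V → StrongDual ℝ V} {B : ℝ → V → H →L[ℝ] H} {γ : ℝ → V → Z → H} {a : ℝ → ℝ}
  {p : (ℝ → H) × (ℝ × Z → ℝ≥0)} {F : ℝ → V → H} {k l : ℝ → ℝ}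

theorem norm_toDual_apply_le (ι : V →L[ℝ] H) (h : H) (v : V) :
    |toDual ι h v| ≤ ‖h‖ * ‖ι v‖ := by
  rw [toDual_apply_apply]
  exact abs_real_inner_le_norm _ _

/-- The drift of the skeleton equation. -/
noncomputable def drift (T : ℝ) (ι : V →L[ℝ] H) (A : ℝ → V → StrongDual ℝ V) (F : ℝ → V → H)
    (t : ℝ) (x : V) : StrongDual ℝ V :=
  onIcc T A t x + toDual ι (F t x)

theorem ae_drift_eq : ∀ᵐ t ∂(timeMeasure T), ∀ x,
    drift T ι A F t x = A t x + toDual ι (F t x) := by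
  filter_upwards [ae_restrict_mem measurableSet_Icc] with t ht x
  rw [drift, onIcc_of_mem ht]

theorem StructuralHypothesis.growth_A (h : StructuralHypothesis T β α ν ι A B γ a) (hβ : 1 < β)
    (R : ℝ) : ∃ C : ℝ, 0 ≤ C ∧ ∀ᵐ t ∂(timeMeasure T), ∀ x : V, ‖ι x‖ ≤ R →
      ‖A t x‖ ≤ (C * (a t + ‖x‖ ^ β)) ^ ((β - 1) / β) := by
  obtain ⟨hα, C, hC, hA⟩ := h.growth
  have hβ1 : 0 < β - 1 := by linarith
  have hβ0 : 0 < β := by linarith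
  have hRα : 0 ≤ |R| ^ α := by positivity
  refine ⟨(1 + C) * (1 + |R| ^ α), by positivity, ?_⟩
  filter_upwards [hA, ae_restrict_mem measurableSet_Icc] with t a1 a2 x hx
  have ha := h.nonneg_a t a2
  have hxb : 0 ≤ ‖x‖ ^ β := by positivity
  have h1 : ‖A t x‖ ^ (β / (β - 1)) ≤ (1 + C) * (1 + |R| ^ α) * (a t + ‖x‖ ^ β) := by
    refine (a1 x).trans ?_
    have e1 : a t + C * ‖x‖ ^ β ≤ (1 + C) * (a t + ‖x‖ ^ β) := by
      nlinarith [mul_nonneg hC ha]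
    have e2 : ‖ι x‖ ^ α ≤ |R| ^ α :=
      Real.rpow_le_rpow (norm_nonneg _) (hx.trans (le_abs_self R)) hα
    calc (a t + C * ‖x‖ ^ β) * (1 + ‖ι x‖ ^ α)
        ≤ ((1 + C) * (a t + ‖x‖ ^ β)) * (1 + |R| ^ α) := by gcongr
      _ = _ := by ring
  have h2 := Real.rpow_le_rpow (by positivity) h1 (show 0 ≤ (β - 1) / β by positivity)
  rw [← Real.rpow_mul (norm_nonneg _)] at h2
  have h3 : β / (β - 1) * ((β - 1) / β) = 1 := by field_simp
  rwa [h3, Real.rpow_one] at h2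

theorem Forcing.mul_le (hF : Forcing T ν ι B γ p F k l) : ∀ᵐ t ∂(timeMeasure T), ∀ x,
    |toDual ι (F t x) x| ≤ 2 * k t * (1 + ‖ι x‖ ^ 2) := by
  filter_upwards [hF.growth, hF.nonneg_growth] with t a1 a2 x
  refine (norm_toDual_apply_le ι _ _).trans ?_
  have h1 : (1 + ‖ι x‖) * ‖ι x‖ ≤ 2 * (1 + ‖ι x‖ ^ 2) := by
    nlinarith [sq_nonneg (‖ι x‖ - 1)]
  calc ‖F t x‖ * ‖ι x‖ ≤ k t * (1 + ‖ι x‖) * ‖ι x‖ := by gcongr; exact a1 x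
    _ = k t * ((1 + ‖ι x‖) * ‖ι x‖) := by ring
    _ ≤ k t * (2 * (1 + ‖ι x‖ ^ 2)) := by gcongr
    _ = _ := by ring

/-- The two noise terms on the left of the monotonicity hypothesis are nonnegative and are dropped;
the control terms are treated through the Lipschitz modulus of `F`. -/
theorem StructuralHypothesis.monotone_A (h : StructuralHypothesis T β α ν ι A B γ a) (R : ℝ) :
    ∃ C : ℝ, 0 ≤ C ∧ ∀ᵐ t ∂(timeMeasure T), ∀ x y, ‖ι x‖ ≤ R → ‖ι y‖ ≤ R →
      2 * (A t x - A t y) (x - y)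
        ≤ (a t + C * (1 + ‖x‖ ^ β + ‖y‖ ^ β)) * ‖ι x - ι y‖ ^ 2 := by
  obtain ⟨ρ, η, ζ, C, -, -, hζ, hC, hmono, hbd⟩ := h.local_monotonicity
  have hRζ : 0 ≤ |R| ^ ζ := by positivity
  refine ⟨2 * C * (1 + |R| ^ ζ), by positivity, ?_⟩
  filter_upwards [hmono] with t a1 x y hx hy
  have h1 := a1 x y
  have h2 : 0 ≤ (hsNormSq (B t x - B t y)).toReal := ENNReal.toReal_nonneg
  have h3 : 0 ≤ ∫ z, ‖γ t x z - γ t y z‖ ^ 2 ∂ν := integral_nonneg fun z => by positivity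
  have h4 : ∀ x, ‖ι x‖ ≤ R → |ρ x| + |η x| ≤ C * (1 + ‖x‖ ^ β) * (1 + |R| ^ ζ) := by
    intro x hx
    refine (hbd x).trans ?_
    have := Real.rpow_le_rpow (norm_nonneg _) (hx.trans (le_abs_self R)) hζ
    gcongr
  have h5 : ρ x + η y ≤ 2 * C * (1 + |R| ^ ζ) * (1 + ‖x‖ ^ β + ‖y‖ ^ β) := by
    have e1 := h4 x hx
    have e2 := h4 y hy
    have e3 : 0 ≤ C * (1 + |R| ^ ζ) * (‖x‖ ^ β + ‖y‖ ^ β) := by positivity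
    nlinarith [le_abs_self (ρ x), le_abs_self (η y), abs_nonneg (η x), abs_nonneg (ρ y)]
  have h6 : (a t + ρ x + η y) * ‖ι x - ι y‖ ^ 2
      ≤ (a t + 2 * C * (1 + |R| ^ ζ) * (1 + ‖x‖ ^ β + ‖y‖ ^ β)) * ‖ι x - ι y‖ ^ 2 := by
    exact mul_le_mul_of_nonneg_right (by linarith) (sq_nonneg _)
  linarith

/-- In the coefficient, `2 k` comes from pairing `F t x` with `x` (see `Forcing.mul_le`), `2 l` from
the factor two in monotonicity, and the one secures `1 ≤ κ`. -/
theorem StructuralHypothesis.coreHyp [SecondCountableTopology (StrongDual ℝ V)]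
    (h : StructuralHypothesis T β α ν ι A B γ a) (hm : MeasurableCoefficients T A B γ)
    (hβ : 1 < β) {L : ℝ} (hL : 0 < L)
    (hco : ∀ᵐ t ∂(timeMeasure T), ∀ x : V, A t x x ≤ a t * (1 + ‖ι x‖ ^ 2) - L * ‖x‖ ^ β)
    (hF : Forcing T ν ι B γ p F k l) :
    CoreHyp T β ι (fun t => 1 + a t + 2 * k t + 2 * l t) L (drift T ι A F) where
  meas := by
    have m1 : Measurable fun q : ℝ × V => toDual ι (F q.1 q.2) :=
      (toDual ι).continuous.measurable.comp hF.meas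
    exact (measurable_onIcc hm.measurable_A).add m1
  integrable := (((integrable_const _).add h.integrable_a).add
    (hF.integrable_growth.const_mul 2)).add (hF.integrable_lipschitz.const_mul 2)
  one_le := by
    filter_upwards [hF.nonneg_growth, hF.nonneg_lipschitz, ae_restrict_mem measurableSet_Icc]
      with t a1 a2 a3
    linarith [h.nonneg_a t a3]
  hemi := by
    filter_upwards [h.hemicontinuity, hF.lipschitz, ae_drift_eq (ι := ι) (A := A) (F := F)]
      with t a1 a2 a3 x y z
    simp only [a3, add_apply, toDual_apply_apply]
    refine (a1 x y z).add (Continuous.inner ?_ continuous_const)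
    have hc : Continuous (F t ∘ fun r : ℝ => x + r • y) := by
      rw [continuous_iff_continuousAt]
      intro r
      rw [ContinuousAt, tendsto_iff_norm_sub_tendsto_zero]
      have e1 : Continuous fun s : ℝ => l t * ‖ι (x + s • y) - ι (x + r • y)‖ := by fun_prop
      have e2 := e1.tendsto r
      rw [sub_self, norm_zero, mul_zero] at e2
      exact squeeze_zero (fun _ => norm_nonneg _) (fun s => a2 _ _) e2
    exact hc
  mono R := by
    obtain ⟨C, hC, hmono⟩ := h.monotone_A R
    refine ⟨1 + C, by positivity, ?_⟩
    filter_upwards [hmono, hF.lipschitz, hF.nonneg_growth, hF.nonneg_lipschitz,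
      ae_drift_eq (ι := ι) (A := A) (F := F), ae_restrict_mem measurableSet_Icc]
      with t a1 a2 a3 a4 a5 a6 x y hx hy
    have ha := h.nonneg_a t a6
    have e1 := a1 x y hx hy
    have e2 := (le_abs_self _).trans (norm_toDual_apply_le ι (F t x - F t y) (x - y))
    rw [map_sub ι] at e2
    have e3 : ‖F t x - F t y‖ * ‖ι x - ι y‖ ≤ l t * ‖ι x - ι y‖ ^ 2 := by
      calc _ ≤ l t * ‖ι x - ι y‖ * ‖ι x - ι y‖ := by gcongr; exact a2 x y
        _ = _ := by ring
    have e4 : (drift T ι A F t x - drift T ι A F t y) (x - y)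
        = (A t x - A t y) (x - y) + toDual ι (F t x - F t y) (x - y) := by
      rw [a5, a5, map_sub (toDual ι)]
      simp only [sub_apply, add_apply]
      ring
    have hb : 0 ≤ ‖x‖ ^ β := by positivity
    have hb' : 0 ≤ ‖y‖ ^ β := by positivity
    have e5 : (a t + C * (1 + ‖x‖ ^ β + ‖y‖ ^ β) + 2 * l t) * ‖ι x - ι y‖ ^ 2
        ≤ ((1 + C) * (1 + a t + 2 * k t + 2 * l t + ‖x‖ ^ β + ‖y‖ ^ β)) * ‖ι x - ι y‖ ^ 2 := by
      gcongr
      nlinarith [mul_nonneg hC ha, mul_nonneg hC a3, mul_nonneg hC a4]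
    rw [e4]
    linarith
  pos := hL
  coer := by
    filter_upwards [hco, hF.mul_le, ae_drift_eq (ι := ι) (A := A) (F := F), hF.nonneg_lipschitz]
      with t a1 a2 a3 a4 x
    rw [a3, add_apply]
    have e1 := a1 x
    have e2 := (le_abs_self _).trans (a2 x)
    have e3 : 0 ≤ (1 + 2 * l t) * (1 + ‖ι x‖ ^ 2) := by positivity
    linarith
  growth R := by
    obtain ⟨C, hC, hA⟩ := h.growth_A hβ R
    refine ⟨C + 1 + |R|, by positivity, ?_⟩
    filter_upwards [hA, hF.growth, ae_drift_eq (ι := ι) (A := A) (F := F), hF.nonneg_growth,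
      hF.nonneg_lipschitz, ae_restrict_mem measurableSet_Icc] with t a1 a2 a3 a4 a5 a6 x hx v
    have ha := h.nonneg_a t a6
    rw [a3, add_apply]
    refine (norm_add_le _ _).trans (add_le_add ?_ ?_)
    · refine ((A t x).le_opNorm v).trans ?_
      gcongr
      refine (a1 x hx).trans (Real.rpow_le_rpow (by positivity) ?_
        (div_nonneg (by linarith) (by linarith)))
      gcongr
      · linarith [abs_nonneg R]
      · linarith
    · refine (norm_toDual_apply_le ι _ _).trans ?_
      gcongr
      have e1 : ‖ι x‖ ≤ |R| := hx.trans (le_abs_self R)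
      calc ‖F t x‖ ≤ k t * (1 + |R|) := (a2 x).trans (by gcongr)
        _ = (1 + |R|) * k t := mul_comm _ _
        _ ≤ (C + 1 + |R|) * (1 + a t + 2 * k t + 2 * l t) := by
          gcongr
          · linarith
          · linarith

theorem Forcing.ae_drift_apply (hF : Forcing T ν ι B γ p F k l) (y : ℝ → V) :
    ∀ᵐ s ∂(timeMeasure T), drift T ι A F s (y s) = A s (y s) + (toDual ι (B s (y s) (p.1 s))
      + toDual ι (∫ z, ((p.2 (s, z) : ℝ) - 1) • γ s (y s) z ∂ν)) := by
  filter_upwards [ae_drift_eq (ι := ι) (A := A) (F := F), hF.eq] with s a1 a2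
  rw [a1, a2, map_add]

theorem intervalIntegral_toDual {f : ℝ → H} (hf : Integrable f (timeMeasure T)) {t : ℝ}
    (ht : t ∈ Icc 0 T) :
    ∫ s in (0 : ℝ)..t, toDual ι (f s) = toDual ι (∫ s in (0 : ℝ)..t, f s) :=
  (toDual ι).intervalIntegral_comp_comm
    (intervalIntegrable_of_timeMeasure hf ⟨le_rfl, ht.1.trans ht.2⟩ ht)

theorem Forcing.intervalIntegral_drift (hF : Forcing T ν ι B γ p F k l) {y : ℝ → V}
    (h1 : Integrable (fun s => A s (y s)) (timeMeasure T))
    (h2 : Integrable (fun s => B s (y s) (p.1 s)) (timeMeasure T))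
    (h3 : Integrable (fun s => ∫ z, ((p.2 (s, z) : ℝ) - 1) • γ s (y s) z ∂ν) (timeMeasure T))
    {t : ℝ} (ht : t ∈ Icc 0 T) :
    ∫ s in (0 : ℝ)..t, drift T ι A F s (y s) = (∫ s in (0 : ℝ)..t, A s (y s))
      + toDual ι (∫ s in (0 : ℝ)..t, B s (y s) (p.1 s))
      + toDual ι (∫ s in (0 : ℝ)..t, ∫ z, ((p.2 (s, z) : ℝ) - 1) • γ s (y s) z ∂ν) := by
  have h0 : (0 : ℝ) ∈ Icc 0 T := ⟨le_rfl, ht.1.trans ht.2⟩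
  have i1 := intervalIntegrable_of_timeMeasure h1 h0 ht
  have i2 := intervalIntegrable_of_timeMeasure ((toDual ι).integrable_comp h2) h0 ht
  have i3 := intervalIntegrable_of_timeMeasure ((toDual ι).integrable_comp h3) h0 ht
  rw [← intervalIntegral_toDual h2 ht, ← intervalIntegral_toDual h3 ht, add_assoc,
    ← intervalIntegral.integral_add i2 i3, ← intervalIntegral.integral_add i1 (i2.add i3)]
  refine intervalIntegral.integral_congr_ae_restrict ?_
  refine ae_restrict_of_ae_restrict_of_subset ?_ (hF.ae_drift_apply y)
  rw [uIoc_of_le ht.1]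
  exact Ioc_subset_Icc_self.trans (Icc_subset_Icc_right ht.2)

theorem IsWeakSolution.coreSol [SFinite ν] {x : H} {Y : ℝ → H} {y : ℝ → V}
    (h : IsWeakSolution T β ν ι A B γ x p Y y)
    (hF : Forcing T ν ι B γ p F k l) : CoreSol T β ι (drift T ι A F) x Y y where
  continuousOn := h.continuousOn
  memLp := h.memLp
  version := h.version
  integrable :=
    (h.integrable_A.add (((toDual ι).integrable_comp h.integrable_B).add
      ((toDual ι).integrable_comp h.integrable_γ.integral_prod_left))).congr
      (by filter_upwards [hF.ae_drift_apply (A := A) y] with s hs using hs.symm)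
  eq t ht := by
    rw [hF.intervalIntegral_drift h.integrable_A h.integrable_B h.integrable_γ.integral_prod_left
      ht, h.equation t ht]
    abel

/-- The drift is integrable, and so are the two control terms because the solution is bounded in
`H`; subtracting them gives integrability of `A s (y s)`. -/
theorem CoreSol.isWeakSolution [SFinite ν] [BorelSpace V] {x : H} {Y : ℝ → H} {y : ℝ → V}
    (h : CoreSol T β ι (drift T ι A F) x Y y)
    (hs : StructuralHypothesis T β α ν ι A B γ a) (hm : MeasurableCoefficients T A B γ)
    (hn : NoiseHypothesis T β α ν ι B γ) {Υ : ℕ} (hp : p ∈ controlBall H T ν Υ)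
    (hF : Forcing T ν ι B γ p F k l) : IsWeakSolution T β ν ι A B γ x p Y y := by
  obtain ⟨R, -, hR⟩ := h.exists_norm_le
  have h2 := hm.integrable_B_apply hs hp.1.1 h.memLp.1 hR
  have h3 := hm.integrable_jump_apply hn hp h.memLp.1 hR
  have h1 : Integrable (fun s => A s (y s)) (timeMeasure T) := by
    refine (h.integrable.sub (((toDual ι).integrable_comp h2).add
      ((toDual ι).integrable_comp h3.integral_prod_left))).congr ?_
    filter_upwards [hF.ae_drift_apply (A := A) y] with s hs
    simp only [Pi.sub_apply, Pi.add_apply]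
    rw [hs, add_sub_cancel_right]
  refine ⟨h.continuousOn, h.memLp, h.version, h1, h2, h3, fun t ht => ?_⟩
  rw [h.eq t ht, hF.intervalIntegral_drift h1 h2 h3.integral_prod_left ht]
  abel

end Main

end SkeletonEq

/-! ### The theorem -/

theorem theorem4p1
    {H V Z : Type*}
    [NormedAddCommGroup H] [InnerProductSpace ℝ H] [CompleteSpace H]
    [TopologicalSpace.SeparableSpace H] [MeasurableSpace H] [BorelSpace H]
    [NormedAddCommGroup V] [NormedSpace ℝ V] [CompleteSpace V]
    [MeasurableSpace V] [BorelSpace V]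
    [TopologicalSpace Z] [PolishSpace Z] [LocallyCompactSpace Z]
    [MeasurableSpace Z] [BorelSpace Z]
    (ν : Measure Z) [IsFiniteMeasureOnCompacts ν]
    (ι : V →L[ℝ] H) (hι : SkeletonEq.IsGelfandTriplet ι)
    (T : ℝ) (hT : 0 < T) (β : ℝ) (hβ : 1 < β) (α : ℝ) (a : ℝ → ℝ)
    (A : ℝ → V → StrongDual ℝ V) (B : ℝ → V → H →L[ℝ] H) (γ : ℝ → V → Z → H)
    (hmeas : SkeletonEq.MeasurableCoefficients T A B γ)
    (hstruct : SkeletonEq.StructuralHypothesis T β α ν ι A B γ a)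
    (hnoise : SkeletonEq.NoiseHypothesis T β α ν ι B γ) :
    (∀ (x : H), ∀ p ∈ SkeletonEq.controls H T ν,
      ∃ (Y : ℝ → H) (y : ℝ → V), SkeletonEq.IsWeakSolution T β ν ι A B γ x p Y y ∧
        ∀ (Y' : ℝ → H) (y' : ℝ → V), SkeletonEq.IsWeakSolution T β ν ι A B γ x p Y' y' →
          EqOn Y' Y (Icc 0 T) ∧ y' =ᵐ[SkeletonEq.timeMeasure T] y) ∧
    (∀ Υ : ℕ, ∃ C : ℝ, 0 < C ∧ ∀ (x : H), ∀ p ∈ SkeletonEq.controlBall H T ν Υ,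
      ∀ (Y : ℝ → H) (y : ℝ → V), SkeletonEq.IsWeakSolution T β ν ι A B γ x p Y y →
        SkeletonEq.energy T β Y y ≤ ENNReal.ofReal (C * (1 + ‖x‖ ^ 2))) := by
  have := hι.separableSpace_dual
  have : SecondCountableTopology (StrongDual ℝ V) := UniformSpace.secondCountable_of_separable _
  obtain ⟨L, hL, hco⟩ := hstruct.coercivity
  refine ⟨fun x p hp => ?_, fun Υ => ?_⟩
  · obtain ⟨Υ, -, hpΥ⟩ := mem_iUnion₂.1 hp
    obtain ⟨_, -, hC⟩ := hstruct.exists_forcing hmeas hnoise Υ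
    obtain ⟨F, k, l, hF, -, -⟩ := hC p hpΥ
    have hc := hstruct.coreHyp hmeas hβ hL hco hF
    obtain ⟨Y, y, hY⟩ := hc.exists_coreSol hT hβ hι x
    exact ⟨Y, y, hY.isWeakSolution hstruct hmeas hnoise hpΥ hF, fun Y' y' h' =>
      hY.eqOn (h'.coreSol hF) hc hT hβ hι.denseRange hι.injective⟩
  · obtain ⟨C, hC0, hC⟩ := hstruct.exists_forcing hmeas hnoise Υ
    have ha : 0 ≤ ∫ t, a t ∂(SkeletonEq.timeMeasure T) :=
      setIntegral_nonneg measurableSet_Icc hstruct.nonneg_a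
    -- Bounds `2 ∫ κ` for `κ = 1 + a + 2 k + 2 l`, as `∫ k` and `∫ l` are at most `C` for every
    -- control in the ball.
    set K : ℝ := 2 * (T + (∫ t, a t ∂(SkeletonEq.timeMeasure T)) + 2 * C + 2 * C) with hK
    refine ⟨Real.exp K + (1 + K * Real.exp K) / (2 * L), by positivity, fun x p hp Y y hY => ?_⟩
    obtain ⟨F, k, l, hF, hk, hl⟩ := hC p hp
    have hc := hstruct.coreHyp hmeas hβ hL hco hF
    refine (hY.coreSol hF).energy_le hc hT hβ hι.denseRange ?_
    have i1 : Integrable (fun t => 1 + a t) (SkeletonEq.timeMeasure T) :=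
      (integrable_const _).add hstruct.integrable_a
    have i2 : Integrable (fun t => 1 + a t + 2 * k t) (SkeletonEq.timeMeasure T) :=
      i1.add (hF.integrable_growth.const_mul 2)
    rw [integral_add i2 (hF.integrable_lipschitz.const_mul 2),
      integral_add i1 (hF.integrable_growth.const_mul 2),
      integral_add (integrable_const _) hstruct.integrable_a, integral_const_mul,
      integral_const_mul]
    have e1 : ∫ _, (1 : ℝ) ∂(SkeletonEq.timeMeasure T) = T := by
      simp [SkeletonEq.timeMeasure, hT.le]
    rw [e1]
    linarith
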